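/- **Two-particle mean values in the sinh-Gordon model.** Let $0<B<1$, $B\neq\frac12$, $m>0$, let $$S(\theta)=\frac{\sinh\theta-i\sin\pi B}{\sinh\theta+i\sin\pi B},\qquad \varphi(\theta)=-i\,\frac{S'(\theta)}{S(\theta)},$$ and let $(F_n)_{n\ge 0}$ be functions satisfying the following form factor axioms. - *Regularity:* away from $\{\sinh^2(\theta_i-\theta_j)=-\sin^2\pi B$ for some $i\ne j\}$, $F_n$ is analytic up to at most simple poles at $\theta_i-\theta_j\in i\pi(2\mathbb Z+1)$, i.e. $F_n\prod_{i<j}\cosh\frac{\theta_i-\theta_j}{2}$ extends analytically. - *Exchange:* $F_n(\dots,\theta_j,\theta_{j+1},\dots)=S(\theta_j-\theta_{j+1})F_n(\dots,\theta_{j+1},\theta_j,\dots)$. - *Kinematical poles:* $-i\,\mathrm{Res}_{\theta=\theta'}F_{n+2}(\theta+i\pi,\theta',\theta_1,\dots,\theta_n)=\big(1-\prod_kS(\theta'-\theta_k)\big)F_n(\theta_1,\dots,\theta_n)$. Let the connected form factor $F_{2n,c}(\theta_1,\dots,\theta_n)$ be the constant term of the Laurent expansion in $\eta_1,\dots,\eta_n$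 at $0$ of $F_{2n}(\theta_1+i\pi+\eta_1,\dots,\theta_n+i\pi+\eta_n,\theta_n,\dots,\theta_1)$, extended by continuity to coinciding rapidities. Assume that for some $a>0$ and $K$ one has $|F_{2n,c}(\theta_1,\dots,\theta_n)|\le n!\,K^n$ for all $n\ge1$ and all $\theta_j$ with $|\mathrm{Im}\,\theta_j|<a$ or $|\mathrm{Im}\,\theta_j-\frac\pi2|<a$. For $L>0$ and real $\bar\theta_1,\bar\theta_2$, a *pseudoenergy* is a function $\varepsilon$, real on $\mathbb R$ with $\log(1+e^{-\varepsilon})$ integrable on $\mathbb R$, such that $$\varepsilon(\theta)=mL\cosh\theta+\sum_{i=1}^2\log S(\theta-\bar\theta_i-\tfrac{i\pi}2)-\int_{\mathbb R}\frac{d\theta'}{2\pi}\varphi(\theta-\theta')\log(1+e^{-\varepsilon(\theta')})$$ for $\theta\in\mathbb R$ and for $|\mathrm{Im}\,\theta-\frac\pi2|<|\frac\pi2-\pi B|$ (principal logarithms). Write $\widetilde{d\theta}=\frac{d\theta}{2\pi}\frac1{1+e^{\varepsilon(\theta)}}$, and $$\mathcal D(\bar\theta_1,\dots,\bar\theta_k)=\sum_{n\ge0}\frac1{n!}\int_{\mathbb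 R^n}\widetilde{d\theta_1}\cdots\widetilde{d\theta_n}\,F_{2(k+n),c}(\bar\theta_1+\tfrac{i\pi}2,\dots,\bar\theta_k+\tfrac{i\pi}2,\theta_1,\dots,\theta_n),$$ with $\langle O\rangle_\varepsilon$ denoting the case $k=0$; $$\Phi_{jl}=\varphi(\bar\theta_j-\bar\theta_l)+\sum_{n\ge1}\int_{\mathbb R^n}\widetilde{d\theta_1}\cdots\widetilde{d\theta_n}\,\varphi(\theta_1-\bar\theta_j-\tfrac{i\pi}2)\varphi(\theta_1-\theta_2)\cdots\varphi(\theta_{n-1}-\theta_n)\varphi(\theta_n-\bar\theta_l-\tfrac{i\pi}2),$$ $N_\varphi=\Phi_{12}$, and $$N_j=mL\cosh\bar\theta_j+\sum_{n\ge1}\int_{\mathbb R^n}\widetilde{d\theta_1}\cdots\widetilde{d\theta_n}\,i\varphi(\theta_1-\bar\theta_j+\tfrac{i\pi}2)\varphi(\theta_1-\theta_2)\cdots\varphi(\theta_{n-1}-\theta_n)\,mL\sinh\theta_n .$$ Then there is $L_0>0$ such that for all $L\ge L_0$ the following holds. Let $\bar\theta_1\ne\bar\theta_2$, let $\varepsilon=\varepsilon_{\theta_1,\theta_2}$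 be a pseudoenergy for every pair of roots $(\theta_1,\theta_2)$ in a neighbourhood of $(\bar\theta_1,\bar\theta_2)$, and suppose that at $(\bar\theta_1,\bar\theta_2)$ the quantization conditions $\varepsilon(\bar\theta_j+\frac{i\pi}2)=i\pi(2I_j+1)$, $I_j\in\mathbb Z$, hold for $j=1,2$. Define the excited state mean value by the contour LeClair–Mussardo series $$\langle\bar\theta_1,\bar\theta_2|O|\bar\theta_1,\bar\theta_2\rangle_L=\sum_{n\ge0}\frac1{n!}\int_{\mathcal C^n}\prod_{j=1}^n\frac{d\theta_j}{2\pi}\frac{1}{1+e^{\varepsilon(\theta_j)}}\,F_{2n,c}(\theta_1,\dots,\theta_n),$$ where $\mathcal C$ consists of the real line and the clockwise circles of radius $r$ around $\bar\theta_1+\frac{i\pi}2$ and $\bar\theta_2+\frac{i\pi}2$. Then: 1. The integrals and series for $N_1$, $N_2$, all $\Phi_{jl}$, $\langle O\rangle_\varepsilon$, $\mathcal D(\bar\theta_1)$, $\mathcal D(\bar\theta_2)$, $\mathcal D(\bar\theta_1,\bar\theta_2)$ converge absolutely, and $N_1N_2+(N_1+N_2)N_\varphi\ne0$. 2. For all sufficiently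 small $r>0$ the integrals and the series for the mean value converge absolutely, and $$\langle\bar\theta_1,\bar\theta_2|O|\bar\theta_1,\bar\theta_2\rangle_L=\langle O\rangle_\varepsilon+\frac{(N_2+N_\varphi)\mathcal D(\bar\theta_1)+(N_1+N_\varphi)\mathcal D(\bar\theta_2)+\mathcal D(\bar\theta_1,\bar\theta_2)}{N_1N_2+(N_1+N_2)N_\varphi}.$$ 3. $e^{\varepsilon}$ has derivative $-i n_j$ at $\bar\theta_j+\frac{i\pi}2$ with $n_j=N_j+N_\varphi+\Phi_{jj}$. 4. The functions $\bar Q_j(\theta_1,\theta_2)=-i\,\varepsilon_{\theta_1,\theta_2}(\theta_j+\frac{i\pi}2)$ are differentiable at $(\bar\theta_1,\bar\theta_2)$, with Jacobian $$\left(\frac{\partial\bar Q_j}{\partial\bar\theta_k}\right)=\begin{pmatrix}N_1+N_\varphi&-N_\varphi\\-N_\varphi&N_2+N_\varphi\end{pmatrix}.$$ -/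

import Mathlib

open Filter Topology MeasureTheory

noncomputable section

namespace SinhGordon

/-- The sinh-Gordon scattering matrix
`S(θ) = (sinh θ - i sin πB) / (sinh θ + i sin πB)`, with coupling parameter `0 < B < 1`. -/
def S (B : ℝ) (θ : ℂ) : ℂ :=
  (Complex.sinh θ - Complex.I * Real.sin (Real.pi * B)) /
    (Complex.sinh θ + Complex.I * Real.sin (Real.pi * B))

/-- `φ(θ) = d/dθ (-i log S(θ)) = -i S'(θ) / S(θ)`. -/
def phi (B : ℝ) (θ : ℂ) : ℂ := -Complex.I * logDeriv (S B) θ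

/-! ### Form factors -/

/-- No rapidity difference is a multiple of `iπ` (kinematical singularities), or a
zero or pole of the scattering matrix. -/
def Generic (B : ℝ) {n : ℕ} (θ : Fin n → ℂ) : Prop :=
  ∀ i j, i ≠ j → Complex.sinh (θ i - θ j) ≠ 0 ∧
    Complex.sinh (θ i - θ j) ^ 2 ≠ -((Real.sin (Real.pi * B) : ℝ) : ℂ) ^ 2

/-- The form factor axioms for the elementary form factors `F_n(θ₁, …, θ_n)` of a local operator.
* `regular`: away from the zeros and poles of `S(θ_i - θ_j)` the only singularities of `F_n` are
  at most simple poles at `θ_i - θ_j ∈ iπ(2ℤ + 1)`;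
* `exchange`: the exchange axiom;
* `kinematical`: the kinematical pole axiom
  `-i Res_{θ = θ'} F_{n+2}(θ + iπ, θ', θ₁, …, θ_n) = (1 - ∏ S(θ' - θ_k)) F_n(θ₁, …, θ_n)`.
The values of `F_n` at non-generic points are irrelevant. -/
structure IsFormFactorFamily (B : ℝ) (F : (n : ℕ) → (Fin n → ℂ) → ℂ) : Prop where
  regular : ∀ n : ℕ, ∃ G : (Fin n → ℂ) → ℂ,
    AnalyticOnNhd ℂ G {θ | ∀ i j, i ≠ j →
      Complex.sinh (θ i - θ j) ^ 2 ≠ -((Real.sin (Real.pi * B) : ℝ) : ℂ) ^ 2} ∧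
    ∀ θ : Fin n → ℂ, Generic B θ →
      (∏ p : Fin n × Fin n with p.1 < p.2, Complex.cosh ((θ p.1 - θ p.2) / 2)) * F n θ = G θ
  exchange : ∀ (n : ℕ) (θ : Fin n → ℂ), Generic B θ → ∀ (i j : Fin n), (i : ℕ) + 1 = j →
    F n θ = S B (θ i - θ j) * F n (θ ∘ Equiv.swap i j)
  kinematical : ∀ (n : ℕ) (θ' : ℂ) (θ : Fin n → ℂ), Generic B (Fin.cons θ' θ : Fin (n + 1) → ℂ) →
    Tendsto (fun z : ℂ => -Complex.I * ((z - θ') *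
        F (n + 2) (Fin.cons (z + Complex.I * Real.pi) (Fin.cons θ' θ : Fin (n + 1) → ℂ))))
      (𝓝[≠] θ') (𝓝 ((1 - ∏ k, S B (θ' - θ k)) * F n θ))

/-- The arguments `(θ₁ + iπ + η₁, …, θ_n + iπ + η_n, θ_n, …, θ₁)`. -/
def diagonalPoint {n : ℕ} (θ η : Fin n → ℂ) : Fin (n + n) → ℂ :=
  Fin.append (fun i => θ i + Complex.I * Real.pi + η i) (fun i => θ (Fin.rev i))

/-- The finite piece at `η → 0` of `F_{2n}(θ₁ + iπ + η₁, …, θ_n + iπ + η_n, θ_n, …, θ₁)`: the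
constant term of its Laurent expansion in `η₁, …, η_n`, which is the coefficient
`(2πi)⁻ⁿ ∮ ⋯ ∮ F_{2n} dη₁/η₁ ⋯ dη_n/η_n` over a small torus. -/
def finitePart (F : (n : ℕ) → (Fin n → ℂ) → ℂ) (n : ℕ) (θ : Fin n → ℂ) : ℂ :=
  limUnder (𝓝[>] (0 : ℝ)) fun ρ =>
    ((2 * Real.pi * Complex.I : ℂ) ^ n)⁻¹ *
      torusIntegral (fun η : Fin n → ℂ => (∏ i, η i)⁻¹ * F (n + n) (diagonalPoint θ η))
        0 (fun _ => ρ)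

/-- The connected diagonal form factor `F_{2n,c}(θ₁, …, θ_n)`; at coinciding rapidities it is
the limit from distinct rapidities. -/
def connectedFF (F : (n : ℕ) → (Fin n → ℂ) → ℂ) (n : ℕ) (θ : Fin n → ℂ) : ℂ :=
  limUnder (𝓝[{θ' : Fin n → ℂ | ∀ i j, i ≠ j → Complex.sinh (θ' i - θ' j) ≠ 0}] θ)
    (finitePart F n)

/-- The growth assumption `|F_{2n,c}(θ₁, …, θ_n)| ≤ n! Kⁿ`, `n ≥ 1`, for rapidities within
distance `a` of the real line or of the line `ℝ + iπ/2`. -/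
def FactorialBound (F : (n : ℕ) → (Fin n → ℂ) → ℂ) (a K : ℝ) : Prop :=
  ∀ n : ℕ, 1 ≤ n → ∀ θ : Fin n → ℂ,
    (∀ j, |(θ j).im| < a ∨ |(θ j).im - Real.pi / 2| < a) →
      ‖connectedFF F n θ‖ ≤ (n.factorial : ℝ) * K ^ n

/-! ### The excited state TBA -/

/-- The position `θ̄ + iπ/2` at which the rapidity `θ̄` enters the TBA. -/
def shifted (x : ℝ) : ℂ := (x : ℂ) + Complex.I * (Real.pi / 2 : ℝ)

/-- `ε` is the pseudoenergy in volume `L` with roots `θb` (not necessarily quantized): it is real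
on the real line, `log (1 + e^{-ε})` is integrable there, and
`ε(θ) = mL cosh θ + ∑ᵢ log S(θ - θ̄ᵢ - iπ/2) - ∫ dθ'/(2π) φ(θ - θ') log(1 + e^{-ε(θ')})`
for `θ` real and for `θ` in the strip around `ℝ + iπ/2` in which the kernel
`φ(θ - θ')` has no singularity at real `θ'`. -/
structure IsPseudoenergy (B m L : ℝ) {k : ℕ} (θb : Fin k → ℝ) (ε : ℂ → ℂ) : Prop where
  real : ∀ x : ℝ, (ε x).im = 0
  integrable : Integrable (fun x : ℝ => Complex.log (1 + Complex.exp (-ε x)))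
  tba : ∀ θ : ℂ, (θ.im = 0 ∨ |θ.im - Real.pi / 2| < |Real.pi / 2 - Real.pi * B|) →
    ε θ = m * L * Complex.cosh θ + ∑ i, Complex.log (S B (θ - shifted (θb i)))
      - ∫ x : ℝ, phi B (θ - x) * Complex.log (1 + Complex.exp (-ε x)) / (2 * Real.pi)

/-- The measure density `1/(2π) · 1/(1 + e^{ε(θ)})`. -/
def weight (ε : ℂ → ℂ) (θ : ℂ) : ℂ := 1 / (2 * Real.pi) * (1 / (1 + Complex.exp (ε θ)))

/-! ### The contour and the excited state mean value -/

/-- The pieces of the contour `𝒞`: `none` is the real line, `some j` is the clockwise circle of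
radius `r` around `θ̄_j + iπ/2`, parametrized by `t ∈ (0, 2π]`. -/
def contourPoint {k : ℕ} (θb : Fin k → ℝ) (r : ℝ) : Option (Fin k) → ℝ → ℂ
  | none, t => (t : ℂ)
  | some j, t => shifted (θb j) + r * Complex.exp (-(Complex.I * t))

/-- The velocity of the parametrization `contourPoint`. -/
def contourVelocity {k : ℕ} (r : ℝ) : Option (Fin k) → ℝ → ℂ
  | none, _ => 1
  | some _, t => -(Complex.I * r * Complex.exp (-(Complex.I * t)))

/-- Lebesgue measure on the parameter range of a piece of the contour. -/
def contourMeasure {k : ℕ} : Option (Fin k) → Measure ℝ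
  | none => volume
  | some _ => volume.restrict (Set.Ioc 0 (2 * Real.pi))

/-- The pulled back integrand of `∫ f(θ₁, …, θ_n) dθ₁ ⋯ dθ_n`, with `θ_i` on the piece `c i`. -/
def contourIntegrand {k : ℕ} (θb : Fin k → ℝ) (r : ℝ) {n : ℕ} (f : (Fin n → ℂ) → ℂ)
    (c : Fin n → Option (Fin k)) (t : Fin n → ℝ) : ℂ :=
  (∏ i, contourVelocity r (c i) (t i)) * f (fun i => contourPoint θb r (c i) (t i))

/-- Absolute convergence of `∫_𝒞 dθ₁ ⋯ ∫_𝒞 dθ_n f(θ₁, …, θ_n)`. -/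
def ContourIntegrable {k : ℕ} (θb : Fin k → ℝ) (r : ℝ) {n : ℕ} (f : (Fin n → ℂ) → ℂ) : Prop :=
  ∀ c : Fin n → Option (Fin k),
    Integrable (contourIntegrand θb r f c) (Measure.pi fun i => contourMeasure (c i))

/-- The multiple contour integral `∫_𝒞 dθ₁ ⋯ ∫_𝒞 dθ_n f(θ₁, …, θ_n)`. -/
def contourIntegral {k : ℕ} (θb : Fin k → ℝ) (r : ℝ) {n : ℕ} (f : (Fin n → ℂ) → ℂ) : ℂ :=
  ∑ c : Fin n → Option (Fin k),
    ∫ t, contourIntegrand θb r f c t ∂(Measure.pi fun i => contourMeasure (c i))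

/-- `∏_j (1/(2π) · 1/(1 + e^{ε(θ_j)})) · F_{2n,c}(θ₁, …, θ_n)`. -/
def meanValueIntegrand (F : (n : ℕ) → (Fin n → ℂ) → ℂ) (ε : ℂ → ℂ) (n : ℕ) (θ : Fin n → ℂ) : ℂ :=
  (∏ j, weight ε (θ j)) * connectedFF F n θ

/-- The `n`-th term of the contour LeClair-Mussardo series. -/
def meanValueTerm (F : (n : ℕ) → (Fin n → ℂ) → ℂ) (ε : ℂ → ℂ) {k : ℕ} (θb : Fin k → ℝ) (r : ℝ)
    (n : ℕ) : ℂ :=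
  1 / (n.factorial : ℂ) * contourIntegral θb r (meanValueIntegrand F ε n)

/-- The excited state mean value `⟨θ̄₁, …, θ̄_k| O |θ̄₁, …, θ̄_k⟩_L`, given by the
LeClair-Mussardo series over the contour `𝒞` with circles of radius `r`. -/
def meanValue (F : (n : ℕ) → (Fin n → ℂ) → ℂ) (ε : ℂ → ℂ) {k : ℕ} (θb : Fin k → ℝ) (r : ℝ) : ℂ :=
  ∑' n, meanValueTerm F ε θb r n

/-- All integrals in the series for the mean value, and the series itself, converge absolutely. -/
def MeanValueConverges (F : (n : ℕ) → (Fin n → ℂ) → ℂ) (ε : ℂ → ℂ) {k : ℕ} (θb : Fin k → ℝ)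
    (r : ℝ) : Prop :=
  (∀ n, ContourIntegrable θb r (meanValueIntegrand F ε n)) ∧ Summable (meanValueTerm F ε θb r)

/-! ### Dressed form factors -/

/-- `∏_j (1/(2π) · 1/(1 + e^{ε(θ_j)})) · F_{2(k+n),c}(θ̄₁ + iπ/2, …, θ̄_k + iπ/2, θ₁, …, θ_n)`. -/
def dressedIntegrand (F : (n : ℕ) → (Fin n → ℂ) → ℂ) (ε : ℂ → ℂ) {k : ℕ} (y : Fin k → ℝ) (n : ℕ)
    (x : Fin n → ℝ) : ℂ :=
  (∏ j, weight ε (x j)) *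
    connectedFF F (k + n) (Fin.append (fun i => shifted (y i)) (fun i => (x i : ℂ)))

/-- The `n`-th term of the dressed form factor series, integrated over the real line. -/
def dressedTerm (F : (n : ℕ) → (Fin n → ℂ) → ℂ) (ε : ℂ → ℂ) {k : ℕ} (y : Fin k → ℝ) (n : ℕ) : ℂ :=
  1 / (n.factorial : ℂ) * ∫ x : Fin n → ℝ, dressedIntegrand F ε y n x

/-- The dressed form factor `𝒟_ε(θ̄₁, …, θ̄_k)`; for `k = 0` it is the series `⟨O⟩_ε`. -/
def dressed (F : (n : ℕ) → (Fin n → ℂ) → ℂ) (ε : ℂ → ℂ) {k : ℕ} (y : Fin k → ℝ) : ℂ :=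
  ∑' n, dressedTerm F ε y n

/-- All integrals in the series for `𝒟_ε`, and the series itself, converge absolutely. -/
def DressedConverges (F : (n : ℕ) → (Fin n → ℂ) → ℂ) (ε : ℂ → ℂ) {k : ℕ} (y : Fin k → ℝ) : Prop :=
  (∀ n, Integrable (dressedIntegrand F ε y n)) ∧ Summable (dressedTerm F ε y)

/-! ### The dressed normalization factors -/

/-- `f(θ₀) φ(θ₀ - θ₁) φ(θ₁ - θ₂) ⋯ φ(θ_{n-1} - θ_n) g(θ_n) ∏_j (1/(2π) · 1/(1 + e^{ε(θ_j)}))`. -/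
def chainIntegrand (B : ℝ) (ε : ℂ → ℂ) (f g : ℂ → ℂ) (n : ℕ) (x : Fin (n + 1) → ℝ) : ℂ :=
  (∏ i, weight ε (x i)) * (f (x 0) *
    (∏ i : Fin n, phi B ((x i.castSucc : ℂ) - (x i.succ : ℂ))) * g (x (Fin.last n)))

/-- The sum over `n ≥ 0` of the integrals of `chainIntegrand` over the real line. -/
def chainSum (B : ℝ) (ε : ℂ → ℂ) (f g : ℂ → ℂ) : ℂ :=
  ∑' n : ℕ, ∫ x : Fin (n + 1) → ℝ, chainIntegrand B ε f g n x

/-- All integrals in `chainSum`, and the series itself, converge absolutely. -/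
def ChainConverges (B : ℝ) (ε : ℂ → ℂ) (f g : ℂ → ℂ) : Prop :=
  (∀ n, Integrable (chainIntegrand B ε f g n)) ∧
    Summable fun n : ℕ => ∫ x : Fin (n + 1) → ℝ, chainIntegrand B ε f g n x

/-- `θ ↦ φ(θ - θ̄ - iπ/2)`. -/
def rootKernel (B : ℝ) (y : ℝ) (θ : ℂ) : ℂ := phi B (θ - shifted y)

/-- `θ ↦ iφ(θ - θ̄ + iπ/2)`. -/
def rootKernel' (B : ℝ) (y : ℝ) (θ : ℂ) : ℂ :=
  Complex.I * phi B (θ - y + Complex.I * (Real.pi / 2 : ℝ))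

/-- `θ ↦ mL sinh θ`. -/
def source (m L : ℝ) (θ : ℂ) : ℂ := m * L * Complex.sinh θ

/-- The dressed kernel
`φ(y - y') + ∑_{n ≥ 1} ∫ φ(θ₁ - y - iπ/2) φ(θ₁ - θ₂) ⋯ φ(θ_{n-1} - θ_n) φ(θ_n - y' - iπ/2)`.
At `(y, y') = (θ̄₁, θ̄₂)` it is `𝒩_φ`. -/
def dressedPhi (B : ℝ) (ε : ℂ → ℂ) (y y' : ℝ) : ℂ :=
  phi B ((y : ℂ) - y') + chainSum B ε (rootKernel B y) (rootKernel B y')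

/-- `mL cosh y + ∑_{n ≥ 1} ∫ iφ(θ₁ - y + iπ/2) φ(θ₁ - θ₂) ⋯ φ(θ_{n-1} - θ_n) mL sinh θ_n`.
At `y = θ̄_j` it is `𝒩_j`. -/
def dressedN (B m L : ℝ) (ε : ℂ → ℂ) (y : ℝ) : ℂ :=
  m * L * Complex.cosh y + chainSum B ε (rootKernel' B y) (source m L)

/-- The exact quantization functions `Q̄_j(θ̄₁, …, θ̄_k) = -i ε(θ̄_j + iπ/2)`, where the
pseudoenergy `ε p` itself depends on the roots `p`. -/
def quantization {k : ℕ} (ε : (Fin k → ℝ) → ℂ → ℂ) (p : Fin k → ℝ) (j : Fin k) : ℂ :=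
  -Complex.I * ε p (shifted (p j))

end SinhGordon

end

/-!
The mean value is a sum over contours of connected form factors, and the contour differs from the
real line by small circles around the zeros of `1 + e^ε` at the roots. The proof turns each circle
into an evaluation at a root and sums what results with the help of an identity for connected form
factors at coinciding rapidities.

*Connected form factors.* Near the diagonal a form factor times the pole factors `θ_i + η_i - θ_j`
is analytic (`diagReg`), so that the connected form factor is a Taylor coefficient of an analytic
germ (`conn`). The kinematical axiom gives the restriction of this germ to `η_l = 0`; because the
residue vanishes at the origin, all other squarefree Laurent coefficients vanish (`topOnly_amp`).
Hence the connected form factors are symmetric, and, being bounded, they continue holomorphically to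
coinciding rapidities. There a connected form factor does not carry new information
(`tendsto_conn_pair`, `IsBoundedFF.coincidence`): `C(β, β, Y)` is twice the sum over all chains
`φ(β - y₁) φ(y₁ - y₂) ⋯ φ(y_p - β) C(β, Y ∖ {y₁, …, y_p})` with distinct `y_i` from `Y`. For two
almost equal rapidities this compares the residues of the two poles with a second order remainder;
since `S(0) = -1`, the two contributions add up.

*Dressing.* Integration of this identity against the weight `(1 + e^ε)⁻¹ / 2π` replaces `φ` by the
dressed kernel `Φ`, because a chain whose intermediate rapidities are integrated over solves a
linear integral equation (`IsDressing.series_chain`, `IsDressing.eq_dressedPhi`). The result is a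
relation (`IsDressing.IsChained.dress_relation`) for the dressed form factors `d k l` with `k`
rapidities at the first root and `l` at the second one.

*The contour.* By `IsPseudoenergy.hasDerivAt_exp_shifted` the circle around the root `j` amounts to
`1 / n_j` times the insertion of a rapidity at the root (`eventually_clockwise`). Insertions and
integrations over the real line are commuting operators on symmetric functions
(`sum_integral_pieces`), and the mean
value is the exponential of their sum: the generating series
`∑ n₁⁻ᵏ n₂⁻ˡ d k l / (k! l!)`. The dressing relation says that this series times
`1 - Φ₁₁ / n₁ - Φ₂₂ / n₂ + (Φ₁₁ Φ₂₂ - Φ₁₂²) / (n₁ n₂)` has only the four terms with `k, l ≤ 1`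
(`hasSum_of_relation`). As `n_j - Φ_jj = N_j + N_φ`, the factor is the Jacobian determinant divided
by `n₁ n₂`, and the four terms combine to the asserted formula (`IsBoundedFF.eventually_meanValue`).

*Quantization functions.* Differentiating the TBA equation shows that the derivative of `ε` solves a
dressing equation, which gives the derivative of `e^ε` at the roots. The dependence of `ε` on the
roots is controlled by a contraction estimate; to first order it solves the linearised TBA equation,
again a dressing equation (`norm_response_sub_le`, `hasFDerivAt_quantization`).

*Large `L`.* Any pseudoenergy satisfies `e^{-ε(x)} ≤ 2 e^{-mL cosh x}`
(`IsPseudoenergy.exp_neg_le`). For large `m L` the weight is therefore so small that all series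
converge geometrically, and `|N_j| ≥ mL - 1` dominates the bounded quantities `Φ`.
-/

noncomputable section

namespace SinhGordon

open Metric (ball closedBall sphere)
open Complex (I exp sinh cosh)
open scoped Real

/-! ### Multi-affine Taylor coefficients of analytic germs -/

section Germs

variable {E : Type*} [NormedAddCommGroup E] [NormedSpace ℂ E]

/-- Points of `ℂⁿ`. -/
abbrev Vec (n : ℕ) := Fin n → ℂ

/-- Prepending a coordinate, as a map into the functions `Fin (n + 1) → ℂ`. -/
abbrev vcons {n : ℕ} (z : ℂ) (η : Vec n) : Vec (n + 1) := Fin.cons z η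

lemma vcons_zero_zero {n : ℕ} : vcons 0 (0 : Vec n) = 0 := by
  ext i; refine Fin.cases ?_ (fun j => ?_) i <;> simp [vcons]

@[fun_prop]
lemma AnalyticAt.vcons' {n : ℕ} {u : E → ℂ} {v : E → Vec n} {e : E}
    (hu : AnalyticAt ℂ u e) (hv : AnalyticAt ℂ v e) :
    AnalyticAt ℂ (fun x => vcons (u x) (v x)) e :=
  analyticAt_pi_iff.2 fun i => Fin.cases hu (analyticAt_pi_iff.1 hv) i

@[fun_prop]
lemma analyticAt_apply {n : ℕ} (e : Vec n) (i : Fin n) : AnalyticAt ℂ (fun x : Vec n => x i) e :=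
  analyticAt_pi_iff.1 analyticAt_id i

@[fun_prop]
lemma AnalyticAt.pi' {ι : Type*} [Fintype ι] {v : E → ι → ℂ} {e : E}
    (hv : ∀ i, AnalyticAt ℂ (fun x => v x i) e) : AnalyticAt ℂ (fun x i => v x i) e :=
  analyticAt_pi_iff.2 hv

attribute [fun_prop] analyticAt_fst analyticAt_snd

lemma _root_.AnalyticAt.comp_of {X : Type*} [NormedAddCommGroup X] [NormedSpace ℂ X] {A : X → ℂ}
    {f : E → X} {x : E} {a : X} (hA : AnalyticAt ℂ A a) (hf : AnalyticAt ℂ f x := by fun_prop)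
    (ha : f x = a := by first | rfl | simp [vcons_zero_zero]) :
    AnalyticAt ℂ (fun e => A (f e)) x := by
  subst ha
  exact AnalyticAt.comp hA hf

/-- Composition of an analytic function of two variables with analytic functions. -/
lemma _root_.AnalyticAt.comp_pair {X Y : Type*} [NormedAddCommGroup X] [NormedSpace ℂ X]
    [NormedAddCommGroup Y] [NormedSpace ℂ Y] {A : X → Y → ℂ} {f : E → X} {g : E → Y} {x : E}
    {a : X} {b : Y} (hA : AnalyticAt ℂ (fun p : X × Y => A p.1 p.2) (a, b))
    (hf : AnalyticAt ℂ f x := by fun_prop) (hg : AnalyticAt ℂ g x := by fun_prop)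
    (ha : f x = a := by first | rfl | simp [vcons_zero_zero])
    (hb : g x = b := by first | rfl | simp [vcons_zero_zero]) :
    AnalyticAt ℂ (fun e => A (f e) (g e)) x := by
  subst ha hb
  exact AnalyticAt.comp₂ (h := fun p : X × Y => A p.1 p.2) hA hf hg

/-- The derivative in one variable of a jointly analytic function is analytic in the others. -/
lemma analyticAt_deriv_snd {g : E → ℂ → ℂ} {x : E} {z : ℂ}
    (hg : AnalyticAt ℂ (fun p : E × ℂ => g p.1 p.2) (x, z)) :
    AnalyticAt ℂ (fun p : E × ℂ => deriv (g p.1) p.2) (x, z) := by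
  have h1 : ∀ᶠ p in 𝓝 (x, z), deriv (g p.1) p.2 =
      fderiv ℂ (fun p : E × ℂ => g p.1 p.2) p (0, 1) := by
    filter_upwards [hg.eventually_analyticAt] with p hp
    have h2 : HasDerivAt (fun z => (p.1, z)) ((0 : E), (1 : ℂ)) p.2 :=
      (hasDerivAt_const _ _).prodMk (hasDerivAt_id _)
    exact (hp.differentiableAt.hasFDerivAt.comp_hasDerivAt p.2 h2).deriv
  refine AnalyticAt.congr ?_ (h1.mono fun p hp => hp.symm)
  exact (ContinuousLinearMap.apply ℂ ℂ ((0 : E), (1 : ℂ))).analyticAt _ |>.comp hg.fderiv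

/-- Partial derivatives of an analytic function commute. -/
lemma deriv_deriv_comm {g : ℂ → ℂ → ℂ} {x y : ℂ}
    (hg : AnalyticAt ℂ (fun p : ℂ × ℂ => g p.1 p.2) (x, y)) :
    deriv (fun a => deriv (fun b => g a b) y) x = deriv (fun b => deriv (fun a => g a b) x) y := by
  set G : ℂ × ℂ → ℂ := fun p => g p.1 p.2 with hG
  have hd : ∀ᶠ p in 𝓝 (x, y), HasFDerivAt G (fderiv ℂ G p) p :=
    hg.eventually_analyticAt.mono fun p hp => hp.differentiableAt.hasFDerivAt
  have u1 : ∀ a b, HasDerivAt (fun z : ℂ => (z, b)) ((1 : ℂ), (0 : ℂ)) a := fun a b =>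
    (hasDerivAt_id _).prodMk (hasDerivAt_const _ _)
  have u2 : ∀ a b, HasDerivAt (fun z : ℂ => (a, z)) ((0 : ℂ), (1 : ℂ)) b := fun a b =>
    (hasDerivAt_const _ _).prodMk (hasDerivAt_id _)
  have h1 : ∀ᶠ a in 𝓝 x, deriv (fun b => g a b) y = fderiv ℂ G (a, y) (0, 1) := by
    filter_upwards [(u1 x y).continuousAt.tendsto.eventually hd] with a ha
    exact (ha.comp_hasDerivAt y (u2 a y)).deriv
  have h2 : ∀ᶠ b in 𝓝 y, deriv (fun a => g a b) x = fderiv ℂ G (x, b) (1, 0) := by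
    filter_upwards [(u2 x y).continuousAt.tendsto.eventually hd] with b hb
    exact (hb.comp_hasDerivAt x (u1 x b)).deriv
  rw [EventuallyEq.deriv_eq h1, EventuallyEq.deriv_eq h2]
  have hD : HasFDerivAt (fderiv ℂ G) (fderiv ℂ (fderiv ℂ G) (x, y)) (x, y) :=
    hg.fderiv.differentiableAt.hasFDerivAt
  have e1 := (hD.comp_hasDerivAt (f := fun z : ℂ => (z, y)) x (u1 x y)).clm_apply
    (hasDerivAt_const x ((0 : ℂ), (1 : ℂ)))
  have e2 := (hD.comp_hasDerivAt (f := fun z : ℂ => (x, z)) y (u2 x y)).clm_apply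
    (hasDerivAt_const y ((1 : ℂ), (0 : ℂ)))
  refine e1.deriv.trans (Eq.trans ?_ e2.deriv.symm)
  simpa using second_derivative_symmetric_of_eventually (𝕜 := ℂ) hd hD _ _

/-- Restriction to `η₀ = 0`. -/
def ev {n : ℕ} (f : Vec (n + 1) → ℂ) : Vec n → ℂ := fun η => f (vcons 0 η)

/-- The coefficient of `η₀`. -/
def dz {n : ℕ} (f : Vec (n + 1) → ℂ) : Vec n → ℂ :=
  fun η => deriv (fun z => f (vcons z η)) 0

/-- The coefficient of `η₁ ⋯ η_n` in the Taylor expansion at the origin. -/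
def coef : (n : ℕ) → (Vec n → ℂ) → ℂ
  | 0, f => f 0
  | n + 1, f => coef n (dz f)

/-- Among the coefficients of the squarefree monomials in the Taylor expansion at the origin,
that of `η₁ ⋯ η_n` is `c` and all others vanish. -/
def TopOnly : (n : ℕ) → ℂ → (Vec n → ℂ) → Prop
  | 0, c, f => f 0 = c
  | n + 1, c, f => TopOnly n 0 (ev f) ∧ TopOnly n c (dz f)

/-- Among the coefficients of the squarefree monomials in the Taylor expansion at the origin,
that of `η₁ ⋯ η_n` is `α`, that of `∏_{i ≠ k} η_i` is `β k`, and all others vanish. -/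
def TopTwo : (n : ℕ) → ℂ → Vec n → (Vec n → ℂ) → Prop
  | 0, α, _, f => f 0 = α
  | n + 1, α, β, f => TopOnly n (β 0) (ev f) ∧ TopTwo n α (Fin.tail β) (dz f)

variable {n : ℕ}

lemma analyticAt_dz_param {A : E → Vec (n + 1) → ℂ} {e : E} {η : Vec n}
    (hA : AnalyticAt ℂ (fun p : E × Vec (n + 1) => A p.1 p.2) (e, vcons 0 η)) :
    AnalyticAt ℂ (fun p : E × Vec n => dz (A p.1) p.2) (e, η) :=
  AnalyticAt.comp_pair (A := fun (q : E × Vec n) => deriv fun z => A q.1 (vcons z q.2))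
    (a := (e, η)) (b := 0) (analyticAt_deriv_snd
      (g := fun (q : E × Vec n) z => A q.1 (vcons z q.2)) hA.comp_pair)

lemma analyticAt_ev_param {A : E → Vec (n + 1) → ℂ} {e : E} {η : Vec n}
    (hA : AnalyticAt ℂ (fun p : E × Vec (n + 1) => A p.1 p.2) (e, vcons 0 η)) :
    AnalyticAt ℂ (fun p : E × Vec n => ev (A p.1) p.2) (e, η) :=
  hA.comp_pair

lemma analyticAt_of_param {f : Vec n → ℂ} {η : Vec n} (hf : AnalyticAt ℂ f η) :
    AnalyticAt ℂ (fun p : ℂ × Vec n => f p.2) (0, η) :=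
  hf.comp_of

lemma analyticAt_param_slice {A : E → Vec n → ℂ} {e : E} {η : Vec n}
    (hA : AnalyticAt ℂ (fun p : E × Vec n => A p.1 p.2) (e, η)) : AnalyticAt ℂ (A e) η :=
  hA.comp_pair

lemma analyticAt_dz {f : Vec (n + 1) → ℂ} {η : Vec n}
    (hf : AnalyticAt ℂ f (vcons 0 η)) : AnalyticAt ℂ (dz f) η :=
  analyticAt_param_slice (A := fun _ : ℂ => dz f)
    (analyticAt_dz_param (A := fun _ : ℂ => f) (analyticAt_of_param hf))

lemma analyticAt_ev {f : Vec (n + 1) → ℂ} {η : Vec n}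
    (hf : AnalyticAt ℂ f (vcons 0 η)) : AnalyticAt ℂ (ev f) η :=
  analyticAt_param_slice (A := fun _ : ℂ => ev f)
    (analyticAt_ev_param (A := fun _ : ℂ => f) (analyticAt_of_param hf))

lemma analyticAt_dz_zero {f : Vec (n + 1) → ℂ} (hf : AnalyticAt ℂ f 0) :
    AnalyticAt ℂ (dz f) 0 := analyticAt_dz (by rwa [vcons_zero_zero])

lemma analyticAt_ev_zero {f : Vec (n + 1) → ℂ} (hf : AnalyticAt ℂ f 0) :
    AnalyticAt ℂ (ev f) 0 := analyticAt_ev (by rwa [vcons_zero_zero])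

/-- The top coefficient depends analytically on parameters. -/
lemma analyticAt_coef {A : E → Vec n → ℂ} {e : E}
    (hA : AnalyticAt ℂ (fun p : E × Vec n => A p.1 p.2) (e, 0)) :
    AnalyticAt ℂ (fun e => coef n (A e)) e := by
  induction n with
  | zero => exact hA.comp_pair
  | succ n ih =>
    exact ih (A := fun e => dz (A e)) (analyticAt_dz_param (by rwa [vcons_zero_zero]))

lemma eventually_vcons {p : Vec (n + 1) → Prop} (h : ∀ᶠ η in 𝓝 0, p η) :
    ∀ᶠ η : Vec n in 𝓝 0, ∀ᶠ z in 𝓝 (0 : ℂ), p (vcons z η) := by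
  have hc : Tendsto (fun q : Vec n × ℂ => vcons q.2 q.1) (𝓝 (0, 0)) (𝓝 0) :=
    Continuous.tendsto' (by fun_prop) _ _ vcons_zero_zero
  have := hc.eventually h
  rw [nhds_prod_eq] at this
  exact this.curry

lemma eventuallyEq_dz {f g : Vec (n + 1) → ℂ} (h : f =ᶠ[𝓝 0] g) : dz f =ᶠ[𝓝 0] dz g := by
  filter_upwards [eventually_vcons h] with η hη
  exact Filter.EventuallyEq.deriv_eq hη

lemma eventuallyEq_ev {f g : Vec (n + 1) → ℂ} (h : f =ᶠ[𝓝 0] g) : ev f =ᶠ[𝓝 0] ev g := by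
  filter_upwards [eventually_vcons h] with η hη
  exact hη.self_of_nhds

lemma coef_congr {f g : Vec n → ℂ} (h : f =ᶠ[𝓝 0] g) : coef n f = coef n g := by
  induction n with
  | zero => exact h.self_of_nhds
  | succ n ih => exact ih (eventuallyEq_dz h)

lemma TopOnly.congr {c : ℂ} {f g : Vec n → ℂ} (hf : TopOnly n c f) (h : f =ᶠ[𝓝 0] g) :
    TopOnly n c g := by
  induction n generalizing c with
  | zero => exact h.self_of_nhds.symm.trans hf
  | succ n ih => exact ⟨ih hf.1 (eventuallyEq_ev h), ih hf.2 (eventuallyEq_dz h)⟩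

lemma TopTwo.congr {α : ℂ} {β : Vec n} {f g : Vec n → ℂ} (hf : TopTwo n α β f)
    (h : f =ᶠ[𝓝 0] g) : TopTwo n α β g := by
  induction n generalizing α with
  | zero => exact h.self_of_nhds.symm.trans hf
  | succ n ih => exact ⟨hf.1.congr (eventuallyEq_ev h), ih hf.2 (eventuallyEq_dz h)⟩

lemma TopOnly.coef_eq {c : ℂ} {f : Vec n → ℂ} (hf : TopOnly n c f) : coef n f = c := by
  induction n generalizing c with
  | zero => exact hf
  | succ n ih => exact ih hf.2

lemma differentiableAt_vcons {f : Vec (n + 1) → ℂ} {η : Vec n}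
    (hf : AnalyticAt ℂ f (vcons 0 η)) : DifferentiableAt ℂ (fun z => f (vcons z η)) 0 :=
  hf.comp_of.differentiableAt

lemma eventually_analyticAt_vcons {f : Vec (n + 1) → ℂ} (hf : AnalyticAt ℂ f 0) :
    ∀ᶠ η : Vec n in 𝓝 0, AnalyticAt ℂ f (vcons 0 η) :=
  (eventually_vcons hf.eventually_analyticAt).mono fun _ h => h.self_of_nhds

lemma dz_add {f g : Vec (n + 1) → ℂ} (hf : AnalyticAt ℂ f 0) (hg : AnalyticAt ℂ g 0) :
    dz (fun η => f η + g η) =ᶠ[𝓝 0] fun η => dz f η + dz g η := by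
  filter_upwards [eventually_analyticAt_vcons hf, eventually_analyticAt_vcons hg] with η h1 h2
  exact deriv_add (differentiableAt_vcons h1) (differentiableAt_vcons h2)

lemma dz_mul {f g : Vec (n + 1) → ℂ} (hf : AnalyticAt ℂ f 0) (hg : AnalyticAt ℂ g 0) :
    dz (fun η => f η * g η) =ᶠ[𝓝 0] fun η => dz f η * ev g η + ev f η * dz g η := by
  filter_upwards [eventually_analyticAt_vcons hf, eventually_analyticAt_vcons hg] with η h1 h2
  exact deriv_mul (differentiableAt_vcons h1) (differentiableAt_vcons h2)

lemma TopOnly.add {c d : ℂ} {f g : Vec n → ℂ} (hf : TopOnly n c f) (hg : TopOnly n d g)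
    (hfa : AnalyticAt ℂ f 0) (hga : AnalyticAt ℂ g 0) :
    TopOnly n (c + d) (fun η => f η + g η) := by
  induction n generalizing c d with
  | zero => exact congr_arg₂ (· + ·) hf hg
  | succ n ih =>
    refine ⟨?_, (ih hf.2 hg.2 (analyticAt_dz_zero hfa) (analyticAt_dz_zero hga)).congr
      (dz_add hfa hga).symm⟩
    have h := ih hf.1 hg.1 (analyticAt_ev_zero hfa) (analyticAt_ev_zero hga)
    rw [add_zero] at h
    exact h

lemma TopTwo.add {α α' : ℂ} {β β' : Vec n} {f g : Vec n → ℂ} (hf : TopTwo n α β f)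
    (hg : TopTwo n α' β' g) (hfa : AnalyticAt ℂ f 0) (hga : AnalyticAt ℂ g 0) :
    TopTwo n (α + α') (β + β') (fun η => f η + g η) := by
  induction n generalizing α α' with
  | zero => exact congr_arg₂ (· + ·) hf hg
  | succ n ih =>
    refine ⟨?_, (ih hf.2 hg.2 (analyticAt_dz_zero hfa) (analyticAt_dz_zero hga)).congr
      (dz_add hfa hga).symm⟩
    exact hf.1.add hg.1 (analyticAt_ev_zero hfa) (analyticAt_ev_zero hga)

lemma TopOnly.topTwo {c : ℂ} {f : Vec n → ℂ} (hf : TopOnly n c f) : TopTwo n c 0 f := by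
  induction n generalizing c with
  | zero => exact hf
  | succ n ih => exact ⟨hf.1, ih hf.2⟩

lemma TopTwo.topOnly {c : ℂ} {f : Vec n → ℂ} (hf : TopTwo n c 0 f) : TopOnly n c f := by
  induction n generalizing c with
  | zero => exact hf
  | succ n ih => exact ⟨hf.1, ih hf.2⟩

/-- Multiplication by an analytic function only rescales the top coefficient. -/
lemma TopOnly.mul {c : ℂ} {q f : Vec n → ℂ} (hf : TopOnly n c f)
    (hqa : AnalyticAt ℂ q 0) (hfa : AnalyticAt ℂ f 0) :
    TopOnly n (q 0 * c) (fun η => q η * f η) := by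
  induction n generalizing c with
  | zero => exact congr_arg (q 0 * ·) hf
  | succ n ih =>
    have he : ev q 0 = q 0 := by simp [ev, vcons_zero_zero]
    have hq := analyticAt_ev_zero hqa
    have hq' := analyticAt_dz_zero hqa
    have hf' := analyticAt_ev_zero hfa
    have hf'' := analyticAt_dz_zero hfa
    refine ⟨?_, TopOnly.congr ?_ (dz_mul hqa hfa).symm⟩
    · have h := ih hf.1 hq hf'
      rw [mul_zero] at h
      exact h
    have := (ih hf.1 hq' hf').add (ih hf.2 hq hf'') (hq'.mul hf') (hq.mul hf'')
    simpa [he] using this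

/-- Multiplication by an analytic function rescales the coefficients of degree `n - 1`, and adds
their products with its linear part to the top coefficient. -/
lemma TopTwo.mul {α : ℂ} {β : Vec n} {q f : Vec n → ℂ} (hf : TopTwo n α β f)
    (hqa : AnalyticAt ℂ q 0) (hfa : AnalyticAt ℂ f 0) :
    TopTwo n (q 0 * α + ∑ k, deriv (fun z => q (Pi.single k z)) 0 * β k) (q 0 • β)
      (fun η => q η * f η) := by
  induction n generalizing α with
  | zero => simpa [TopTwo] using congr_arg (q 0 * ·) hf
  | succ n ih =>
    have he : ev q 0 = q 0 := by simp [ev, vcons_zero_zero]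
    have hq := analyticAt_ev_zero hqa
    have hq' := analyticAt_dz_zero hqa
    have hf' := analyticAt_ev_zero hfa
    have hf'' := analyticAt_dz_zero hfa
    refine ⟨?_, TopTwo.congr ?_ (dz_mul hqa hfa).symm⟩
    · have h := hf.1.mul hq hf'
      rw [he] at h
      exact h
    have h1 := (hf.1.mul hq' hf').topTwo.add (ih hf.2 hq hf'') (hq'.mul hf') (hq.mul hf'')
    have h2 : dz q 0 = deriv (fun z => q (Pi.single 0 z)) 0 := by
      unfold dz
      congr 1; ext z; congr 1; ext i
      refine Fin.cases ?_ (fun j => ?_) i <;> simp [vcons]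
    have h3 : ∀ k : Fin n, deriv (fun z => ev q (Pi.single k z)) 0 =
        deriv (fun z => q (Pi.single k.succ z)) 0 := by
      intro k
      congr 1; ext z; unfold ev; congr 1; ext i
      refine Fin.cases ?_ (fun j => ?_) i
      · simp [vcons, (Fin.succ_ne_zero k).symm]
      · simp [vcons, Pi.single_apply]
    simp only [h2, h3, he, zero_add] at h1
    change TopTwo n _ (q 0 • Fin.tail β) _
    convert h1 using 1
    rw [Fin.sum_univ_succ]
    simp only [Fin.tail]; ring

lemma vcons_insertNth (l : Fin (n + 1)) (z w : ℂ) (η : Vec n) :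
    vcons z (l.insertNth w η : Vec (n + 1)) =
      (l.succ.insertNth w (vcons z η) : Vec (n + 2)) := by
  ext i
  refine Fin.succAboveCases l.succ ?_ (fun j => ?_) i
  · simp [vcons]
  · rw [Fin.insertNth_apply_succAbove]
    refine Fin.cases ?_ (fun k => ?_) j
    · simp [vcons]
    · simp [vcons]

lemma insertNth_zero_eq (w : ℂ) (η : Vec n) :
    ((0 : Fin (n + 1)).insertNth w η : Vec (n + 1)) = vcons w η := by
  simp [vcons]

/-- The coefficients of degree `n` in `n + 1` variables are visible on the coordinate planes. -/
lemma TopTwo.of_restrict {f : Vec (n + 1) → ℂ} {β : Vec (n + 1)}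
    (h : ∀ l : Fin (n + 1), TopOnly n (β l) (fun η => f (l.insertNth 0 η))) :
    ∃ α, TopTwo (n + 1) α β f := by
  have h0 : TopOnly n (β 0) (ev f) := by
    have h0 := h 0
    simp only [insertNth_zero_eq] at h0
    exact h0
  induction n with
  | zero => exact ⟨dz f 0, h0, rfl⟩
  | succ n ih =>
    have hl : ∀ l : Fin (n + 1), TopOnly n (β l.succ) (fun η => dz f (l.insertNth 0 η)) := by
      intro l
      have := (h l.succ).2
      simp only [dz, vcons_insertNth] at this ⊢
      exact this
    obtain ⟨c, hc⟩ := ih (β := Fin.tail β) hl (by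
      have := hl 0
      simp only [insertNth_zero_eq] at this
      exact this)
    exact ⟨c, h0, hc⟩

/-- If the restrictions to the coordinate hyperplanes have no squarefree monomials,
only the top coefficient can survive. -/
lemma TopOnly.of_restrict {f : Vec (n + 1) → ℂ}
    (h : ∀ l : Fin (n + 1), TopOnly n 0 (fun η => f (l.insertNth 0 η))) :
    ∃ c, TopOnly (n + 1) c f :=
  (TopTwo.of_restrict (β := 0) h).imp fun _ => TopTwo.topOnly

/-- The top coefficient commutes with differentiation in a parameter. -/
lemma coef_deriv {A : ℂ → Vec n → ℂ} {e : ℂ}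
    (hA : AnalyticAt ℂ (fun p : ℂ × Vec n => A p.1 p.2) (e, 0)) :
    coef n (fun η => deriv (fun x => A x η) e) = deriv (fun x => coef n (A x)) e := by
  induction n with
  | zero => rfl
  | succ n ih =>
    have h0 : AnalyticAt ℂ (fun p : ℂ × Vec (n + 1) => A p.1 p.2) (e, vcons 0 0) := by
      rwa [vcons_zero_zero]
    change coef n (dz fun η => deriv (fun x => A x η) e) = deriv (fun x => coef n (dz (A x))) e
    rw [← ih (A := fun x => dz (A x)) (analyticAt_dz_param h0)]
    refine coef_congr ?_
    have h1 : ∀ᶠ η : Vec n in 𝓝 0,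
        AnalyticAt ℂ (fun p : ℂ × Vec (n + 1) => A p.1 p.2) (e, vcons 0 η) :=
      (Continuous.tendsto' (by fun_prop) _ _ (by rw [vcons_zero_zero])).eventually
        hA.eventually_analyticAt
    filter_upwards [h1] with η hη
    exact deriv_deriv_comm (g := fun z x => A x (vcons z η)) hη.comp_pair

end Germs

/-! ### Torus integrals and Laurent coefficients -/

section Torus

variable {n : ℕ}

lemma torusIntegrable_of_continuousOn {f : Vec n → ℂ} {ρ : ℝ}
    (hf : ContinuousOn f {η | ∀ i, ‖η i‖ = |ρ|}) : TorusIntegrable f 0 (fun _ => ρ) := by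
  refine ContinuousOn.integrableOn_compact isCompact_Icc (hf.comp ?_ ?_)
  · exact Continuous.continuousOn (by unfold torusMap; fun_prop)
  · intro θ _ i
    simp [torusMap]

lemma norm_vcons_lt {z : ℂ} {η : Vec n} {δ : ℝ} (hz : ‖z‖ < δ) (hη : ‖η‖ < δ) :
    ‖vcons z η‖ < δ := by
  rw [pi_norm_lt_iff ((norm_nonneg _).trans_lt hz)]
  intro i
  refine Fin.cases ?_ (fun j => ?_) i
  · simpa [vcons] using hz
  · simpa [vcons] using (norm_le_pi_norm η j).trans_lt hη

/-- The constant term of the Laurent expansion of `f / (η₁ ⋯ η_n)` is a torus integral. -/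
lemma torusIntegral_eq_coef {f : Vec n → ℂ} {δ ρ : ℝ} (hρ : 0 < ρ) (hρδ : ρ < δ)
    (hf : AnalyticOnNhd ℂ f (ball 0 δ)) :
    torusIntegral (fun η : Vec n => (∏ i, η i)⁻¹ * ((∏ i, η i)⁻¹ * f η)) 0 (fun _ => ρ) =
      (2 * π * I) ^ n * coef n f := by
  induction n with
  | zero => simp [torusIntegral_dim0, coef]
  | succ n ih =>
    have hδ : 0 < δ := hρ.trans hρδ
    have hint : TorusIntegrable (fun η : Vec (n + 1) =>
        (∏ i, η i)⁻¹ * ((∏ i, η i)⁻¹ * f η)) 0 (fun _ => ρ) := by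
      apply torusIntegrable_of_continuousOn
      have h0 : ContinuousOn (fun η : Vec (n + 1) => (∏ i, η i)⁻¹)
          {η | ∀ i, ‖η i‖ = |ρ|} := by
        refine ContinuousOn.inv₀ (Continuous.continuousOn (by fun_prop)) ?_
        intro η hη
        refine Finset.prod_ne_zero_iff.2 fun i _ => ?_
        rw [← norm_pos_iff, hη i]
        exact abs_pos.2 hρ.ne'
      refine h0.mul (h0.mul (hf.continuousOn.mono ?_))
      intro η hη
      rw [mem_ball_zero_iff, pi_norm_lt_iff hδ]
      intro i
      rw [hη i, abs_of_pos hρ]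
      exact hρδ
    -- the outermost integral is a Cauchy integral for the derivative at `η₀ = 0`
    rw [torusIntegral_succ hint]
    have hslice : ∀ z : ℂ, ‖z‖ < δ → AnalyticOnNhd ℂ (fun η => f (vcons z η))
        (ball 0 δ) := by
      intro z hz η hη
      exact (hf _ (mem_ball_zero_iff.2 (norm_vcons_lt hz (mem_ball_zero_iff.1 hη)))).comp_of
    have hpar : ∀ z : ℂ, ‖z‖ < δ →
        AnalyticAt ℂ (fun p : ℂ × Vec n => f (vcons p.1 p.2)) (z, 0) := by
      intro z hz
      exact (hf _ (mem_ball_zero_iff.2 (norm_vcons_lt hz (norm_zero.trans_lt hδ)))).comp_of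
    have hin : ∀ z ∈ sphere (0 : ℂ) ρ,
        torusIntegral (fun y : Vec n => (∏ i, (vcons z y) i)⁻¹ *
          ((∏ i, (vcons z y) i)⁻¹ * f (vcons z y))) 0 (fun _ => ρ) =
        (2 * π * I) ^ n •
          (((z - 0) ^ 2)⁻¹ • coef n (fun η => f (vcons z η))) := by
      intro z hz
      have hz' : ‖z‖ < δ := by rw [mem_sphere_zero_iff_norm.1 hz]; exact hρδ
      have := ih (hslice z hz')
      have h2 : (fun y : Vec n => (∏ i, (vcons z y) i)⁻¹ *
          ((∏ i, (vcons z y) i)⁻¹ * f (vcons z y))) = fun y => (((z - 0) ^ 2)⁻¹ : ℂ) •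
            ((∏ i, y i)⁻¹ * ((∏ i, y i)⁻¹ * f (vcons z y))) := by
        ext y
        simp only [vcons, Fin.prod_univ_succ, Fin.cons_zero, Fin.cons_succ, smul_eq_mul, mul_inv,
          sub_zero]
        ring
      rw [h2, torusIntegral_smul, this, smul_eq_mul, smul_eq_mul, smul_eq_mul]
      ring
    have e1 : ((fun _ => ρ : Fin (n + 1) → ℝ) ∘ Fin.succ) = fun _ => ρ := rfl
    have e2 : ((0 : Vec (n + 1)) ∘ Fin.succ) = 0 := rfl
    rw [e1, e2]
    have hc0 : (0 : Vec (n + 1)) 0 = 0 := rfl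
    rw [hc0]
    refine (circleIntegral.integral_congr hρ.le hin).trans ?_
    rw [circleIntegral.integral_smul]
    have hd : DifferentiableOn ℂ (fun z => coef n (fun η => f (vcons z η))) (ball 0 δ) := by
      intro z hz
      exact (analyticAt_coef (A := fun z η => f (vcons z η))
        (hpar z (mem_ball_zero_iff.1 hz))).differentiableAt.differentiableWithinAt
    have hc := Complex.two_pi_I_inv_smul_circleIntegral_sub_sq_inv_smul_of_differentiable
      Metric.isOpen_ball (Metric.closedBall_subset_ball hρδ) hd (Metric.mem_ball_self hρ)
    have hc' : (∮ z in C(0, ρ), ((z - 0) ^ 2)⁻¹ • coef n (fun η => f (vcons z η))) =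
        (2 * π * I) * coef (n + 1) f := by
      rw [show coef (n + 1) f = deriv (fun z => coef n (fun η => f (vcons z η))) 0 from
        coef_deriv (A := fun z η => f (vcons z η)) (hpar 0 (by simpa using hδ)), ← hc,
        smul_eq_mul, mul_inv_cancel_left₀ Complex.two_pi_I_ne_zero]
    rw [hc', smul_eq_mul]; ring

lemma torusIntegral_comp_perm (g : Vec n → ℂ) (ρ : ℝ) (σ : Equiv.Perm (Fin n)) :
    torusIntegral (fun η => g (η ∘ σ)) 0 (fun _ => ρ) = torusIntegral g 0 (fun _ => ρ) := by
  unfold torusIntegral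
  have hmp := volume_measurePreserving_piCongrLeft (fun _ : Fin n => ℝ) σ
  have hpre : (MeasurableEquiv.piCongrLeft (fun _ : Fin n => ℝ) σ) ⁻¹'
      (Set.Icc (0 : Fin n → ℝ) fun _ => 2 * π) = Set.Icc 0 fun _ => 2 * π := by
    ext θ
    simp only [Set.mem_preimage, Set.mem_Icc, Pi.le_def]
    have : ∀ i, (MeasurableEquiv.piCongrLeft (fun _ : Fin n => ℝ) σ) θ (σ i) = θ i := fun i =>
      Equiv.piCongrLeft_apply_apply (fun _ : Fin n => ℝ) σ θ i
    constructor
    · rintro ⟨h1, h2⟩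
      exact ⟨fun i => by simpa [this] using h1 (σ i), fun i => by simpa [this] using h2 (σ i)⟩
    · rintro ⟨h1, h2⟩
      refine ⟨fun i => ?_, fun i => ?_⟩
      · obtain ⟨j, rfl⟩ := σ.surjective i
        simpa [this] using h1 j
      · obtain ⟨j, rfl⟩ := σ.surjective i
        simpa [this] using h2 j
  rw [← hmp.setIntegral_preimage_emb (MeasurableEquiv.measurableEmbedding _), hpre]
  refine integral_congr_ae (ae_of_all _ fun θ => ?_)
  have h1 : ∀ i, (MeasurableEquiv.piCongrLeft (fun _ : Fin n => ℝ) σ) θ (σ i) = θ i := fun i =>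
    Equiv.piCongrLeft_apply_apply (fun _ : Fin n => ℝ) σ θ i
  dsimp only
  congr 1
  · rw [← Equiv.prod_comp σ]
    simp only [h1]
  · congr 1
    ext i
    simp [torusMap, h1]

/-- The limit of the torus integrals defining the finite part is a Taylor coefficient of the
regularized function. -/
lemma tendsto_torusIntegral {f Fd : Vec n → ℂ} (hf : AnalyticAt ℂ f 0)
    (hFd : ∀ᶠ η in 𝓝 (0 : Vec n), (∀ i, η i ≠ 0) → (∏ i, η i) * Fd η = f η) :
    Tendsto (fun ρ : ℝ => ((2 * π * I : ℂ) ^ n)⁻¹ *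
      torusIntegral (fun η : Vec n => (∏ i, η i)⁻¹ * Fd η) 0 (fun _ => ρ))
      (𝓝[>] 0) (𝓝 (coef n f)) := by
  obtain ⟨δ, hδ, hball⟩ := Metric.eventually_nhds_iff_ball.1 (hf.eventually_analyticAt.and hFd)
  refine tendsto_const_nhds.congr' ?_
  filter_upwards [Ioo_mem_nhdsGT hδ] with ρ hρ
  have h := torusIntegral_eq_coef hρ.1 hρ.2 (fun η hη => (hball η hη).1)
  have h2 : torusIntegral (fun η : Vec n => (∏ i, η i)⁻¹ * Fd η) 0 (fun _ => ρ) =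
      torusIntegral (fun η : Vec n => (∏ i, η i)⁻¹ * ((∏ i, η i)⁻¹ * f η)) 0 (fun _ => ρ) := by
    unfold torusIntegral
    congr 1
    ext θ
    congr 2
    have hn : ∀ i, ‖torusMap 0 (fun _ => ρ) θ i‖ = ρ := fun i => by
      simp [torusMap, abs_of_pos hρ.1]
    have hne : ∀ i, torusMap 0 (fun _ => ρ) θ i ≠ 0 := fun i => by
      rw [← norm_pos_iff, hn i]; exact hρ.1
    have := (hball (torusMap 0 (fun _ => ρ) θ) (by
      rw [mem_ball_zero_iff, pi_norm_lt_iff hδ]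
      intro i; rw [hn i]; exact hρ.2)).2 hne
    dsimp only
    rw [← this, inv_mul_cancel_left₀ (Finset.prod_ne_zero_iff.2 fun i _ => hne i)]
  rw [h2, h, inv_mul_cancel_left₀ (pow_ne_zero _ Complex.two_pi_I_ne_zero)]

end Torus

/-! ### The scattering matrix -/

section Scattering

variable {B : ℝ}

/-- `z` is neither a zero nor a pole of `S`. -/
def Reg (B : ℝ) (z : ℂ) : Prop :=
  sinh z ^ 2 ≠ -((Real.sin (π * B) : ℝ) : ℂ) ^ 2

/-- The condition on rapidity differences in `Generic`. -/
def Gen (B : ℝ) (z : ℂ) : Prop := sinh z ≠ 0 ∧ Reg B z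

lemma sinh_add_I_pi (z : ℂ) : sinh (z + I * π) = -sinh z := by
  rw [Complex.sinh_add, mul_comm I, Complex.sinh_mul_I, Complex.cosh_mul_I]
  simp

lemma cosh_add_I_pi (z : ℂ) : cosh (z + I * π) = -cosh z := by
  rw [Complex.cosh_add, mul_comm I, Complex.sinh_mul_I, Complex.cosh_mul_I]
  simp

lemma reg_neg {z : ℂ} : Reg B (-z) ↔ Reg B z := by simp [Reg, Complex.sinh_neg]

lemma gen_neg {z : ℂ} : Gen B (-z) ↔ Gen B z := by simp [Gen, reg_neg, Complex.sinh_neg]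

lemma gen_sub_comm {a b : ℂ} : Gen B (a - b) ↔ Gen B (b - a) := by rw [← gen_neg, neg_sub]

lemma reg_sub_comm {a b : ℂ} : Reg B (a - b) ↔ Reg B (b - a) := by rw [← reg_neg, neg_sub]

lemma reg_add_I_pi {z : ℂ} : Reg B (z + I * π) ↔ Reg B z := by
  simp [Reg, sinh_add_I_pi]

lemma gen_add_I_pi {z : ℂ} : Gen B (z + I * π) ↔ Gen B z := by
  simp [Gen, reg_add_I_pi, sinh_add_I_pi]

lemma isOpen_reg : IsOpen {z | Reg B z} :=
  isOpen_ne_fun (by fun_prop) continuous_const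

lemma isOpen_gen : IsOpen {z | Gen B z} :=
  (isOpen_ne_fun (by fun_prop) continuous_const).inter isOpen_reg

lemma sinh_sub_ne {z : ℂ} (hz : Reg B z) :
    sinh z - I * Real.sin (π * B) ≠ 0 := by
  intro h
  apply hz
  rw [sub_eq_zero.1 h, mul_pow, Complex.I_sq]; ring

lemma sinh_add_ne {z : ℂ} (hz : Reg B z) :
    sinh z + I * Real.sin (π * B) ≠ 0 := by
  intro h
  apply hz
  rw [eq_neg_of_add_eq_zero_left h, neg_sq, mul_pow, Complex.I_sq]; ring

lemma S_ne_zero {z : ℂ} (hz : Reg B z) : S B z ≠ 0 :=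
  div_ne_zero (sinh_sub_ne hz) (sinh_add_ne hz)

lemma S_neg (z : ℂ) : S B (-z) = (S B z)⁻¹ := by
  unfold S
  rw [Complex.sinh_neg, inv_div, ← neg_div_neg_eq]
  congr 1 <;> ring

lemma S_add_I_pi (z : ℂ) : S B (z + I * π) = (S B z)⁻¹ := by
  rw [← S_neg]
  unfold S
  rw [sinh_add_I_pi, Complex.sinh_neg]

lemma sin_pi_mul_pos (hB0 : 0 < B) (hB1 : B < 1) : 0 < Real.sin (π * B) :=
  Real.sin_pos_of_pos_of_lt_pi (by positivity) (by nlinarith [Real.pi_pos])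

lemma reg_zero (hB0 : 0 < B) (hB1 : B < 1) : Reg B 0 := by
  have := (sin_pi_mul_pos hB0 hB1).ne'
  unfold Reg
  rw [Complex.sinh_zero]
  intro h
  have h2 : ((Real.sin (π * B) : ℝ) : ℂ) ^ 2 = 0 := by linear_combination h
  exact this (by exact_mod_cast pow_eq_zero_iff (two_ne_zero) |>.1 h2)

lemma S_zero (hB0 : 0 < B) (hB1 : B < 1) : S B 0 = -1 := by
  have := sinh_add_ne (reg_zero hB0 hB1)
  rw [Complex.sinh_zero, zero_add] at this
  unfold S
  rw [Complex.sinh_zero, zero_sub, zero_add, neg_div, div_self this]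

lemma analyticAt_sinh (z : ℂ) : AnalyticAt ℂ sinh z :=
  Complex.analyticAt_sinh

lemma analyticAt_S {z : ℂ} (hz : Reg B z) : AnalyticAt ℂ (S B) z :=
  ((analyticAt_sinh z).sub analyticAt_const).div ((analyticAt_sinh z).add analyticAt_const)
    (sinh_add_ne hz)

lemma hasDerivAt_S {z : ℂ} (hz : Reg B z) :
    HasDerivAt (S B) (I * phi B z * S B z) z := by
  have h := (analyticAt_S hz).differentiableAt.hasDerivAt
  have e : I * phi B z * S B z = deriv (S B) z := by
    have := S_ne_zero hz
    rw [phi, logDeriv_apply, mul_assoc, mul_assoc, div_mul_cancel₀ _ this, ← mul_assoc, mul_neg,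
      Complex.I_mul_I, neg_neg, one_mul]
  rw [e]
  exact h

lemma phi_eq {z : ℂ} (hz : Reg B z) : phi B z =
    2 * Real.sin (π * B) * cosh z /
      (sinh z ^ 2 + (Real.sin (π * B) : ℝ) ^ 2) := by
  have h1 := sinh_sub_ne hz
  have h2 := sinh_add_ne hz
  have hd : HasDerivAt (S B) ((cosh z * (sinh z + I * Real.sin (π * B))
      - (sinh z - I * Real.sin (π * B)) * cosh z) /
      (sinh z + I * Real.sin (π * B)) ^ 2) z :=
    ((Complex.hasDerivAt_sinh z).sub_const _).div ((Complex.hasDerivAt_sinh z).add_const _) h2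
  have h3 : sinh z ^ 2 + (Real.sin (π * B) : ℝ) ^ 2 =
      (sinh z - I * Real.sin (π * B)) *
      (sinh z + I * Real.sin (π * B)) := by
    linear_combination ((Real.sin (π * B) : ℝ) : ℂ) ^ 2 * Complex.I_sq
  unfold phi
  rw [logDeriv_apply, hd.deriv, h3]
  unfold S
  field_simp
  linear_combination (-2 * ((Real.sin (π * B) : ℝ) : ℂ) * cosh z) * Complex.I_sq

lemma phi_neg (z : ℂ) (hz : Reg B z) : phi B (-z) = phi B z := by
  rw [phi_eq hz, phi_eq (reg_neg.2 hz), Complex.sinh_neg, Complex.cosh_neg, neg_sq]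

lemma phi_add_I_pi (z : ℂ) (hz : Reg B z) : phi B (z + I * π) = -phi B z := by
  rw [phi_eq hz, phi_eq (reg_add_I_pi.2 hz), sinh_add_I_pi, cosh_add_I_pi, neg_sq]
  ring

lemma analyticAt_phi {z : ℂ} (hz : Reg B z) : AnalyticAt ℂ (phi B) z := by
  unfold phi
  exact analyticAt_const.mul ((analyticAt_S hz).deriv.div (analyticAt_S hz) (S_ne_zero hz))

end Scattering

/-! ### Form factors of lists of rapidities -/

section Lists

variable {B : ℝ} {F : (n : ℕ) → Vec n → ℂ}

/-- The elementary form factor of a list of rapidities. -/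
def listFF (F : (n : ℕ) → Vec n → ℂ) (l : List ℂ) : ℂ := F l.length l.get

lemma listFF_ofFn {n : ℕ} (θ : Vec n) : listFF F (List.ofFn θ) = F n θ := by
  have key : ∀ (m : ℕ) (hm : m = n) (ξ : Vec m), (∀ i, ξ i = θ (Fin.cast hm i)) →
      F m ξ = F n θ := by
    rintro m rfl ξ h
    congr 1
    exact funext h
  exact key _ List.length_ofFn _ fun i => by simp; rfl

/-- All pairs of rapidities of the list are generic. -/
def ListGen (B : ℝ) (l : List ℂ) : Prop := l.Pairwise fun a b => Gen B (a - b)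

lemma generic_iff {n : ℕ} {θ : Vec n} : Generic B θ ↔ ListGen B (List.ofFn θ) := by
  unfold Generic ListGen
  rw [List.pairwise_ofFn]
  constructor
  · intro h i j hij
    exact h i j hij.ne
  · intro h i j hij
    rcases lt_or_gt_of_ne hij with h1 | h1
    · exact h h1
    · exact gen_sub_comm.1 (h h1)

lemma ListGen.perm {l l' : List ℂ} (h : ListGen B l) (hp : l.Perm l') : ListGen B l' :=
  (hp.pairwise_iff fun hab => gen_sub_comm.1 hab).1 h

/-- Exchange of neighbouring rapidities of a list. -/
lemma listFF_exchange (hF : IsFormFactorFamily B F) {P R : List ℂ} {a b : ℂ}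
    (h : ListGen B (P ++ a :: b :: R)) :
    listFF F (P ++ a :: b :: R) = S B (a - b) * listFF F (P ++ b :: a :: R) := by
  set l := P ++ a :: b :: R with hl
  have hlen : l.length = P.length + (R.length + 2) := by simp [hl]
  have h1 : P.length < l.length := by omega
  have h2 : P.length + 1 < l.length := by omega
  have hg : Generic B l.get := by rw [generic_iff, List.ofFn_get]; exact h
  have hex := hF.exchange l.length l.get hg ⟨P.length, h1⟩ ⟨P.length + 1, h2⟩ rfl
  have ha : l.get ⟨P.length, h1⟩ = a := by simp [hl]
  have hb : l.get ⟨P.length + 1, h2⟩ = b := by simp [hl]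
  rw [ha, hb] at hex
  rw [show listFF F l = F l.length l.get from rfl, hex]
  congr 1
  refine (listFF_ofFn _).symm.trans (congr_arg (listFF F) ?_)
  apply List.ext_getElem
  · simp [hl]; omega
  intro k hk hk'
  rw [List.getElem_ofFn]
  simp only [Function.comp, List.get_eq_getElem]
  rw [Equiv.swap_apply_def]
  have hk2 : k < l.length := by simpa using hk
  by_cases c1 : k = P.length
  · subst c1
    simp [hl]
  by_cases c2 : k = P.length + 1
  · subst c2
    simp [hl]
  · rw [if_neg (by simpa using c1), if_neg (by simpa using c2)]
    simp only [hl]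
    rcases lt_or_ge k P.length with c3 | c3
    · rw [List.getElem_append_left c3, List.getElem_append_left c3]
    · rw [List.getElem_append_right c3, List.getElem_append_right c3]
      obtain ⟨j, hj⟩ : ∃ j, k - P.length = j + 2 := ⟨k - P.length - 2, by omega⟩
      simp [hj]

/-- Repeated exchange: the rapidity `a` moves to the left past `Q`. -/
lemma listFF_moveLeft (hF : IsFormFactorFamily B F) {R : List ℂ} {a : ℂ} (Q : List ℂ) :
    ∀ P : List ℂ, ListGen B (P ++ Q ++ a :: R) →
    listFF F (P ++ Q ++ a :: R) =
      (Q.map fun y => S B (y - a)).prod * listFF F (P ++ a :: Q ++ R) := by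
  induction Q with
  | nil => intro P _; simp
  | cons y Q ih =>
    intro P h
    have e1 : P ++ y :: Q ++ a :: R = (P ++ [y]) ++ Q ++ a :: R := by simp
    have h' : ListGen B (P ++ y :: a :: (Q ++ R)) := by
      refine h.perm ?_
      rw [List.append_assoc]
      refine List.Perm.append_left _ ?_
      exact List.Perm.cons _ (List.perm_middle)
    rw [e1, ih (P ++ [y]) (by rwa [← e1])]
    have e2 : P ++ [y] ++ a :: Q ++ R = P ++ y :: a :: (Q ++ R) := by simp
    rw [e2, listFF_exchange hF h', List.map_cons, List.prod_cons]
    simp only [List.append_assoc, List.cons_append]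
    ring

lemma eventually_listGen_cons {a : ℂ} {l : List ℂ} (h : ∀ b ∈ l, Gen B (a - b)) :
    ∀ᶠ z in 𝓝 a, ∀ b ∈ l, Gen B (z - b) := by
  induction l with
  | nil => simp
  | cons b l ih =>
    have h1 : ∀ᶠ z in 𝓝 a, Gen B (z - b) :=
      (Continuous.tendsto (by fun_prop : Continuous fun z : ℂ => z - b) a).eventually
        (isOpen_gen.mem_nhds (h b (by simp)))
    filter_upwards [h1, ih fun c hc => h c (by simp [hc])] with z hz1 hz2
    simpa using ⟨hz1, hz2⟩

lemma eventually_gen_zero (hB0 : 0 < B) (hB1 : B < 1) : ∀ᶠ z in 𝓝[≠] (0 : ℂ), Gen B z := by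
  have h1 : ∀ᶠ z in 𝓝[≠] (0 : ℂ), sinh z ≠ 0 := by
    have hd : HasDerivAt sinh 1 0 := by simpa using Complex.hasDerivAt_sinh 0
    simpa using hd.eventually_ne (c := 0) one_ne_zero
  filter_upwards [h1, nhdsWithin_le_nhds (isOpen_reg.mem_nhds (reg_zero hB0 hB1))] with z h1 h2
  exact ⟨h1, h2⟩

/-- The kinematical residue for a particle and its antiparticle at arbitrary positions in the
list of rapidities. -/
lemma listFF_residue (hB0 : 0 < B) (hB1 : B < 1) (hF : IsFormFactorFamily B F) {P Q R : List ℂ}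
    {a : ℂ} (h : ListGen B (a :: (P ++ Q ++ R))) :
    Tendsto (fun z => (z - a) * listFF F (P ++ (z + I * π) :: (Q ++ a :: R)))
      (𝓝[≠] a) (𝓝 ((P.map fun y => S B (y - a - I * π)).prod *
        ((P ++ Q).map fun y => S B (y - a)).prod *
        (I * (1 - ((P ++ Q ++ R).map fun y => S B (a - y)).prod)) *
          listFF F (P ++ Q ++ R))) := by
  set T := P ++ Q ++ R with hT
  have hgT : ∀ b ∈ T, Gen B (a - b) := (List.pairwise_cons.1 h).1
  -- the residue with the pair in front
  have hkin : Tendsto (fun z => (z - a) * listFF F ((z + I * π) :: a :: T))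
      (𝓝[≠] a) (𝓝 (I * (1 - (T.map fun y => S B (a - y)).prod) * listFF F T)) := by
    have hgen : Generic B (Fin.cons a T.get : Vec (T.length + 1)) := by
      rw [generic_iff, List.ofFn_cons, List.ofFn_get]; exact h
    have h1 := (hF.kinematical T.length a T.get hgen).const_mul I
    have e1 : (T.map fun y => S B (a - y)).prod = ∏ k, S B (a - T.get k) := by
      conv_lhs => rw [← List.ofFn_get T, List.map_ofFn, List.prod_ofFn]
      rfl
    rw [e1, mul_assoc]
    refine h1.congr fun z => ?_
    have e2 := listFF_ofFn (F := F)
      (Fin.cons (z + I * π) (Fin.cons a T.get : Vec (T.length + 1)) :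
        Vec (T.length + 2))
    rw [List.ofFn_cons, List.ofFn_cons, List.ofFn_get] at e2
    rw [e2]
    linear_combination (-(z - a) * F (T.length + 2)
        (Fin.cons (z + I * π) (Fin.cons a T.get : Vec (T.length + 1)))) *
        Complex.I_sq
  have hcont : Tendsto (fun z : ℂ => (P.map fun y => S B (y - (z + I * π))).prod)
      (𝓝[≠] a) (𝓝 (P.map fun y => S B (y - a - I * π)).prod) := by
    have : ∀ P' : List ℂ, (∀ y ∈ P', Gen B (a - y)) →
        Tendsto (fun z : ℂ => (P'.map fun y => S B (y - (z + I * π))).prod)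
        (𝓝[≠] a) (𝓝 (P'.map fun y => S B (y - a - I * π)).prod) := by
      intro P'
      induction P' with
      | nil => intro _; simp
      | cons y P' ih =>
        intro hP
        simp only [List.map_cons, List.prod_cons]
        refine Tendsto.mul ?_ (ih fun y hy => hP y (by simp [hy]))
        have hr : Reg B (y - a - I * π) := by
          have := (gen_sub_comm.1 (hP y (by simp))).2
          rw [← reg_add_I_pi, sub_add_cancel]; exact this
        have hc := (analyticAt_S hr).continuousAt.tendsto
        refine hc.comp ((Continuous.tendsto' (by fun_prop) _ _ ?_).mono_left nhdsWithin_le_nhds)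
        ring
    exact this P fun y hy => hgT y (by simp [hT, hy])
  have hlim := (hcont.mul_const ((P ++ Q).map fun y => S B (y - a)).prod).mul hkin
  have hlim2 := hlim.congr' (f₂ := fun z => (z - a) *
      listFF F (P ++ (z + I * π) :: (Q ++ a :: R))) ?_
  · convert hlim2 using 2; ring
  have hz0 : ∀ᶠ z in 𝓝[≠] a, Gen B (z - a) := by
    have : Tendsto (fun z : ℂ => z - a) (𝓝[≠] a) (𝓝[≠] 0) := by
      refine tendsto_nhdsWithin_iff.2 ⟨?_, ?_⟩
      · exact ((by fun_prop : Continuous fun z : ℂ => z - a).tendsto' a 0 (sub_self a)).mono_left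
          nhdsWithin_le_nhds
      · filter_upwards [self_mem_nhdsWithin] with z hz
        exact sub_ne_zero.2 hz
    exact this.eventually (eventually_gen_zero hB0 hB1)
  filter_upwards [hz0, nhdsWithin_le_nhds (eventually_listGen_cons hgT)] with z hza hzT
  -- exchanges move the pair to the front
  set z' := z + I * π with hz'
  have hz'g : ∀ b, Gen B (z - b) → Gen B (z' - b) := fun b hb => by
    rw [hz', add_sub_right_comm, gen_add_I_pi]; exact hb
  have hbig : ListGen B (z' :: a :: T) := by
    refine List.pairwise_cons.2 ⟨?_, h⟩
    intro b hb
    rcases List.mem_cons.1 hb with rfl | hb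
    · exact hz'g _ hza
    · exact hz'g _ (hzT b hb)
  have hperm1 : (z' :: a :: T).Perm (P ++ z' :: Q ++ a :: R) := by
    have p1 : (P ++ z' :: Q ++ a :: R).Perm (a :: (P ++ z' :: Q ++ R)) := List.perm_middle
    have p2 : (P ++ z' :: Q ++ R).Perm (z' :: T) := by
      rw [hT, List.append_assoc, List.append_assoc]
      exact List.perm_middle
    exact (p1.trans ((p2.cons a).trans (List.Perm.swap _ _ _))).symm
  have e1 : P ++ z' :: (Q ++ a :: R) = [] ++ (P ++ z' :: Q) ++ a :: R := by simp
  rw [e1, listFF_moveLeft hF (P ++ z' :: Q) [] (hbig.perm (by simpa using hperm1))]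
  have e2 : [] ++ a :: (P ++ z' :: Q) ++ R = [a] ++ P ++ z' :: (Q ++ R) := by simp
  have e3 : [a] ++ z' :: P ++ (Q ++ R) = [] ++ [a] ++ z' :: T := by simp [hT]
  rw [e2, listFF_moveLeft hF P [a] (hbig.perm ?_), e3, listFF_moveLeft hF [a] [] (hbig.perm ?_)]
  · have e4 : [] ++ z' :: [a] ++ T = z' :: a :: T := by simp
    rw [e4]
    simp only [List.map_append, List.prod_append, List.map_cons, List.prod_cons, List.map_nil,
      List.prod_nil, mul_one]
    have e5 : S B (z' - a) * S B (a - z') = 1 := by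
      rw [← neg_sub z' a, S_neg, mul_inv_cancel₀ (S_ne_zero (hz'g _ hza).2)]
    linear_combination ((-(List.map (fun y => S B (y - z')) P).prod *
      ((List.map (fun y => S B (y - a)) P).prod * (List.map (fun y => S B (y - a)) Q).prod) *
      ((z - a) * listFF F (z' :: a :: T)))) * e5
  · exact (List.Perm.swap _ _ _)
  · have p2 : (P ++ z' :: (Q ++ R)).Perm (z' :: T) := by
      rw [hT, List.append_assoc]
      exact List.perm_middle
    exact (List.Perm.swap _ _ _).trans (p2.symm.cons a)

end Lists

/-! ### Regularized form factors near the diagonal -/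

section Regularized

variable {B : ℝ} {F G : (n : ℕ) → Vec n → ℂ}

/-- `G n` is the analytic continuation of `F_n ∏_{i<j} cosh ((θ_i - θ_j)/2)`. -/
def Regularizes (B : ℝ) (F G : (n : ℕ) → Vec n → ℂ) : Prop :=
  ∀ n, AnalyticOnNhd ℂ (G n) {θ | ∀ i j, i ≠ j → Reg B (θ i - θ j)} ∧
    ∀ θ : Vec n, Generic B θ →
      (∏ p : Fin n × Fin n with p.1 < p.2, cosh ((θ p.1 - θ p.2) / 2)) * F n θ = G n θ

lemma IsFormFactorFamily.exists_regularizes (hF : IsFormFactorFamily B F) :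
    ∃ G, Regularizes B F G := by
  choose G hG using hF.regular
  exact ⟨G, hG⟩

/-- The entire function `i sinh (z/2) / z`. -/
def shc : ℂ → ℂ := dslope (fun z => I * sinh (z / 2)) 0

lemma mul_shc (z : ℂ) : z * shc z = I * sinh (z / 2) := by
  have := sub_smul_dslope (fun z => I * sinh (z / 2)) 0 z
  simpa [shc] using this

lemma shc_zero : shc 0 ≠ 0 := by
  have : HasDerivAt (fun z : ℂ => I * sinh (z / 2))
      (I * (cosh (0 / 2) * (1 / 2))) 0 :=
    ((Complex.hasDerivAt_sinh _).comp (0 : ℂ) ((hasDerivAt_id (0 : ℂ)).div_const 2)).const_mul _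
  rw [shc, dslope_same, this.deriv]
  simp

lemma analyticAt_shc (z : ℂ) : AnalyticAt ℂ shc z := by
  have h : DifferentiableOn ℂ shc Set.univ := by
    refine (Complex.differentiableOn_dslope univ_mem).2 (Differentiable.differentiableOn ?_)
    fun_prop
  exact h.analyticAt univ_mem

lemma cosh_half_eq (z : ℂ) : cosh (z / 2) =
    (z - I * π) * shc (z - I * π) := by
  rw [mul_shc]
  have h : z / 2 = (z - I * π) / 2 + π / 2 * I := by ring
  rw [h, Complex.cosh_add, Complex.cosh_mul_I, Complex.sinh_mul_I]
  simp
  ring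

lemma cosh_half_ne {z : ℂ} (h : sinh z ≠ 0) : cosh (z / 2) ≠ 0 := by
  intro h0
  apply h
  rw [show z = 2 * (z / 2) by ring, Complex.sinh_two_mul, h0, mul_zero]

lemma sinh_half_ne {z : ℂ} (h : sinh z ≠ 0) : sinh (z / 2) ≠ 0 := by
  intro h0
  apply h
  rw [show z = 2 * (z / 2) by ring, Complex.sinh_two_mul, h0, mul_zero, zero_mul]

/-- The form factor with the poles at `θ_p - θ_q = iπ`, `(p, q) ∈ P`, removed. -/
def regFF (G : (n : ℕ) → Vec n → ℂ) {N : ℕ} (P : Finset (Fin N × Fin N)) (x : Vec N) :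
    ℂ :=
  G N x * (∏ p ∈ (Finset.univ.filter fun p : Fin N × Fin N => p.1 < p.2) \ P,
    (cosh ((x p.1 - x p.2) / 2))⁻¹) *
    ∏ p ∈ P, (shc (x p.1 - x p.2 - I * π))⁻¹

lemma analyticAt_regFF (hG : Regularizes B F G) {N : ℕ} {P : Finset (Fin N × Fin N)}
    {x : Vec N} (h1 : ∀ i j, i ≠ j → Reg B (x i - x j))
    (h2 : ∀ p : Fin N × Fin N, p.1 < p.2 → p ∉ P → cosh ((x p.1 - x p.2) / 2) ≠ 0)
    (h3 : ∀ p ∈ P, shc (x p.1 - x p.2 - I * π) ≠ 0) :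
    AnalyticAt ℂ (regFF G P) x := by
  unfold regFF
  refine (((hG N).1 x h1).mul ?_).mul ?_
  · refine Finset.analyticAt_fun_prod _ fun p hp => ?_
    rw [Finset.mem_sdiff, Finset.mem_filter] at hp
    refine AnalyticAt.inv ?_ (h2 p hp.1.2 hp.2)
    exact Complex.analyticAt_cosh.comp_of
  · refine Finset.analyticAt_fun_prod _ fun p hp => ?_
    refine AnalyticAt.inv ?_ (h3 p hp)
    exact (analyticAt_shc _).comp_of

/-- At generic points `regFF` is the form factor times the factors of the removed poles. -/
lemma regFF_eq (hG : Regularizes B F G) {N : ℕ} {P : Finset (Fin N × Fin N)}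
    (hP : ∀ p ∈ P, p.1 < p.2) {x : Vec N} (hx : Generic B x) :
    (∏ p ∈ P, (x p.1 - x p.2 - I * π)) * F N x = regFF G P x := by
  unfold regFF
  rw [← (hG N).2 x hx]
  have hsub : P ⊆ Finset.univ.filter fun p : Fin N × Fin N => p.1 < p.2 :=
    fun p hp => Finset.mem_filter.2 ⟨Finset.mem_univ _, hP p hp⟩
  have hne : ∀ p : Fin N × Fin N, p.1 < p.2 → cosh ((x p.1 - x p.2) / 2) ≠ 0 :=
    fun p hp => cosh_half_ne (hx p.1 p.2 hp.ne).1
  rw [← Finset.prod_sdiff hsub, Finset.prod_inv_distrib, Finset.prod_inv_distrib]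
  have e : ∏ p ∈ P, cosh ((x p.1 - x p.2) / 2) =
      (∏ p ∈ P, (x p.1 - x p.2 - I * π)) *
        ∏ p ∈ P, shc (x p.1 - x p.2 - I * π) := by
    rw [← Finset.prod_mul_distrib]
    exact Finset.prod_congr rfl fun p _ => cosh_half_eq _
  have hA : ∏ p ∈ (Finset.univ.filter fun p : Fin N × Fin N => p.1 < p.2) \ P,
      cosh ((x p.1 - x p.2) / 2) ≠ 0 := by
    refine Finset.prod_ne_zero_iff.2 fun p hp => ?_
    rw [Finset.mem_sdiff, Finset.mem_filter] at hp
    exact hne p hp.1.2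
  have hB : ∏ p ∈ P, cosh ((x p.1 - x p.2) / 2) ≠ 0 :=
    Finset.prod_ne_zero_iff.2 fun p hp => hne p (hP p hp)
  rw [e] at hB ⊢
  have hC := right_ne_zero_of_mul hB
  field_simp

variable {n : ℕ}

lemma diagonalPoint_castAdd (θ η : Vec n) (i : Fin n) :
    diagonalPoint θ η (Fin.castAdd n i) = θ i + I * π + η i := by
  simp [diagonalPoint]

lemma diagonalPoint_natAdd (θ η : Vec n) (i : Fin n) :
    diagonalPoint θ η (Fin.natAdd n i) = θ i.rev := by
  rw [diagonalPoint, Fin.append_right]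

lemma analyticAt_diagonalPoint (q : Vec n × Vec n) :
    AnalyticAt ℂ (fun p : Vec n × Vec n => diagonalPoint p.1 p.2) q := by
  rw [analyticAt_pi_iff]
  intro k
  refine Fin.addCases (fun i => ?_) (fun i => ?_) k
  · simp only [diagonalPoint_castAdd]
    fun_prop
  · simp only [diagonalPoint_natAdd]
    fun_prop

/-- The positions of the pairs `θ_i + iπ + η_i`, `θ_j` in `diagonalPoint`, for `(i, j) ∈ r`. -/
def diagPairs (r : Finset (Fin n × Fin n)) : Finset (Fin (n + n) × Fin (n + n)) :=
  r.image fun p => (Fin.castAdd n p.1, Fin.natAdd n p.2.rev)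

lemma diagPairs_injective : Function.Injective
    (fun p : Fin n × Fin n => (Fin.castAdd n p.1, Fin.natAdd n p.2.rev)) := by
  rintro ⟨a, b⟩ ⟨c, d⟩ h
  simp only [Prod.mk.injEq, Fin.castAdd_inj, Fin.natAdd_inj, Fin.rev_inj] at h
  exact Prod.ext h.1 h.2

/-- The form factor at `diagonalPoint` times `∏_{(i, j) ∈ r} (θ_i + η_i - θ_j)`, continued
analytically. -/
def diagReg (G : (n : ℕ) → Vec n → ℂ) (r : Finset (Fin n × Fin n)) (θ η : Vec n) : ℂ :=
  regFF G (diagPairs r) (diagonalPoint θ η)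

/-- The shifts by `iπ` do not matter for genericity. -/
lemma generic_diagonalPoint_iff {θ η : Vec n} : Generic B (diagonalPoint θ η) ↔
    (∀ i j, i ≠ j → Gen B (θ i - θ j)) ∧
    (∀ i j, i ≠ j → Gen B (θ i + η i - (θ j + η j))) ∧ ∀ i j, Gen B (θ i + η i - θ j) := by
  have e1 : ∀ i j, θ i + I * π + η i - (θ j + I * π + η j) =
      θ i + η i - (θ j + η j) := fun i j => by ring
  have e2 : ∀ i j, θ i + I * π + η i - θ j =
      (θ i + η i - θ j) + I * π := fun i j => by ring
  constructor
  · intro h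
    refine ⟨fun i j hij => ?_, fun i j hij => ?_, fun i j => ?_⟩
    · have := h (Fin.natAdd n i.rev) (Fin.natAdd n j.rev) (by simpa using hij)
      simp only [diagonalPoint_natAdd, Fin.rev_rev] at this
      exact this
    · have := h (Fin.castAdd n i) (Fin.castAdd n j) (by simpa using hij)
      simp only [diagonalPoint_castAdd, e1] at this
      exact this
    · have := h (Fin.castAdd n i) (Fin.natAdd n j.rev)
        (by simp only [ne_eq, Fin.ext_iff, Fin.val_castAdd, Fin.val_natAdd]; omega)
      simp only [diagonalPoint_castAdd, diagonalPoint_natAdd, Fin.rev_rev, e2] at this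
      exact gen_add_I_pi.1 this
  · rintro ⟨h1, h2, h3⟩ p q
    refine Fin.addCases (fun i => ?_) (fun i => ?_) p <;>
      refine Fin.addCases (fun j => ?_) (fun j => ?_) q <;> intro hpq
    · simp only [diagonalPoint_castAdd, e1]
      exact h2 i j (by simpa using hpq)
    · simp only [diagonalPoint_castAdd, diagonalPoint_natAdd, e2]
      exact gen_add_I_pi.2 (h3 _ _)
    · simp only [diagonalPoint_castAdd, diagonalPoint_natAdd]
      refine gen_sub_comm.1 ?_
      rw [e2]
      exact gen_add_I_pi.2 (h3 _ _)
    · simp only [diagonalPoint_natAdd]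
      exact h1 _ _ (by simpa using hpq)

/-- Any two rapidities coincide or are generic. -/
def Separated (B : ℝ) (θ : Vec n) : Prop := ∀ i j, θ i = θ j ∨ Gen B (θ i - θ j)

lemma Separated.reg (hB0 : 0 < B) (hB1 : B < 1) {θ : Vec n} (h : Separated B θ) (i j : Fin n) :
    Reg B (θ i - θ j) := by
  rcases h i j with h | h
  · rw [h, sub_self]; exact reg_zero hB0 hB1
  · exact h.2

lemma separated_of_generic {θ : Vec n} (h : Generic B θ) : Separated B θ := fun i j => by
  by_cases hij : i = j
  · exact Or.inl (by rw [hij])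
  · exact Or.inr (h i j hij)

/-- Removal of the poles of all pairs of equal rapidities leaves an analytic function. -/
lemma analyticAt_diagReg (hB0 : 0 < B) (hB1 : B < 1) (hG : Regularizes B F G)
    {r : Finset (Fin n × Fin n)} {θ : Vec n} (hθ : Separated B θ)
    (hr : ∀ p, p ∈ r ↔ θ p.1 = θ p.2) :
    AnalyticAt ℂ (fun p : Vec n × Vec n => diagReg G r p.1 p.2) (θ, 0) := by
  have e2 : ∀ i j, θ i + I * π - θ j = (θ i - θ j) + I * π :=
    fun i j => by ring
  refine AnalyticAt.comp_of (A := regFF G (diagPairs r)) (a := diagonalPoint θ 0)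
    (analyticAt_regFF hG ?_ ?_ ?_) (analyticAt_diagonalPoint _)
  · intro p q
    refine Fin.addCases (fun i => ?_) (fun i => ?_) p <;>
      refine Fin.addCases (fun j => ?_) (fun j => ?_) q <;> intro _ <;>
      simp only [diagonalPoint_castAdd, diagonalPoint_natAdd, Pi.zero_apply, add_zero,
        add_sub_add_right_eq_sub]
    · exact hθ.reg hB0 hB1 _ _
    · rw [e2, reg_add_I_pi]; exact hθ.reg hB0 hB1 _ _
    · rw [reg_sub_comm, e2, reg_add_I_pi]; exact hθ.reg hB0 hB1 _ _
    · exact hθ.reg hB0 hB1 _ _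
  · rintro ⟨p, q⟩
    refine Fin.addCases (fun i => ?_) (fun i => ?_) p <;>
      refine Fin.addCases (fun j => ?_) (fun j => ?_) q <;> intro hlt hnot <;>
      simp only [diagonalPoint_castAdd, diagonalPoint_natAdd, Pi.zero_apply, add_zero,
        add_sub_add_right_eq_sub]
    · rcases hθ i j with h | h
      · simp [h]
      · exact cosh_half_ne h.1
    · have hne : θ i ≠ θ j.rev := fun h => hnot (Finset.mem_image.2
        ⟨(i, j.rev), (hr (i, j.rev)).2 h, by simp⟩)
      have := sinh_half_ne ((hθ i j.rev).resolve_left hne).1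
      rw [cosh_half_eq, e2, add_sub_cancel_right, mul_shc]
      exact mul_ne_zero Complex.I_ne_zero this
    · exfalso
      simp only [Fin.lt_def, Fin.val_castAdd, Fin.val_natAdd] at hlt
      omega
    · rcases hθ i.rev j.rev with h | h
      · simp [h]
      · exact cosh_half_ne h.1
  · intro p hp
    obtain ⟨⟨i, j⟩, hij, rfl⟩ := Finset.mem_image.1 hp
    have h := (hr _).1 hij
    simp only at h
    simp only [diagonalPoint_castAdd, diagonalPoint_natAdd, Pi.zero_apply, add_zero, Fin.rev_rev]
    rw [e2, h, sub_self, zero_add, sub_self]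
    exact shc_zero

lemma diagReg_eq (hG : Regularizes B F G) (r : Finset (Fin n × Fin n)) {θ η : Vec n}
    (h : Generic B (diagonalPoint θ η)) :
    (∏ p ∈ r, (θ p.1 + η p.1 - θ p.2)) * F (n + n) (diagonalPoint θ η) = diagReg G r θ η := by
  unfold diagReg
  rw [← regFF_eq hG _ h]
  · congr 1
    unfold diagPairs
    rw [Finset.prod_image fun a _ b _ h => diagPairs_injective h]
    refine Finset.prod_congr rfl fun p _ => ?_
    simp only [diagonalPoint_castAdd, diagonalPoint_natAdd, Fin.rev_rev]
    ring
  · intro p hp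
    obtain ⟨⟨i, j⟩, hij, rfl⟩ := Finset.mem_image.1 hp
    simp only [Fin.lt_def, Fin.val_castAdd, Fin.val_natAdd]
    omega

lemma eventually_gen_of_ne (hB0 : 0 < B) (hB1 : B < 1) {X : Type*} [TopologicalSpace X] {x : X}
    {u v : X → ℂ} (hu : ContinuousAt u x) (hv : ContinuousAt v x)
    (h : u x = v x ∨ Gen B (u x - v x)) : ∀ᶠ y in 𝓝 x, u y ≠ v y → Gen B (u y - v y) := by
  have ht : Tendsto (fun y => u y - v y) (𝓝 x) (𝓝 (u x - v x)) := hu.sub hv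
  rcases h with h | h
  · rw [h, sub_self] at ht
    have h2 := eventually_nhdsWithin_iff.1 (eventually_gen_zero hB0 hB1)
    filter_upwards [ht.eventually h2] with y hy hne
    exact hy (by simpa [sub_eq_zero] using hne)
  · filter_upwards [ht.eventually (isOpen_gen.mem_nhds h)] with y hy _ using hy

/-- Close to separated rapidities only coincidences are non-generic. -/
lemma eventually_generic_diagonalPoint (hB0 : 0 < B) (hB1 : B < 1) {θ₀ : Vec n}
    (hθ : Separated B θ₀) :
    ∀ᶠ p : Vec n × Vec n in 𝓝 (θ₀, 0), (∀ i j, i ≠ j → p.1 i ≠ p.1 j) →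
      (∀ i j, i ≠ j → p.1 i + p.2 i ≠ p.1 j + p.2 j) → (∀ i j, p.1 i + p.2 i ≠ p.1 j) →
      Generic B (diagonalPoint p.1 p.2) := by
  have c1 : ∀ i, Continuous fun p : Vec n × Vec n => p.1 i := fun i => by fun_prop
  have c2 : ∀ i, Continuous fun p : Vec n × Vec n => p.1 i + p.2 i :=
    fun i => by fun_prop
  have h1 := eventually_all.2 fun i => eventually_all.2 fun j => eventually_gen_of_ne hB0 hB1
    (c1 i).continuousAt (c1 j).continuousAt (x := (θ₀, 0)) (hθ i j)
  have h2 := eventually_all.2 fun i => eventually_all.2 fun j => eventually_gen_of_ne hB0 hB1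
    (c2 i).continuousAt (c2 j).continuousAt (x := (θ₀, 0)) (by simpa using hθ i j)
  have h3 := eventually_all.2 fun i => eventually_all.2 fun j => eventually_gen_of_ne hB0 hB1
    (c2 i).continuousAt (c1 j).continuousAt (x := (θ₀, 0)) (by simpa using hθ i j)
  filter_upwards [h1, h2, h3] with p h1 h2 h3 a1 a2 a3
  exact generic_diagonalPoint_iff.2 ⟨fun i j hij => h1 i j (a1 i j hij),
    fun i j hij => h2 i j (a2 i j hij), fun i j => h3 i j (a3 i j)⟩

lemma ne_of_generic {θ : Vec n} (h : Generic B θ) {i j : Fin n} (hij : i ≠ j) : θ i ≠ θ j := by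
  intro h0
  apply (h i j hij).1
  rw [h0, sub_self, Complex.sinh_zero]

/-- Close to generic rapidities, nonzero shifts lead to generic points. -/
lemma eventually_generic_diagonalPoint' (hB0 : 0 < B) (hB1 : B < 1) {θ₀ : Vec n}
    (hθ : Generic B θ₀) :
    ∀ᶠ p : Vec n × Vec n in 𝓝 (θ₀, 0), (∀ i, p.2 i ≠ 0) →
      Generic B (diagonalPoint p.1 p.2) := by
  have c1 : ∀ i, Continuous fun p : Vec n × Vec n => p.1 i := fun i => by fun_prop
  have c2 : ∀ i, Continuous fun p : Vec n × Vec n => p.1 i + p.2 i :=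
    fun i => by fun_prop
  have key : ∀ u v : Vec n × Vec n → ℂ, Continuous u → Continuous v →
      ∀ i j, i ≠ j → u (θ₀, 0) = θ₀ i → v (θ₀, 0) = θ₀ j → ∀ᶠ p in 𝓝 (θ₀, 0), u p ≠ v p := by
    intro u v hu hv i j hij h1 h2
    refine (isOpen_ne_fun hu hv).mem_nhds ?_
    simp only [Set.mem_ofPred_eq, h1, h2]
    exact ne_of_generic hθ hij
  have h1 : ∀ᶠ p : Vec n × Vec n in 𝓝 (θ₀, 0), ∀ i j, i ≠ j → p.1 i ≠ p.1 j :=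
    eventually_all.2 fun i => eventually_all.2 fun j => eventually_imp_distrib_left.2 fun hij =>
      key _ _ (c1 i) (c1 j) i j hij rfl rfl
  have h2 : ∀ᶠ p : Vec n × Vec n in 𝓝 (θ₀, 0), ∀ i j, i ≠ j →
      p.1 i + p.2 i ≠ p.1 j + p.2 j :=
    eventually_all.2 fun i => eventually_all.2 fun j => eventually_imp_distrib_left.2 fun hij =>
      key _ _ (c2 i) (c2 j) i j hij (by simp) (by simp)
  have h3 : ∀ᶠ p : Vec n × Vec n in 𝓝 (θ₀, 0), ∀ i j, i ≠ j →
      p.1 i + p.2 i ≠ p.1 j :=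
    eventually_all.2 fun i => eventually_all.2 fun j => eventually_imp_distrib_left.2 fun hij =>
      key _ _ (c2 i) (c1 j) i j hij (by simp) (by simp)
  filter_upwards [eventually_generic_diagonalPoint hB0 hB1 (separated_of_generic hθ), h1, h2, h3]
    with p hp h1 h2 h3 hne
  refine hp h1 h2 fun i j => ?_
  by_cases hij : i = j
  · subst hij
    simpa using hne i
  · exact h3 i j hij

end Regularized

/-! ### Kinematical residues at the diagonal -/

section Kinematical

variable {B : ℝ} {F G : (n : ℕ) → Vec n → ℂ} {n : ℕ}

/-- `S(t) / S(t + η)`. -/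
def ratS (B : ℝ) (t η : ℂ) : ℂ := S B t / S B (t + η)

/-- The factor relating the residue at `η_l = 0` of a form factor at `diagonalPoint` to the form
factor without the `l`-th rapidity. -/
def kinFactor (B : ℝ) (θ : Vec (n + 1)) (l : Fin (n + 1)) (η : Vec n) : ℂ :=
  I * ((∏ j : Fin n with (l : ℕ) ≤ j.val, ratS B (θ (l.succAbove j) - θ l) (η j)) -
    ∏ j : Fin n with j.val < (l : ℕ), (ratS B (θ (l.succAbove j) - θ l) (η j))⁻¹)

lemma ratS_zero {t : ℂ} (ht : Reg B t) : ratS B t 0 = 1 := by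
  rw [ratS, add_zero, div_self (S_ne_zero ht)]

lemma analyticAt_ratS {t η : ℂ} (ht : Reg B t) (htη : Reg B (t + η)) :
    AnalyticAt ℂ (fun p : ℂ × ℂ => ratS B p.1 p.2) (t, η) :=
  (analyticAt_S ht).comp_of.div (analyticAt_S htη).comp_of (S_ne_zero htη)

lemma ratS_ne_zero {t η : ℂ} (ht : Reg B t) (htη : Reg B (t + η)) : ratS B t η ≠ 0 :=
  div_ne_zero (S_ne_zero ht) (S_ne_zero htη)

lemma hasDerivAt_ratS {t : ℂ} (ht : Reg B t) :
    HasDerivAt (ratS B t) (-(I * phi B t)) 0 := by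
  have h0 : Reg B (t + 0) := by rwa [add_zero]
  have h1 : HasDerivAt (fun η => S B (t + η)) (I * phi B t * S B t) 0 := by
    have := hasDerivAt_S h0
    rw [add_zero] at this
    exact HasDerivAt.comp_const_add t 0 (by rwa [add_zero])
  have h2 := (hasDerivAt_const (0 : ℂ) (S B t)).div h1 (by rw [add_zero]; exact S_ne_zero ht)
  refine h2.congr_deriv ?_
  have := S_ne_zero ht
  rw [add_zero]
  field_simp
  ring

lemma hasDerivAt_ratS_inv {t : ℂ} (ht : Reg B t) :
    HasDerivAt (fun η => (ratS B t η)⁻¹) (I * phi B t) 0 := by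
  have h := (hasDerivAt_ratS ht).inv (by rw [ratS_zero ht]; exact one_ne_zero)
  refine h.congr_deriv ?_
  rw [ratS_zero ht]
  ring

lemma kinFactor_zero {θ : Vec (n + 1)} {l : Fin (n + 1)}
    (h : ∀ j, Reg B (θ (l.succAbove j) - θ l)) : kinFactor B θ l 0 = 0 := by
  unfold kinFactor
  simp [ratS_zero (h _)]

lemma analyticAt_kinFactor {θ : Vec (n + 1)} {l : Fin (n + 1)}
    (h : ∀ j, Reg B (θ (l.succAbove j) - θ l)) :
    AnalyticAt ℂ (fun p : Vec (n + 1) × Vec n => kinFactor B p.1 l p.2) (θ, 0) := by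
  have hr : ∀ j : Fin n, AnalyticAt ℂ (fun p : Vec (n + 1) × Vec n =>
      ratS B (p.1 (l.succAbove j) - p.1 l) (p.2 j)) (θ, 0) := fun j =>
    AnalyticAt.comp_pair (A := ratS B) (a := θ (l.succAbove j) - θ l) (b := 0)
      (analyticAt_ratS (h j) (by simpa using h j))
  refine analyticAt_const.mul (AnalyticAt.sub ?_ ?_)
  · exact Finset.analyticAt_fun_prod _ fun j _ => hr j
  · refine Finset.analyticAt_fun_prod _ fun j _ => (hr j).inv ?_
    simpa using ratS_ne_zero (h j) (by simpa using h j)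

lemma analyticAt_kinFactor_snd {θ : Vec (n + 1)} {l : Fin (n + 1)}
    (h : ∀ j, Reg B (θ (l.succAbove j) - θ l)) : AnalyticAt ℂ (kinFactor B θ l) 0 :=
  analyticAt_param_slice (A := fun θ η => kinFactor B θ l η) (analyticAt_kinFactor h)

/-- The linear part of the kinematical factor is given by `φ`, irrespective of the ordering. -/
lemma deriv_kinFactor {θ : Vec (n + 1)} {l : Fin (n + 1)}
    (h : ∀ j, Reg B (θ (l.succAbove j) - θ l)) (k : Fin n) :
    deriv (fun z => kinFactor B θ l (Pi.single k z)) 0 = phi B (θ (l.succAbove k) - θ l) := by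
  unfold kinFactor
  set t : Vec n := fun j => θ (l.succAbove j) - θ l with ht
  have hne : ∀ j, j ≠ k → ∀ z : ℂ, ratS B (t j) ((Pi.single k z : Vec n) j) = 1 := by
    intro j hj z
    rw [Pi.single_eq_of_ne hj, ratS_zero (h j)]
  have e1 : ∀ (p : Fin n → Prop) [DecidablePred p] (f : ℂ → ℂ) (_ : f 1 = 1) (z : ℂ),
      (∏ j : Fin n with p j, f (ratS B (t j) ((Pi.single k z : Vec n) j))) =
        if p k then f (ratS B (t k) z) else 1 := by
    intro p _ f hf z
    rw [Finset.prod_filter, Finset.prod_eq_single k]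
    · simp
    · intro j _ hj
      rw [hne j hj, hf, ite_self]
    · simp
  have e2 : (fun z => I * ((∏ j : Fin n with (l : ℕ) ≤ j.val,
      ratS B (t j) ((Pi.single k z : Vec n) j)) -
      ∏ j : Fin n with j.val < (l : ℕ), (ratS B (t j) ((Pi.single k z : Vec n) j))⁻¹)) =
      fun z => I * ((if (l : ℕ) ≤ k then ratS B (t k) z else 1) -
        if (k : ℕ) < l then (ratS B (t k) z)⁻¹ else 1) := by
    ext z
    rw [e1 (fun j => (l : ℕ) ≤ j.val) (fun x => x) rfl z,
      e1 (fun j => j.val < (l : ℕ)) (fun x => x⁻¹) inv_one z]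
  change deriv (fun z => I * ((∏ j : Fin n with (l : ℕ) ≤ j.val,
      ratS B (t j) ((Pi.single k z : Vec n) j)) -
      ∏ j : Fin n with j.val < (l : ℕ), (ratS B (t j) ((Pi.single k z : Vec n) j))⁻¹)) 0 = _
  rw [e2]
  by_cases hk : (l : ℕ) ≤ k
  · simp only [hk, if_true, not_lt.2 hk, if_false]
    rw [(((hasDerivAt_ratS (h k)).sub_const 1).const_mul I).deriv]
    linear_combination (-phi B (θ (l.succAbove k) - θ l)) * Complex.I_sq
  · simp only [hk, if_false, not_le.1 hk, if_true]
    rw [(((hasDerivAt_ratS_inv (h k)).const_sub 1).const_mul I).deriv]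
    linear_combination (-phi B (θ (l.succAbove k) - θ l)) * Complex.I_sq

lemma prod_drop_ofFn {M : Type*} [CommMonoid M] {n : ℕ} (f : Fin n → M) (i : ℕ) :
    ((List.ofFn f).drop i).prod = ∏ j : Fin n with i ≤ j.val, f j := by
  induction n generalizing i with
  | zero => simp
  | succ n ih =>
    cases i with
    | zero => simp [List.prod_ofFn, Fin.prod_univ_succ]
    | succ i =>
      rw [List.ofFn_succ, List.drop_succ_cons, ih]
      simp [Finset.prod_filter, Fin.prod_univ_succ]

lemma ofFn_split {α : Type*} {n : ℕ} (u : Fin (n + 1) → α) (l : Fin (n + 1)) :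
    List.ofFn u = (List.ofFn fun j => u (l.succAbove j)).take l ++
      u l :: (List.ofFn fun j => u (l.succAbove j)).drop l := by
  have hl := l.2
  apply List.ext_getElem
  · simp; omega
  intro k hk hk'
  have hk2 : k < n + 1 := by simpa using hk
  rw [List.getElem_ofFn]
  have hlen : ((List.ofFn fun j => u (l.succAbove j)).take (l : ℕ)).length = l := by
    simp; omega
  rcases lt_trichotomy k (l : ℕ) with h | h | h
  · rw [List.getElem_append_left (by rw [hlen]; exact h)]
    simp only [List.getElem_take, List.getElem_ofFn]
    congr 1
    rw [Fin.succAbove_of_castSucc_lt]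
    · rfl
    · exact h
  · rw [List.getElem_append_right (by rw [hlen, h])]
    simp [hlen, h]
  · rw [List.getElem_append_right (by rw [hlen]; exact h.le)]
    obtain ⟨j, hj⟩ : ∃ j, k - l = j + 1 := ⟨k - l - 1, by omega⟩
    simp only [hlen, hj, List.getElem_cons_succ, List.getElem_drop, List.getElem_ofFn]
    congr 1
    rw [Fin.succAbove_of_le_castSucc]
    · ext; simp; omega
    · simp only [Fin.le_def, Fin.val_castSucc]; omega

lemma ofFn_diagonalPoint (θ η : Vec n) : List.ofFn (diagonalPoint θ η) =
    (List.ofFn fun i => θ i + I * π + η i) ++ (List.ofFn θ).reverse := by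
  unfold diagonalPoint
  rw [List.ofFn_fin_append]
  congr 1
  apply List.ext_getElem
  · simp
  intro k h1 h2
  simp [Fin.rev]
  congr 1
  ext
  simp
  omega

lemma listFF_diagonalPoint (θ η : Vec n) : F (n + n) (diagonalPoint θ η) =
    listFF F ((List.ofFn fun i => θ i + I * π + η i) ++ (List.ofFn θ).reverse) := by
  rw [← ofFn_diagonalPoint]
  exact (listFF_ofFn _).symm

/-- The residue at `η_l = 0` of a form factor at `diagonalPoint`. -/
lemma tendsto_diagonal_residue (hB0 : 0 < B) (hB1 : B < 1) (hF : IsFormFactorFamily B F)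
    {θ : Vec (n + 1)} {l : Fin (n + 1)} {η : Vec n}
    (hd : Generic B (diagonalPoint (fun j => θ (l.succAbove j)) η))
    (h1 : ∀ j, Gen B (θ (l.succAbove j) - θ l))
    (h2 : ∀ j, Gen B (θ (l.succAbove j) - θ l + η j)) :
    Tendsto (fun z => z * F (n + 1 + (n + 1)) (diagonalPoint θ (l.insertNth z η))) (𝓝[≠] 0)
      (𝓝 (kinFactor B θ l η * F (n + n) (diagonalPoint (fun j => θ (l.succAbove j)) η))) := by
  set X := List.ofFn fun j => θ (l.succAbove j) + I * π + η j with hX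
  set Y := List.ofFn fun j => θ (l.succAbove j) with hY
  have hXmem : ∀ y ∈ X, ∃ j, y = θ (l.succAbove j) + I * π + η j := by
    intro y hy
    obtain ⟨j, hj⟩ := (List.mem_ofFn' _ _).1 hy
    exact ⟨j, hj.symm⟩
  have hYmem : ∀ y ∈ Y, ∃ j, y = θ (l.succAbove j) := by
    intro y hy
    obtain ⟨j, hj⟩ := (List.mem_ofFn' _ _).1 hy
    exact ⟨j, hj.symm⟩
  set P := X.take l with hP
  set Q := X.drop l ++ (Y.drop l).reverse with hQ
  set R := (Y.take l).reverse with hR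
  have hPQR : P ++ Q ++ R = X ++ Y.reverse := by
    rw [hP, hQ, hR]
    have e1 : (Y.drop l).reverse ++ (Y.take l).reverse = Y.reverse := by
      rw [← List.reverse_append, List.take_append_drop]
    rw [List.append_assoc, List.append_assoc, e1, ← List.append_assoc, List.take_append_drop]
  have hgen : ListGen B (θ l :: (P ++ Q ++ R)) := by
    rw [hPQR]
    refine List.pairwise_cons.2 ⟨?_, ?_⟩
    · intro b hb
      rcases List.mem_append.1 hb with hb | hb
      · obtain ⟨j, rfl⟩ := hXmem b hb
        refine gen_sub_comm.1 ?_
        have e : θ (l.succAbove j) + I * π + η j - θ l =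
            (θ (l.succAbove j) - θ l + η j) + I * π := by ring
        rw [e, gen_add_I_pi]; exact h2 j
      · obtain ⟨j, rfl⟩ := hYmem b (List.mem_reverse.1 hb)
        exact gen_sub_comm.1 (h1 j)
    · have := generic_iff.1 hd
      rwa [ofFn_diagonalPoint] at this
  have hres := listFF_residue hB0 hB1 hF hgen
  have hshift : Tendsto (fun z : ℂ => z + θ l) (𝓝[≠] 0) (𝓝[≠] (θ l)) := by
    refine tendsto_nhdsWithin_iff.2 ⟨?_, ?_⟩
    · exact ((by fun_prop : Continuous fun z : ℂ => z + θ l).tendsto' 0 (θ l)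
        (zero_add _)).mono_left nhdsWithin_le_nhds
    · filter_upwards [self_mem_nhdsWithin] with z hz
      simpa using hz
  have hres2 := hres.comp hshift
  convert hres2 using 1
  · ext z
    simp only [Function.comp, add_sub_cancel_right]
    congr 1
    rw [listFF_diagonalPoint (F := F)]
    congr 1
    rw [ofFn_split _ l, ofFn_split θ l]
    simp only [Fin.insertNth_apply_same, Fin.insertNth_apply_succAbove, List.reverse_append,
      List.reverse_cons, List.append_assoc, hP, hQ, hR, hX, hY, List.cons_append, List.nil_append]
    congr 2
    ring
  · congr 1
    rw [listFF_diagonalPoint (F := F), hPQR]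
    congr 1
    have hS1 : ∀ j, S B (θ (l.succAbove j) - θ l) ≠ 0 := fun j => S_ne_zero (h1 j).2
    have hS2 : ∀ j, S B (θ (l.succAbove j) - θ l + η j) ≠ 0 := fun j => S_ne_zero (h2 j).2
    set s1 : Vec n := fun j => S B (θ (l.succAbove j) - θ l) with hs1
    set s2 : Vec n := fun j => S B (θ (l.succAbove j) - θ l + η j) with hs2
    -- crossing `S(θ + iπ) = S(θ)⁻¹` and unitarity `S(-θ) = S(θ)⁻¹` leave the factors `s1`, `s2`
    have m1 : X.map (fun y => S B (y - θ l - I * π)) = List.ofFn s2 := by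
      rw [hX, List.map_ofFn]
      congr 1; ext j
      simp only [Function.comp, hs2]
      congr 1; ring
    have m2 : X.map (fun y => S B (y - θ l)) = List.ofFn fun j => (s2 j)⁻¹ := by
      rw [hX, List.map_ofFn]
      congr 1; ext j
      simp only [Function.comp, hs2]
      rw [← S_add_I_pi]
      congr 1; ring
    have m3 : X.map (fun y => S B (θ l - y)) = List.ofFn s2 := by
      rw [hX, List.map_ofFn]
      congr 1; ext j
      simp only [Function.comp, hs2]
      have e : θ l - (θ (l.succAbove j) + I * π + η j) =
        -((θ (l.succAbove j) - θ l + η j) + I * π) := by ring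
      rw [e, S_neg, S_add_I_pi, inv_inv]
    have m4 : Y.map (fun y => S B (y - θ l)) = List.ofFn s1 := by
      rw [hY, List.map_ofFn]; rfl
    have m5 : Y.map (fun y => S B (θ l - y)) = List.ofFn fun j => (s1 j)⁻¹ := by
      rw [hY, List.map_ofFn]
      congr 1; ext j
      simp only [Function.comp, hs1]
      rw [← S_neg, neg_sub]
    have p1 : (P.map fun y => S B (y - θ l - I * π)).prod =
        ∏ j : Fin n with j.val < (l : ℕ), s2 j := by
      rw [hP, List.map_take, m1, List.prod_take_ofFn]
    have p2 : ((P ++ Q).map fun y => S B (y - θ l)).prod =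
        (∏ j, (s2 j)⁻¹) * ∏ j : Fin n with (l : ℕ) ≤ j.val, s1 j := by
      have : P ++ Q = X ++ (Y.drop l).reverse := by
        rw [hP, hQ, ← List.append_assoc, List.take_append_drop]
      rw [this, List.map_append, List.prod_append, m2, List.prod_ofFn, List.map_reverse,
        List.prod_reverse, List.map_drop, m4, prod_drop_ofFn]
    have p3 : ((X ++ Y.reverse).map fun y => S B (θ l - y)).prod = (∏ j, s2 j) * ∏ j, (s1 j)⁻¹ := by
      rw [List.map_append, List.prod_append, m3, List.prod_ofFn, List.map_reverse,
        List.prod_reverse, m5, List.prod_ofFn]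
    rw [p1, p2, p3]
    have hA : ∀ f : Vec n, ∏ j, f j = (∏ j : Fin n with j.val < (l : ℕ), f j) *
        ∏ j : Fin n with (l : ℕ) ≤ j.val, f j := by
      intro f
      rw [← Finset.prod_filter_mul_prod_filter_not Finset.univ (fun j : Fin n => (j : ℕ) < l)]
      simp only [not_lt]
    have hne : ∀ (s : Vec n) (p : Fin n → Prop) [DecidablePred p], (∀ j, s j ≠ 0) →
        ∏ j : Fin n with p j, s j ≠ 0 := fun s p _ h => Finset.prod_ne_zero_iff.2 fun j _ => h j
    have n1 := hne s1 (fun j => j.val < (l : ℕ)) hS1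
    have n2 := hne s1 (fun j => (l : ℕ) ≤ j.val) hS1
    have n3 := hne s2 (fun j => j.val < (l : ℕ)) hS2
    have n4 := hne s2 (fun j => (l : ℕ) ≤ j.val) hS2
    have hk : kinFactor B θ l η = I * (
        (∏ j : Fin n with (l : ℕ) ≤ j.val, s1 j) / (∏ j : Fin n with (l : ℕ) ≤ j.val, s2 j) -
        ((∏ j : Fin n with j.val < (l : ℕ), s1 j) /
          (∏ j : Fin n with j.val < (l : ℕ), s2 j))⁻¹) := by
      unfold kinFactor ratS
      rw [Finset.prod_inv_distrib, Finset.prod_div_distrib, Finset.prod_div_distrib]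
    rw [hk, hA (fun j => (s2 j)⁻¹), hA s2, hA (fun j => (s1 j)⁻¹)]
    simp only [Finset.prod_inv_distrib]
    field_simp

end Kinematical

/-! ### Connected form factors at distinct rapidities -/

section Connected

variable {B : ℝ} {F G : (n : ℕ) → Vec n → ℂ} {n : ℕ}

/-- `η₁ ⋯ η_n F_{2n}` at `diagonalPoint θ η`, continued analytically to `η = 0`. -/
def amp (G : (n : ℕ) → Vec n → ℂ) (θ η : Vec n) : ℂ :=
  diagReg G (Finset.univ.filter fun p : Fin n × Fin n => p.1 = p.2) θ η

/-- The connected form factor at distinct rapidities. -/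
def conn (G : (n : ℕ) → Vec n → ℂ) (θ : Vec n) : ℂ := coef n (amp G θ)

lemma analyticAt_amp (hB0 : 0 < B) (hB1 : B < 1) (hG : Regularizes B F G) {θ : Vec n}
    (hθ : Generic B θ) :
    AnalyticAt ℂ (fun p : Vec n × Vec n => amp G p.1 p.2) (θ, 0) := by
  refine analyticAt_diagReg hB0 hB1 hG (separated_of_generic hθ) fun p => ?_
  rw [Finset.mem_filter]
  constructor
  · rintro ⟨-, h⟩; rw [h]
  · intro h
    refine ⟨Finset.mem_univ _, ?_⟩
    by_contra hne
    exact ne_of_generic hθ hne h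

lemma analyticAt_amp_snd (hB0 : 0 < B) (hB1 : B < 1) (hG : Regularizes B F G) {θ : Vec n}
    (hθ : Generic B θ) : AnalyticAt ℂ (amp G θ) 0 :=
  analyticAt_param_slice (analyticAt_amp hB0 hB1 hG hθ)

lemma amp_eq (hG : Regularizes B F G) {θ η : Vec n} (h : Generic B (diagonalPoint θ η)) :
    (∏ i, η i) * F (n + n) (diagonalPoint θ η) = amp G θ η := by
  rw [amp, ← diagReg_eq hG _ h]
  congr 1
  rw [Finset.prod_filter, ← Finset.univ_product_univ, Finset.prod_product]
  simp

lemma analyticAt_conn (hB0 : 0 < B) (hB1 : B < 1) (hG : Regularizes B F G) {θ : Vec n}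
    (hθ : Generic B θ) : AnalyticAt ℂ (fun θ : Vec n => conn G θ) θ :=
  analyticAt_coef (analyticAt_amp hB0 hB1 hG hθ)

lemma eventually_slice {X Y : Type*} [TopologicalSpace X] [TopologicalSpace Y] {x : X} {y : Y}
    {p : X × Y → Prop} (h : ∀ᶠ q in 𝓝 (x, y), p q) : ∀ᶠ b in 𝓝 y, p (x, b) :=
  (Continuous.tendsto (by fun_prop : Continuous fun b : Y => (x, b)) y).eventually h

lemma finitePart_eq (hB0 : 0 < B) (hB1 : B < 1) (hG : Regularizes B F G) {θ : Vec n}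
    (hθ : Generic B θ) : finitePart F n θ = conn G θ := by
  refine Tendsto.limUnder_eq (tendsto_torusIntegral (analyticAt_amp_snd hB0 hB1 hG hθ) ?_)
  filter_upwards [eventually_slice (eventually_generic_diagonalPoint' hB0 hB1 hθ)] with η h hne
  exact amp_eq hG (h hne)

/-- Germs of continuous functions that agree where all coordinates are nonzero are equal. -/
lemma eventuallyEq_of_ne_zero {f g : Vec n → ℂ} (hf : ∀ᶠ η in 𝓝 0, ContinuousAt f η)
    (hg : ∀ᶠ η in 𝓝 0, ContinuousAt g η)
    (h : ∀ᶠ η in 𝓝 (0 : Vec n), (∀ i, η i ≠ 0) → f η = g η) : f =ᶠ[𝓝 0] g := by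
  have hdense : Dense {η : Vec n | ∀ i, η i ≠ 0} := by
    have := dense_pi (Set.univ : Set (Fin n)) (s := fun _ => ({0}ᶜ : Set ℂ))
      fun i _ => dense_compl_singleton 0
    refine this.mono fun η hη i => ?_
    exact hη i (Set.mem_univ i)
  filter_upwards [hf, hg, h.eventually_nhds] with η h1 h2 h3
  refine tendsto_nhds_unique_of_frequently_eq h1.tendsto h2.tendsto ?_
  refine ((mem_closure_iff_frequently.1 (hdense η)).and_eventually h3).mono ?_
  rintro η' ⟨a, b⟩
  exact b a

lemma continuous_insertNth (l : Fin (n + 1)) :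
    Continuous fun p : ℂ × Vec n => (l.insertNth p.1 p.2 : Vec (n + 1)) := by
  refine continuous_pi fun i => ?_
  refine Fin.succAboveCases l ?_ (fun j => ?_) i
  · simpa using continuous_fst
  · simp only [Fin.insertNth_apply_succAbove]
    exact (continuous_apply j).comp continuous_snd

lemma insertNth_zero_zero (l : Fin (n + 1)) :
    (l.insertNth (0 : ℂ) (0 : Vec n) : Vec (n + 1)) = 0 := by
  ext i
  refine Fin.succAboveCases l ?_ (fun j => ?_) i <;> simp

lemma Generic.succAbove {θ : Vec (n + 1)} (h : Generic B θ) (l : Fin (n + 1)) :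
    Generic B (fun j => θ (l.succAbove j)) := fun _ _ hij =>
  h _ _ fun h' => hij (Fin.succAbove_right_injective h')

/-- The kinematical axiom in terms of the regularized form factors. -/
lemma amp_insertNth_zero (hB0 : 0 < B) (hB1 : B < 1) (hF : IsFormFactorFamily B F)
    (hG : Regularizes B F G) {θ : Vec (n + 1)} (hθ : Generic B θ) (l : Fin (n + 1)) :
    (fun η => amp G θ (l.insertNth 0 η)) =ᶠ[𝓝 0]
      fun η => kinFactor B θ l η * amp G (fun j => θ (l.succAbove j)) η := by
  have hA := analyticAt_amp_snd hB0 hB1 hG hθ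
  have hA' := analyticAt_amp_snd hB0 hB1 hG (hθ.succAbove l)
  have hreg : ∀ j, Gen B (θ (l.succAbove j) - θ l) := fun j => hθ _ _ (Fin.succAbove_ne l j)
  have hK := analyticAt_kinFactor_snd fun j => (hreg j).2
  have hcl : Continuous fun η : Vec n => (l.insertNth (0 : ℂ) η : Vec (n + 1)) :=
    (continuous_insertNth l).comp (by fun_prop : Continuous fun η : Vec n => ((0 : ℂ), η))
  have hcl0 : Tendsto (fun η : Vec n => (l.insertNth (0 : ℂ) η : Vec (n + 1)))
      (𝓝 0) (𝓝 0) := hcl.tendsto' _ _ (insertNth_zero_zero l)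
  have hins : Tendsto (fun p : Vec n × ℂ => (l.insertNth p.2 p.1 : Vec (n + 1)))
      (𝓝 (0, 0)) (𝓝 0) :=
    ((continuous_insertNth l).comp continuous_swap).tendsto' _ _ (insertNth_zero_zero l)
  have hcA := hcl0.eventually hA.eventually_analyticAt
  -- by continuity it suffices to compare where all `η_j` are nonzero
  refine eventuallyEq_of_ne_zero ?_ ?_ ?_
  · filter_upwards [hcA] with η hη
    exact ContinuousAt.comp (f := fun η : Vec n => (l.insertNth (0 : ℂ) η : Vec (n + 1)))
      hη.continuousAt hcl.continuousAt
  · filter_upwards [hA'.eventually_analyticAt, hK.eventually_analyticAt] with η h1 h2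
    exact h2.continuousAt.mul h1.continuousAt
  have hgen : ∀ᶠ η : Vec n in 𝓝 0, ∀ᶠ z in 𝓝 (0 : ℂ),
      (∀ i, (l.insertNth z η : Vec (n + 1)) i ≠ 0) →
      Generic B (diagonalPoint θ (l.insertNth z η)) := by
    have := hins.eventually
      (eventually_slice (eventually_generic_diagonalPoint' hB0 hB1 hθ))
    rw [nhds_prod_eq] at this
    exact this.curry
  have hgen' := eventually_slice (eventually_generic_diagonalPoint' hB0 hB1 (hθ.succAbove l))
  have hg2 : ∀ᶠ η : Vec n in 𝓝 0, ∀ j, Gen B (θ (l.succAbove j) - θ l + η j) := by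
    refine eventually_all.2 fun j => ?_
    refine ((by fun_prop : Continuous fun η : Vec n =>
      θ (l.succAbove j) - θ l + η j).tendsto 0).eventually (isOpen_gen.mem_nhds ?_)
    simpa using hreg j
  filter_upwards [hcA, hgen, hgen', hg2] with η h1 h2 h3 h4 hne
  have hres := tendsto_diagonal_residue hB0 hB1 hF (h3 hne) hreg h4
  have hres2 := hres.const_mul (∏ j, η j)
  have hlim : Tendsto (fun z => amp G θ (l.insertNth z η)) (𝓝[≠] 0)
      (𝓝 (amp G θ (l.insertNth 0 η))) := by
    have : ContinuousAt (fun z : ℂ => amp G θ (l.insertNth z η)) 0 :=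
      ContinuousAt.comp (f := fun z : ℂ => (l.insertNth z η : Vec (n + 1)))
        h1.continuousAt ((continuous_insertNth l).comp
          (by fun_prop : Continuous fun z : ℂ => (z, η))).continuousAt
    exact this.tendsto.mono_left nhdsWithin_le_nhds
  have hev : (fun z => amp G θ (l.insertNth z η)) =ᶠ[𝓝[≠] 0] fun z => (∏ j, η j) *
      (z * F (n + 1 + (n + 1)) (diagonalPoint θ (l.insertNth z η))) := by
    filter_upwards [nhdsWithin_le_nhds h2, self_mem_nhdsWithin] with z hz hz0
    rw [← amp_eq hG (hz fun i => ?_), Fin.prod_univ_succAbove _ l]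
    · simp only [Fin.insertNth_apply_same, Fin.insertNth_apply_succAbove]; ring
    · refine Fin.succAboveCases l ?_ (fun j => ?_) i
      · simpa using hz0
      · simpa using hne j
  rw [tendsto_nhds_unique (hlim.congr' hev) hres2, ← amp_eq hG (h3 hne)]
  ring

/-- The only squarefree Laurent coefficient of a form factor at the diagonal is the
connected form factor. -/
lemma topOnly_amp (hB0 : 0 < B) (hB1 : B < 1) (hF : IsFormFactorFamily B F)
    (hG : Regularizes B F G) {θ : Vec n} (hθ : Generic B θ) :
    TopOnly n (conn G θ) (amp G θ) := by
  induction n with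
  | zero => rfl
  | succ n ih =>
    obtain ⟨c, hc⟩ := TopOnly.of_restrict (f := amp G θ) fun l => by
      have hreg : ∀ j, Gen B (θ (l.succAbove j) - θ l) := fun j => hθ _ _ (Fin.succAbove_ne l j)
      have h1 := (ih (hθ.succAbove l)).mul
        (analyticAt_kinFactor_snd fun j => (hreg j).2)
        (analyticAt_amp_snd hB0 hB1 hG (hθ.succAbove l))
      rw [kinFactor_zero fun j => (hreg j).2, zero_mul] at h1
      exact h1.congr (amp_insertNth_zero hB0 hB1 hF hG hθ l).symm
    rwa [conn, hc.coef_eq]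

lemma Generic.comp_perm {θ : Vec n} (h : Generic B θ) (σ : Equiv.Perm (Fin n)) :
    Generic B (θ ∘ σ) := fun _ _ hij => h _ _ fun h' => hij (σ.injective h')

lemma exchange_lower (hF : IsFormFactorFamily B F) {θ η : Vec n} {i j : Fin n}
    (hij : (i : ℕ) + 1 = j) (h : Generic B (diagonalPoint θ η)) :
    Generic B (diagonalPoint (θ ∘ Equiv.swap i j) fun k => θ k + η k - θ (Equiv.swap i j k)) ∧
    F (n + n) (diagonalPoint θ η) = S B (θ j - θ i) *
      F (n + n) (diagonalPoint (θ ∘ Equiv.swap i j)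
        fun k => θ k + η k - θ (Equiv.swap i j k)) := by
  have hjn := j.2
  have h2 := hF.exchange (n + n) _ h (Fin.natAdd n j.rev) (Fin.natAdd n i.rev) (by
      simp only [Fin.val_natAdd, Fin.val_rev]; omega)
  have hne : ∀ a b : Fin n, Fin.natAdd n a ≠ Fin.castAdd n b := fun a b hab => by
    have := congr_arg Fin.val hab
    simp only [Fin.val_natAdd, Fin.val_castAdd] at this
    omega
  have e : diagonalPoint θ η ∘ Equiv.swap (Fin.natAdd n j.rev) (Fin.natAdd n i.rev) =
      diagonalPoint (θ ∘ Equiv.swap i j) fun k => θ k + η k - θ (Equiv.swap i j k) := by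
    ext k
    simp only [Function.comp]
    refine Fin.addCases (fun a => ?_) (fun a => ?_) k
    · rw [Equiv.swap_apply_of_ne_of_ne (hne _ _).symm (hne _ _).symm, diagonalPoint_castAdd,
        diagonalPoint_castAdd]
      simp only [Function.comp]
      ring
    · rw [(Fin.natAdd_injective n n).swap_apply, diagonalPoint_natAdd, diagonalPoint_natAdd]
      simp only [Function.comp]
      congr 1
      rcases eq_or_ne a j.rev with rfl | ha
      · simp
      rcases eq_or_ne a i.rev with rfl | hb
      · simp
      rw [Equiv.swap_apply_of_ne_of_ne ha hb, Equiv.swap_apply_of_ne_of_ne]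
      · exact fun h => hb (by rw [← h, Fin.rev_rev])
      · exact fun h => ha (by rw [← h, Fin.rev_rev])
  rw [← e]
  refine ⟨h.comp_perm _, ?_⟩
  rw [h2]
  simp only [diagonalPoint_natAdd, Fin.rev_rev]

lemma exchange_upper (hF : IsFormFactorFamily B F) {θ η : Vec n} {i j : Fin n}
    (hij : (i : ℕ) + 1 = j) (h : Generic B (diagonalPoint θ η)) :
    Generic B (diagonalPoint θ fun k => θ (Equiv.swap i j k) + η (Equiv.swap i j k) - θ k) ∧
    F (n + n) (diagonalPoint θ η) = S B (θ i + η i - (θ j + η j)) *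
      F (n + n) (diagonalPoint θ
        fun k => θ (Equiv.swap i j k) + η (Equiv.swap i j k) - θ k) := by
  have h1 := hF.exchange (n + n) _ h (Fin.castAdd n i) (Fin.castAdd n j) hij
  have hne : ∀ a b : Fin n, Fin.natAdd n a ≠ Fin.castAdd n b := fun a b hab => by
    have := congr_arg Fin.val hab
    simp only [Fin.val_natAdd, Fin.val_castAdd] at this
    omega
  have e : diagonalPoint θ η ∘ Equiv.swap (Fin.castAdd n i) (Fin.castAdd n j) =
      diagonalPoint θ fun k => θ (Equiv.swap i j k) + η (Equiv.swap i j k) - θ k := by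
    ext k
    simp only [Function.comp]
    refine Fin.addCases (fun a => ?_) (fun a => ?_) k
    · rw [(Fin.castAdd_injective n n).swap_apply, diagonalPoint_castAdd, diagonalPoint_castAdd]
      ring
    · rw [Equiv.swap_apply_of_ne_of_ne (hne _ _) (hne _ _), diagonalPoint_natAdd,
        diagonalPoint_natAdd]
  rw [← e]
  refine ⟨h.comp_perm _, ?_⟩
  rw [h1, diagonalPoint_castAdd, diagonalPoint_castAdd,
    show θ i + I * π + η i - (θ j + I * π + η j) =
    θ i + η i - (θ j + η j) by ring]

lemma exchange_diagonalPoint (hF : IsFormFactorFamily B F) {θ η : Vec n} {i j : Fin n}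
    (hij : (i : ℕ) + 1 = j) (h : Generic B (diagonalPoint θ η)) :
    F (n + n) (diagonalPoint θ η) = S B (θ i + η i - (θ j + η j)) * S B (θ j - θ i) *
      F (n + n) (diagonalPoint (θ ∘ Equiv.swap i j) (η ∘ Equiv.swap i j)) := by
  obtain ⟨hg, e⟩ := exchange_lower hF hij h
  rw [e, (exchange_upper hF hij hg).2]
  simp [Function.comp_def]
  ring

lemma finitePart_swap (hB0 : 0 < B) (hB1 : B < 1) (hF : IsFormFactorFamily B F)
    (hG : Regularizes B F G) {θ : Vec n} (hθ : Generic B θ) {i j : Fin n}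
    (hij : (i : ℕ) + 1 = j) : finitePart F n (θ ∘ Equiv.swap i j) = finitePart F n θ := by
  set σ := Equiv.swap i j with hσ
  have hne : i ≠ j := fun h => by rw [h] at hij; omega
  set q : Vec n → ℂ := fun η => (S B (θ i + η i - (θ j + η j)) * S B (θ j - θ i))⁻¹ with hq
  have hr := (hθ i j hne).2
  have hr' := reg_sub_comm.1 hr
  have hq0 : q 0 = 1 := by
    simp only [hq, Pi.zero_apply, add_zero]
    rw [← neg_sub (θ i) (θ j), S_neg, mul_inv_cancel₀ (S_ne_zero hr), inv_one]
  have hqa : AnalyticAt ℂ q 0 := by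
    refine AnalyticAt.inv (AnalyticAt.mul ?_ analyticAt_const) ?_
    · exact (analyticAt_S hr).comp_of
    · simpa using ⟨S_ne_zero hr, S_ne_zero hr'⟩
  have hA := analyticAt_amp_snd hB0 hB1 hG hθ
  have key := tendsto_torusIntegral (f := fun η => q η * amp G θ η)
    (Fd := fun η => F (n + n) (diagonalPoint (θ ∘ σ) (η ∘ σ))) (hqa.mul hA) (by
      have hS : ∀ᶠ η : Vec n in 𝓝 0, Reg B (θ i + η i - (θ j + η j)) := by
        refine ((by fun_prop : Continuous fun η : Vec n =>
          θ i + η i - (θ j + η j)).tendsto 0).eventually (isOpen_reg.mem_nhds ?_)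
        simp only [Pi.zero_apply, add_zero]; exact hr
      filter_upwards [eventually_slice (eventually_generic_diagonalPoint' hB0 hB1 hθ), hS]
        with η h hS hne
      rw [← amp_eq hG (h hne), exchange_diagonalPoint hF hij (h hne)]
      have := S_ne_zero hS
      have := S_ne_zero hr'
      simp only [hq, ← hσ]
      field_simp)
  rw [((topOnly_amp hB0 hB1 hF hG hθ).mul hqa hA).coef_eq, hq0, one_mul] at key
  rw [finitePart_eq hB0 hB1 hG hθ]
  refine Tendsto.limUnder_eq (key.congr fun ρ => ?_)
  congr 1
  refine Eq.trans ?_ (torusIntegral_comp_perm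
    (fun η => (∏ i, η i)⁻¹ * F (n + n) (diagonalPoint (θ ∘ σ) η)) ρ σ)
  congr 1
  ext η
  dsimp only [Function.comp]
  rw [Equiv.prod_comp σ η]

end Connected

/-! ### Connected form factors at coinciding rapidities -/

section SecondOrder

variable {E : Type*} [NormedAddCommGroup E] [NormedSpace ℂ E]

/-- The second derivative in the variable `η₀`, at `η₀ = 0`. -/
def d2 {n : ℕ} (f : Vec (n + 1) → ℂ) : Vec n → ℂ :=
  fun η => deriv (deriv fun z => f (vcons z η)) 0

lemma analyticAt_deriv_deriv_snd {g : E → ℂ → ℂ} {x : E} {z : ℂ}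
    (hg : AnalyticAt ℂ (fun p : E × ℂ => g p.1 p.2) (x, z)) :
    AnalyticAt ℂ (fun p : E × ℂ => deriv (deriv (g p.1)) p.2) (x, z) :=
  analyticAt_deriv_snd (g := fun x => deriv (g x)) (analyticAt_deriv_snd hg)

variable {n : ℕ}

lemma analyticAt_d2_zero {f : Vec (n + 1) → ℂ} (hf : AnalyticAt ℂ f 0) :
    AnalyticAt ℂ (d2 f) 0 := by
  have h : AnalyticAt ℂ (fun p : Vec n × ℂ => f (vcons p.2 p.1)) (0, 0) := hf.comp_of
  exact AnalyticAt.comp_pair (A := fun η => deriv (deriv fun z => f (vcons z η))) (b := 0)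
    (analyticAt_deriv_deriv_snd (g := fun η z => f (vcons z η)) h)

lemma eventuallyEq_d2 {f g : Vec (n + 1) → ℂ} (h : f =ᶠ[𝓝 0] g) : d2 f =ᶠ[𝓝 0] d2 g := by
  filter_upwards [eventually_vcons h] with η hη
  exact Filter.EventuallyEq.deriv_eq (Filter.EventuallyEq.deriv hη)

lemma analyticAt_slice {f : Vec (n + 1) → ℂ} {η : Vec n}
    (hf : AnalyticAt ℂ f (vcons 0 η)) : AnalyticAt ℂ (fun z => f (vcons z η)) 0 :=
  hf.comp_of

lemma deriv_deriv_mul {f g : ℂ → ℂ} {z : ℂ} (hf : AnalyticAt ℂ f z) (hg : AnalyticAt ℂ g z) :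
    deriv (deriv fun z => f z * g z) z =
      deriv (deriv f) z * g z + 2 * (deriv f z * deriv g z) + f z * deriv (deriv g) z := by
  have h : (deriv fun z => f z * g z) =ᶠ[𝓝 z] fun z => deriv f z * g z + f z * deriv g z := by
    filter_upwards [hf.eventually_analyticAt, hg.eventually_analyticAt] with w h1 h2
    exact deriv_fun_mul h1.differentiableAt h2.differentiableAt
  rw [h.deriv_eq, deriv_fun_add, deriv_fun_mul, deriv_fun_mul]
  · ring
  · exact hf.differentiableAt
  · exact hg.deriv.differentiableAt
  · exact hf.deriv.differentiableAt
  · exact hg.differentiableAt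
  · exact (hf.deriv.mul hg).differentiableAt
  · exact (hf.mul hg.deriv).differentiableAt

lemma d2_mul {f g : Vec (n + 1) → ℂ} (hf : AnalyticAt ℂ f 0) (hg : AnalyticAt ℂ g 0) :
    d2 (fun η => f η * g η) =ᶠ[𝓝 0]
      fun η => d2 f η * ev g η + 2 * (dz f η * dz g η) + ev f η * d2 g η := by
  filter_upwards [eventually_analyticAt_vcons hf, eventually_analyticAt_vcons hg] with η h1 h2
  exact deriv_deriv_mul (analyticAt_slice h1) (analyticAt_slice h2)

lemma TopOnly.const_mul {c : ℂ} {f : Vec n → ℂ} (hf : TopOnly n c f) (a : ℂ)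
    (hfa : AnalyticAt ℂ f 0) : TopOnly n (a * c) (fun η => a * f η) :=
  hf.mul (q := fun _ => a) analyticAt_const hfa

end SecondOrder

section Coincidence

variable {B : ℝ} {F G : (n : ℕ) → Vec n → ℂ} {n : ℕ}

/-- The rapidities `Y` without the `k`-th one. -/
abbrev del {n : ℕ} (k : Fin (n + 1)) (Y : Vec (n + 1)) : Vec n :=
  fun j => Y (k.succAbove j)

/-- The sum over all chains `φ(τ - y₁) φ(y₁ - y₂) ⋯ φ(y_m - b) C(b, Y ∖ {y₁, …, y_m})`, with
distinct `y_i` from `Y`. -/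
def chainFF (B : ℝ) (C : (n : ℕ) → Vec n → ℂ) : (n : ℕ) → ℂ → ℂ → Vec n → ℂ
  | 0, τ, b, Y => phi B (τ - b) * C 1 (vcons b Y)
  | n + 1, τ, b, Y => phi B (τ - b) * C (n + 2) (vcons b Y) +
      ∑ k, phi B (τ - Y k) * chainFF B C n (Y k) b (del k Y)

lemma vcons_comp_succAbove (b : ℂ) (Y : Vec (n + 1)) (k : Fin (n + 1)) :
    (fun j => vcons b Y (k.succ.succAbove j)) = vcons b (del k Y) := by
  ext j
  refine Fin.cases ?_ (fun j => ?_) j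
  · simp [vcons]
  · simp [vcons, del, Fin.succ_succAbove_succ]

lemma vcons_zero_right (z : ℂ) : vcons z (0 : Vec n) = Pi.single 0 z := by
  ext j
  refine Fin.cases ?_ (fun j => ?_) j <;> simp [vcons]

lemma vcons_zero_single (k : Fin n) (z : ℂ) :
    vcons 0 (Pi.single k z : Vec n) = Pi.single k.succ z := by
  ext j
  refine Fin.cases ?_ (fun j => ?_) j <;> simp [vcons, Pi.single_apply]

/-- The first two derivatives in `η₀` of a kinematical residue, in terms of those of the
remaining form factor. -/
lemma topOnly_kinFactor_mul_aux (hB0 : 0 < B) (hB1 : B < 1) (hF : IsFormFactorFamily B F)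
    (hG : Regularizes B F G) {b : ℂ} {Y : Vec n} (hY : Generic B (vcons b Y))
    {θ : Vec (n + 2)} {l : Fin (n + 2)} (hθ : ∀ j, θ (l.succAbove j) = vcons b Y j)
    (hl : ∀ j, Reg B (θ (l.succAbove j) - θ l)) :
    TopOnly n 0 (ev fun η => kinFactor B θ l η * amp G (vcons b Y) η) ∧
    TopOnly n 0 (dz fun η => kinFactor B θ l η * amp G (vcons b Y) η) ∧
    ∀ α β, TopTwo n α β (d2 (amp G (vcons b Y))) →
      TopOnly n (2 * (phi B (θ l - b) * conn G (vcons b Y)) + ∑ k, phi B (θ l - Y k) * β k)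
      (d2 fun η => kinFactor B θ l η * amp G (vcons b Y) η) := by
  have hA := analyticAt_amp_snd hB0 hB1 hG hY
  have hE := analyticAt_kinFactor_snd hl
  have hE0 : ev (kinFactor B θ l) 0 = 0 := by
    rw [ev, vcons_zero_zero, kinFactor_zero hl]
  have hphi : ∀ j, phi B (θ (l.succAbove j) - θ l) = phi B (θ l - vcons b Y j) := fun j => by
    rw [← phi_neg _ (hl j), neg_sub, hθ]
  have hE1 : dz (kinFactor B θ l) 0 = phi B (θ l - b) := by
    simp only [dz, vcons_zero_right]
    rw [deriv_kinFactor hl, hphi]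
    rfl
  have hE0' : ∀ k : Fin n, deriv (fun z => ev (kinFactor B θ l) (Pi.single k z)) 0 =
      phi B (θ l - Y k) := by
    intro k
    simp only [ev, vcons_zero_single]
    rw [deriv_kinFactor hl, hphi]
    rfl
  obtain ⟨hA0, hA1⟩ := topOnly_amp hB0 hB1 hF hG hY
  have a0 := analyticAt_ev_zero hA
  have a1 := analyticAt_dz_zero hA
  have a2 := analyticAt_d2_zero hA
  have e0 := analyticAt_ev_zero hE
  have e1 := analyticAt_dz_zero hE
  have e2 := analyticAt_d2_zero hE
  refine ⟨?_, ?_, fun α β h2 => ?_⟩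
  · have := hA0.mul e0 a0
    rw [mul_zero] at this
    exact this
  · have := (hA0.mul e1 a0).add (hA1.mul e0 a1) (e1.mul a0) (e0.mul a1)
    rw [hE0, mul_zero, zero_mul, add_zero] at this
    exact this.congr (dz_mul hE hA).symm
  -- Leibniz rule; the factor vanishes at the origin and has gradient `φ(θ_l - ·)`, so that only the
  --  linear terms in `η_Y` of the second derivative contribute to top order
  have h20 := hA0.mul e2 a0
  have h11 := (hA1.mul e1 a1).const_mul 2 (e1.mul a1)
  have h02 := h2.mul e0 a2
  rw [hE0, zero_smul, zero_mul, zero_add] at h02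
  have := (h20.add h11 (e2.mul a0) (analyticAt_const.mul (e1.mul a1))).add h02.topOnly
    ((e2.mul a0).add (analyticAt_const.mul (e1.mul a1))) (e0.mul a2)
  rw [mul_zero, zero_add, hE1] at this
  simp only [hE0'] at this
  exact this.congr (d2_mul hE hA).symm

/-- The second derivative in `η₀` of a kinematical residue gives `chainFF`. -/
lemma topOnly_d2_kinFactor_mul (hB0 : 0 < B) (hB1 : B < 1) (hF : IsFormFactorFamily B F)
    (hG : Regularizes B F G) {b : ℂ} {Y : Vec n} (hY : Generic B (vcons b Y))
    {θ : Vec (n + 2)} {l : Fin (n + 2)} (hθ : ∀ j, θ (l.succAbove j) = vcons b Y j)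
    (hl : ∀ j, Reg B (θ (l.succAbove j) - θ l)) :
    TopOnly n (2 * chainFF B (fun _ => conn G) n (θ l) b Y)
      (d2 fun η => kinFactor B θ l η * amp G (vcons b Y) η) := by
  have key := (topOnly_kinFactor_mul_aux hB0 hB1 hF hG hY hθ hl).2.2
  induction n with
  | zero =>
    have := key (d2 (amp G (vcons b Y)) 0) 0 rfl
    simpa [chainFF] using this
  | succ n ih =>
    obtain ⟨α, hα⟩ := TopTwo.of_restrict (f := d2 (amp G (vcons b Y)))
      (β := fun k => 2 * chainFF B (fun _ => conn G) n (Y k) b (del k Y)) fun k => by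
        have hY' : Generic B (vcons b (del k Y)) := by
          rw [← vcons_comp_succAbove]; exact hY.succAbove _
        have hl' : ∀ j, Reg B (vcons b Y (k.succ.succAbove j) - vcons b Y k.succ) := fun j =>
          (hY _ _ (Fin.succAbove_ne _ _)).2
        have hθ' : ∀ j, vcons b Y (k.succ.succAbove j) = vcons b (del k Y) j := fun j =>
          congr_fun (vcons_comp_succAbove b Y k) j
        have h := ih hY' hθ' hl' (topOnly_kinFactor_mul_aux hB0 hB1 hF hG hY' hθ' hl').2.2
        refine h.congr ?_
        have h1 := eventuallyEq_d2 (amp_insertNth_zero hB0 hB1 hF hG hY k.succ)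
        rw [vcons_comp_succAbove] at h1
        refine h1.symm.trans (Eventually.of_forall fun η => ?_)
        simp only [d2, vcons_insertNth]
    convert key α _ hα using 1
    rw [chainFF, mul_add, Finset.mul_sum]
    congr 1
    exact Finset.sum_congr rfl fun k _ => by ring

end Coincidence

section Remainders

variable {E : Type*} [NormedAddCommGroup E] [NormedSpace ℂ E]

/-- The second order Taylor remainder of a bounded holomorphic function. -/
lemma norm_taylor_two_le {f : ℂ → ℂ} {ρ M : ℝ} (hρ : 0 < ρ)
    (hf : DifferentiableOn ℂ f (ball 0 ρ)) (hM : ∀ z ∈ ball (0 : ℂ) ρ, ‖f z‖ ≤ M)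
    {z : ℂ} (hz : z ∈ ball (0 : ℂ) ρ) :
    ‖f z - f 0 - z * deriv f 0‖ ≤ 4 * M / ρ ^ 2 * ‖z‖ ^ 2 := by
  have h0 : (0 : ℂ) ∈ ball (0 : ℂ) ρ := Metric.mem_ball_self hρ
  have hn : ball (0 : ℂ) ρ ∈ 𝓝 0 := Metric.ball_mem_nhds _ hρ
  have h1 : ∀ w ∈ ball (0 : ℂ) ρ, ‖dslope f 0 w‖ ≤ 2 * M / ρ := fun w hw =>
    Complex.norm_dslope_le_div_of_mapsTo_ball hf (fun u hu => by
      rw [mem_closedBall_iff_norm]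
      linarith [norm_sub_le (f u) (f 0), hM u hu, hM 0 h0]) hw
  have h2 := Complex.norm_dslope_le_div_of_mapsTo_ball (R₂ := 4 * M / ρ)
    ((Complex.differentiableOn_dslope hn).2 hf) (fun u hu => by
      rw [mem_closedBall_iff_norm]
      have h3 := norm_sub_le (dslope f 0 u) (dslope f 0 0)
      have h4 : 4 * M / ρ = 2 * M / ρ + 2 * M / ρ := by ring
      linarith [h1 u hu, h1 0 h0]) hz
  have e : f z - f 0 - z * deriv f 0 = z * (z * dslope (dslope f 0) 0 z) := by
    have e1 := sub_smul_dslope f 0 z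
    have e2 := sub_smul_dslope (dslope f 0) 0 z
    rw [sub_zero, smul_eq_mul] at e1 e2
    rw [e2, mul_sub, e1, dslope_same]
  rw [e, norm_mul, norm_mul]
  calc _ ≤ ‖z‖ * (‖z‖ * (4 * M / ρ / ρ)) := by gcongr
    _ = _ := by ring

/-- The second order Taylor expansion, uniformly in parameters. -/
lemma eventually_taylor_two {g : E → ℂ → ℂ} {e : E}
    (hg : AnalyticAt ℂ (fun p : E × ℂ => g p.1 p.2) (e, 0))
    (h0 : ∀ᶠ x in 𝓝 e, g x 0 = 0) (h1 : ∀ᶠ x in 𝓝 e, deriv (g x) 0 = 0) {r : ℝ} (hr : 0 < r) :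
    ∀ᶠ p : E × ℂ in 𝓝 (e, 0),
      ‖g p.1 p.2 - deriv (deriv (g e)) 0 / 2 * p.2 ^ 2‖ ≤ r * ‖p.2‖ ^ 2 := by
  have hd := analyticAt_deriv_snd hg
  have hdd := analyticAt_deriv_deriv_snd hg
  set c := deriv (deriv (g e)) 0 with hc
  have hclose : ∀ᶠ p : E × ℂ in 𝓝 (e, 0), ‖deriv (deriv (g p.1)) p.2 - c‖ ≤ r := by
    have := (hdd.continuousAt.tendsto.sub_const c).norm
    rw [← hc, sub_self, norm_zero] at this
    exact this.eventually (ge_mem_nhds hr)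
  have hall := (hclose.and (hg.eventually_analyticAt.and hd.eventually_analyticAt))
  obtain ⟨U, hU, W, hW, hUW⟩ := (Filter.eventually_prod_iff.1 (by rwa [nhds_prod_eq] at hall))
  obtain ⟨ρ, hρ, hρW⟩ := Metric.eventually_nhds_iff_ball.1 hW
  rw [nhds_prod_eq]
  filter_upwards [((hU.and (h0.and h1))).prod_mk (Metric.ball_mem_nhds (0 : ℂ) hρ)]
    with ⟨x, z⟩ ⟨⟨hx, hx0, hx1⟩, hz⟩
  have hz' : z ∈ ball (0 : ℂ) ρ := hz
  have hsub : ∀ w ∈ closedBall (0 : ℂ) ‖z‖, w ∈ ball (0 : ℂ) ρ := fun w hw => by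
    rw [mem_closedBall_zero_iff] at hw
    rw [mem_ball_zero_iff] at hz' ⊢
    exact hw.trans_lt hz'
  have hz0 : (0 : ℂ) ∈ closedBall (0 : ℂ) ‖z‖ := Metric.mem_closedBall_self (norm_nonneg _)
  have hgx : ∀ w ∈ closedBall (0 : ℂ) ‖z‖, DifferentiableAt ℂ (g x) w := fun w hw =>
    (AnalyticAt.comp_pair (A := g) (hUW hx (hρW w (hsub w hw))).2.1).differentiableAt
  have hgx' : ∀ w ∈ closedBall (0 : ℂ) ‖z‖, DifferentiableAt ℂ (deriv (g x)) w :=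
    fun w hw => (AnalyticAt.comp_pair (A := fun x => deriv (g x))
      (hUW hx (hρW w (hsub w hw))).2.2).differentiableAt
  -- twice the mean value inequality
  have step1 : ∀ w ∈ closedBall (0 : ℂ) ‖z‖, ‖deriv (g x) w - c * w‖ ≤ r * ‖z‖ := by
    intro w hw
    have := (convex_closedBall (0 : ℂ) ‖z‖).norm_image_sub_le_of_norm_hasDerivWithin_le
      (f := fun w => deriv (g x) w - c * w) (f' := fun w => deriv (deriv (g x)) w - c) (C := r)
      (fun w hw => (((hgx' w hw).hasDerivAt).sub
        (by simpa using (hasDerivAt_id w).const_mul c)).hasDerivWithinAt)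
      (fun w hw => (hUW hx (hρW w (hsub w hw))).1) hz0 hw
    simp only [hx1, mul_zero, sub_zero] at this
    refine this.trans ?_
    gcongr
    simpa using hw
  have := (convex_closedBall (0 : ℂ) ‖z‖).norm_image_sub_le_of_norm_hasDerivWithin_le
      (f := fun w => g x w - c / 2 * w ^ 2) (f' := fun w => deriv (g x) w - c * w) (C := r * ‖z‖)
      (fun w hw => (((hgx w hw).hasDerivAt).sub
        (((hasDerivAt_pow 2 w).const_mul (c / 2)).congr_deriv
          (by push_cast; ring))).hasDerivWithinAt) step1 hz0
      (by simp : z ∈ closedBall (0 : ℂ) ‖z‖)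
  simp only [hx0, ne_eq, OfNat.ofNat_ne_zero, not_false_eq_true, zero_pow, mul_zero,
    sub_zero] at this
  exact this.trans (le_of_eq (by ring))

/-- The second order remainder in two variables of a function vanishing at `d = 0`. -/
lemma exists_double_remainder_le {V : ℂ → ℂ → ℂ → ℂ}
    (hV : AnalyticAt ℂ (fun p : ℂ × ℂ × ℂ => V p.1 p.2.1 p.2.2) 0)
    (h0 : ∀ᶠ q : ℂ × ℂ in 𝓝 0, V 0 q.1 q.2 = 0) :
    ∃ C, ∀ᶠ d in 𝓝 (0 : ℂ), ∀ g : ℂ → ℂ,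
      (∀ η, g η = V d η d - V d η 0 - d * deriv (V d η) 0) →
      ‖g (-d) - g 0 - (-d) * deriv g 0‖ ≤ C * ‖d‖ ^ 5 := by
  obtain ⟨K, s, hs, hK⟩ := hV.hasStrictFDerivAt.exists_lipschitzOnWith
  have h0' : ∀ᶠ p : ℂ × ℂ × ℂ in 𝓝 0, V 0 p.2.1 p.2.2 = 0 := by
    have : Tendsto (fun p : ℂ × ℂ × ℂ => p.2) (𝓝 0) (𝓝 0) := continuous_snd.tendsto' _ _ rfl
    exact this.eventually h0
  obtain ⟨ρ, hρ, hball⟩ := Metric.eventually_nhds_iff_ball.1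
    ((hV.eventually_analyticAt.and (Filter.eventually_mem_set.2 hs)).and h0')
  have hmem : ∀ d η η' : ℂ, d ∈ ball (0 : ℂ) ρ → η ∈ ball (0 : ℂ) ρ →
      η' ∈ ball (0 : ℂ) ρ → (d, η, η') ∈ ball (0 : ℂ × ℂ × ℂ) ρ := by
    intro d η η' h1 h2 h3
    rw [mem_ball_zero_iff] at *
    simp [Prod.norm_def, h1, h2, h3]
  have hz : (0 : ℂ) ∈ ball (0 : ℂ) ρ := Metric.mem_ball_self hρ
  have hbd : ∀ d η η' : ℂ, d ∈ ball (0 : ℂ) ρ → η ∈ ball (0 : ℂ) ρ →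
      η' ∈ ball (0 : ℂ) ρ → ‖V d η η'‖ ≤ K * ‖d‖ := by
    intro d η η' h1 h2 h3
    have a := hball _ (hmem d η η' h1 h2 h3)
    have b := hball _ (hmem 0 η η' hz h2 h3)
    have := hK.dist_le_mul _ a.1.2 _ b.1.2
    simp only at this
    rw [dist_eq_norm, b.2, sub_zero, dist_eq_norm] at this
    refine this.trans (le_of_eq ?_)
    simp [Prod.norm_def]
  refine ⟨4 * (4 * K / ρ ^ 2) / ρ ^ 2, ?_⟩
  filter_upwards [Metric.ball_mem_nhds (0 : ℂ) hρ] with d hd g hg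
  have han : ∀ η ∈ ball (0 : ℂ) ρ, ∀ η' ∈ ball (0 : ℂ) ρ,
      AnalyticAt ℂ (fun p : ℂ × ℂ => V d p.1 p.2) (η, η') := fun η h1 η' h2 =>
    AnalyticAt.comp_of (f := fun p : ℂ × ℂ => (d, p.1, p.2)) (hball _ (hmem d η η' hd h1 h2)).1.1
  have hg' : g = fun η => V d η d - V d η 0 - d * deriv (V d η) 0 := funext hg
  have hsl : ∀ η' ∈ ball (0 : ℂ) ρ, DifferentiableOn ℂ (fun η => V d η η')
      (ball 0 ρ) := fun η' h2 η h1 =>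
    (AnalyticAt.comp_pair (A := V d) (han η h1 η' h2)).differentiableAt.differentiableWithinAt
  have hdv : DifferentiableOn ℂ (fun η => deriv (V d η) 0) (ball 0 ρ) := fun η h1 =>
    (AnalyticAt.comp_pair (A := fun η => deriv (V d η)) (analyticAt_deriv_snd
      (g := V d) (han η h1 0 hz))).differentiableAt.differentiableWithinAt
  have hgd : DifferentiableOn ℂ g (ball 0 ρ) := by
    rw [hg']
    exact ((hsl d hd).sub (hsl 0 hz)).sub (hdv.const_mul d)
  -- `V d` is of order `d`, and each of the two Taylor remainders contributes `‖d‖ ^ 2`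
  have hgb : ∀ η ∈ ball (0 : ℂ) ρ, ‖g η‖ ≤ 4 * (K * ‖d‖) / ρ ^ 2 * ‖d‖ ^ 2 := by
    intro η h1
    rw [hg]
    refine norm_taylor_two_le hρ (fun η' h2 => ?_) (fun η' h2 => hbd d η η' hd h1 h2) hd
    exact (AnalyticAt.comp_pair (A := V d) (han η h1 η' h2)).differentiableAt.differentiableWithinAt
  have := norm_taylor_two_le hρ hgd hgb (z := -d) (by simpa using hd)
  refine this.trans (le_of_eq ?_)
  rw [norm_neg]
  ring

end Remainders

section Density

variable {P : Type*} [NormedAddCommGroup P] [NormedSpace ℂ P] [CompleteSpace P]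

lemma dense_forall_ne_zero {ι : Type*} [Countable ι] {ℓ : ι → P →L[ℂ] ℂ} (hℓ : ∀ k, ℓ k ≠ 0) :
    Dense {p | ∀ k, ℓ k p ≠ 0} := by
  have h : ∀ k, Dense {p | ℓ k p ≠ 0} := fun k =>
    (dense_compl_singleton (0 : ℂ)).preimage
      ((ℓ k).isOpenMap ((LinearMap.surjective (f := ((ℓ k : P →L[ℂ] ℂ) : P →ₗ[ℂ] ℂ))
        fun h => hℓ k (by ext x; exact LinearMap.congr_fun h x))))
  have := dense_iInter_of_isOpen (f := fun k => {p | ℓ k p ≠ 0})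
    (fun k => isOpen_ne_fun (ℓ k).continuous continuous_const) h
  refine this.mono fun p hp k => ?_
  exact Set.mem_iInter.1 hp k

/-- Germs of analytic functions that agree outside of finitely many hyperplanes are equal. -/
lemma eventuallyEq_of_forall_ne {ι : Type*} [Countable ι] {ℓ : ι → P →L[ℂ] ℂ}
    (hℓ : ∀ k, ℓ k ≠ 0) {x : P} {f g : P → ℂ} (hf : AnalyticAt ℂ f x) (hg : AnalyticAt ℂ g x)
    (h : ∀ᶠ p in 𝓝 x, (∀ k, ℓ k p ≠ 0) → f p = g p) : f =ᶠ[𝓝 x] g := by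
  filter_upwards [hf.eventually_analyticAt, hg.eventually_analyticAt, h.eventually_nhds]
    with p h1 h2 h3
  refine tendsto_nhds_unique_of_frequently_eq h1.continuousAt.tendsto h2.continuousAt.tendsto ?_
  refine ((mem_closure_iff_frequently.1 (dense_forall_ne_zero hℓ p)).and_eventually h3).mono ?_
  rintro q ⟨a, b⟩
  exact b a

end Density

section TwoEqual

variable {B : ℝ} {F G : (n : ℕ) → Vec n → ℂ} {n : ℕ}

/-- The pairs of equal rapidities if only the first two rapidities are equal. -/
def eqPairs (n : ℕ) : Finset (Fin (n + 2) × Fin (n + 2)) :=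
  (Finset.univ.filter fun p => p.1 = p.2) ∪ {(0, 1), (1, 0)}

lemma prod_eqPairs (g : Fin (n + 2) × Fin (n + 2) → ℂ) :
    ∏ p ∈ eqPairs n, g p = (∏ i, g (i, i)) * (g (0, 1) * g (1, 0)) := by
  rw [eqPairs, Finset.prod_union, Finset.prod_pair]
  · congr 1
    rw [Finset.prod_filter, ← Finset.univ_product_univ, Finset.prod_product]
    simp
  · simp
  · rw [Finset.disjoint_left]
    rintro ⟨a, b⟩ h1 h2
    simp only [Finset.mem_filter, Finset.mem_univ, true_and] at h1
    simp only [Finset.mem_insert, Finset.mem_singleton, Prod.mk.injEq] at h2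
    rcases h2 with ⟨rfl, rfl⟩ | ⟨rfl, rfl⟩ <;> simp at h1

lemma mem_eqPairs {b : ℂ} {Y : Vec n} (hY : Generic B (vcons b Y))
    (p : Fin (n + 2) × Fin (n + 2)) : p ∈ eqPairs n ↔
      (vcons b (vcons b Y) : Vec (n + 2)) p.1 = (vcons b (vcons b Y) : Vec (n + 2)) p.2 := by
  have hbY : ∀ i : Fin n, b ≠ Y i := fun i => ne_of_generic hY (Fin.succ_ne_zero i).symm
  have hYY : ∀ i j : Fin n, Y i = Y j ↔ i = j := fun i j => by
    constructor
    · intro h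
      by_contra hne
      exact ne_of_generic hY (fun h => hne (Fin.succ_injective _ h) : i.succ ≠ j.succ) h
    · rintro rfl; rfl
  obtain ⟨i, j⟩ := p
  simp only [eqPairs, Finset.mem_union, Finset.mem_filter, Finset.mem_univ, true_and,
    Finset.mem_insert, Finset.mem_singleton, Prod.mk.injEq]
  refine Fin.cases ?_ (fun i => ?_) i <;> refine Fin.cases ?_ (fun j => ?_) j
  · simp
  · refine Fin.cases ?_ (fun j => ?_) j
    · simp [vcons]
    · simp [vcons, hbY, Fin.ext_iff]
  · refine Fin.cases ?_ (fun i => ?_) i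
    · simp [vcons]
    · simp [vcons, (hbY _).symm, Fin.ext_iff]
  · refine Fin.cases ?_ (fun i => ?_) i <;> refine Fin.cases ?_ (fun j => ?_) j
    · simp
    · simp [vcons, hbY, Fin.ext_iff]
    · simp [vcons, (hbY _).symm, Fin.ext_iff]
    · simp [vcons, hYY, Fin.ext_iff]

lemma separated_vcons_vcons {b : ℂ} {Y : Vec n} (hY : Generic B (vcons b Y)) :
    Separated B (vcons b (vcons b Y) : Vec (n + 2)) := by
  have h := separated_of_generic hY
  intro i j
  refine Fin.cases ?_ (fun i => ?_) i <;> refine Fin.cases ?_ (fun j => ?_) j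
  · exact Or.inl rfl
  · exact h 0 j
  · exact h i 0
  · exact h i j

lemma analyticAt_eqPairs (hB0 : 0 < B) (hB1 : B < 1) (hG : Regularizes B F G) {b : ℂ}
    {Y : Vec n} (hY : Generic B (vcons b Y)) :
    AnalyticAt ℂ (fun p : Vec (n + 2) × Vec (n + 2) =>
      diagReg G (eqPairs n) p.1 p.2) (vcons b (vcons b Y), 0) :=
  analyticAt_diagReg hB0 hB1 hG (separated_vcons_vcons hY) (mem_eqPairs hY)

/-- The differences of the rapidities `u_i + v_i`, `u_j`; `diagonalPoint` is not generic where one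
of them vanishes. -/
def wall {P : Type*} [NormedAddCommGroup P] [NormedSpace ℂ P] {m : ℕ} (u v : Fin m → P →L[ℂ] ℂ) :
    Fin 3 × Fin m × Fin m → P →L[ℂ] ℂ
  | (0, i, j) => u i - u j
  | (1, i, j) => u i + v i - (u j + v j)
  | (2, i, j) => u i + v i - u j

/-- The hyperplanes on which `diagonalPoint` is not generic. -/
def diagWall (m : ℕ) (k : {k : Fin 3 × Fin m × Fin m // k.1 = 2 ∨ k.2.1 ≠ k.2.2}) :
    (Vec m × Vec m) →L[ℂ] ℂ :=
  wall (fun i => (ContinuousLinearMap.proj i).comp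
      (ContinuousLinearMap.fst ℂ (Vec m) (Vec m)))
    (fun i => (ContinuousLinearMap.proj i).comp
      (ContinuousLinearMap.snd ℂ (Vec m) (Vec m))) k.1

lemma diagWall_ne_zero (m : ℕ) (k) : diagWall m k ≠ 0 := by
  intro h
  obtain ⟨⟨a, i, j⟩, hk⟩ := k
  fin_cases a
  · have hk : i ≠ j := by simpa using hk
    have := congr_arg (fun f => f ((Pi.single i 1 : Vec m), (0 : Vec m))) h
    simp [diagWall, wall, hk.symm] at this
  · have hk : i ≠ j := by simpa using hk
    have := congr_arg (fun f => f ((Pi.single i 1 : Vec m), (0 : Vec m))) h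
    simp [diagWall, wall, hk.symm] at this
  · have := congr_arg (fun f => f ((0 : Vec m), (Pi.single i 1 : Vec m))) h
    simp [diagWall, wall] at this

lemma eventually_generic_of_diagWall (hB0 : 0 < B) (hB1 : B < 1) {m : ℕ} {θ₀ : Vec m}
    (hθ : Separated B θ₀) : ∀ᶠ p : Vec m × Vec m in 𝓝 (θ₀, 0),
      (∀ k, diagWall m k p ≠ 0) → Generic B (diagonalPoint p.1 p.2) := by
  filter_upwards [eventually_generic_diagonalPoint hB0 hB1 hθ] with p hp hw
  refine hp (fun i j hij h => hw ⟨(0, i, j), Or.inr hij⟩ ?_)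
    (fun i j hij h => hw ⟨(1, i, j), Or.inr hij⟩ ?_) (fun i j h => hw ⟨(2, i, j), Or.inl rfl⟩ ?_)
  · simp [diagWall, wall, h]
  · simp [diagWall, wall, h]
  · simp [diagWall, wall, h]

lemma vcons_vcons_swap (b : ℂ) (Y : Vec n) (i : Fin (n + 2)) :
    (vcons b (vcons b Y) : Vec (n + 2)) (Equiv.swap 0 1 i) =
      (vcons b (vcons b Y) : Vec (n + 2)) i := by
  rcases eq_or_ne i 0 with rfl | h0
  · rw [Equiv.swap_apply_left]; rfl
  rcases eq_or_ne i 1 with rfl | h1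
  · rw [Equiv.swap_apply_right]; rfl
  rw [Equiv.swap_apply_of_ne_of_ne h0 h1]

lemma vcons_vcons_comp_swap (b : ℂ) (Y : Vec n) :
    (vcons b (vcons b Y) : Vec (n + 2)) ∘ Equiv.swap 0 1 = vcons b (vcons b Y) :=
  funext (vcons_vcons_swap b Y)

/-- An exchange relation of the form factors at generic points extends to almost equal
rapidities. -/
lemma eventually_diagReg_exchange (hB0 : 0 < B) (hB1 : B < 1) (hG : Regularizes B F G) {b : ℂ}
    {Y : Vec n} (hY : Generic B (vcons b Y)) {u : Vec (n + 2) × Vec (n + 2) → ℂ}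
    {v w : Vec (n + 2) × Vec (n + 2) → Vec (n + 2)}
    (hu : AnalyticAt ℂ u (vcons b (vcons b Y), 0)) (hv : AnalyticAt ℂ v (vcons b (vcons b Y), 0))
    (hw : AnalyticAt ℂ w (vcons b (vcons b Y), 0)) (hu0 : u (vcons b (vcons b Y), 0) = 0)
    (hv0 : v (vcons b (vcons b Y), 0) = vcons b (vcons b Y))
    (hw0 : w (vcons b (vcons b Y), 0) = 0)
    (he : ∀ p : Vec (n + 2) × Vec (n + 2), Generic B (diagonalPoint p.1 p.2) →
      Generic B (diagonalPoint (v p) (w p)) ∧ F (n + 2 + (n + 2)) (diagonalPoint p.1 p.2) =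
        S B (u p) * F (n + 2 + (n + 2)) (diagonalPoint (v p) (w p)))
    (hp : ∀ p : Vec (n + 2) × Vec (n + 2), ∏ q ∈ eqPairs n, (p.1 q.1 + p.2 q.1 - p.1 q.2) =
      ∏ q ∈ eqPairs n, (v p q.1 + w p q.1 - v p q.2)) :
    ∀ᶠ p : Vec (n + 2) × Vec (n + 2) in 𝓝 (vcons b (vcons b Y), 0),
      diagReg G (eqPairs n) p.1 p.2 = S B (u p) * diagReg G (eqPairs n) (v p) (w p) := by
  have hV := analyticAt_eqPairs hB0 hB1 hG hY
  refine eventuallyEq_of_forall_ne (diagWall_ne_zero (n + 2)) hV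
    (((analyticAt_S (reg_zero hB0 hB1)).comp_of hu hu0).mul (hV.comp_pair hv hw hv0 hw0)) ?_
  filter_upwards [eventually_generic_of_diagWall hB0 hB1 (separated_vcons_vcons hY)] with p h hne
  obtain ⟨hg, e⟩ := he p (h hne)
  rw [← diagReg_eq hG _ (h hne), ← diagReg_eq hG _ hg, e, hp]
  ring

lemma swap_zero_one_succ_succ (i : Fin n) :
    Equiv.swap (0 : Fin (n + 2)) 1 i.succ.succ = i.succ.succ :=
  Equiv.swap_apply_of_ne_of_ne (Fin.succ_ne_zero _) (by simp [Fin.ext_iff])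

/-- Exchange of the first two unshifted rapidities, at almost equal rapidities. -/
lemma diagReg_exchange_lower (hB0 : 0 < B) (hB1 : B < 1) (hF : IsFormFactorFamily B F)
    (hG : Regularizes B F G) {b : ℂ} {Y : Vec n} (hY : Generic B (vcons b Y)) :
    ∀ᶠ p : Vec (n + 2) × Vec (n + 2) in 𝓝 (vcons b (vcons b Y), 0),
      diagReg G (eqPairs n) p.1 p.2 = S B (p.1 1 - p.1 0) * diagReg G (eqPairs n)
        (p.1 ∘ Equiv.swap 0 1) (fun k => p.1 k + p.2 k - p.1 (Equiv.swap 0 1 k)) := by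
  refine eventually_diagReg_exchange hB0 hB1 hG hY (by fun_prop) (by fun_prop) (by fun_prop)
    (sub_self b) (vcons_vcons_comp_swap b Y) (by ext i; simp [vcons_vcons_swap])
    (fun p => exchange_lower hF rfl) fun p => ?_
  simp only [prod_eqPairs, Fin.prod_univ_succ, Function.comp, Fin.succ_zero_eq_one,
    Equiv.swap_apply_left, Equiv.swap_apply_right, swap_zero_one_succ_succ, add_sub_cancel]
  ring

/-- Exchange of the first two shifted rapidities, at almost equal rapidities. -/
lemma diagReg_exchange_upper (hB0 : 0 < B) (hB1 : B < 1) (hF : IsFormFactorFamily B F)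
    (hG : Regularizes B F G) {b : ℂ} {Y : Vec n} (hY : Generic B (vcons b Y)) :
    ∀ᶠ p : Vec (n + 2) × Vec (n + 2) in 𝓝 (vcons b (vcons b Y), 0),
      diagReg G (eqPairs n) p.1 p.2 = S B (p.1 0 + p.2 0 - (p.1 1 + p.2 1)) *
        diagReg G (eqPairs n) p.1
          (fun k => p.1 (Equiv.swap 0 1 k) + p.2 (Equiv.swap 0 1 k) - p.1 k) := by
  refine eventually_diagReg_exchange hB0 hB1 hG hY (by fun_prop) (by fun_prop) (by fun_prop)
    (sub_self (b + 0)) rfl (by ext i; simp [vcons_vcons_swap])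
    (fun p => exchange_upper hF rfl) fun p => ?_
  simp only [prod_eqPairs, Fin.prod_univ_succ, Fin.succ_zero_eq_one,
    Equiv.swap_apply_left, Equiv.swap_apply_right, swap_zero_one_succ_succ, add_sub_cancel]
  ring

/-- The hyperplanes on which `diagonalPoint` with `η₀ → 0` is not generic. -/
def diagWall₀ (m : ℕ) (k : {k : Fin 3 × Fin (m + 1) × Fin (m + 1) //
      k.2.1 ≠ k.2.2 ∨ (k.1 = 2 ∧ k.2.1 ≠ 0)}) :
    (Vec (m + 1) × Vec m) →L[ℂ] ℂ :=
  wall (fun i => (ContinuousLinearMap.proj i).comp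
      (ContinuousLinearMap.fst ℂ (Vec (m + 1)) (Vec m)))
    (Fin.cases 0 fun i => (ContinuousLinearMap.proj i).comp
      (ContinuousLinearMap.snd ℂ (Vec (m + 1)) (Vec m))) k.1

lemma diagWall₀_ne_zero (m : ℕ) (k) : diagWall₀ m k ≠ 0 := by
  intro h
  obtain ⟨⟨a, i, j⟩, hk⟩ := k
  by_cases hij : i = j
  · obtain ⟨h2, hi⟩ : a = 2 ∧ i ≠ 0 := by simpa [hij] using hk
    subst h2 hij
    obtain ⟨i, rfl⟩ := Fin.exists_succ_eq.2 hi
    have := congr_arg (fun f => f ((0 : Vec (m + 1)), (Pi.single i 1 : Vec m))) h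
    simp [diagWall₀, wall] at this
  · have := congr_arg (fun f => f ((Pi.single i 1 : Vec (m + 1)), (0 : Vec m))) h
    have hv : ∀ l : Fin (m + 1), (Fin.cases 0 (fun i => (ContinuousLinearMap.proj i).comp
      (ContinuousLinearMap.snd ℂ (Vec (m + 1)) (Vec m))) l :
        (Vec (m + 1) × Vec m) →L[ℂ] ℂ) (Pi.single i 1, 0) = 0 := fun l => by
      refine Fin.cases ?_ (fun l => ?_) l <;> simp
    fin_cases a <;> simp [diagWall₀, wall, Ne.symm hij, hv] at this

lemma diagWall₀_apply (m : ℕ) (k) (p : Vec (m + 1) × Vec m) :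
    diagWall₀ m k p = match k.1 with
      | (0, i, j) => p.1 i - p.1 j
      | (1, i, j) => p.1 i + vcons 0 p.2 i - (p.1 j + vcons 0 p.2 j)
      | (2, i, j) => p.1 i + vcons 0 p.2 i - p.1 j := by
  have hv : ∀ l : Fin (m + 1), (Fin.cases 0 (fun i => (ContinuousLinearMap.proj i).comp
      (ContinuousLinearMap.snd ℂ (Vec (m + 1)) (Vec m))) l :
        (Vec (m + 1) × Vec m) →L[ℂ] ℂ) p = vcons 0 p.2 l := fun l => by
      refine Fin.cases ?_ (fun l => ?_) l <;> simp [vcons]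
  obtain ⟨⟨a, i, j⟩, hk⟩ := k
  fin_cases a <;> simp [diagWall₀, wall, hv]

/-- The kinematical axiom at almost equal rapidities. -/
lemma diagReg_kinematical (hB0 : 0 < B) (hB1 : B < 1) (hF : IsFormFactorFamily B F)
    (hG : Regularizes B F G) {b : ℂ} {Y : Vec n} (hY : Generic B (vcons b Y)) :
    ∀ᶠ p : Vec (n + 2) × Vec (n + 1) in 𝓝 (vcons b (vcons b Y), 0),
      diagReg G (eqPairs n) p.1 (vcons 0 p.2) = (p.1 0 - p.1 1) * (p.1 1 + p.2 0 - p.1 0) *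
        (kinFactor B p.1 0 p.2 * amp G (fun j => p.1 j.succ) p.2) := by
  have hV := analyticAt_eqPairs hB0 hB1 hG hY
  have hsep := separated_vcons_vcons hY
  have hJ0 : Tendsto (fun p : Vec (n + 2) × Vec (n + 1) =>
      ((p.1, vcons 0 p.2) : Vec (n + 2) × Vec (n + 2)))
      (𝓝 (vcons b (vcons b Y), 0)) (𝓝 (vcons b (vcons b Y), 0)) :=
    Continuous.tendsto' (by fun_prop) _ _ (by simp only [vcons_zero_zero])
  have hs : Tendsto (fun p : Vec (n + 2) × Vec (n + 1) =>
      ((fun j => p.1 j.succ : Vec (n + 1)), p.2)) (𝓝 (vcons b (vcons b Y), 0))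
      (𝓝 (vcons b Y, 0)) := Continuous.tendsto' (by fun_prop) _ _ rfl
  refine eventuallyEq_of_forall_ne (diagWall₀_ne_zero (n + 1)) hV.comp_pair ?_ ?_
  · refine AnalyticAt.mul (by fun_prop)
      ((analyticAt_kinFactor fun j => hsep.reg hB0 hB1 _ _).mul ?_)
    exact (analyticAt_amp hB0 hB1 hG hY).comp_pair
  have hz : Tendsto (fun q : (Vec (n + 2) × Vec (n + 1)) × ℂ =>
      ((q.1.1, vcons q.2 q.1.2) : Vec (n + 2) × Vec (n + 2)))
      (𝓝 ((vcons b (vcons b Y), 0), 0)) (𝓝 (vcons b (vcons b Y), 0)) :=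
    Continuous.tendsto' (by fun_prop) _ _ (by simp only [vcons_zero_zero])
  have hgz := hz.eventually (eventually_generic_diagonalPoint hB0 hB1 hsep)
  rw [nhds_prod_eq] at hgz
  have hg2 := (hs.eventually
    (eventually_generic_diagonalPoint' hB0 hB1 (θ₀ := vcons b Y) hY))
  have h1 := eventually_all.2 fun j : Fin (n + 1) => eventually_gen_of_ne hB0 hB1
    (x := ((vcons b (vcons b Y), 0) : Vec (n + 2) × Vec (n + 1)))
    (u := fun p => p.1 j.succ) (v := fun p => p.1 0)
    (by fun_prop) (by fun_prop)
    (hsep j.succ 0)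
  have h2 := eventually_all.2 fun j : Fin (n + 1) => eventually_gen_of_ne hB0 hB1
    (x := ((vcons b (vcons b Y), 0) : Vec (n + 2) × Vec (n + 1)))
    (u := fun p => p.1 j.succ + p.2 j) (v := fun p => p.1 0)
    (by fun_prop) (by fun_prop)
    (by simp only [Pi.zero_apply, add_zero]; exact hsep j.succ 0)
  filter_upwards [hgz.curry, hg2, h1, h2, hJ0.eventually hV.eventually_analyticAt]
    with ⟨θ, η⟩ hgz hg2 h1 h2 han hw
  dsimp only at hgz hg2 h1 h2 han ⊢
  have c1 : ∀ i j, i ≠ j → θ i ≠ θ j := fun i j hij h =>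
    hw ⟨(0, i, j), Or.inl hij⟩ (by rw [diagWall₀_apply]; simp [h])
  have c2 : ∀ i j, i ≠ j → θ i + vcons 0 η i ≠ θ j + vcons 0 η j := fun i j hij h =>
    hw ⟨(1, i, j), Or.inl hij⟩ (by rw [diagWall₀_apply]; simp [h])
  have c3 : ∀ i j, i ≠ j ∨ i ≠ 0 → θ i + vcons 0 η i ≠ θ j := fun i j hij h =>
    hw ⟨(2, i, j), hij.imp id fun h => ⟨rfl, h⟩⟩ (by rw [diagWall₀_apply]; simp [h])
  have c4 : ∀ j, η j ≠ 0 := fun j h => c3 j.succ j.succ (Or.inr (Fin.succ_ne_zero _))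
    (by simp [vcons, h])
  have hv : ∀ i, Continuous fun z : ℂ => vcons z η i := fun i => by fun_prop
  have d2 : ∀ᶠ z in 𝓝 (0 : ℂ), ∀ i j, i ≠ j → θ i + vcons z η i ≠ θ j + vcons z η j := by
    refine eventually_all.2 fun i => eventually_all.2 fun j => eventually_imp_distrib_left.2
      fun hij => ?_
    exact (isOpen_ne_fun (continuous_const.add (hv i))
      (continuous_const.add (hv j))).mem_nhds (c2 i j hij)
  have d3 : ∀ᶠ z in 𝓝 (0 : ℂ), ∀ i j, i ≠ j ∨ i ≠ 0 → θ i + vcons z η i ≠ θ j := by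
    refine eventually_all.2 fun i => eventually_all.2 fun j => eventually_imp_distrib_left.2
      fun hij => ?_
    exact (isOpen_ne_fun (continuous_const.add (hv i)) continuous_const).mem_nhds (c3 i j hij)
  have hgen : ∀ᶠ z in 𝓝[≠] (0 : ℂ), Generic B (diagonalPoint θ (vcons z η)) := by
    filter_upwards [nhdsWithin_le_nhds hgz, nhdsWithin_le_nhds d2, nhdsWithin_le_nhds d3,
      self_mem_nhdsWithin] with z hz d2 d3 hz0
    refine hz c1 d2 fun i j => ?_
    by_cases h : i ≠ j ∨ i ≠ 0
    · exact d3 i j h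
    · push Not at h
      obtain ⟨rfl, rfl⟩ := h
      intro h
      exact hz0 (by simpa [vcons] using h)
  -- both sides are limits as `η₀ → 0` of the form factor times its pole factors
  have hres := tendsto_diagonal_residue hB0 hB1 hF (θ := θ) (l := 0) (η := η)
    (by simp only [Fin.succAbove_zero]; exact hg2 c4)
    (fun j => by rw [Fin.succAbove_zero]; exact h1 j (c1 _ _ (Fin.succ_ne_zero j)))
    (fun j => by
      rw [Fin.succAbove_zero, show θ j.succ - θ 0 + η j = θ j.succ + η j - θ 0 by ring]
      exact h2 j (by simpa [vcons] using c3 j.succ 0 (Or.inl (Fin.succ_ne_zero j))))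
  simp only [insertNth_zero_eq, Fin.succAbove_zero] at hres
  have hlim : Tendsto (fun z => diagReg G (eqPairs n) θ (vcons z η)) (𝓝[≠] 0)
      (𝓝 (diagReg G (eqPairs n) θ (vcons 0 η))) := by
    have : ContinuousAt (fun z : ℂ => diagReg G (eqPairs n) θ (vcons z η)) 0 :=
      ContinuousAt.comp (g := fun p : Vec (n + 2) × Vec (n + 2) =>
        diagReg G (eqPairs n) p.1 p.2) (f := fun z : ℂ => (θ, vcons z η)) han.continuousAt
        (by fun_prop)
    exact this.tendsto.mono_left nhdsWithin_le_nhds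
  have hfac : Tendsto (fun z => (θ 0 + z - θ 1) * (θ 1 + η 0 - θ 0) * ∏ i, η i) (𝓝[≠] 0)
      (𝓝 ((θ 0 - θ 1) * (θ 1 + η 0 - θ 0) * ∏ i, η i)) := by
    have : Continuous fun z : ℂ => (θ 0 + z - θ 1) * (θ 1 + η 0 - θ 0) * ∏ i, η i := by fun_prop
    have h := this.tendsto 0
    rw [add_zero] at h
    exact h.mono_left nhdsWithin_le_nhds
  have hev : (fun z => diagReg G (eqPairs n) θ (vcons z η)) =ᶠ[𝓝[≠] 0] fun z =>
      (θ 0 + z - θ 1) * (θ 1 + η 0 - θ 0) * (∏ i, η i) *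
      (z * F (n + 1 + 1 + (n + 1 + 1)) (diagonalPoint θ (vcons z η))) := by
    filter_upwards [hgen] with z hz
    rw [← diagReg_eq hG _ hz, prod_eqPairs, Fin.prod_univ_succ]
    simp only [vcons, Fin.cons_zero, Fin.cons_succ, add_sub_cancel_left,
      show (1 : Fin (n + 2)) = (0 : Fin (n + 1)).succ from rfl]
    ring
  rw [tendsto_nhds_unique (hlim.congr' hev) (hfac.mul hres), ← amp_eq hG (hg2 c4)]
  ring

end TwoEqual

section CoincidenceLimit

variable {B : ℝ} {F G : (n : ℕ) → Vec n → ℂ} {n : ℕ}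

lemma coef_const_mul (c : ℂ) (f : Vec n → ℂ) : coef n (fun η => c * f η) = c * coef n f := by
  induction n with
  | zero => rfl
  | succ n ih =>
    have : dz (fun η => c * f η) = fun η => c * dz f η := by
      ext η
      exact deriv_const_mul_field c
    rw [coef, this, ih, coef]

/-- The residue of the form factor of the rapidities `τ, β, Y` at `η_τ = 0`, expanded to top
order in `η_Y`. -/
def resFF (B : ℝ) (G : (n : ℕ) → Vec n → ℂ) (Y : Vec n) (p : ℂ × ℂ) (ζ : ℂ) : ℂ :=
  coef n fun η => kinFactor B (vcons p.1 (vcons p.2 Y)) 0 (vcons ζ η) *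
    amp G (vcons p.2 Y) (vcons ζ η)

lemma vcons_succAbove_zero (τ β : ℂ) (Y : Vec n) (j : Fin (n + 1)) :
    (vcons τ (vcons β Y) : Vec (n + 2)) ((0 : Fin (n + 2)).succAbove j) = vcons β Y j := by
  rw [Fin.succAbove_zero]; rfl

lemma analyticAt_resFF_integrand (hB0 : 0 < B) (hB1 : B < 1) (hG : Regularizes B F G) {τ β : ℂ}
    {Y : Vec n} (hY : Generic B (vcons β Y)) (hτ : ∀ j, Reg B (vcons β Y j - τ)) :
    AnalyticAt ℂ (fun q : ((ℂ × ℂ) × ℂ) × Vec n =>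
      kinFactor B (vcons q.1.1.1 (vcons q.1.1.2 Y)) 0 (vcons q.1.2 q.2) *
      amp G (vcons q.1.1.2 Y) (vcons q.1.2 q.2)) (((τ, β), 0), 0) := by
  have hk := analyticAt_kinFactor (B := B) (θ := vcons τ (vcons β Y)) (l := 0) fun j => by
    rw [vcons_succAbove_zero]; exact hτ j
  exact (AnalyticAt.comp_pair (A := fun θ η => kinFactor B θ 0 η) hk).mul
    (analyticAt_amp hB0 hB1 hG hY).comp_pair

lemma analyticAt_resFF (hB0 : 0 < B) (hB1 : B < 1) (hG : Regularizes B F G) {τ β : ℂ}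
    {Y : Vec n} (hY : Generic B (vcons β Y)) (hτ : ∀ j, Reg B (vcons β Y j - τ)) :
    AnalyticAt ℂ (fun q : (ℂ × ℂ) × ℂ => resFF B G Y q.1 q.2) ((τ, β), 0) :=
  analyticAt_coef (A := fun (q : (ℂ × ℂ) × ℂ) η =>
    kinFactor B (vcons q.1.1 (vcons q.1.2 Y)) 0 (vcons q.2 η) *
      amp G (vcons q.1.2 Y) (vcons q.2 η)) (analyticAt_resFF_integrand hB0 hB1 hG hY hτ)

/-- The expansion of `resFF` up to second order. -/
lemma resFF_taylor (hB0 : 0 < B) (hB1 : B < 1) (hF : IsFormFactorFamily B F)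
    (hG : Regularizes B F G) {τ β : ℂ} {Y : Vec n} (hY : Generic B (vcons β Y))
    (hτ : ∀ j, Reg B (vcons β Y j - τ)) :
    resFF B G Y (τ, β) 0 = 0 ∧ deriv (resFF B G Y (τ, β)) 0 = 0 ∧
      deriv (deriv (resFF B G Y (τ, β))) 0 = 2 * chainFF B (fun _ => conn G) n τ β Y := by
  have hθ := vcons_succAbove_zero τ β Y
  have hl : ∀ j, Reg B ((vcons τ (vcons β Y) : Vec (n + 2)) ((0 : Fin (n + 2)).succAbove j) -
      (vcons τ (vcons β Y) : Vec (n + 2)) 0) := fun j => by rw [hθ]; exact hτ j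
  obtain ⟨h0, h1, -⟩ := topOnly_kinFactor_mul_aux hB0 hB1 hF hG hY hθ hl
  have h2 := topOnly_d2_kinFactor_mul hB0 hB1 hF hG hY hθ hl
  have hA : AnalyticAt ℂ (fun p : ℂ × Vec n =>
      kinFactor B (vcons τ (vcons β Y)) 0 (vcons p.1 p.2) * amp G (vcons β Y) (vcons p.1 p.2))
      (0, 0) :=
    (analyticAt_resFF_integrand hB0 hB1 hG hY hτ).comp_of
      (f := fun p : ℂ × Vec n => (((τ, β), p.1), p.2))
  have hd : ∀ᶠ ζ in 𝓝 (0 : ℂ), deriv (resFF B G Y (τ, β)) ζ = coef n fun η =>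
      deriv (fun ζ => kinFactor B (vcons τ (vcons β Y)) 0 (vcons ζ η) *
        amp G (vcons β Y) (vcons ζ η)) ζ := by
    have : Tendsto (fun ζ : ℂ => (ζ, (0 : Vec n))) (𝓝 0) (𝓝 (0, 0)) :=
      Continuous.tendsto' (by fun_prop) _ _ rfl
    filter_upwards [this.eventually hA.eventually_analyticAt] with ζ hζ
    exact (coef_deriv (A := fun ζ η => kinFactor B (vcons τ (vcons β Y)) 0 (vcons ζ η) *
        amp G (vcons β Y) (vcons ζ η)) hζ).symm
  refine ⟨h0.coef_eq, ?_, ?_⟩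
  · rw [hd.self_of_nhds]
    exact h1.coef_eq
  · rw [EventuallyEq.deriv_eq hd]
    refine Eq.trans ?_ h2.coef_eq
    refine (coef_deriv (A := fun ζ η => deriv (fun ζ => kinFactor B (vcons τ (vcons β Y)) 0
      (vcons ζ η) * amp G (vcons β Y) (vcons ζ η)) ζ) ?_).symm
    have hA' : AnalyticAt ℂ (fun p : Vec n × ℂ =>
      kinFactor B (vcons τ (vcons β Y)) 0 (vcons p.2 p.1) * amp G (vcons β Y) (vcons p.2 p.1))
      (0, 0) := hA.comp_of (f := fun p : Vec n × ℂ => (p.2, p.1))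
    exact (analyticAt_deriv_snd (g := fun η ζ => kinFactor B (vcons τ (vcons β Y)) 0 (vcons ζ η) *
      amp G (vcons β Y) (vcons ζ η)) hA').comp_of (f := fun p : ℂ × Vec n => (p.2, p.1))

/-- The top coefficient in `η_Y` of the form factor of the rapidities `b, b - d, Y`, with its poles
removed. -/
def pairFF (G : (n : ℕ) → Vec n → ℂ) (b : ℂ) (Y : Vec n) (d η η' : ℂ) : ℂ :=
  coef n fun ηY => diagReg G (eqPairs n) (vcons b (vcons (b - d) Y)) (vcons η (vcons η' ηY))

section PairFF

variable {b : ℂ} {Y : Vec n}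

lemma tendsto_pair {X : Type*} [TopologicalSpace X] {u : X → ℂ × ℂ × ℂ × ℂ} {x : X}
    (hu : ContinuousAt u x) (hx : u x = (b, b, 0, 0)) :
    Tendsto (fun q : X × Vec n => ((vcons (u q.1).1 (vcons (u q.1).2.1 Y),
      vcons (u q.1).2.2.1 (vcons (u q.1).2.2.2 q.2)) :
      (Vec (n + 2)) × Vec (n + 2))) (𝓝 (x, 0)) (𝓝 (vcons b (vcons b Y), 0)) := by
  have h1 : Continuous fun q : (ℂ × ℂ × ℂ × ℂ) × Vec n => ((vcons q.1.1 (vcons q.1.2.1 Y),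
      vcons q.1.2.2.1 (vcons q.1.2.2.2 q.2)) : Vec (n + 2) × Vec (n + 2)) := by fun_prop
  have h2 : Tendsto (fun q : X × Vec n => (u q.1, q.2)) (𝓝 (x, 0))
      (𝓝 ((b, b, 0, 0), 0)) := by
    rw [nhds_prod_eq, nhds_prod_eq, ← hx]
    exact hu.tendsto.prodMap tendsto_id
  have h3 := h1.tendsto ((b, b, 0, 0), 0)
  simp only [vcons_zero_zero] at h3
  exact h3.comp h2

lemma eventually_pair {X : Type*} [TopologicalSpace X] {u : X → ℂ × ℂ × ℂ × ℂ} {x : X}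
    (hu : ContinuousAt u x) (hx : u x = (b, b, 0, 0))
    {p : Vec (n + 2) × Vec (n + 2) → Prop}
    (h : ∀ᶠ q in 𝓝 (vcons b (vcons b Y), 0), p q) : ∀ᶠ e in 𝓝 x, ∀ᶠ ηY : Vec n in 𝓝 0,
      p (vcons (u e).1 (vcons (u e).2.1 Y), vcons (u e).2.2.1 (vcons (u e).2.2.2 ηY)) := by
  have := (tendsto_pair (n := n) (Y := Y) hu hx).eventually h
  rw [nhds_prod_eq] at this
  exact this.curry

lemma eventually_pair_tail {X : Type*} [TopologicalSpace X] {u : X → ℂ × ℂ × ℂ × ℂ} {x : X}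
    (hu : ContinuousAt u x) (hx : u x = (b, b, 0, 0))
    {p : Vec (n + 2) × Vec (n + 1) → Prop}
    (h : ∀ᶠ q in 𝓝 (vcons b (vcons b Y), 0), p q) : ∀ᶠ e in 𝓝 x, ∀ᶠ ηY : Vec n in 𝓝 0,
      p (vcons (u e).1 (vcons (u e).2.1 Y), vcons (u e).2.2.2 ηY) := by
  have hs : Continuous fun q : Vec (n + 2) × Vec (n + 2) =>
      (q.1, fun j : Fin (n + 1) => q.2 j.succ) := by fun_prop
  exact eventually_pair hu hx (hs.tendsto (vcons b (vcons b Y), 0) |>.eventually h)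

lemma pair_comp_swap (x y : ℂ) (Y : Vec n) :
    (vcons x (vcons y Y) : Vec (n + 2)) ∘ Equiv.swap 0 1 = vcons y (vcons x Y) := by
  ext i
  simp only [Function.comp]
  refine Fin.cases ?_ (fun i => ?_) i
  · rw [Equiv.swap_apply_left]; rfl
  · refine Fin.cases ?_ (fun i => ?_) i
    · rw [Fin.succ_zero_eq_one, Equiv.swap_apply_right]; rfl
    · rw [Equiv.swap_apply_of_ne_of_ne (Fin.succ_ne_zero _) (by simp [Fin.ext_iff])]; rfl

lemma pair_sub_swap (x y z w : ℂ) (Y η : Vec n) :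
    (fun k => (vcons x (vcons y Y) : Vec (n + 2)) k + (vcons z (vcons w η) : Vec (n + 2)) k -
      (vcons x (vcons y Y) : Vec (n + 2)) (Equiv.swap 0 1 k)) =
      vcons (x + z - y) (vcons (y + w - x) η) := by
  have e : ∀ k, (vcons x (vcons y Y) : Vec (n + 2)) (Equiv.swap 0 1 k) =
      (vcons y (vcons x Y) : Vec (n + 2)) k := congr_fun (pair_comp_swap x y Y)
  ext k
  rw [e]
  refine Fin.cases rfl (fun k => Fin.cases rfl (fun k => ?_) k) k
  simp [vcons]

lemma pair_swap_sub (x y z w : ℂ) (Y η : Vec n) :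
    (fun k => (vcons x (vcons y Y) : Vec (n + 2)) (Equiv.swap 0 1 k) +
      (vcons z (vcons w η) : Vec (n + 2)) (Equiv.swap 0 1 k) -
      (vcons x (vcons y Y) : Vec (n + 2)) k) =
      vcons (y + w - x) (vcons (x + z - y) η) := by
  have e : ∀ k, (vcons x (vcons y Y) : Vec (n + 2)) (Equiv.swap 0 1 k) =
      (vcons y (vcons x Y) : Vec (n + 2)) k := congr_fun (pair_comp_swap x y Y)
  have e' : ∀ k, (vcons z (vcons w η) : Vec (n + 2)) (Equiv.swap 0 1 k) =
      (vcons w (vcons z η) : Vec (n + 2)) k := congr_fun (pair_comp_swap z w η)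
  ext k
  rw [e, e']
  refine Fin.cases rfl (fun k => Fin.cases rfl (fun k => ?_) k) k
  simp [vcons]

lemma analyticAt_pairFF (hB0 : 0 < B) (hB1 : B < 1) (hG : Regularizes B F G)
    (hY : Generic B (vcons b Y)) :
    AnalyticAt ℂ (fun p : ℂ × ℂ × ℂ => pairFF G b Y p.1 p.2.1 p.2.2) 0 := by
  exact analyticAt_coef (A := fun (p : ℂ × ℂ × ℂ) ηY => diagReg G (eqPairs n)
    (vcons b (vcons (b - p.1) Y)) (vcons p.2.1 (vcons p.2.2 ηY)))
    (analyticAt_eqPairs hB0 hB1 hG hY).comp_pair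

/-- Exchanging two equal rapidities changes the sign, as `S(0) = -1`. -/
lemma pairFF_zero (hB0 : 0 < B) (hB1 : B < 1) (hF : IsFormFactorFamily B F)
    (hG : Regularizes B F G) (hY : Generic B (vcons b Y)) :
    ∀ᶠ q : ℂ × ℂ in 𝓝 0, pairFF G b Y 0 q.1 q.2 = 0 := by
  filter_upwards [eventually_pair (u := fun q : ℂ × ℂ => (b, b, q.1, q.2)) (x := 0)
    (by fun_prop) rfl (diagReg_exchange_lower hB0 hB1 hF hG hY)] with q hq
  have : pairFF G b Y 0 q.1 q.2 = coef n fun ηY : Vec n => 0 * (0 : ℂ) := by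
    refine coef_congr ?_
    filter_upwards [hq] with η hη
    rw [pair_comp_swap, pair_sub_swap] at hη
    have e1 : (vcons b (vcons b Y) : Vec (n + 2)) 1 -
      (vcons b (vcons b Y) : Vec (n + 2)) 0 = 0 := sub_self b
    rw [e1, S_zero hB0 hB1, add_sub_cancel_left, add_sub_cancel_left] at hη
    rw [sub_zero]
    linear_combination hη / 2
  rw [this, coef_const_mul, zero_mul]

lemma pairFF_neg_left (hB0 : 0 < B) (hB1 : B < 1) (hF : IsFormFactorFamily B F)
    (hG : Regularizes B F G) (hY : Generic B (vcons b Y)) :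
    ∀ᶠ q : ℂ × ℂ in 𝓝 0, pairFF G b Y q.1 (-q.1) q.2 =
      S B (-q.1) * (-q.1) * q.2 * resFF B G Y (b - q.1, b) (q.2 - q.1) := by
  filter_upwards [eventually_pair (u := fun q : ℂ × ℂ => (b, b - q.1, -q.1, q.2)) (x := 0)
    (by fun_prop) (by simp) (diagReg_exchange_lower hB0 hB1 hF hG hY),
    eventually_pair_tail (u := fun q : ℂ × ℂ => (b - q.1, b, 0, q.2 - q.1)) (x := 0)
    (by fun_prop) (by simp) (diagReg_kinematical hB0 hB1 hF hG hY)] with q h1 h2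
  rw [resFF, ← coef_const_mul]
  refine coef_congr ?_
  filter_upwards [h1, h2] with η h1 h2
  rw [pair_comp_swap, pair_sub_swap] at h1
  rw [h1, show b + -q.1 - (b - q.1) = 0 by ring, show b - q.1 + q.2 - b = q.2 - q.1 by ring, h2]
  have e1 : (vcons b (vcons (b - q.1) Y) : Vec (n + 2)) 1 = b - q.1 := rfl
  have e2 : (vcons b (vcons (b - q.1) Y) : Vec (n + 2)) 0 = b := rfl
  have e3 : (vcons (b - q.1) (vcons b Y) : Vec (n + 2)) 1 = b := rfl
  have e4 : (vcons (b - q.1) (vcons b Y) : Vec (n + 2)) 0 = b - q.1 := rfl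
  have e5 : (vcons (q.2 - q.1) η : Vec (n + 1)) 0 = q.2 - q.1 := rfl
  have e6 : (fun j : Fin (n + 1) => (vcons (b - q.1) (vcons b Y) : Vec (n + 2)) j.succ) =
    vcons b Y := rfl
  rw [e1, e2, e3, e4, e5, e6, show b - q.1 - b = -q.1 by ring,
    show b + (q.2 - q.1) - (b - q.1) = q.2 by ring]
  ring

lemma pairFF_right (hB0 : 0 < B) (hB1 : B < 1) (hF : IsFormFactorFamily B F)
    (hG : Regularizes B F G) (hY : Generic B (vcons b Y)) :
    ∀ᶠ q : ℂ × ℂ in 𝓝 0, pairFF G b Y q.1 q.2 q.1 =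
      S B q.2 * q.1 * q.2 * resFF B G Y (b, b - q.1) (q.2 + q.1) := by
  filter_upwards [eventually_pair (u := fun q : ℂ × ℂ => (b, b - q.1, q.2, q.1)) (x := 0)
    (by fun_prop) (by simp) (diagReg_exchange_upper hB0 hB1 hF hG hY),
    eventually_pair_tail (u := fun q : ℂ × ℂ => (b, b - q.1, 0, q.2 + q.1)) (x := 0)
    (by fun_prop) (by simp) (diagReg_kinematical hB0 hB1 hF hG hY)] with q h1 h2
  rw [resFF, ← coef_const_mul]
  refine coef_congr ?_
  filter_upwards [h1, h2] with η h1 h2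
  rw [pair_swap_sub] at h1
  rw [h1, show b - q.1 + q.1 - b = 0 by ring, show b + q.2 - (b - q.1) = q.2 + q.1 by ring, h2]
  have e1 : (vcons b (vcons (b - q.1) Y) : Vec (n + 2)) 1 = b - q.1 := rfl
  have e2 : (vcons b (vcons (b - q.1) Y) : Vec (n + 2)) 0 = b := rfl
  have e3 : (vcons q.2 (vcons q.1 η) : Vec (n + 2)) 0 = q.2 := rfl
  have e4 : (vcons q.2 (vcons q.1 η) : Vec (n + 2)) 1 = q.1 := rfl
  have e5 : (vcons (q.2 + q.1) η : Vec (n + 1)) 0 = q.2 + q.1 := rfl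
  have e6 : (fun j : Fin (n + 1) => (vcons b (vcons (b - q.1) Y) : Vec (n + 2)) j.succ) =
    vcons (b - q.1) Y := rfl
  rw [e1, e2, e3, e4, e5, e6, show b + q.2 - (b - q.1 + q.1) = q.2 by ring,
    show b - (b - q.1) = q.1 by ring, show b - q.1 + (q.2 + q.1) - b = q.2 by ring]
  ring

lemma generic_vcons_iff {x : ℂ} {θ : Vec n} :
    Generic B (vcons x θ) ↔ (∀ j, Gen B (x - θ j)) ∧ Generic B θ := by
  constructor
  · intro h
    refine ⟨fun j => h 0 j.succ (Fin.succ_ne_zero j).symm, fun i j hij => ?_⟩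
    exact h i.succ j.succ fun h => hij (Fin.succ_injective _ h)
  · rintro ⟨h1, h2⟩ i j
    refine Fin.cases ?_ (fun i => ?_) i <;> refine Fin.cases ?_ (fun j => ?_) j
    · intro h; exact absurd rfl h
    · intro _; exact h1 j
    · intro _; exact gen_sub_comm.1 (h1 i)
    · intro h; exact h2 i j fun h' => h (by rw [h'])

lemma eventually_generic_pair (hB0 : 0 < B) (hB1 : B < 1) (hY : Generic B (vcons b Y)) :
    ∀ᶠ d in 𝓝[≠] (0 : ℂ), Generic B (vcons b (vcons (b - d) Y)) := by
  obtain ⟨h1, h2⟩ := generic_vcons_iff.1 hY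
  have h3 : ∀ᶠ d in 𝓝 (0 : ℂ), ∀ j, Gen B (b - d - Y j) := eventually_all.2 fun j => by
    have hc : Continuous fun d => b - d - Y j := by fun_prop
    refine (hc.tendsto 0).eventually (isOpen_gen.mem_nhds ?_)
    simpa [Gen] using h1 j
  filter_upwards [eventually_gen_zero hB0 hB1, nhdsWithin_le_nhds h3] with d hd h3
  refine generic_vcons_iff.2 ⟨fun j => ?_, generic_vcons_iff.2 ⟨h3, h2⟩⟩
  refine Fin.cases ?_ (fun j => ?_) j
  · simpa [vcons] using hd
  · exact h1 j

end PairFF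

end CoincidenceLimit

section CoincidenceLimit

variable {B : ℝ} {F G : (n : ℕ) → Vec n → ℂ} {n : ℕ} {b : ℂ} {Y : Vec n}

/-- At distinct rapidities `pairFF` is determined to second order by the connected form factor. -/
lemma pairFF_germ (hB0 : 0 < B) (hB1 : B < 1) (hF : IsFormFactorFamily B F)
    (hG : Regularizes B F G) (hY : Generic B (vcons b Y)) :
    ∀ᶠ d in 𝓝[≠] (0 : ℂ), pairFF G b Y d 0 0 = 0 ∧ deriv (pairFF G b Y d 0) 0 = 0 ∧
      HasDerivAt (fun η => pairFF G b Y d η 0) 0 0 ∧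
      HasDerivAt (fun η => deriv (pairFF G b Y d η) 0)
        (-(d ^ 2 * conn G (vcons b (vcons (b - d) Y)))) 0 := by
  have hVan : ∀ᶠ d in 𝓝 (0 : ℂ), AnalyticAt ℂ (fun p : Vec (n + 2) × Vec (n + 2) =>
      diagReg G (eqPairs n) p.1 p.2) (vcons b (vcons (b - d) Y), 0) := by
    have := (eventually_pair (Y := Y) (u := fun d : ℂ => (b, b - d, 0, 0)) (x := 0)
      (by fun_prop) (by simp) (analyticAt_eqPairs hB0 hB1 hG hY).eventually_analyticAt)
    filter_upwards [this] with d hd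
    have := hd.self_of_nhds
    simpa only [vcons_zero_zero] using this
  filter_upwards [eventually_generic_pair hB0 hB1 hY, nhdsWithin_le_nhds hVan,
    self_mem_nhdsWithin] with d hgen hd hd0
  set θ : Vec (n + 2) := vcons b (vcons (b - d) Y) with hθ
  set f := amp G θ with hf
  have hfa : AnalyticAt ℂ f 0 := analyticAt_amp_snd hB0 hB1 hG hgen
  have hVf : AnalyticAt ℂ (diagReg G (eqPairs n) θ) 0 :=
    analyticAt_param_slice (A := fun θ η => diagReg G (eqPairs n) θ η) hd
  -- the regularized form factor in terms of the one at distinct rapidities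
  have hEq : (diagReg G (eqPairs n) θ) =ᶠ[𝓝 0] fun η => (η 0 + d) * (η 1 - d) * f η := by
    refine eventuallyEq_of_ne_zero (hVf.eventually_analyticAt.mono fun _ h => h.continuousAt)
      ?_ ?_
    · filter_upwards [hfa.eventually_analyticAt] with η hη
      exact ContinuousAt.mul (by fun_prop) hη.continuousAt
    · filter_upwards [eventually_slice (eventually_generic_diagonalPoint' hB0 hB1 hgen)]
        with η h hne
      rw [← diagReg_eq hG _ (h hne), hf, ← amp_eq hG (h hne), prod_eqPairs]
      have e1 : θ 0 = b := rfl
      have e2 : θ 1 = b - d := rfl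
      simp only [e1, e2, add_sub_cancel_left]
      ring
  obtain ⟨⟨t00, t01⟩, t10, t11⟩ := topOnly_amp hB0 hB1 hF hG hgen
  set a : ℂ → ℂ → ℂ := fun η η' => coef n fun ηY => f (vcons η (vcons η' ηY)) with ha
  have hg3 : AnalyticAt ℂ (fun q : (ℂ × ℂ) × Vec n => f (vcons q.1.1 (vcons q.1.2 q.2)))
      ((0, 0), 0) := hfa.comp_of
  have haa : AnalyticAt ℂ (fun p : ℂ × ℂ => a p.1 p.2) (0, 0) :=
    analyticAt_coef (A := fun (p : ℂ × ℂ) ηY => f (vcons p.1 (vcons p.2 ηY))) hg3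
  have a00 : a 0 0 = 0 := t00.coef_eq
  have a01 : deriv (fun η' => a 0 η') 0 = 0 := by
    refine Eq.trans ?_ t01.coef_eq
    exact (coef_deriv (A := fun η' ηY => f (vcons 0 (vcons η' ηY)))
      hfa.comp_of).symm
  have a10 : deriv (fun η => a η 0) 0 = 0 := by
    refine Eq.trans ?_ t10.coef_eq
    exact (coef_deriv (A := fun η ηY => f (vcons η (vcons 0 ηY)))
      hfa.comp_of).symm
  have a11 : deriv (fun η => deriv (fun η' => a η η') 0) 0 = conn G θ := by
    rw [deriv_deriv_comm haa, ← t11.coef_eq]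
    have h1 : ∀ᶠ η' in 𝓝 (0 : ℂ), deriv (fun η => a η η') 0 =
        coef n fun ηY => dz f (vcons η' ηY) := by
      have ht : Tendsto (fun η' : ℂ => (((0 : ℂ), η'), (0 : Vec n))) (𝓝 0) (𝓝 ((0, 0), 0)) :=
        Continuous.tendsto' (by fun_prop) _ _ rfl
      filter_upwards [ht.eventually hg3.eventually_analyticAt] with η' hη'
      refine (coef_deriv (A := fun η ηY => f (vcons η (vcons η' ηY))) ?_).symm
      exact hη'.comp_of (f := fun p : ℂ × Vec n => ((p.1, η'), p.2))
    rw [EventuallyEq.deriv_eq h1]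
    exact (coef_deriv (A := fun η' ηY => dz f (vcons η' ηY)) (analyticAt_dz_zero hfa).comp_of).symm
  have hpair : ∀ᶠ q : ℂ × ℂ in 𝓝 (0, 0), pairFF G b Y d q.1 q.2 =
      (q.1 + d) * (q.2 - d) * a q.1 q.2 := by
    have ht : Tendsto (fun q : (ℂ × ℂ) × Vec n => vcons q.1.1 (vcons q.1.2 q.2))
        (𝓝 ((0, 0), 0)) (𝓝 0) :=
      Continuous.tendsto' (by fun_prop) _ _ (by simp only [vcons_zero_zero])
    have := ht.eventually hEq
    rw [nhds_prod_eq] at this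
    filter_upwards [this.curry] with q hq
    rw [ha, ← coef_const_mul]
    exact coef_congr hq
  have hp1 : ∀ᶠ η in 𝓝 (0 : ℂ), ∀ᶠ η' in 𝓝 (0 : ℂ), pairFF G b Y d η η' =
      (η + d) * (η' - d) * a η η' := by
    rw [nhds_prod_eq] at hpair
    exact hpair.curry
  have hα0 : AnalyticAt ℂ (fun η => a η 0) 0 :=
    haa.comp_pair
  have hα1 : AnalyticAt ℂ (fun η => deriv (fun η' => a η η') 0) 0 :=
    AnalyticAt.comp_pair (A := fun η => deriv (a η)) (analyticAt_deriv_snd haa)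
  have hα : ∀ᶠ η in 𝓝 (0 : ℂ), DifferentiableAt ℂ (fun η' => a η η') 0 := by
    have ht : Tendsto (fun η : ℂ => (η, (0 : ℂ))) (𝓝 0) (𝓝 (0, 0)) :=
      Continuous.tendsto' (by fun_prop) _ _ rfl
    filter_upwards [ht.eventually haa.eventually_analyticAt] with η hη
    exact (hη.comp_pair (f := fun _ => η)).differentiableAt
  have hP : ∀ᶠ η in 𝓝 (0 : ℂ), deriv (pairFF G b Y d η) 0 =
      (η + d) * (a η 0 - d * deriv (fun η' => a η η') 0) := by
    filter_upwards [hp1, hα] with η h1 h2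
    have h3 : HasDerivAt (fun η' => (η + d) * (η' - d) * a η η')
        ((η + d) * 1 * a η 0 + (η + d) * (0 - d) * deriv (fun η' => a η η') 0) 0 :=
      (((hasDerivAt_id (0 : ℂ)).sub_const d).const_mul (η + d)).mul h2.hasDerivAt
    rw [EventuallyEq.deriv_eq h1, h3.deriv]
    ring
  -- the factor `(η + d) (η' - d)` is that of the poles at almost equal rapidities; by `topOnly_amp`
  -- the terms `1`, `η`, `η'` of `a` vanish and `η η'` has the coefficient `conn G θ`
  refine ⟨?_, ?_, ?_, ?_⟩
  · rw [hp1.self_of_nhds.self_of_nhds, a00, mul_zero]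
  · rw [hP.self_of_nhds, a00, a01]; ring
  · have h1 : ∀ᶠ η in 𝓝 (0 : ℂ), pairFF G b Y d η 0 = (η + d) * (0 - d) * a η 0 :=
      hp1.mono fun η h => h.self_of_nhds
    have h2 := (((hasDerivAt_id (0 : ℂ)).add_const d).mul_const (0 - d)).mul
      hα0.differentiableAt.hasDerivAt
    simp only [a00, a10, mul_zero, add_zero] at h2
    exact h2.congr_of_eventuallyEq h1
  · have h2 := ((hasDerivAt_id (0 : ℂ)).add_const d).mul
      (hα0.differentiableAt.hasDerivAt.sub (hα1.differentiableAt.hasDerivAt.const_mul d))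
    refine HasDerivAt.congr_of_eventuallyEq ?_ hP
    refine h2.congr_deriv ?_
    simp only [Pi.sub_apply, a00, a01, a10, a11, id]
    ring

lemma hasDerivAt_mul_self {u : ℂ → ℂ} (hu : DifferentiableAt ℂ u 0) :
    HasDerivAt (fun z => z * u z) (u 0) 0 := by
  have h : HasDerivAt (fun z => z * u z) (1 * u 0 + id 0 * deriv u 0) 0 :=
    (hasDerivAt_id (0 : ℂ)).mul hu.hasDerivAt
  exact h.congr_deriv (by simp)

/-- The connected form factor at two almost equal rapidities. -/
theorem tendsto_conn_pair (hB0 : 0 < B) (hB1 : B < 1) (hF : IsFormFactorFamily B F)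
    (hG : Regularizes B F G) (hY : Generic B (vcons b Y)) :
    Tendsto (fun d => conn G (vcons b (vcons (b - d) Y))) (𝓝[≠] 0)
      (𝓝 (2 * chainFF B (fun _ => conn G) n b b Y)) := by
  set h := chainFF B (fun _ => conn G) n b b Y with hh
  have hreg : ∀ j, Reg B (vcons b Y j - b) := fun j => by
    refine Fin.cases ?_ (fun j => ?_) j
    · simpa [vcons] using reg_zero hB0 hB1
    · exact (hY j.succ 0 (Fin.succ_ne_zero _)).2
  have hRan := analyticAt_resFF hB0 hB1 hG hY hreg
  have hnear : ∀ᶠ q : ℂ × ℂ in 𝓝 (b, b), Generic B (vcons q.2 Y) ∧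
      ∀ j, Reg B (vcons q.2 Y j - q.1) := by
    obtain ⟨h1, h2⟩ := generic_vcons_iff.1 hY
    have h3 : ∀ᶠ q : ℂ × ℂ in 𝓝 (b, b), ∀ j, Gen B (q.2 - Y j) := eventually_all.2 fun j => by
      have hc : Continuous fun q : ℂ × ℂ => q.2 - Y j := by fun_prop
      exact (hc.tendsto (b, b)).eventually (isOpen_gen.mem_nhds (h1 j))
    have h4 : ∀ᶠ q : ℂ × ℂ in 𝓝 (b, b), ∀ j, Reg B (vcons q.2 Y j - q.1) :=
      eventually_all.2 fun j => by
        have hc : Continuous fun q : ℂ × ℂ => vcons q.2 Y j - q.1 := by fun_prop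
        exact (hc.tendsto (b, b)).eventually (isOpen_reg.mem_nhds (hreg j))
    filter_upwards [h3, h4] with q h3 h4
    exact ⟨generic_vcons_iff.2 ⟨h3, h2⟩, h4⟩
  have hT : ∀ r > 0, ∀ᶠ q : (ℂ × ℂ) × ℂ in 𝓝 ((b, b), 0),
      ‖resFF B G Y q.1 q.2 - h * q.2 ^ 2‖ ≤ r * ‖q.2‖ ^ 2 := fun r hr => by
    have := eventually_taylor_two hRan
      (hnear.mono fun q hq => (resFF_taylor hB0 hB1 hF hG hq.1 hq.2).1)
      (hnear.mono fun q hq => (resFF_taylor hB0 hB1 hF hG hq.1 hq.2).2.1) hr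
    rw [(resFF_taylor hB0 hB1 hF hG hY hreg).2.2, mul_div_cancel_left₀ _ two_ne_zero] at this
    exact this
  obtain ⟨C, hC⟩ := exists_double_remainder_le (analyticAt_pairFF hB0 hB1 hG hY)
    (pairFF_zero hB0 hB1 hF hG hY)
  -- the difference quotients of the two kinematical residues
  have hlim : ∀ u : ℂ → (ℂ × ℂ) × ℂ, ContinuousAt u 0 → u 0 = ((b, b), 0) →
      (∀ d, ‖(u d).2‖ = ‖d‖) →
      Tendsto (fun d => resFF B G Y (u d).1 (u d).2 / (u d).2 ^ 2) (𝓝[≠] 0) (𝓝 h) := by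
    intro u hu hu0 hud
    rw [Metric.tendsto_nhds]
    intro r hr
    have hu' := hu.tendsto
    rw [hu0] at hu'
    filter_upwards [nhdsWithin_le_nhds (hu'.eventually (hT (r / 2) (half_pos hr))),
      self_mem_nhdsWithin] with d hd hd0
    have hne : (u d).2 ≠ 0 := by
      rw [← norm_ne_zero_iff, hud, norm_ne_zero_iff]; exact hd0
    have e : resFF B G Y (u d).1 (u d).2 / (u d).2 ^ 2 - h =
        (resFF B G Y (u d).1 (u d).2 - h * (u d).2 ^ 2) / (u d).2 ^ 2 := by
      field_simp
    rw [dist_eq_norm, e, norm_div, norm_pow, div_lt_iff₀ (by positivity)]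
    refine hd.trans_lt ?_
    have : 0 < ‖(u d).2‖ ^ 2 := by positivity
    nlinarith
  have l1 := hlim (fun d => ((b, b - d), d)) (by fun_prop) (by simp) (fun d => rfl)
  have l2 := hlim (fun d => ((b - d, b), -d)) (by fun_prop) (by simp) (fun d => norm_neg d)
  -- `S 0 = -1`: the contributions of the two residues add up instead of cancelling
  have lS : Tendsto (fun d : ℂ => S B (-d)) (𝓝[≠] 0) (𝓝 (-1)) := by
    have h1 : ContinuousAt (fun d : ℂ => S B (-d)) 0 :=
      ((analyticAt_S (reg_zero hB0 hB1)).comp_of (f := fun d : ℂ => -d)).continuousAt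
    have := h1.tendsto
    rw [neg_zero, S_zero hB0 hB1] at this
    exact this.mono_left nhdsWithin_le_nhds
  have lmain := l1.sub (lS.mul l2)
  rw [show h - -1 * h = 2 * h by ring] at lmain
  have hR1 : ∀ᶠ d in 𝓝 (0 : ℂ), ∀ᶠ η' in 𝓝 (0 : ℂ), pairFF G b Y d (-d) η' =
      S B (-d) * (-d) * η' * resFF B G Y (b - d, b) (η' - d) := by
    have := pairFF_neg_left hB0 hB1 hF hG hY
    rw [show (0 : ℂ × ℂ) = (0, 0) from rfl, nhds_prod_eq] at this
    exact this.curry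
  have hR2 : ∀ᶠ d in 𝓝 (0 : ℂ), ∀ᶠ η in 𝓝 (0 : ℂ), pairFF G b Y d η d =
      S B η * d * η * resFF B G Y (b, b - d) (η + d) := by
    have := pairFF_right hB0 hB1 hF hG hY
    rw [show (0 : ℂ × ℂ) = (0, 0) from rfl, nhds_prod_eq] at this
    exact this.curry
  have hdiag : Tendsto (fun d : ℂ => ((d, d) : ℂ × ℂ)) (𝓝 0) (𝓝 0) :=
    Continuous.tendsto' (by fun_prop) _ _ rfl
  have hR1d := hdiag.eventually (pairFF_neg_left hB0 hB1 hF hG hY)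
  have han : ∀ u : ℂ → (ℂ × ℂ) × ℂ, ContinuousAt u 0 → u 0 = ((b, b), 0) →
      ∀ᶠ d in 𝓝 (0 : ℂ), DifferentiableAt ℂ (resFF B G Y (u d).1) (u d).2 := by
    intro u hu hu0
    have hu' := hu.tendsto
    rw [hu0] at hu'
    filter_upwards [hu'.eventually hRan.eventually_analyticAt] with d hd
    exact (hd.comp_pair (A := resFF B G Y) (f := fun _ => (u d).1)).differentiableAt
  have hd1 := han (fun d => ((b, b - d), d)) (by fun_prop) (by simp)
  have hd2 := han (fun d => ((b - d, b), -d)) (by fun_prop) (by simp)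
  have hS0 : DifferentiableAt ℂ (S B) 0 := (analyticAt_S (reg_zero hB0 hB1)).differentiableAt
  have hz : ∀ᶠ d in 𝓝 (0 : ℂ), resFF B G Y (b - d, b) 0 = 0 := by
    have ht : Tendsto (fun d : ℂ => (b - d, b)) (𝓝 0) (𝓝 (b, b)) :=
      Continuous.tendsto' (by fun_prop) _ _ (by simp)
    exact (ht.eventually hnear).mono fun d hq => (resFF_taylor hB0 hB1 hF hG hq.1 hq.2).1
  -- `pairFF` at the corners `η ∈ {0, -d}`, `η' ∈ {0, d}`: the double second order remainder is
  -- of order `‖d‖ ^ 5`, and the connected form factor enters it with the factor `d ^ 4`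
  have hbound : ∀ᶠ d in 𝓝[≠] (0 : ℂ), ‖conn G (vcons b (vcons (b - d) Y)) -
      (resFF B G Y (b, b - d) d / d ^ 2 - S B (-d) * (resFF B G Y (b - d, b) (-d) / (-d) ^ 2))‖ ≤
      C * ‖d‖ := by
    filter_upwards [pairFF_germ hB0 hB1 hF hG hY, nhdsWithin_le_nhds hC, nhdsWithin_le_nhds hR1,
      nhdsWithin_le_nhds hR2, nhdsWithin_le_nhds hR1d, nhdsWithin_le_nhds hd1,
      nhdsWithin_le_nhds hd2, nhdsWithin_le_nhds hz, self_mem_nhdsWithin]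
      with d ⟨g1, g2, g3, g4⟩ hC hR1 hR2 hR1d hd1 hd2 hz hd0
    set c := conn G (vcons b (vcons (b - d) Y)) with hc
    set k1 := resFF B G Y (b, b - d) d with hk1
    set k2 := resFF B G Y (b - d, b) (-d) with hk2
    have e1 : pairFF G b Y d (-d) d = 0 := by
      rw [hR1d, sub_self, hz, mul_zero]
    have e2 : pairFF G b Y d (-d) 0 = 0 := by
      rw [hR1.self_of_nhds, mul_zero, zero_mul]
    have e3 : deriv (pairFF G b Y d (-d)) 0 = S B (-d) * (-d) * k2 := by
      have h1 : HasDerivAt (fun η' => η' * (S B (-d) * (-d) * resFF B G Y (b - d, b) (η' - d)))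
          (S B (-d) * (-d) * resFF B G Y (b - d, b) (0 - d)) 0 := by
        refine hasDerivAt_mul_self (u := fun η' =>
          S B (-d) * (-d) * resFF B G Y (b - d, b) (η' - d))
          (DifferentiableAt.const_mul ?_ _)
        refine DifferentiableAt.comp (g := resFF B G Y (b - d, b)) (f := fun η' => η' - d) 0 ?_
          (by fun_prop)
        rw [zero_sub]; exact hd2
      rw [zero_sub] at h1
      rw [← h1.deriv]
      refine EventuallyEq.deriv_eq (hR1.mono fun η' h => ?_)
      rw [h]; ring
    have e4 : pairFF G b Y d 0 d = 0 := by
      rw [hR2.self_of_nhds, mul_zero, zero_mul]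
    have e5 : HasDerivAt (fun η => pairFF G b Y d η d) (-(d * k1)) 0 := by
      have h1 : HasDerivAt (fun η => η * (S B η * d * resFF B G Y (b, b - d) (η + d)))
          (S B 0 * d * resFF B G Y (b, b - d) (0 + d)) 0 := by
        refine hasDerivAt_mul_self (u := fun η => S B η * d * resFF B G Y (b, b - d) (η + d))
          ((hS0.mul_const d).mul ?_)
        refine DifferentiableAt.comp (g := resFF B G Y (b, b - d)) (f := fun η => η + d) 0 ?_
          (by fun_prop)
        rw [zero_add]; exact hd1
      rw [zero_add, S_zero hB0 hB1] at h1
      refine (h1.congr_deriv (by ring)).congr_of_eventuallyEq (hR2.mono fun η h => ?_)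
      simp only
      rw [h]; ring
    have e6 : deriv (fun η => pairFF G b Y d η d - pairFF G b Y d η 0 -
        d * deriv (pairFF G b Y d η) 0) 0 = -(d * k1) - 0 - d * (-(d ^ 2 * c)) :=
      ((e5.sub g3).sub (g4.const_mul d)).deriv
    have key := hC _ fun η => rfl
    rw [e6] at key
    simp only [e1, e2, e3, e4, g1, g2] at key
    have e7 : c - (k1 / d ^ 2 - S B (-d) * (k2 / (-d) ^ 2)) =
        (0 - 0 - d * (S B (-d) * (-d) * k2) - (0 - 0 - d * 0) -
          (-d) * (-(d * k1) - 0 - d * (-(d ^ 2 * c)))) / d ^ 4 := by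
      have : d ≠ 0 := hd0
      field_simp
      ring
    have hdpos : 0 < ‖d‖ := norm_pos_iff.2 hd0
    rw [e7, norm_div, norm_pow, div_le_iff₀ (by positivity)]
    refine key.trans (le_of_eq ?_)
    ring
  have l0 : Tendsto (fun d => conn G (vcons b (vcons (b - d) Y)) -
      (resFF B G Y (b, b - d) d / d ^ 2 - S B (-d) * (resFF B G Y (b - d, b) (-d) / (-d) ^ 2)))
      (𝓝[≠] 0) (𝓝 0) := by
    refine squeeze_zero_norm' hbound ?_
    have : Tendsto (fun d : ℂ => C * ‖d‖) (𝓝 0) (𝓝 0) :=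
      Continuous.tendsto' (by fun_prop) _ _ (by simp)
    exact this.mono_left nhdsWithin_le_nhds
  have := l0.add lmain
  rw [zero_add] at this
  exact this.congr fun d => by ring

end CoincidenceLimit

/-! ### Rapidities near the real line and the line `ℝ + iπ/2` -/

section Strip

/-- The rapidities within distance `b` of the real line or of the line `ℝ + iπ/2`. -/
def strip (b : ℝ) : Set ℂ := {z | |z.im| < b ∨ |z.im - π / 2| < b}

/-- The strips of width `b` are so narrow that the differences of their points stay away from the
zeros and poles of `S`. -/
structure IsNarrow (B b κ : ℝ) : Prop where
  pos : 0 < b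
  lt_pi : b < π / 8
  lt_width : b < |π / 2 - π * B|
  kpos : 0 < κ
  sin_ge : ∀ y : ℝ, (|y| < 2 * b ∨ |y - π / 2| < 2 * b ∨ |y + π / 2| < 2 * b) →
    κ ≤ |Real.sin (y + π * B)| ∧ κ ≤ |Real.sin (y - π * B)|

lemma exists_isNarrow {B a : ℝ} (hB0 : 0 < B) (hB1 : B < 1) (hB : B ≠ 1 / 2) (ha : 0 < a) :
    ∃ b κ, b ≤ a ∧ IsNarrow B b κ := by
  have hs := sin_pi_mul_pos hB0 hB1
  have hpi := Real.pi_pos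
  have hw : 0 < |π / 2 - π * B| := by
    rw [abs_pos]
    intro h
    apply hB
    have : π * (1 / 2 - B) = 0 := by linarith
    rcases mul_eq_zero.1 this with h | h
    · exact absurd h hpi.ne'
    · linarith
  have hc : 0 < |Real.cos (π * B)| := by
    rw [abs_pos, Real.cos_ne_zero_iff]
    intro k hk
    have h1 : π * (B - (2 * k + 1) / 2) = 0 := by rw [mul_sub, hk]; ring
    have h2 : B = (2 * k + 1) / 2 := by
      rcases mul_eq_zero.1 h1 with h | h
      · exact absurd h hpi.ne'
      · linarith
    have h3 : (0 : ℝ) < 2 * k + 1 := by linarith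
    have h4 : (2 * k + 1 : ℝ) < 2 := by linarith
    have h5 : (0 : ℤ) < 2 * k + 1 := by exact_mod_cast h3
    have h6 : 2 * k + 1 < (2 : ℤ) := by exact_mod_cast h4
    have h7 : k = 0 := by omega
    apply hB
    rw [h2, h7]; norm_num
  -- `S` and `φ` have poles on the lines `Im θ ≡ ±π B`; `B ≠ 1 / 2` keeps them off `Im θ = ±π / 2`
  set κ := min |Real.sin (π * B)| |Real.cos (π * B)| / 2 with hκ
  have hs' : 0 < |Real.sin (π * B)| := abs_pos.2 hs.ne'
  have hκ0 : 0 < κ := half_pos (lt_min hs' hc)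
  have hκs : κ < |Real.sin (π * B)| := by
    have := min_le_left |Real.sin (π * B)| |Real.cos (π * B)|
    linarith [half_lt_self (lt_min hs' hc)]
  have hκc : κ < |Real.cos (π * B)| := by
    have := min_le_right |Real.sin (π * B)| |Real.cos (π * B)|
    linarith [half_lt_self (lt_min hs' hc)]
  have key : ∀ y₀ : ℝ, κ < |Real.sin (y₀ + π * B)| → κ < |Real.sin (y₀ - π * B)| →
      ∃ δ > 0, ∀ y, |y - y₀| < δ → κ ≤ |Real.sin (y + π * B)| ∧
        κ ≤ |Real.sin (y - π * B)| := by
    intro y₀ h1 h2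
    have c1 : Continuous fun y : ℝ => |Real.sin (y + π * B)| := by fun_prop
    have c2 : Continuous fun y : ℝ => |Real.sin (y - π * B)| := by fun_prop
    obtain ⟨δ, hδ, h⟩ := Metric.eventually_nhds_iff.1
      (((c1.tendsto y₀).eventually (lt_mem_nhds h1)).and
        ((c2.tendsto y₀).eventually (lt_mem_nhds h2)))
    exact ⟨δ, hδ, fun y hy => ⟨(h hy).1.le, (h hy).2.le⟩⟩
  obtain ⟨δ₁, hδ₁, k1⟩ := key 0 (by simpa using hκs) (by simpa using hκs)
  obtain ⟨δ₂, hδ₂, k2⟩ := key (π / 2)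
    (by rw [add_comm, Real.sin_add_pi_div_two]; exact hκc)
    (by rw [Real.sin_pi_div_two_sub]; exact hκc)
  obtain ⟨δ₃, hδ₃, k3⟩ := key (-(π / 2))
    (by rw [neg_add_eq_sub, Real.sin_sub_pi_div_two, abs_neg]; exact hκc)
    (by rw [← neg_add', Real.sin_neg, add_comm, Real.sin_add_pi_div_two, abs_neg]; exact hκc)
  set b := min a (min (π / 16) (min (|π / 2 - π * B| / 2)
    (min (δ₁ / 2) (min (δ₂ / 2) (δ₃ / 2))))) with hb
  have b1 : b ≤ a := min_le_left _ _
  have b2 : b ≤ π / 16 := (min_le_right _ _).trans (min_le_left _ _)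
  have b3 : b ≤ |π / 2 - π * B| / 2 :=
    (min_le_right _ _).trans ((min_le_right _ _).trans (min_le_left _ _))
  have b4 : b ≤ min (δ₁ / 2) (min (δ₂ / 2) (δ₃ / 2)) :=
    (min_le_right _ _).trans ((min_le_right _ _).trans (min_le_right _ _))
  have b5 : b ≤ δ₁ / 2 := b4.trans (min_le_left _ _)
  have b6 : b ≤ δ₂ / 2 := b4.trans ((min_le_right _ _).trans (min_le_left _ _))
  have b7 : b ≤ δ₃ / 2 := b4.trans ((min_le_right _ _).trans (min_le_right _ _))
  refine ⟨b, κ, b1, by positivity, by linarith, by linarith, hκ0, fun y hy => ?_⟩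
  rcases hy with hy | hy | hy
  · exact k1 y (by rw [sub_zero]; linarith)
  · exact k2 y (by linarith)
  · exact k3 y (by rw [sub_neg_eq_add]; linarith)

lemma sinh_sq_add_sin_sq (z : ℂ) (α : ℝ) : sinh z ^ 2 + (Real.sin α : ℂ) ^ 2 =
    sinh (z + α * I) * sinh (z - α * I) := by
  rw [Complex.sinh_add, Complex.sinh_sub, Complex.cosh_mul_I, Complex.sinh_mul_I]
  have h1 := Complex.cosh_sq z
  have h2 := Complex.sin_sq_add_cos_sq (α : ℂ)
  push_cast
  have h3 := Complex.I_sq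
  linear_combination (cosh z ^ 2 * Complex.sin α ^ 2) * h3 - sinh z ^ 2 * h2 -
    Complex.sin α ^ 2 * h1

lemma abs_sin_mul_cosh_le (x α : ℝ) :
    |Real.sin α| * Real.cosh x ≤ ‖sinh (x + α * I)‖ := by
  have h : ‖sinh (x + α * I)‖ ^ 2 = Real.sinh x ^ 2 + Real.sin α ^ 2 := by
    have e : sinh (x + α * I) = ((Real.sinh x * Real.cos α : ℝ) : ℂ) +
        ((Real.cosh x * Real.sin α : ℝ) : ℂ) * I := by
      rw [Complex.sinh_add, Complex.cosh_mul_I, Complex.sinh_mul_I]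
      push_cast
      ring
    rw [e, ← Complex.normSq_eq_norm_sq, Complex.normSq_add_mul_I]
    have h1 := Real.cosh_sq x
    have h2 := Real.sin_sq_add_cos_sq α
    linear_combination Real.sinh x ^ 2 * h2 + Real.sin α ^ 2 * h1
  refine abs_le_of_sq_le_sq' ?_ (norm_nonneg _) |>.2
  rw [h, mul_pow, sq_abs, Real.cosh_sq]
  have h2 := Real.sin_sq_add_cos_sq α
  nlinarith [sq_nonneg (Real.sinh x), sq_nonneg (Real.cos α), sq_nonneg (Real.sinh x * Real.cos α)]

lemma norm_cosh_le (z : ℂ) : ‖cosh z‖ ≤ Real.cosh z.re := by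
  rw [cosh, Real.cosh_eq, norm_div]
  have h1 := norm_add_le (exp z) (exp (-z))
  rw [Complex.norm_exp, Complex.norm_exp, Complex.neg_re] at h1
  simpa using div_le_div_of_nonneg_right h1 zero_le_two

variable {B b κ : ℝ}

/-- The imaginary parts of differences of points of the strips. -/
def diffIm (b y : ℝ) : Prop := |y| < 2 * b ∨ |y - π / 2| < 2 * b ∨ |y + π / 2| < 2 * b

lemma norm_sinh_sq_add_ge (h : IsNarrow B b κ) {z : ℂ} (hz : diffIm b z.im) :
    κ ^ 2 * Real.cosh z.re ^ 2 ≤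
      ‖sinh z ^ 2 + ((Real.sin (π * B) : ℝ) : ℂ) ^ 2‖ := by
  obtain ⟨h1, h2⟩ := h.sin_ge _ hz
  have e1 : z + (π * B : ℝ) * I = z.re + (z.im + π * B : ℝ) * I := by
    conv_lhs => rw [← Complex.re_add_im z]
    push_cast; ring
  have e2 : z - (π * B : ℝ) * I = z.re + (z.im - π * B : ℝ) * I := by
    conv_lhs => rw [← Complex.re_add_im z]
    push_cast; ring
  rw [sinh_sq_add_sin_sq, norm_mul, e1, e2]
  have hc := Real.cosh_pos z.re
  calc κ ^ 2 * Real.cosh z.re ^ 2 = (κ * Real.cosh z.re) * (κ * Real.cosh z.re) := by ring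
    _ ≤ _ := mul_le_mul
      ((mul_le_mul_of_nonneg_right h1 hc.le).trans (abs_sin_mul_cosh_le _ _))
      ((mul_le_mul_of_nonneg_right h2 hc.le).trans (abs_sin_mul_cosh_le _ _))
      (mul_nonneg h.kpos.le hc.le) (norm_nonneg _)

lemma reg_of_diffIm (h : IsNarrow B b κ) {z : ℂ} (hz : diffIm b z.im) : Reg B z := by
  intro h0
  have h1 := norm_sinh_sq_add_ge h hz
  rw [h0, neg_add_cancel, norm_zero] at h1
  have := h.kpos
  have := Real.cosh_pos z.re
  have : 0 < κ ^ 2 * Real.cosh z.re ^ 2 := by positivity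
  linarith

lemma norm_phi_le (h : IsNarrow B b κ) {z : ℂ} (hz : diffIm b z.im) :
    ‖phi B z‖ ≤ 2 / (κ ^ 2 * Real.cosh z.re) := by
  have hc := Real.cosh_pos z.re
  have hk := h.kpos
  have h1 := norm_sinh_sq_add_ge h hz
  rw [phi_eq (reg_of_diffIm h hz), norm_div, norm_mul, norm_mul]
  have h2 : ‖((Real.sin (π * B) : ℝ) : ℂ)‖ ≤ 1 := by
    rw [Complex.norm_real]; exact Real.abs_sin_le_one _
  calc _ ≤ 2 * 1 * Real.cosh z.re / (κ ^ 2 * Real.cosh z.re ^ 2) := by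
        rw [Complex.norm_two]
        gcongr
        exact norm_cosh_le z
    _ = _ := by field_simp

lemma diffIm_sub {z w : ℂ} (hz : z ∈ strip b) (hw : w ∈ strip b) : diffIm b (z - w).im := by
  rw [Complex.sub_im]
  simp only [strip, Set.mem_ofPred_eq, abs_lt] at hz hw
  simp only [diffIm, abs_lt]
  rcases hz with ⟨h1, h2⟩ | ⟨h1, h2⟩ <;> rcases hw with ⟨h3, h4⟩ | ⟨h3, h4⟩
  · exact Or.inl ⟨by linarith, by linarith⟩
  · exact Or.inr (Or.inr ⟨by linarith, by linarith⟩)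
  · exact Or.inr (Or.inl ⟨by linarith, by linarith⟩)
  · exact Or.inl ⟨by linarith, by linarith⟩

lemma eq_zero_of_sinh_eq_zero (h : IsNarrow B b κ) {z : ℂ} (hz : diffIm b z.im)
    (h0 : sinh z = 0) : z = 0 := by
  have h1 : Complex.sin (z * I) = 0 := by rw [Complex.sin_mul_I, h0, zero_mul]
  obtain ⟨k, hk⟩ := Complex.sin_eq_zero_iff.1 h1
  have hre : z.re = 0 := by
    have := congr_arg Complex.im hk
    simpa using this
  have him : -z.im = k * π := by
    have := congr_arg Complex.re hk
    simpa using this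
  have hpi := Real.pi_pos
  have hb := h.lt_pi
  have hlt : |z.im| < π := by
    rw [abs_lt]
    simp only [diffIm, abs_lt] at hz
    rcases hz with ⟨h1, h2⟩ | ⟨h1, h2⟩ | ⟨h1, h2⟩ <;> constructor <;> linarith
  rw [← abs_neg, him, abs_mul, abs_of_pos hpi] at hlt
  have hk1 : |(k : ℝ)| < 1 := by
    by_contra hcon
    push Not at hcon
    nlinarith
  have hk0 : k = 0 := by
    have : |k| < 1 := by exact_mod_cast hk1
    exact Int.abs_lt_one_iff.1 this
  refine Complex.ext hre ?_
  rw [hk0] at him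
  simpa using him

lemma gen_of_ne (h : IsNarrow B b κ) {z w : ℂ} (hz : z ∈ strip b) (hw : w ∈ strip b)
    (hne : z ≠ w) : Gen B (z - w) :=
  ⟨fun h0 => hne (sub_eq_zero.1 (eq_zero_of_sinh_eq_zero h (diffIm_sub hz hw) h0)),
    reg_of_diffIm h (diffIm_sub hz hw)⟩

lemma isOpen_strip : IsOpen (strip b) :=
  (isOpen_lt (Complex.continuous_im.abs) continuous_const).union
    (isOpen_lt ((Complex.continuous_im.sub continuous_const).abs) continuous_const)

lemma ofReal_mem_strip (h : 0 < b) (x : ℝ) : (x : ℂ) ∈ strip b := Or.inl (by simpa using h)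

lemma shifted_im (x : ℝ) : (shifted x).im = π / 2 := by simp [shifted]

lemma shifted_mem_strip (h : 0 < b) (x : ℝ) : shifted x ∈ strip b :=
  Or.inr (by rw [shifted_im, sub_self, abs_zero]; exact h)

/-- Tuples of rapidities in the strips. -/
def stripPi (b : ℝ) (n : ℕ) : Set (Vec n) := {θ | ∀ j, θ j ∈ strip b}

lemma isOpen_stripPi {n : ℕ} : IsOpen (stripPi b n) := by
  have : stripPi b n = Set.univ.pi fun _ => strip b := by ext; simp [stripPi]
  rw [this]
  exact isOpen_set_pi Set.finite_univ fun _ _ => isOpen_strip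

lemma generic_of_mem (h : IsNarrow B b κ) {n : ℕ} {θ : Vec n} (hθ : θ ∈ stripPi b n)
    (hne : ∀ i j, i ≠ j → θ i ≠ θ j) : Generic B θ := fun i j hij =>
  gen_of_ne h (hθ i) (hθ j) (hne i j hij)

lemma dense_injective (n : ℕ) : Dense {θ : Vec n | ∀ i j, i ≠ j → θ i ≠ θ j} := by
  have h := dense_forall_ne_zero (P := Vec n) (ι := {p : Fin n × Fin n // p.1 ≠ p.2})
    (ℓ := fun p => (ContinuousLinearMap.proj p.1.1 : (Vec n) →L[ℂ] ℂ) -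
      (ContinuousLinearMap.proj p.1.2 : (Vec n) →L[ℂ] ℂ)) fun p h0 => by
    have := congr_arg (fun f => f (Pi.single p.1.1 1)) h0
    simp [p.2.symm] at this
  refine h.mono ?_
  intro θ hθ i j hij h0
  refine (hθ : ∀ k : {p : Fin n × Fin n // p.1 ≠ p.2}, _) ⟨(i, j), hij⟩ ?_
  simp [h0]

end Strip

/-! ### Continuation of the connected form factors to coinciding rapidities -/

section Removable

variable {g : ℂ → ℂ}

lemma limUnder_eq_of_continuousAt {t : ℂ} (h : ContinuousAt g t) : limUnder (𝓝[≠] t) g = g t :=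
  (h.tendsto.mono_left nhdsWithin_le_nhds).limUnder_eq

/-- Removable singularities, for all of the isolated singularities at once. -/
lemma differentiableAt_limUnder {t : ℂ} {M : ℝ}
    (h : ∀ᶠ z in 𝓝[≠] t, DifferentiableAt ℂ g z ∧ ‖g z‖ ≤ M) :
    DifferentiableAt ℂ (fun z => limUnder (𝓝[≠] z) g) t := by
  have hs := eventually_nhdsWithin_iff.1 h
  set s := {z | z ∈ ({t}ᶜ : Set ℂ) → DifferentiableAt ℂ g z ∧ ‖g z‖ ≤ M} with hsdef
  have hsn : s ∈ 𝓝 t := hs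
  have h1 := Complex.differentiableOn_update_limUnder_of_bddAbove hsn
    (fun z hz => (hz.1 hz.2).1.differentiableWithinAt)
    ⟨M, by rintro _ ⟨z, hz, rfl⟩; exact (hz.1 hz.2).2⟩
  refine (h1.differentiableAt hsn).congr_of_eventuallyEq ?_
  filter_upwards [hs] with z hz
  rcases eq_or_ne z t with rfl | hne
  · simp
  · rw [Function.update_of_ne hne]
    exact limUnder_eq_of_continuousAt (hz hne).1.continuousAt

/-- The mean value property for bounded functions with isolated singularities. -/
lemma circleIntegral_eq_of_bounded {r M : ℝ} (hr : 0 < r)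
    (h : ∀ t ∈ closedBall (0 : ℂ) r, ∀ᶠ z in 𝓝[≠] t, DifferentiableAt ℂ g z ∧ ‖g z‖ ≤ M)
    (hs : ∀ t ∈ sphere (0 : ℂ) r, ContinuousAt g t) (h0 : ContinuousAt g 0) :
    (2 * π * I : ℂ)⁻¹ • (∮ z in C(0, r), (z - 0)⁻¹ • g z) = g 0 := by
  have hd := fun t ht => differentiableAt_limUnder (h t ht)
  have := Complex.two_pi_I_inv_smul_circleIntegral_sub_inv_smul_of_differentiable_on_off_countable
    (s := ∅) (f := fun z => limUnder (𝓝[≠] z) g) Set.countable_empty (Metric.mem_ball_self hr)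
    (fun t ht => (hd t ht).continuousAt.continuousWithinAt)
    (fun t ht => hd t (Metric.ball_subset_closedBall ht.1))
  rw [limUnder_eq_of_continuousAt h0] at this
  rw [← this]
  congr 1
  refine circleIntegral.integral_congr hr.le fun z hz => ?_
  simp only [limUnder_eq_of_continuousAt (hs z hz)]

end Removable

section Continuation

variable {B b κ : ℝ} {F G : (n : ℕ) → Vec n → ℂ} {n : ℕ}

/-- The points at which `connectedFF` is defined without a limit. -/
abbrev offDiag (n : ℕ) : Set (Vec n) := {θ | ∀ i j, i ≠ j → sinh (θ i - θ j) ≠ 0}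

lemma generic_of_offDiag (hN : IsNarrow B b κ) {θ : Vec n} (hθ : θ ∈ stripPi b n)
    (h : θ ∈ offDiag n) : Generic B θ :=
  generic_of_mem hN hθ fun i j hij h0 =>
    (h : ∀ i j, i ≠ j → sinh (θ i - θ j) ≠ 0) i j hij (by rw [h0]; simp)

lemma Generic.offDiag {θ : Vec n} (h : Generic B θ) : θ ∈ offDiag n := fun i j hij =>
  (h i j hij).1

lemma eventually_generic {θ : Vec n} (h : Generic B θ) : ∀ᶠ x in 𝓝 θ, Generic B x := by
  refine eventually_all.2 fun i => eventually_all.2 fun j => eventually_imp_distrib_left.2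
    fun hij => ?_
  have hc : Continuous fun x : Vec n => x i - x j := by fun_prop
  exact (hc.tendsto θ).eventually (isOpen_gen.mem_nhds (h i j hij))

lemma connectedFF_eq_conn (hB0 : 0 < B) (hB1 : B < 1) (hG : Regularizes B F G) {θ : Vec n}
    (hθ : Generic B θ) : connectedFF F n θ = conn G θ := by
  have h1 : finitePart F n =ᶠ[𝓝 θ] fun θ => conn G θ :=
    (eventually_generic hθ).mono fun x hx => finitePart_eq hB0 hB1 hG hx
  have h2 : Tendsto (finitePart F n) (𝓝 θ) (𝓝 (conn G θ)) :=
    (analyticAt_conn hB0 hB1 hG hθ).continuousAt.tendsto.congr' h1.symm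
  have : (𝓝[offDiag n] θ).NeBot := mem_closure_iff_nhdsWithin_neBot.1 (subset_closure hθ.offDiag)
  exact (h2.mono_left nhdsWithin_le_nhds).limUnder_eq

lemma subset_closure_offDiag (hN : IsNarrow B b κ) : stripPi b n ⊆ closure (offDiag n) := by
  intro θ hθ
  rw [mem_closure_iff_nhds]
  intro U hU
  obtain ⟨x, hx, hxd⟩ := mem_closure_iff_nhds.1 (dense_injective n θ) _
    (Filter.inter_mem hU (isOpen_stripPi.mem_nhds hθ))
  exact ⟨x, hx.1, (generic_of_mem hN hx.2 hxd).offDiag⟩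

/-- Connected form factors are given by their mean value over a circle of tuples of distinct
rapidities, and hence have limits at coinciding rapidities. -/
lemma exists_tendsto_finitePart (hB0 : 0 < B) (hB1 : B < 1) (hG : Regularizes B F G)
    (hN : IsNarrow B b κ) {M : ℝ}
    (hM : ∀ θ ∈ stripPi b n, Generic B θ → ‖conn G θ‖ ≤ M) {θ₀ : Vec n}
    (hθ₀ : θ₀ ∈ stripPi b n) : ∃ y, Tendsto (finitePart F n) (𝓝[offDiag n] θ₀) (𝓝 y) := by
  -- a direction in which all differences of rapidities change
  set v : Vec n := fun i => (i : ℕ) with hv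
  have hvne : ∀ i j, i ≠ j → v i - v j ≠ 0 := fun i j hij h => by
    rw [sub_eq_zero] at h
    exact hij (Fin.ext (by simpa [hv] using h))
  have hcont : Continuous fun p : Vec n × ℂ => p.1 + p.2 • v := by fun_prop
  -- a radius for which the circle around `θ₀` avoids coinciding rapidities
  obtain ⟨r, hr, hr1, hr2⟩ : ∃ r : ℝ, 0 < r ∧
      (∀ t ∈ closedBall (0 : ℂ) r, θ₀ + t • v ∈ stripPi b n) ∧
      ∀ i j, i ≠ j → ‖θ₀ i - θ₀ j‖ ≠ r * ‖v i - v j‖ := by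
    have hc : Continuous fun t : ℂ => θ₀ + t • v := by fun_prop
    have h1 : ∀ᶠ t in 𝓝 (0 : ℂ), θ₀ + t • v ∈ stripPi b n :=
      hc.continuousAt.eventually (isOpen_stripPi.mem_nhds (by simpa using hθ₀))
    obtain ⟨ρ, hρ, h1⟩ := Metric.eventually_nhds_iff_ball.1 h1
    have h2 : ∀ᶠ r in 𝓝[>] (0 : ℝ), ∀ i j, i ≠ j → ‖θ₀ i - θ₀ j‖ ≠ r * ‖v i - v j‖ := by
      refine eventually_all.2 fun i => eventually_all.2 fun j => eventually_imp_distrib_left.2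
        fun hij => ?_
      have hpos : 0 < ‖v i - v j‖ := norm_pos_iff.2 (hvne i j hij)
      rcases eq_or_ne (θ₀ i) (θ₀ j) with h | h
      · filter_upwards [self_mem_nhdsWithin] with r hr
        rw [h, sub_self, norm_zero]
        exact (mul_pos hr hpos).ne
      · have hc : Continuous fun r : ℝ => r * ‖v i - v j‖ := by fun_prop
        refine nhdsWithin_le_nhds ((hc.tendsto 0).eventually_ne ?_ |>.mono fun _ h => h.symm)
        rw [zero_mul]
        exact (norm_pos_iff.2 (sub_ne_zero.2 h)).ne
    have h3 : ∀ᶠ r in 𝓝[>] (0 : ℝ), r < ρ := nhdsWithin_le_nhds (gt_mem_nhds hρ)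
    obtain ⟨r, ⟨h2, h3⟩, hr⟩ := ((h2.and h3).and self_mem_nhdsWithin).exists
    exact ⟨r, hr, fun t ht => h1 t (Metric.closedBall_subset_ball h3 ht), h2⟩
  have hgen₀ : ∀ t ∈ sphere (0 : ℂ) r, Generic B (θ₀ + t • v) := fun t ht => by
    refine generic_of_mem hN (hr1 t (Metric.sphere_subset_closedBall ht)) fun i j hij h => ?_
    apply hr2 i j hij
    have e : θ₀ i - θ₀ j = -(t * (v i - v j)) := by
      simp only [Pi.add_apply, Pi.smul_apply, smul_eq_mul] at h
      linear_combination h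
    rw [e, norm_neg, norm_mul, mem_sphere_zero_iff_norm.1 ht]
  have hev1 : ∀ᶠ θ in 𝓝 θ₀, ∀ t ∈ closedBall (0 : ℂ) r, θ + t • v ∈ stripPi b n :=
    (isCompact_closedBall _ _).eventually_forall_of_forall_eventually fun t ht =>
      (hcont.tendsto (θ₀, t)).eventually (isOpen_stripPi.mem_nhds (hr1 t ht))
  have hev2 : ∀ᶠ θ in 𝓝 θ₀, ∀ t ∈ sphere (0 : ℂ) r, Generic B (θ + t • v) :=
    (isCompact_sphere _ _).eventually_forall_of_forall_eventually fun t ht =>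
      (hcont.tendsto (θ₀, t)).eventually (eventually_generic (hgen₀ t ht))
  have hline : ∀ (θ : Vec n) t, Generic B (θ + t • v) →
      DifferentiableAt ℂ (fun t : ℂ => conn G (θ + t • v)) t := fun θ t h =>
    DifferentiableAt.comp (g := fun θ : Vec n => conn G θ) (f := fun t : ℂ => θ + t • v) t
      (analyticAt_conn hB0 hB1 hG h).differentiableAt (by fun_prop)
  -- the circle mean
  set m : Vec n → ℂ := fun θ => (2 * π * I : ℂ)⁻¹ •
    (∮ z in C(0, r), (z - 0)⁻¹ • conn G (θ + z • v)) with hm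
  have hmean : ∀ᶠ θ in 𝓝[offDiag n] θ₀, m θ = finitePart F n θ := by
    filter_upwards [nhdsWithin_le_nhds hev1, nhdsWithin_le_nhds hev2, self_mem_nhdsWithin]
      with θ h1 h2 hθ
    have hθs : θ ∈ stripPi b n := by
      have := h1 0 (Metric.mem_closedBall_self hr.le)
      rwa [zero_smul, add_zero] at this
    have hg := generic_of_offDiag hN hθs hθ
    rw [finitePart_eq hB0 hB1 hG hg, hm]
    refine Eq.trans (circleIntegral_eq_of_bounded (g := fun z => conn G (θ + z • v)) (M := M) hr
      ?_ (fun t ht => (hline θ t (h2 t ht)).continuousAt) (hline θ 0 ?_).continuousAt) ?_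
    · intro t ht
      have hd : ∀ᶠ z in 𝓝[≠] t, ∀ i j, i ≠ j → (θ + z • v) i ≠ (θ + z • v) j := by
        refine eventually_all.2 fun i => eventually_all.2 fun j => eventually_imp_distrib_left.2
          fun hij => ?_
        have : ∀ᶠ z in 𝓝[≠] t, z ≠ -(θ i - θ j) / (v i - v j) :=
          nhdsNE_le_cofinite t (Set.finite_singleton _).eventually_cofinite_notMem
        filter_upwards [this] with z hz h
        apply hz
        rw [eq_div_iff (hvne i j hij)]
        simp only [Pi.add_apply, Pi.smul_apply, smul_eq_mul] at h
        linear_combination h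
      have hs : ∀ᶠ z in 𝓝 t, θ + z • v ∈ stripPi b n :=
        (Continuous.tendsto (by fun_prop : Continuous fun z : ℂ => θ + z • v) t).eventually
          (isOpen_stripPi.mem_nhds (h1 t ht))
      filter_upwards [hd, nhdsWithin_le_nhds hs] with z hz hs
      have hzg := generic_of_mem hN hs hz
      exact ⟨hline θ z hzg, hM _ hs hzg⟩
    · rwa [zero_smul, add_zero]
    · simp
  refine ⟨m θ₀, Tendsto.congr' hmean (Tendsto.mono_left ?_ nhdsWithin_le_nhds)⟩
  refine Tendsto.const_smul ?_ _
  have hmem : ∀ x : ℝ, circleMap 0 r x ∈ sphere (0 : ℂ) r := fun x =>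
    circleMap_mem_sphere 0 hr.le x
  have hcd : Continuous (deriv (circleMap 0 r)) := by
    have : deriv (circleMap 0 r) = fun x => circleMap 0 r x * I :=
      funext fun x => deriv_circleMap 0 r x
    rw [this]; fun_prop
  refine intervalIntegral.continuousAt_of_dominated_interval
    (bound := fun x => ‖deriv (circleMap 0 r) x‖ * (‖(circleMap 0 r x - 0)⁻¹‖ * M))
    ?_ ?_ ?_ ?_
  · filter_upwards [hev2] with θ h2
    refine Continuous.aestronglyMeasurable ?_
    refine Continuous.fun_smul hcd (Continuous.fun_smul ?_ ?_)
    · refine Continuous.inv₀ (by fun_prop) fun x => ?_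
      rw [sub_zero]
      exact ne_of_mem_of_not_mem (hmem x) (by simp [hr.ne])
    · exact continuous_iff_continuousAt.2 fun x =>
        ContinuousAt.comp (g := fun t : ℂ => conn G (θ + t • v)) (f := circleMap 0 r)
          (hline θ _ (h2 _ (hmem x))).continuousAt (continuous_circleMap 0 r).continuousAt
  · filter_upwards [hev1, hev2] with θ h1 h2
    refine Eventually.of_forall fun x _ => ?_
    rw [norm_smul, norm_smul]
    have := hM _ (h1 _ (Metric.sphere_subset_closedBall (hmem x))) (h2 _ (hmem x))
    gcongr
  · refine Continuous.intervalIntegrable ?_ _ _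
    refine Continuous.mul hcd.norm (Continuous.mul ?_
      continuous_const)
    refine (Continuous.inv₀ (by fun_prop) fun x => ?_).norm
    rw [sub_zero]
    exact ne_of_mem_of_not_mem (hmem x) (by simp [hr.ne])
  · refine Eventually.of_forall fun x _ => ?_
    refine ContinuousAt.fun_smul continuousAt_const (ContinuousAt.fun_smul continuousAt_const ?_)
    exact ContinuousAt.comp (g := fun θ : Vec n => conn G θ)
      (f := fun θ : Vec n => θ + circleMap 0 r x • v)
      (analyticAt_conn hB0 hB1 hG (hgen₀ _ (hmem x))).continuousAt (by fun_prop)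

/-- The hypotheses under which the connected form factors continue to the strips. -/
structure IsBoundedFF (B b κ : ℝ) (F G : (n : ℕ) → Vec n → ℂ) : Prop where
  pos : 0 < B
  lt_one : B < 1
  family : IsFormFactorFamily B F
  regularizes : Regularizes B F G
  narrow : IsNarrow B b κ
  bounded : ∀ n, ∃ M, ∀ θ ∈ stripPi b n, Generic B θ → ‖conn G θ‖ ≤ M

variable (H : IsBoundedFF B b κ F G)

include H

lemma IsBoundedFF.eq_conn {θ : Vec n} (hθ : Generic B θ) : connectedFF F n θ = conn G θ :=
  connectedFF_eq_conn H.pos H.lt_one H.regularizes hθ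

lemma IsBoundedFF.continuousOn (n : ℕ) : ContinuousOn (connectedFF F n) (stripPi b n) := by
  obtain ⟨M, hM⟩ := H.bounded n
  exact continuousOn_extendFrom (subset_closure_offDiag H.narrow) fun θ hθ =>
    exists_tendsto_finitePart H.pos H.lt_one H.regularizes H.narrow hM hθ

lemma IsBoundedFF.continuousAt {θ : Vec n} (hθ : θ ∈ stripPi b n) :
    ContinuousAt (connectedFF F n) θ :=
  (H.continuousOn n).continuousAt (isOpen_stripPi.mem_nhds hθ)

omit H in
/-- Continuous functions on the strips that agree at distinct rapidities are equal. -/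
lemma eq_of_eq_generic {f g : Vec n → ℂ} (hf : ContinuousOn f (stripPi b n))
    (hg : ContinuousOn g (stripPi b n))
    (h : ∀ θ ∈ stripPi b n, (∀ i j, i ≠ j → θ i ≠ θ j) → f θ = g θ) {θ : Vec n}
    (hθ : θ ∈ stripPi b n) : f θ = g θ := by
  have hn := isOpen_stripPi.mem_nhds hθ
  refine tendsto_nhds_unique_of_frequently_eq (hf.continuousAt hn).tendsto
    (hg.continuousAt hn).tendsto ?_
  refine ((mem_closure_iff_frequently.1 (dense_injective n θ)).and_eventually
    (Filter.eventually_mem_set.2 hn)).mono ?_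
  rintro x ⟨h1, h2⟩
  exact h x h2 h1

omit H in
lemma comp_mem_stripPi {m : ℕ} {θ : Vec n} (hθ : θ ∈ stripPi b n) (σ : Fin m → Fin n) :
    θ ∘ σ ∈ stripPi b m := fun j => hθ (σ j)

/-- The connected form factors are symmetric. -/
lemma IsBoundedFF.comp_perm (σ : Equiv.Perm (Fin n)) {θ : Vec n} (hθ : θ ∈ stripPi b n) :
    connectedFF F n (θ ∘ σ) = connectedFF F n θ := by
  rcases n with _ | n
  · congr 1; ext i; exact i.elim0
  have hadj : ∀ (i : Fin n) {θ : Vec (n + 1)} (_ : θ ∈ stripPi b (n + 1)),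
      connectedFF F (n + 1) (θ ∘ Equiv.swap i.castSucc i.succ) = connectedFF F (n + 1) θ := by
    intro i θ hθ
    refine eq_of_eq_generic (b := b)
      (f := fun θ => connectedFF F (n + 1) (θ ∘ Equiv.swap i.castSucc i.succ))
      (ContinuousOn.comp (g := connectedFF F (n + 1))
        (f := fun θ : Vec (n + 1) => θ ∘ Equiv.swap i.castSucc i.succ) (H.continuousOn _)
        (Continuous.continuousOn (by fun_prop)) fun θ hθ => comp_mem_stripPi hθ _)
      (H.continuousOn _) (fun θ hθ hne => ?_) hθ
    have hg := generic_of_mem H.narrow hθ hne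
    have hs := hg.comp_perm (Equiv.swap i.castSucc i.succ)
    rw [H.eq_conn hg, H.eq_conn hs, ← finitePart_eq H.pos H.lt_one H.regularizes hg,
      ← finitePart_eq H.pos H.lt_one H.regularizes hs]
    exact finitePart_swap H.pos H.lt_one H.family H.regularizes hg (by simp)
  have hσ : σ ∈ Submonoid.closure
      (Set.range fun i : Fin n => Equiv.swap i.castSucc i.succ) := by
    rw [Equiv.Perm.mclosure_swap_castSucc_succ]; exact Submonoid.mem_top _
  induction hσ using Submonoid.closure_induction generalizing θ with
  | mem x hx => obtain ⟨i, rfl⟩ := hx; exact hadj i hθ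
  | one => rfl
  | mul x y _ _ hx hy =>
    rw [Equiv.Perm.coe_mul, ← Function.comp_assoc]
    rw [hy (comp_mem_stripPi hθ x), hx hθ]

omit H in
lemma update_mem_stripPi {θ : Vec n} (hθ : θ ∈ stripPi b n) (i : Fin n) {z : ℂ}
    (hz : z ∈ strip b) : Function.update θ i z ∈ stripPi b n := fun j => by
  rcases eq_or_ne j i with rfl | h
  · rwa [Function.update_self]
  · rw [Function.update_of_ne h]; exact hθ j

/-- The connected form factors are holomorphic in each rapidity. -/
lemma IsBoundedFF.differentiableOn {θ : Vec n} (hθ : θ ∈ stripPi b n) (i : Fin n) :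
    DifferentiableOn ℂ (fun z => connectedFF F n (Function.update θ i z)) (strip b) := by
  have hup : Continuous fun p : Vec n × ℂ => Function.update p.1 i p.2 := by fun_prop
  have hdist : ∀ θ ∈ stripPi b n, (∀ i j, i ≠ j → θ i ≠ θ j) →
      DifferentiableOn ℂ (fun z => connectedFF F n (Function.update θ i z)) (strip b) := by
    intro θ hθ hne z₀ hz₀
    refine (Complex.analyticAt_of_differentiable_on_punctured_nhds_of_continuousAt ?_
      ?_).differentiableAt.differentiableWithinAt
    · have h1 : ∀ᶠ z in 𝓝[≠] z₀, ∀ j, z ≠ θ j := eventually_all.2 fun j =>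
        nhdsNE_le_cofinite z₀ (Set.finite_singleton _).eventually_cofinite_notMem
      filter_upwards [h1, nhdsWithin_le_nhds (isOpen_strip.mem_nhds hz₀)] with z hz hzs
      have hg : Generic B (Function.update θ i z) := by
        refine generic_of_mem H.narrow (update_mem_stripPi hθ i hzs) fun j k hjk => ?_
        rcases eq_or_ne j i with rfl | hj
        · rw [Function.update_self, Function.update_of_ne hjk.symm]; exact hz k
        rcases eq_or_ne k i with rfl | hk
        · rw [Function.update_self, Function.update_of_ne hj]; exact (hz j).symm
        rw [Function.update_of_ne hj, Function.update_of_ne hk]; exact hne j k hjk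
      have hd : DifferentiableAt ℂ (connectedFF F n) (Function.update θ i z) :=
        (analyticAt_conn H.pos H.lt_one H.regularizes hg).differentiableAt.congr_of_eventuallyEq
          ((eventually_generic hg).mono fun x hx => H.eq_conn hx)
      exact DifferentiableAt.comp (g := connectedFF F n) (f := fun z => Function.update θ i z) z hd
        (hasFDerivAt_update θ z).differentiableAt
    · exact ContinuousAt.comp (g := connectedFF F n) (f := fun z => Function.update θ i z)
        (H.continuousAt (update_mem_stripPi hθ i hz₀))
        (Continuous.continuousAt (by fun_prop))
  have hne : (𝓝[{θ : Vec n | ∀ i j, i ≠ j → θ i ≠ θ j}] θ).NeBot :=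
    mem_closure_iff_nhdsWithin_neBot.1 (dense_injective n θ)
  -- a locally uniform limit of the functions for distinct rapidities
  refine TendstoLocallyUniformlyOn.differentiableOn (φ := 𝓝[{θ : Vec n |
    ∀ i j, i ≠ j → θ i ≠ θ j}] θ) (F := fun θ z => connectedFF F n (Function.update θ i z))
    ?_ ?_ isOpen_strip
  · rw [Metric.tendstoLocallyUniformlyOn_iff]
    intro ε hε z hz
    have hc : ContinuousAt (fun p : Vec n × ℂ => connectedFF F n (Function.update p.1 i p.2))
        (θ, z) := ContinuousAt.comp (g := connectedFF F n)
      (f := fun p : Vec n × ℂ => Function.update p.1 i p.2)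
      (H.continuousAt (update_mem_stripPi hθ i hz)) hup.continuousAt
    have h1 := Metric.tendsto_nhds.1 hc.tendsto (ε / 2) (half_pos hε)
    rw [nhds_prod_eq] at h1
    obtain ⟨p1, hp1, p2, hp2, h12⟩ := Filter.eventually_prod_iff.1 h1
    refine ⟨{y | p2 y}, nhdsWithin_le_nhds hp2, nhdsWithin_le_nhds ?_⟩
    filter_upwards [hp1] with θ' hθ' y hy
    have a1 := h12 hθ' hy
    have a2 := h12 hp1.self_of_nhds hy
    rw [dist_comm] at a1
    linarith [dist_triangle_right (connectedFF F n (Function.update θ i y))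
      (connectedFF F n (Function.update θ' i y)) (connectedFF F n (Function.update θ i z)),
      dist_comm (connectedFF F n (Function.update θ i z))
      (connectedFF F n (Function.update θ' i y))]
  · filter_upwards [self_mem_nhdsWithin, nhdsWithin_le_nhds (isOpen_stripPi.mem_nhds hθ)]
      with θ' h1 h2
    exact hdist θ' h2 h1

omit H in
lemma vcons_mem_stripPi {x : ℂ} {Y : Vec n} (hx : x ∈ strip b) (hY : Y ∈ stripPi b n) :
    vcons x Y ∈ stripPi b (n + 1) := fun j => by
  refine Fin.cases ?_ (fun j => ?_) j
  · exact hx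
  · exact hY j

lemma IsBoundedFF.continuousOn_chainFF (n : ℕ) :
    ContinuousOn (fun p : ℂ × ℂ × Vec n => chainFF B (connectedFF F) n p.1 p.2.1 p.2.2)
      {p | p.1 ∈ strip b ∧ p.2.1 ∈ strip b ∧ p.2.2 ∈ stripPi b n} := by
  have hphi : ∀ z ∈ strip b, ∀ w ∈ strip b, ContinuousAt (phi B) (z - w) := fun z hz w hw =>
    (analyticAt_phi (reg_of_diffIm H.narrow (diffIm_sub hz hw))).continuousAt
  have hfirst : ∀ m, ContinuousOn (fun p : ℂ × ℂ × Vec m =>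
      phi B (p.1 - p.2.1) * connectedFF F (m + 1) (vcons p.2.1 p.2.2))
      {p | p.1 ∈ strip b ∧ p.2.1 ∈ strip b ∧ p.2.2 ∈ stripPi b m} := by
    rintro m ⟨τ, β, Y⟩ ⟨h1, h2, h3⟩
    refine (ContinuousAt.mul ?_ ?_).continuousWithinAt
    · exact ContinuousAt.comp (g := phi B) (f := fun p : ℂ × ℂ × Vec m => p.1 - p.2.1)
        (hphi _ h1 _ h2) (by fun_prop)
    · exact ContinuousAt.comp (g := connectedFF F (m + 1))
        (f := fun p : ℂ × ℂ × Vec m => vcons p.2.1 p.2.2)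
        (H.continuousAt (vcons_mem_stripPi h2 h3))
        (Continuous.continuousAt (by fun_prop))
  induction n with
  | zero => exact hfirst 0
  | succ n ih =>
    refine (hfirst (n + 1)).add (continuousOn_finsetSum _ fun k _ => ContinuousOn.mul ?_ ?_)
    · rintro ⟨τ, β, Y⟩ ⟨h1, h2, h3⟩
      exact (ContinuousAt.comp (g := phi B)
        (f := fun p : ℂ × ℂ × Vec (n + 1) => p.1 - p.2.2 k)
        (hphi _ h1 _ (h3 k)) (by fun_prop)).continuousWithinAt
    · refine ContinuousOn.comp (f := fun p : ℂ × ℂ × Vec (n + 1) =>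
        (p.2.2 k, p.2.1, del k p.2.2)) ih (Continuous.continuousOn (by fun_prop)) ?_
      rintro ⟨τ, β, Y⟩ ⟨h1, h2, h3⟩
      exact ⟨h3 k, h2, fun j => h3 _⟩

lemma IsBoundedFF.chainFF_eq {τ β : ℂ} {Y : Vec n} (h : Generic B (vcons β Y)) :
    chainFF B (connectedFF F) n τ β Y = chainFF B (fun _ => conn G) n τ β Y := by
  induction n generalizing τ with
  | zero => simp only [chainFF]; rw [H.eq_conn h]
  | succ n ih =>
    simp only [chainFF]
    rw [H.eq_conn h]
    congr 1
    refine Finset.sum_congr rfl fun k _ => ?_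
    rw [ih]
    rw [← vcons_comp_succAbove]
    exact h.succAbove _

/-- The connected form factors at coinciding rapidities. -/
theorem IsBoundedFF.coincidence {β : ℂ} {Y : Vec n} (hβ : β ∈ strip b)
    (hY : Y ∈ stripPi b n) :
    connectedFF F (n + 2) (vcons β (vcons β Y)) = 2 * chainFF B (connectedFF F) n β β Y := by
  have key : ∀ X ∈ stripPi b (n + 1), connectedFF F (n + 2) (vcons (X 0) X) =
      2 * chainFF B (connectedFF F) n (X 0) (X 0) (Fin.tail X) := by
    intro X hX
    refine eq_of_eq_generic (b := b) (f := fun X => connectedFF F (n + 2) (vcons (X 0) X))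
      (g := fun X => 2 * chainFF B (connectedFF F) n (X 0) (X 0) (Fin.tail X)) ?_ ?_ ?_ hX
    · refine ContinuousOn.comp (g := connectedFF F (n + 2))
        (f := fun X : Vec (n + 1) => (vcons (X 0) X : Vec (n + 2))) (H.continuousOn _)
        (Continuous.continuousOn (by fun_prop)) fun X hX => vcons_mem_stripPi (hX 0) hX
    · refine continuousOn_const.mul (ContinuousOn.comp (f := fun X : Vec (n + 1) =>
        (X 0, X 0, Fin.tail X)) (H.continuousOn_chainFF n) (by unfold Fin.tail; fun_prop)
        fun X hX => ⟨hX 0, hX 0, fun j => hX j.succ⟩)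
    · intro X hX hne
      have hg : Generic B (vcons (X 0) (Fin.tail X)) := by
        have : vcons (X 0) (Fin.tail X) = X := Fin.cons_self_tail X
        rw [this]
        exact generic_of_mem H.narrow hX hne
      have h1 := tendsto_conn_pair H.pos H.lt_one H.family H.regularizes hg
      rw [← H.chainFF_eq hg] at h1
      have hc : Continuous fun d : ℂ => (vcons (X 0) (vcons (X 0 - d) (Fin.tail X)) :
          Vec (n + 2)) := by unfold Fin.tail; fun_prop
      have hX' : vcons (X 0) (Fin.tail X) = X := Fin.cons_self_tail X
      have h2 : Tendsto (fun d => connectedFF F (n + 2)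
          (vcons (X 0) (vcons (X 0 - d) (Fin.tail X)))) (𝓝[≠] 0)
          (𝓝 (connectedFF F (n + 2) (vcons (X 0) X))) := by
        have h3 := (hc.tendsto 0)
        rw [sub_zero, hX'] at h3
        exact ((H.continuousAt (vcons_mem_stripPi (hX 0) hX)).tendsto.comp h3).mono_left
          nhdsWithin_le_nhds
      refine tendsto_nhds_unique h2 (h1.congr' ?_)
      filter_upwards [eventually_generic_pair H.pos H.lt_one hg] with d hd
      rw [H.eq_conn hd]
  exact key (vcons β Y) (vcons_mem_stripPi hβ hY)

end Continuation

/-! ### The TBA equation on the real line -/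

/-- Differentiation of a dominated integral of holomorphic functions; the derivatives are dominated
by Cauchy's estimate. -/
theorem hasDerivAt_integral_of_holomorphic {α : Type*} [MeasurableSpace α] {μ : Measure α}
    {U : Set ℂ} (hU : IsOpen U) {f : ℂ → α → ℂ} {bound : α → ℝ}
    (hm : ∀ z ∈ U, AEStronglyMeasurable (f z) μ)
    (hd : ∀ a, DifferentiableOn ℂ (fun z => f z a) U)
    (hb : ∀ z ∈ U, ∀ a, ‖f z a‖ ≤ bound a) (hi : Integrable bound μ) {z : ℂ} (hz : z ∈ U) :
    Integrable (fun a => deriv (fun z => f z a) z) μ ∧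
      HasDerivAt (fun z => ∫ a, f z a ∂μ) (∫ a, deriv (fun z => f z a) z ∂μ) z := by
  obtain ⟨R, hR, hRU⟩ := Metric.isOpen_iff.1 hU z hz
  have hR2 : 0 < R / 2 := by linarith
  have hsub : ∀ y ∈ ball z (R / 2), closedBall y (R / 2) ⊆ U := by
    intro y hy
    refine (Metric.closedBall_subset_ball' (ε₂ := R) ?_).trans hRU
    have := Metric.mem_ball.1 hy
    linarith
  have hder : ∀ a, ∀ y ∈ U, HasDerivAt (fun z => f z a) (deriv (fun z => f z a) y) y :=
    fun a y hy => ((hd a).differentiableAt (hU.mem_nhds hy)).hasDerivAt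
  have hin : ∀ y ∈ ball z (R / 2), y ∈ U := fun y hy =>
    hsub y hy (Metric.mem_closedBall_self hR2.le)
  refine hasDerivAt_integral_of_dominated_loc_of_deriv_le (Metric.ball_mem_nhds z hR2)
    ((hU.mem_nhds hz |> Filter.eventually_of_mem) hm) (hi.mono' (hm z hz)
      (Eventually.of_forall (hb z hz))) (F' := fun y a => deriv (fun z => f z a) y)
    (bound := fun a => bound a / (R / 2)) ?_ ?_ (hi.div_const _) ?_
  · -- the derivative is a limit of difference quotients along a sequence
    obtain ⟨v, -, hv0, hv⟩ := exists_seq_strictAnti_tendsto' hR2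
    have hv' : ∀ n, z + (v n : ℂ) ∈ U := fun n => hin _ (by
      rw [Metric.mem_ball, dist_eq_norm, add_sub_cancel_left, Complex.norm_real, Real.norm_eq_abs,
        abs_of_pos (hv0 n).1]
      exact (hv0 n).2)
    refine aestronglyMeasurable_of_tendsto_ae (u := atTop)
      (f := fun n a => ((v n : ℂ))⁻¹ • (f (z + v n) a - f z a))
      (fun n => ((hm _ (hv' n)).sub (hm z hz)).const_smul ((v n : ℂ))⁻¹)
      (Eventually.of_forall fun a => ?_)
    refine (hasDerivAt_iff_tendsto_slope_zero.1 (hder a z hz)).comp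
      (f := fun n => (v n : ℂ)) (tendsto_nhdsWithin_iff.2 ⟨?_, Eventually.of_forall fun n => ?_⟩)
    · exact_mod_cast (Complex.continuous_ofReal.tendsto 0).comp hv
    · simpa using (hv0 n).1.ne'
  · refine Eventually.of_forall fun a y hy => ?_
    refine Complex.norm_deriv_le_of_forall_mem_sphere_norm_le hR2 ?_ fun x hx =>
      hb x (hsub y hy (Metric.sphere_subset_closedBall hx)) a
    refine DifferentiableOn.diffContOnCl ((hd a).mono ?_)
    rw [closure_ball _ hR2.ne']
    exact hsub y hy
  · exact Eventually.of_forall fun a y hy => hder a y (hin y hy)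

variable {B b κ : ℝ}

lemma continuous_phi_sub (h : IsNarrow B b κ) {z : ℂ} (hz : z ∈ strip b) :
    Continuous fun x : ℝ => phi B (z - x) := by
  rw [continuous_iff_continuousAt]
  intro x
  exact ContinuousAt.comp (g := phi B) (f := fun x : ℝ => z - x)
    (analyticAt_phi (reg_of_diffIm h (diffIm_sub hz (ofReal_mem_strip h.pos x)))).continuousAt
    (by fun_prop)

/-- A bound for the kernel `phi B` on differences of points of the strips. -/
lemma norm_phi_sub_le (h : IsNarrow B b κ) {z w : ℂ} (hz : z ∈ strip b) (hw : w ∈ strip b) :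
    ‖phi B (z - w)‖ ≤ 2 / κ ^ 2 := by
  refine (norm_phi_le h (diffIm_sub hz hw)).trans ?_
  have := h.kpos
  refine div_le_div_of_nonneg_left zero_le_two (by positivity) ?_
  exact le_mul_of_one_le_right (by positivity) (Real.one_le_cosh _)

/-- The convolution of `phi B` with an integrable function on the real line is holomorphic in the
strips. -/
lemma hasDerivAt_conv (h : IsNarrow B b κ) {f : ℝ → ℂ} (hf : Integrable f) {z : ℂ}
    (hz : z ∈ strip b) :
    Integrable (fun x : ℝ => deriv (phi B) (z - x) * f x) ∧
      HasDerivAt (fun z => ∫ x : ℝ, phi B (z - x) * f x)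
        (∫ x : ℝ, deriv (phi B) (z - x) * f x) z := by
  have hreg : ∀ z ∈ strip b, ∀ x : ℝ, Reg B (z - x) := fun z hz x =>
    reg_of_diffIm h (diffIm_sub hz (ofReal_mem_strip h.pos x))
  have hd : ∀ x : ℝ, ∀ z ∈ strip b, HasDerivAt (fun z => phi B (z - x) * f x)
      (deriv (phi B) (z - x) * f x) z := fun x z hz => by
    have := ((analyticAt_phi (hreg z hz x)).differentiableAt.hasDerivAt.comp z
      ((hasDerivAt_id z).sub_const (x : ℂ))).mul_const (f x)
    simpa using this
  have := hasDerivAt_integral_of_holomorphic (μ := volume) isOpen_strip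
    (f := fun z (x : ℝ) => phi B (z - x) * f x) (bound := fun x => 2 / κ ^ 2 * ‖f x‖)
    (fun z hz => (continuous_phi_sub h hz).aestronglyMeasurable.mul hf.aestronglyMeasurable)
    (fun x z hz => (hd x z hz).differentiableAt.differentiableWithinAt)
    (fun z hz x => by
      rw [norm_mul]
      exact mul_le_mul_of_nonneg_right (norm_phi_sub_le h hz (ofReal_mem_strip h.pos x))
        (norm_nonneg _))
    (hf.norm.const_mul _) hz
  simpa only [(hd _ z hz).deriv] using this

/-! On the real line `phi B` is positive with integral `2π`. -/

lemma phi_ofReal (hB0 : 0 < B) (hB1 : B < 1) (x : ℝ) : phi B x =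
    ((2 * Real.sin (π * B) * Real.cosh x /
      (Real.sinh x ^ 2 + Real.sin (π * B) ^ 2) : ℝ) : ℂ) := by
  have hs := sin_pi_mul_pos hB0 hB1
  rw [phi_eq]
  · push_cast; rfl
  · intro h0
    have : ((Real.sinh x ^ 2 + Real.sin (π * B) ^ 2 : ℝ) : ℂ) = 0 := by
      push_cast at h0 ⊢
      rw [h0]; ring
    exact (by positivity : Real.sinh x ^ 2 + Real.sin (π * B) ^ 2 ≠ 0)
      (Complex.ofReal_eq_zero.1 this)

lemma phi_ofReal_re_nonneg (hB0 : 0 < B) (hB1 : B < 1) (x : ℝ) : 0 ≤ (phi B x).re := by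
  have hs := sin_pi_mul_pos hB0 hB1
  rw [phi_ofReal hB0 hB1, Complex.ofReal_re]
  have := Real.cosh_pos x
  positivity

lemma ofReal_re_phi (hB0 : 0 < B) (hB1 : B < 1) (x : ℝ) : ((phi B x).re : ℂ) = phi B x := by
  rw [phi_ofReal hB0 hB1, Complex.ofReal_re]

lemma tendsto_sinh_atTop : Tendsto Real.sinh atTop atTop :=
  Real.sinhOrderIso.tendsto_atTop

lemma tendsto_sinh_atBot : Tendsto Real.sinh atBot atBot :=
  Real.sinhOrderIso.tendsto_atBot

lemma one_add_sq_le_cosh (x : ℝ) : 1 + x ^ 2 ≤ 2 * Real.cosh x := by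
  have h1 : Real.cosh x = 1 + 2 * Real.sinh (x / 2) ^ 2 := by
    have := Real.cosh_two_mul (x / 2)
    rw [mul_div_cancel₀ x two_ne_zero, Real.cosh_sq] at this
    linarith
  have h2 : (x / 2) ^ 2 ≤ Real.sinh (x / 2) ^ 2 := by
    rw [sq_le_sq]
    rcases le_total 0 (x / 2) with h | h
    · rw [abs_of_nonneg h, abs_of_nonneg (Real.sinh_nonneg_iff.2 h)]
      exact Real.self_le_sinh_iff.2 h
    · rw [abs_of_nonpos h, abs_of_nonpos (Real.sinh_nonpos_iff.2 h)]
      exact neg_le_neg (Real.sinh_le_self_iff.2 h)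
  nlinarith

/-- The kernel is the derivative of `2 arctan (sinh x / sin (π B))`. -/
lemma integral_phi (hB0 : 0 < B) (hB1 : B < 1) :
    Integrable (fun x : ℝ => (phi B x).re) ∧ ∫ x : ℝ, (phi B x).re = 2 * π := by
  have hs := sin_pi_mul_pos hB0 hB1
  set s := Real.sin (π * B)
  have hd : ∀ x : ℝ, HasDerivAt (fun x => 2 * Real.arctan (Real.sinh x / s)) ((phi B x).re) x := by
    intro x
    have := (((Real.hasDerivAt_sinh x).div_const s).arctan).const_mul 2
    refine this.congr_deriv ?_
    rw [phi_ofReal hB0 hB1, Complex.ofReal_re]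
    change _ = 2 * s * Real.cosh x / (Real.sinh x ^ 2 + s ^ 2)
    have : Real.sinh x ^ 2 + s ^ 2 ≠ 0 := by positivity
    have : 1 + (Real.sinh x / s) ^ 2 ≠ 0 := by positivity
    field_simp
    ring
  have ht : Tendsto (fun x => 2 * Real.arctan (Real.sinh x / s)) atTop (𝓝 π) := by
    have := ((Real.tendsto_arctan_atTop.mono_right nhdsWithin_le_nhds).comp
      (tendsto_sinh_atTop.atTop_div_const hs)).const_mul 2
    simpa [mul_div_cancel₀] using this
  have hbt : Tendsto (fun x => 2 * Real.arctan (Real.sinh x / s)) atBot (𝓝 (-π)) := by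
    have := ((Real.tendsto_arctan_atBot.mono_right nhdsWithin_le_nhds).comp
      (tendsto_sinh_atBot.atBot_div_const hs)).const_mul 2
    simpa [mul_div_cancel₀] using this
  have hint : Integrable (fun x : ℝ => (phi B x).re) := by
    refine (integrable_inv_one_add_sq.const_mul (4 / s)).mono' ?_ (Eventually.of_forall fun x => ?_)
    · refine (measurable_deriv fun x =>
        2 * Real.arctan (Real.sinh x / s)).aestronglyMeasurable.congr (Eventually.of_forall fun x => (hd x).deriv)
    · rw [Real.norm_of_nonneg (phi_ofReal_re_nonneg hB0 hB1 x), phi_ofReal hB0 hB1,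
        Complex.ofReal_re]
      change 2 * s * Real.cosh x / (Real.sinh x ^ 2 + s ^ 2) ≤ _
      have h1 := one_add_sq_le_cosh x
      have hs1 : s ≤ 1 := Real.sin_le_one _
      have h2 := Real.cosh_sq x
      have hc := Real.cosh_pos x
      rw [← div_eq_mul_inv, div_div, div_le_div_iff₀ (by positivity) (by positivity)]
      have h3 : s ^ 2 * Real.cosh x ^ 2 ≤ Real.sinh x ^ 2 + s ^ 2 := by
        rw [h2]; nlinarith [sq_nonneg (Real.sinh x), mul_le_one₀ hs1 hs.le hs1]
      calc 2 * s * Real.cosh x * (s * (1 + x ^ 2))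
          ≤ 2 * s * Real.cosh x * (s * (2 * Real.cosh x)) := by gcongr
        _ = 4 * (s ^ 2 * Real.cosh x ^ 2) := by ring
        _ ≤ _ := by gcongr
  refine ⟨hint, ?_⟩
  rw [integral_of_hasDerivAt_of_tendsto hd hint hbt ht]
  ring

/-- The argument `S(x - y - iπ/2)` of the logarithm of the source terms is at least one. -/
lemma S_sub_shifted (hB0 : 0 < B) (hB1 : B < 1) (hB : B ≠ 1 / 2) (x y : ℝ) :
    ∃ v : ℝ, 1 < v ∧ S B (x - shifted y) = v := by
  have hs := sin_pi_mul_pos hB0 hB1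
  have hs1 : Real.sin (π * B) < 1 := by
    refine lt_of_le_of_ne (Real.sin_le_one _) fun h1 => hB ?_
    have hpi := Real.pi_pos
    have h2 : Real.cos (π / 2 - π * B) = 1 := by rw [Real.cos_pi_div_two_sub, h1]
    have h3 := (Real.cos_eq_one_iff_of_lt_of_lt (by nlinarith) (by nlinarith)).1 h2
    have : π * (1 / 2 - B) = 0 := by linarith
    rcases mul_eq_zero.1 this with h | h <;> linarith
  set s := Real.sin (π * B)
  have hc := Real.one_le_cosh (x - y)
  refine ⟨(Real.cosh (x - y) + s) / (Real.cosh (x - y) - s), ?_, ?_⟩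
  · rw [lt_div_iff₀ (by linarith)]; linarith
  · have e : sinh (x - shifted y) = -(I * Real.cosh (x - y)) := by
      have : (x : ℂ) - shifted y = ((x - y : ℝ) : ℂ) - (π / 2 : ℝ) * I := by
        rw [shifted]; push_cast; ring
      rw [this, Complex.sinh_sub, Complex.cosh_mul_I, Complex.sinh_mul_I, ← Complex.ofReal_cos,
        ← Complex.ofReal_sin, Real.cos_pi_div_two, Real.sin_pi_div_two]
      push_cast; ring
    unfold S
    rw [e]
    have h1 : ((Real.cosh (x - y) : ℝ) : ℂ) - (s : ℂ) ≠ 0 := by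
      exact_mod_cast (by intro; linarith : Real.cosh (x - y) - s ≠ 0)
    change (-(I * _) - I * (s : ℂ)) / (-(I * _) + I * (s : ℂ)) = _
    rw [Complex.ofReal_div, Complex.ofReal_add, Complex.ofReal_sub,
      div_eq_div_iff _ h1]
    · ring
    · intro h0
      apply h1
      have : I * (((Real.cosh (x - y) : ℝ) : ℂ) - (s : ℂ)) = 0 := by linear_combination -h0
      simpa using this

section TBA

variable {B b κ m L : ℝ} {k : ℕ} {θb : Fin k → ℝ} {ε : ℂ → ℂ}

/-- `log (1 + e^{-ε})` on the real line. -/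
def lg (ε : ℂ → ℂ) (x : ℝ) : ℝ := Real.log (1 + Real.exp (-(ε x).re))

lemma lg_nonneg (x : ℝ) : 0 ≤ lg ε x :=
  Real.log_nonneg (by have := Real.exp_pos (-(ε x).re); linarith)

namespace IsPseudoenergy

variable (hε : IsPseudoenergy B m L θb ε)
include hε

lemma ofReal_re (x : ℝ) : ((ε x).re : ℂ) = ε x :=
  Complex.ext (by simp) (by simp [hε.real x])

lemma log_eq (x : ℝ) : Complex.log (1 + exp (-ε x)) = (lg ε x : ℂ) := by
  rw [← hε.ofReal_re x, lg, Complex.ofReal_log (by positivity)]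
  push_cast
  rw [hε.ofReal_re x]

lemma integrable_lg : Integrable (lg ε) := by
  have := hε.integrable.re
  refine this.congr (Eventually.of_forall fun x => ?_)
  simp only [hε.log_eq x]
  exact Complex.ofReal_re _

lemma eq_sub_integral {θ : ℂ} (hθ : θ.im = 0 ∨ |θ.im - π / 2| < |π / 2 - π * B|) :
    ε θ = m * L * cosh θ + ∑ i, Complex.log (S B (θ - shifted (θb i)))
      - ∫ x : ℝ, phi B (θ - x) * ((lg ε x : ℂ) / (2 * π)) := by
  rw [hε.tba θ hθ]
  congr 2
  ext x
  rw [hε.log_eq, mul_div_assoc]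

lemma re_eq (hB0 : 0 < B) (hB1 : B < 1) (x : ℝ) :
    (ε x).re = m * L * Real.cosh x + ∑ i, Real.log ‖S B (x - shifted (θb i))‖
      - (∫ y : ℝ, (phi B (x - y : ℝ)).re * lg ε y) / (2 * π) := by
  have h1 : ∫ y : ℝ, phi B (x - y) * ((lg ε y : ℂ) / (2 * π)) =
      (((∫ y : ℝ, (phi B (x - y : ℝ)).re * lg ε y) / (2 * π) : ℝ) : ℂ) := by
    rw [Complex.ofReal_div, ← integral_complex_ofReal, ← integral_div]
    congr 1
    ext y
    rw [Complex.ofReal_mul, ofReal_re_phi hB0 hB1]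
    push_cast
    ring
  rw [hε.eq_sub_integral (Or.inl (Complex.ofReal_im x)), h1, Complex.sub_re, Complex.ofReal_re,
    Complex.add_re, Complex.re_sum]
  simp only [Complex.log_re]
  congr 2
  rw [← Complex.ofReal_cosh, ← Complex.ofReal_mul, ← Complex.ofReal_mul, Complex.ofReal_re]

/-- The a priori bound `e^{-ε(x)} ≤ 2 e^{-mL cosh x}`: with `c` the supremum of the convolution
term one has `ε(x) ≥ mL cosh x - c`, hence `c ≤ log (1 + e^{c - mL})` because the kernel is a
probability density. -/
lemma exp_neg_le (h : IsNarrow B b κ) (hB0 : 0 < B) (hB1 : B < 1) (hB : B ≠ 1 / 2)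
    (hmL : 0 < m * L) (hE : Real.exp (-(m * L)) ≤ 1 / 2) (x : ℝ) :
    Real.exp (-(ε x).re) ≤ 2 * Real.exp (-(m * L * Real.cosh x)) := by
  set v : ℝ → ℝ := fun x => (∫ y : ℝ, (phi B (x - y : ℝ)).re * lg ε y) / (2 * π)
  have hpi := Real.pi_pos
  have hmeas : ∀ x : ℝ, AEStronglyMeasurable (fun y : ℝ => (phi B (x - y : ℝ)).re) volume :=
    fun x => (Complex.continuous_re.comp (by
      simpa using continuous_phi_sub h (ofReal_mem_strip h.pos x))).aestronglyMeasurable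
  have hre : ∀ x y : ℝ, (phi B (x - y : ℝ)).re ≤ 2 / κ ^ 2 := fun x y => by
    refine (Complex.re_le_norm _).trans ?_
    simpa using norm_phi_sub_le h (ofReal_mem_strip h.pos x) (ofReal_mem_strip h.pos y)
  have hpos : ∀ x y : ℝ, 0 ≤ (phi B (x - y : ℝ)).re := fun x y => phi_ofReal_re_nonneg hB0 hB1 _
  have hint : ∀ x : ℝ, Integrable fun y : ℝ => (phi B (x - y : ℝ)).re * lg ε y := fun x =>
    hε.integrable_lg.bdd_mul (hmeas x) (Eventually.of_forall fun y => by
      rw [Real.norm_of_nonneg (hpos x y)]; exact hre x y)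
  have hbdd : BddAbove (Set.range v) := by
    refine ⟨(∫ y, 2 / κ ^ 2 * lg ε y) / (2 * π), ?_⟩
    rintro _ ⟨x, rfl⟩
    refine div_le_div_of_nonneg_right ?_ (by positivity)
    exact integral_mono (hint x) (hε.integrable_lg.const_mul _) fun y =>
      mul_le_mul_of_nonneg_right (hre x y) (lg_nonneg y)
  set c := ⨆ x, v x
  have hvc : ∀ x, v x ≤ c := le_ciSup hbdd
  have hge : ∀ x, m * L * Real.cosh x - c ≤ (ε x).re := fun x => by
    rw [hε.re_eq hB0 hB1 x]
    have : 0 ≤ ∑ i, Real.log ‖S B (x - shifted (θb i))‖ := Finset.sum_nonneg fun i _ => by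
      obtain ⟨v, hv, e⟩ := S_sub_shifted hB0 hB1 hB x (θb i)
      rw [e, Complex.norm_real, Real.norm_of_nonneg (by linarith)]
      exact Real.log_nonneg hv.le
    have := hvc x
    change _ ≤ _ - v x
    linarith
  have hlg : ∀ y, lg ε y ≤ Real.log (1 + Real.exp (c - m * L)) := fun y => by
    refine Real.log_le_log (by positivity) ?_
    have h1 := hge y
    have h2 : m * L ≤ m * L * Real.cosh y := le_mul_of_one_le_right hmL.le (Real.one_le_cosh y)
    gcongr
    linarith
  have hphi := integral_phi hB0 hB1
  have hc : c ≤ Real.log (1 + Real.exp (c - m * L)) := by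
    refine ciSup_le fun x => ?_
    change _ / _ ≤ _
    rw [div_le_iff₀ (by positivity)]
    have hi : Integrable fun y : ℝ => (phi B (x - y : ℝ)).re := hphi.1.comp_sub_left x
    calc _ ≤ ∫ y : ℝ, (phi B (x - y : ℝ)).re * Real.log (1 + Real.exp (c - m * L)) :=
          integral_mono (hint x) (hi.mul_const _) fun y =>
            mul_le_mul_of_nonneg_left (hlg y) (hpos x y)
      _ = _ := by
        rw [integral_mul_const, integral_sub_left_eq_self (fun y : ℝ => (phi B y).re) volume x,
          hphi.2, mul_comm]
  -- `e^c ≤ 1 + e^c e^{-mL} ≤ 1 + e^c / 2`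
  have hec : Real.exp c ≤ 2 := by
    have h1 := Real.exp_le_exp.2 hc
    rw [Real.exp_log (by positivity), sub_eq_add_neg, Real.exp_add] at h1
    nlinarith [Real.exp_pos c]
  calc Real.exp (-(ε x).re) ≤ Real.exp (c + -(m * L * Real.cosh x)) :=
        Real.exp_le_exp.2 (by have := hge x; linarith)
    _ ≤ _ := by
      rw [Real.exp_add]
      exact mul_le_mul_of_nonneg_right hec (Real.exp_pos _).le

omit hε in
lemma exp_neg_mul_le {u : ℝ} (hu : 0 < u) : Real.exp (-u) * (1 + u) ≤ 3 / u := by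
  rw [Real.exp_neg, inv_mul_eq_div, div_le_div_iff₀ (Real.exp_pos u) hu]
  nlinarith [Real.quadratic_le_exp_of_nonneg hu.le]

omit hε in
lemma exp_neg_cosh_le (hmL : 0 < m * L) (x : ℝ) :
    1 / π * (Real.exp (-(m * L * Real.cosh x)) * (1 + m * L * Real.cosh x)) ≤
      2 / (m * L) * (1 + x ^ 2)⁻¹ := by
  have hpi := Real.pi_gt_three
  have hc := one_add_sq_le_cosh x
  have hc0 := Real.cosh_pos x
  have h3 := exp_neg_mul_le (u := m * L * Real.cosh x) (by positivity)
  calc _ ≤ 1 / 3 * (3 / (m * L * Real.cosh x)) := by gcongr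
    _ = 1 / (m * L) * (1 / Real.cosh x) := by field_simp
    _ ≤ 1 / (m * L) * (2 / (1 + x ^ 2)) := by
        gcongr 1 / (m * L) * ?_
        rw [div_le_div_iff₀ hc0 (by positivity)]
        linarith
    _ = _ := by ring

/-- The weight decays fast enough to be integrated against the source `mL sinh x`, and is small in
large volume. -/
lemma norm_weight_mul_le (h : IsNarrow B b κ) (hB0 : 0 < B) (hB1 : B < 1) (hB : B ≠ 1 / 2)
    (hmL : 0 < m * L) (hE : Real.exp (-(m * L)) ≤ 1 / 2) (x : ℝ) :
    ‖weight ε x‖ * (1 + m * L * Real.cosh x) ≤ 2 / (m * L) * (1 + x ^ 2)⁻¹ := by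
  have hpi := Real.pi_gt_three
  have hc0 := Real.cosh_pos x
  set u := m * L * Real.cosh x
  have h1 := hε.exp_neg_le h hB0 hB1 hB hmL hE x
  have h2 : ‖weight ε x‖ ≤ 1 / (2 * π) * Real.exp (-(ε x).re) := by
    have e : weight ε x = ((1 / (2 * π) * (1 / (1 + Real.exp (ε x).re)) : ℝ) : ℂ) := by
      rw [weight]; push_cast; rw [hε.ofReal_re x]
    rw [e, Complex.norm_real, Real.norm_of_nonneg (by positivity), Real.exp_neg, ← one_div]
    gcongr
    linarith
  calc ‖weight ε x‖ * (1 + u) ≤ 1 / (2 * π) * (2 * Real.exp (-u)) * (1 + u) := by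
        have : 0 < u := by positivity
        gcongr
        exact h2.trans (by gcongr)
    _ = 1 / π * (Real.exp (-u) * (1 + u)) := by field_simp
    _ ≤ _ := exp_neg_cosh_le hmL x

end IsPseudoenergy

end TBA

/-! ### Chains and the dressing operator -/

/-- Fubini for the first coordinate of a finite product measure. -/
lemma integral_pi_succ {n : ℕ} {μ : Fin (n + 1) → Measure ℝ} [∀ i, SigmaFinite (μ i)]
    {f : (Fin (n + 1) → ℝ) → ℂ} (hf : Integrable f (Measure.pi μ)) :
    Integrable (fun p : ℝ × (Fin n → ℝ) => f (Fin.cons p.1 p.2))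
      ((μ 0).prod (Measure.pi fun i => μ i.succ)) ∧
    ∫ x, f x ∂(Measure.pi μ) = ∫ p : ℝ × (Fin n → ℝ), f (Fin.cons p.1 p.2)
      ∂((μ 0).prod (Measure.pi fun i => μ i.succ)) := by
  have h := (measurePreserving_piFinSuccAbove μ 0).symm
  have e : ∀ p : ℝ × (Fin n → ℝ), (MeasurableEquiv.piFinSuccAbove (fun _ => ℝ) 0).symm p =
      (Fin.cons p.1 p.2 : Fin (n + 1) → ℝ) := fun p => by
    simp [MeasurableEquiv.piFinSuccAbove, Fin.insertNthEquiv]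
  have h1 := h.integrable_comp_emb (MeasurableEquiv.measurableEmbedding _) (g := f)
  have h2 := h.integral_comp (MeasurableEquiv.measurableEmbedding _) f
  simp only [Function.comp_def, e] at h1 h2
  exact ⟨h1.2 hf, h2.symm⟩

/-- A continuous function dominated by a product of integrable functions is integrable. -/
lemma integrable_pi_of_le {n : ℕ} {μ : Fin n → Measure ℝ} [∀ i, SigmaFinite (μ i)]
    {f : (Fin n → ℝ) → ℂ} {v : Fin n → ℝ → ℝ} {M : ℝ} (hf : AEStronglyMeasurable f (Measure.pi μ))
    (hv : ∀ i, Integrable (v i) (μ i)) (hb : ∀ x, ‖f x‖ ≤ M * ∏ i, v i (x i)) :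
    Integrable f (Measure.pi μ) :=
  ((Integrable.fintype_prod hv).const_mul M).mono' hf (Eventually.of_forall hb)

/-- The hypotheses on the weight under which the dressing equations `u = g + T u` are solved by
Neumann series. -/
structure IsDressing (B b κ : ℝ) (ε : ℂ → ℂ) : Prop where
  narrow : IsNarrow B b κ
  cont : Continuous fun x : ℝ => weight ε x
  int : Integrable fun x : ℝ => weight ε x
  small : 2 / κ ^ 2 * ∫ x : ℝ, ‖weight ε x‖ ≤ 1 / 2

/-- The continuous functions on the real line that are integrable against the weight. -/
def adm (ε : ℂ → ℂ) : Submodule ℂ (ℝ → ℂ) where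
  carrier := {g | Continuous g ∧ Integrable fun x : ℝ => weight ε x * g x}
  add_mem' {f g} hf hg := ⟨hf.1.add hg.1, by
    refine (hf.2.add hg.2).congr (Eventually.of_forall fun x => ?_)
    simp only [Pi.add_apply, mul_add]⟩
  zero_mem' := ⟨continuous_const, by simp⟩
  smul_mem' c f hf := ⟨hf.1.const_smul c, by
    refine (hf.2.const_mul c).congr (Eventually.of_forall fun x => ?_)
    simp only [Pi.smul_apply, smul_eq_mul]; ring⟩

namespace IsDressing

variable {B b κ : ℝ} {ε : ℂ → ℂ} (hD : IsDressing B b κ ε)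
include hD

lemma mem_adm_of_bounded {g : ℝ → ℂ} {M : ℝ} (hg : Continuous g) (hM : ∀ x, ‖g x‖ ≤ M) :
    g ∈ adm ε :=
  ⟨hg, hD.int.mul_bdd hg.aestronglyMeasurable (Eventually.of_forall hM)⟩

omit hD in
lemma integrable_mul {f g : ℝ → ℂ} {M : ℝ} (hf : Continuous f) (hM : ∀ x, ‖f x‖ ≤ M)
    (hg : g ∈ adm ε) : Integrable fun x : ℝ => weight ε x * (f x * g x) := by
  refine (hg.2.bdd_mul hf.aestronglyMeasurable (Eventually.of_forall hM)).congr
    (Eventually.of_forall fun x => ?_)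
  simp only; ring

lemma continuous_phi {z : ℂ} (hz : z ∈ strip b) : Continuous fun x : ℝ => phi B (z - x) :=
  continuous_phi_sub hD.narrow hz

lemma norm_phi_le {z : ℂ} (hz : z ∈ strip b) (x : ℝ) : ‖phi B (z - x)‖ ≤ 2 / κ ^ 2 :=
  norm_phi_sub_le hD.narrow hz (ofReal_mem_strip hD.narrow.pos x)

lemma norm_integral_phi_le {z : ℂ} (hz : z ∈ strip b) {g : ℝ → ℂ} (hg : g ∈ adm ε) :
    ‖∫ x : ℝ, phi B (z - x) * (weight ε x * g x)‖ ≤ 2 / κ ^ 2 * ∫ x : ℝ, ‖weight ε x * g x‖ := by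
  rw [← integral_const_mul]
  refine norm_integral_le_of_norm_le (hg.2.norm.const_mul _) (Eventually.of_forall fun x => ?_)
  rw [norm_mul]
  exact mul_le_mul_of_nonneg_right (hD.norm_phi_le hz x) (norm_nonneg _)

lemma integrable_phi_mul {z : ℂ} (hz : z ∈ strip b) {g : ℝ → ℂ} (hg : g ∈ adm ε) :
    Integrable fun x : ℝ => phi B (z - x) * (weight ε x * g x) :=
  hg.2.bdd_mul (hD.continuous_phi hz).aestronglyMeasurable
    (Eventually.of_forall (hD.norm_phi_le hz))

lemma continuous_integral_phi {g : ℝ → ℂ} (hg : g ∈ adm ε) :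
    Continuous fun x : ℝ => ∫ y : ℝ, phi B (x - y) * (weight ε y * g y) := by
  rw [continuous_iff_continuousAt]
  intro x
  exact ContinuousAt.comp
    (g := fun z : ℂ => ∫ y : ℝ, phi B (z - y) * (weight ε y * g y)) (f := fun x : ℝ => (x : ℂ))
    (hasDerivAt_conv hD.narrow hg.2 (ofReal_mem_strip hD.narrow.pos x)).2.continuousAt
    Complex.continuous_ofReal.continuousAt

/-- The dressing operator `T g(x) = ∫ φ(x - y) w(y) g(y) dy`. -/
def op : Module.End ℂ (adm ε) where
  toFun g := ⟨fun x => ∫ y : ℝ, phi B (x - y) * (weight ε y * g.1 y),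
    hD.mem_adm_of_bounded (hD.continuous_integral_phi g.2) fun x =>
      hD.norm_integral_phi_le (ofReal_mem_strip hD.narrow.pos x) g.2⟩
  map_add' f g := by
    ext x
    have hx := ofReal_mem_strip hD.narrow.pos x
    refine Eq.trans ?_ (integral_add (hD.integrable_phi_mul hx f.2) (hD.integrable_phi_mul hx g.2))
    change ∫ y : ℝ, _ = _
    congr 1
    ext y
    simp only [Submodule.coe_add, Pi.add_apply]; ring
  map_smul' c g := by
    ext x
    refine Eq.trans ?_ (integral_const_mul c _)
    change ∫ y : ℝ, _ = _
    congr 1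
    ext y
    simp only [Submodule.coe_smul, Pi.smul_apply, smul_eq_mul]; ring

lemma op_apply (g : adm ε) (x : ℝ) :
    (hD.op g).1 x = ∫ y : ℝ, phi B (x - y) * (weight ε y * g.1 y) := rfl

lemma norm_op_le (g : adm ε) (x : ℝ) :
    ‖(hD.op g).1 x‖ ≤ 2 / κ ^ 2 * ∫ x : ℝ, ‖weight ε x * g.1 x‖ :=
  hD.norm_integral_phi_le (ofReal_mem_strip hD.narrow.pos x) g.2

lemma integral_norm_op_le (g : adm ε) :
    ∫ x : ℝ, ‖weight ε x * (hD.op g).1 x‖ ≤ 1 / 2 * ∫ x : ℝ, ‖weight ε x * g.1 x‖ := by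
  have h0 : 0 ≤ ∫ x : ℝ, ‖weight ε x * g.1 x‖ := integral_nonneg fun x => norm_nonneg _
  calc _ ≤ ∫ x : ℝ, ‖weight ε x‖ * (2 / κ ^ 2 * ∫ x : ℝ, ‖weight ε x * g.1 x‖) := by
        refine integral_mono (hD.op g).2.2.norm (hD.int.norm.mul_const _) fun x => ?_
        simp only [norm_mul]
        refine mul_le_mul_of_nonneg_left ?_ (norm_nonneg _)
        simpa only [norm_mul] using hD.norm_op_le g x
    _ = (2 / κ ^ 2 * ∫ x : ℝ, ‖weight ε x‖) * ∫ x : ℝ, ‖weight ε x * g.1 x‖ := by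
        rw [integral_mul_const]; ring
    _ ≤ _ := mul_le_mul_of_nonneg_right hD.small h0

lemma integral_norm_op_pow_le (g : adm ε) (n : ℕ) :
    ∫ x : ℝ, ‖weight ε x * ((hD.op ^ n) g).1 x‖ ≤ (1 / 2) ^ n * ∫ x : ℝ, ‖weight ε x * g.1 x‖ := by
  induction n with
  | zero => simp
  | succ n ih =>
    rw [pow_succ', Module.End.mul_apply]
    refine (hD.integral_norm_op_le _).trans ?_
    rw [pow_succ', mul_assoc]
    exact mul_le_mul_of_nonneg_left ih (by norm_num)

omit hD in
lemma norm_pairing_le {f : ℝ → ℂ} {M : ℝ} (hM : ∀ x, ‖f x‖ ≤ M) (g : adm ε) :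
    ‖∫ x : ℝ, weight ε x * (f x * g.1 x)‖ ≤ M * ∫ x : ℝ, ‖weight ε x * g.1 x‖ := by
  rw [← integral_const_mul]
  refine norm_integral_le_of_norm_le (g.2.2.norm.const_mul M) (Eventually.of_forall fun x => ?_)
  rw [mul_left_comm, norm_mul]
  exact mul_le_mul_of_nonneg_right (hM x) (norm_nonneg _)

/-- The integral of a chain is the pairing of its first function with an iterate of the dressing
operator. -/
lemma integral_chain (n : ℕ) {f g : ℂ → ℂ} {M : ℝ} (hf : Continuous fun x : ℝ => f x)
    (hM : ∀ x : ℝ, ‖f x‖ ≤ M) (hg : (fun x : ℝ => g x) ∈ adm ε) :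
    Integrable (chainIntegrand B ε f g n) ∧
    ∫ x, chainIntegrand B ε f g n x =
      ∫ x : ℝ, weight ε x * (f x * ((hD.op ^ n) ⟨_, hg⟩).1 x) := by
  have hreal := fun x : ℝ => ofReal_mem_strip hD.narrow.pos x
  have hphi : Continuous fun x : ℝ => phi B x := by
    simpa [Function.comp_def] using (hD.continuous_phi (hreal 0)).comp continuous_neg
  have hphi' : ∀ x : ℝ, ‖phi B x‖ ≤ 2 / κ ^ 2 := fun x => by
    simpa using hD.norm_phi_le (hreal x) 0
  have hint : ∀ (n : ℕ) (f : ℂ → ℂ) (M : ℝ), (Continuous fun x : ℝ => f x) →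
      (∀ x : ℝ, ‖f x‖ ≤ M) → Integrable (chainIntegrand B ε f g n) := by
    intro n f M hf hM
    have hM0 : 0 ≤ M := (norm_nonneg _).trans (hM 0)
    have hc : Continuous (chainIntegrand B ε f g n) := by
      have h1 : ∀ i : Fin (n + 1), Continuous fun x : Fin (n + 1) → ℝ => weight ε (x i) :=
        fun i => hD.cont.comp (continuous_apply i)
      have h2 : Continuous fun x : Fin (n + 1) → ℝ => f (x 0) := hf.comp (continuous_apply 0)
      have h3 : Continuous fun x : Fin (n + 1) → ℝ => g (x (Fin.last n)) :=
        hg.1.comp (continuous_apply (Fin.last n))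
      have h4 : ∀ i : Fin n, Continuous fun x : Fin (n + 1) → ℝ =>
          phi B ((x i.castSucc : ℂ) - (x i.succ : ℂ)) := fun i => by
        have := hphi.comp (f := fun x : Fin (n + 1) → ℝ => x i.castSucc - x i.succ) (by fun_prop)
        simpa [Function.comp_def] using this
      exact (continuous_finsetProd _ fun i _ => h1 i).mul
        ((h2.mul (continuous_finsetProd _ fun i _ => h4 i)).mul h3)
    -- `g` need not be bounded, but its product with the last weight is integrable
    refine integrable_pi_of_le (M := M * (2 / κ ^ 2) ^ n)
      (v := Fin.snoc (α := fun _ => ℝ → ℝ) (fun _ x => ‖weight ε x‖) fun x => ‖weight ε x * g x‖)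
      hc.aestronglyMeasurable (fun i => ?_) fun x => ?_
    · induction i using Fin.lastCases with
      | last => simpa only [Fin.snoc_last] using hg.2.norm
      | cast i => simpa only [Fin.snoc_castSucc] using hD.int.norm
    · rw [Fin.prod_univ_castSucc]
      simp only [Fin.snoc_last, Fin.snoc_castSucc]
      rw [chainIntegrand, Fin.prod_univ_castSucc]
      simp only [norm_mul, norm_prod]
      have h1 : ∏ i : Fin n, ‖phi B ((x i.castSucc : ℂ) - (x i.succ : ℂ))‖ ≤ (2 / κ ^ 2) ^ n := by
        refine (Finset.prod_le_prod (g := fun _ => 2 / κ ^ 2) (fun _ _ => norm_nonneg _)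
          fun i _ => ?_).trans_eq (by simp [div_pow])
        simpa using hphi' (x i.castSucc - x i.succ)
      have h0 : 0 ≤ ∏ i : Fin n, ‖weight ε (x i.castSucc)‖ :=
        Finset.prod_nonneg fun _ _ => norm_nonneg _
      calc _ = (∏ i : Fin n, ‖weight ε (x i.castSucc)‖) * (‖weight ε (x (Fin.last n))‖ *
            ‖g (x (Fin.last n))‖) *
            (‖f (x 0)‖ * ∏ i : Fin n, ‖phi B ((x i.castSucc : ℂ) - (x i.succ : ℂ))‖) := by ring
        _ ≤ (∏ i : Fin n, ‖weight ε (x i.castSucc)‖) * (‖weight ε (x (Fin.last n))‖ *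
            ‖g (x (Fin.last n))‖) * (M * (2 / κ ^ 2) ^ n) := by
          refine mul_le_mul_of_nonneg_left (mul_le_mul (hM _) h1
            (Finset.prod_nonneg fun _ _ => norm_nonneg _) hM0) (by positivity)
        _ = _ := by ring
  refine ⟨hint n f M hf hM, ?_⟩
  induction n generalizing f M with
  | zero =>
    refine ((volume_preserving_funUnique (Fin 1) ℝ).symm.integral_comp
      (MeasurableEquiv.measurableEmbedding _) (chainIntegrand B ε f g 0)).symm.trans ?_
    congr 1
    ext x
    simp [chainIntegrand]
  | succ n ih =>
    have h1 := integral_pi_succ (μ := fun _ : Fin (n + 1 + 1) => (volume : Measure ℝ))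
      (hint (n + 1) f M hf hM)
    have h2 := h1.2.trans (integral_prod _ h1.1)
    refine Eq.trans h2 ?_
    congr 1
    ext x
    have h3 : ∀ y : Fin (n + 1) → ℝ, chainIntegrand B ε f g (n + 1) (Fin.cons x y) =
        weight ε x * (f x * chainIntegrand B ε (fun z => phi B (x - z)) g n y) := fun y => by
      have e1 : ∏ i, weight ε ((Fin.cons x y : Fin (n + 1 + 1) → ℝ) i) =
          weight ε x * ∏ i, weight ε (y i) := by
        rw [Fin.prod_univ_succ]; simp
      have e2 : ∏ i : Fin (n + 1), phi B (((Fin.cons x y : Fin (n + 1 + 1) → ℝ) i.castSucc : ℂ) -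
          ((Fin.cons x y : Fin (n + 1 + 1) → ℝ) i.succ : ℂ)) =
          phi B (x - y 0) * ∏ i : Fin n, phi B (y i.castSucc - y i.succ) := by
        rw [Fin.prod_univ_succ]; simp
      simp only [chainIntegrand]
      rw [e1, e2, ← Fin.succ_last, Fin.cons_zero, Fin.cons_succ]
      ring
    simp only [h3]
    rw [integral_const_mul, integral_const_mul]
    have h4 := ih (f := fun z => phi B (x - z)) (hD.continuous_phi (hreal x))
      (hD.norm_phi_le (hreal x))
    rw [← volume_pi, h4, pow_succ', Module.End.mul_apply, hD.op_apply]
    congr 3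
    ext y
    ring

lemma summable_pairing {f : ℝ → ℂ} {M : ℝ} (hM : ∀ x, ‖f x‖ ≤ M) (g : adm ε) :
    (Summable fun n : ℕ => ∫ x : ℝ, weight ε x * (f x * ((hD.op ^ n) g).1 x)) ∧
    ‖∑' n : ℕ, ∫ x : ℝ, weight ε x * (f x * ((hD.op ^ n) g).1 x)‖ ≤
      2 * M * ∫ x : ℝ, ‖weight ε x * g.1 x‖ := by
  have hM0 : 0 ≤ M := (norm_nonneg _).trans (hM 0)
  have hb : ∀ n : ℕ, ‖∫ x : ℝ, weight ε x * (f x * ((hD.op ^ n) g).1 x)‖ ≤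
      M * (∫ x : ℝ, ‖weight ε x * g.1 x‖) * (1 / 2) ^ n := fun n => by
    refine (norm_pairing_le hM _).trans ?_
    rw [mul_assoc, mul_comm (∫ x : ℝ, _)]
    exact mul_le_mul_of_nonneg_left (hD.integral_norm_op_pow_le g n) hM0
  have hs := (hasSum_geometric_two).mul_left (M * ∫ x : ℝ, ‖weight ε x * g.1 x‖)
  refine ⟨Summable.of_norm_bounded hs.summable hb, ?_⟩
  refine (tsum_of_norm_bounded hs hb).trans_eq (by ring)

lemma chainConverges {f g : ℂ → ℂ} {M : ℝ} (hf : Continuous fun x : ℝ => f x)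
    (hM : ∀ x : ℝ, ‖f x‖ ≤ M) (hg : (fun x : ℝ => g x) ∈ adm ε) : ChainConverges B ε f g :=
  ⟨fun n => (hD.integral_chain n hf hM hg).1, by
    simpa only [(hD.integral_chain _ hf hM hg).2] using (hD.summable_pairing hM ⟨_, hg⟩).1⟩

lemma chainSum_eq {f g : ℂ → ℂ} {M : ℝ} (hf : Continuous fun x : ℝ => f x)
    (hM : ∀ x : ℝ, ‖f x‖ ≤ M) (hg : (fun x : ℝ => g x) ∈ adm ε) : chainSum B ε f g =
    ∑' n : ℕ, ∫ x : ℝ, weight ε x * (f x * ((hD.op ^ n) ⟨_, hg⟩).1 x) := by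
  simp only [chainSum, (hD.integral_chain _ hf hM hg).2]

/-- A solution `u` of the dressing equation `u = g + T u` is integrated by a chain sum. -/
lemma tsum_eq_of_eq {f : ℝ → ℂ} {M : ℝ} (hf : Continuous f) (hM : ∀ x, ‖f x‖ ≤ M)
    {u g : adm ε} (h : u = g + hD.op u) :
    ∑' n : ℕ, ∫ x : ℝ, weight ε x * (f x * ((hD.op ^ n) g).1 x) =
      ∫ x : ℝ, weight ε x * (f x * u.1 x) := by
  set c : ℕ → ℂ := fun n => ∫ x : ℝ, weight ε x * (f x * ((hD.op ^ n) u).1 x)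
  have h1 : ∀ n, ∫ x : ℝ, weight ε x * (f x * ((hD.op ^ n) g).1 x) = c n - c (n + 1) := fun n => by
    simp only [c]
    rw [← integral_sub (integrable_mul hf hM ((hD.op ^ n) u).2)
      (integrable_mul hf hM ((hD.op ^ (n + 1)) u).2)]
    congr 1
    ext x
    have : (hD.op ^ n) g = (hD.op ^ n) u - (hD.op ^ (n + 1)) u := by
      rw [pow_succ, Module.End.mul_apply, ← map_sub, eq_sub_of_add_eq h.symm]
    rw [this, Submodule.coe_sub, Pi.sub_apply]
    ring
  have h2 : Tendsto c atTop (𝓝 0) :=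
    (hD.summable_pairing hM u).1.tendsto_atTop_zero
  have h3 := (hD.summable_pairing hM g).1.hasSum.tendsto_sum_nat
  simp only [h1] at h3 ⊢
  simp only [Finset.sum_range_sub'] at h3
  have h4 := tendsto_nhds_unique h3 (h2.const_sub (c 0))
  simpa [c] using h4

lemma chainSum_eq_of_eq {f g : ℂ → ℂ} {M : ℝ} (hf : Continuous fun x : ℝ => f x)
    (hM : ∀ x : ℝ, ‖f x‖ ≤ M) (hg : (fun x : ℝ => g x) ∈ adm ε) {u : ℝ → ℂ} (hu : u ∈ adm ε)
    (h : ∀ x : ℝ, u x = g x + ∫ y : ℝ, phi B (x - y) * (weight ε y * u y)) :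
    chainSum B ε f g = ∫ x : ℝ, weight ε x * (f x * u x) := by
  rw [hD.chainSum_eq hf hM hg]
  exact hD.tsum_eq_of_eq hf hM (u := ⟨u, hu⟩) (g := ⟨_, hg⟩) (Subtype.ext (funext h))

lemma chainSum_add {f g g' : ℂ → ℂ} {M : ℝ} (hf : Continuous fun x : ℝ => f x)
    (hM : ∀ x : ℝ, ‖f x‖ ≤ M) (hg : (fun x : ℝ => g x) ∈ adm ε)
    (hg' : (fun x : ℝ => g' x) ∈ adm ε) :
    chainSum B ε f (fun z => g z + g' z) = chainSum B ε f g + chainSum B ε f g' := by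
  have hgg : (fun x : ℝ => g x + g' x) ∈ adm ε := (adm ε).add_mem hg hg'
  rw [hD.chainSum_eq hf hM hg, hD.chainSum_eq hf hM hg', hD.chainSum_eq hf hM hgg,
    ← (hD.summable_pairing hM ⟨_, hg⟩).1.tsum_add (hD.summable_pairing hM ⟨_, hg'⟩).1]
  congr 1
  ext n
  rw [← integral_add (integrable_mul hf hM (Subtype.prop _))
    (integrable_mul hf hM (Subtype.prop _))]
  congr 1
  ext x
  have : (⟨_, hgg⟩ : adm ε) = ⟨_, hg⟩ + ⟨_, hg'⟩ := rfl
  rw [this, map_add, Submodule.coe_add, Pi.add_apply]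
  ring

lemma chainSum_const_mul {f g : ℂ → ℂ} {M : ℝ} (hf : Continuous fun x : ℝ => f x)
    (hM : ∀ x : ℝ, ‖f x‖ ≤ M) (hg : (fun x : ℝ => g x) ∈ adm ε) (c : ℂ) :
    chainSum B ε f (fun z => c * g z) = c * chainSum B ε f g := by
  have hgg : (fun x : ℝ => c * g x) ∈ adm ε := (adm ε).smul_mem c hg
  rw [hD.chainSum_eq hf hM hg, hD.chainSum_eq hf hM hgg, ← tsum_mul_left]
  congr 1
  ext n
  rw [← integral_const_mul]
  congr 1
  ext x
  have : (⟨_, hgg⟩ : adm ε) = c • ⟨_, hg⟩ := rfl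
  rw [this, map_smul, Submodule.coe_smul, Pi.smul_apply, smul_eq_mul]
  ring

lemma norm_chainSum_le {f g : ℂ → ℂ} {M : ℝ} (hf : Continuous fun x : ℝ => f x)
    (hM : ∀ x : ℝ, ‖f x‖ ≤ M) (hg : (fun x : ℝ => g x) ∈ adm ε) :
    ‖chainSum B ε f g‖ ≤ 2 * M * ∫ x : ℝ, ‖weight ε x * g x‖ := by
  rw [hD.chainSum_eq hf hM hg]
  exact (hD.summable_pairing hM ⟨_, hg⟩).2

/-- The dressing operator is symmetric because `phi B` is even. -/
lemma pairing_op (f g : adm ε) :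
    ∫ x : ℝ, weight ε x * (f.1 x * (hD.op g).1 x) =
      ∫ x : ℝ, weight ε x * (g.1 x * (hD.op f).1 x) := by
  have hreal := fun x : ℝ => ofReal_mem_strip hD.narrow.pos x
  have hphi : Continuous fun x : ℝ => phi B x := by
    simpa [Function.comp_def] using (hD.continuous_phi (hreal 0)).comp continuous_neg
  have hi : Integrable (fun p : ℝ × ℝ => phi B (p.1 - p.2) *
      ((weight ε p.1 * f.1 p.1) * (weight ε p.2 * g.1 p.2))) (volume.prod volume) := by
    refine (f.2.2.mul_prod g.2.2).bdd_mul (c := 2 / κ ^ 2) ?_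
      (Eventually.of_forall fun p => hD.norm_phi_le (hreal p.1) p.2)
    have := hphi.comp (f := fun p : ℝ × ℝ => p.1 - p.2) (by fun_prop)
    simpa [Function.comp_def] using this.aestronglyMeasurable
  have h1 := integral_integral_swap (f := fun x y : ℝ => phi B (x - y) *
      ((weight ε x * f.1 x) * (weight ε y * g.1 y))) hi
  have e1 : ∀ x : ℝ, weight ε x * (f.1 x * (hD.op g).1 x) = ∫ y : ℝ, phi B (x - y) *
      ((weight ε x * f.1 x) * (weight ε y * g.1 y)) := fun x => by
    rw [hD.op_apply, ← integral_const_mul, ← integral_const_mul]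
    congr 1; ext y; ring
  have e2 : ∀ y : ℝ, weight ε y * (g.1 y * (hD.op f).1 y) = ∫ x : ℝ, phi B (x - y) *
      ((weight ε x * f.1 x) * (weight ε y * g.1 y)) := fun y => by
    rw [hD.op_apply, ← integral_const_mul, ← integral_const_mul]
    congr 1; ext x
    rw [← phi_neg ((x : ℂ) - y) (reg_of_diffIm hD.narrow (diffIm_sub (hreal x) (hreal y))), neg_sub]
    ring
  simp only [e1, e2, h1]

/-- Reversal of all chains. -/
lemma chainSum_comm {f g : ℂ → ℂ} {M M' : ℝ} (hf : Continuous fun x : ℝ => f x)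
    (hM : ∀ x : ℝ, ‖f x‖ ≤ M) (hg : Continuous fun x : ℝ => g x) (hM' : ∀ x : ℝ, ‖g x‖ ≤ M') :
    chainSum B ε f g = chainSum B ε g f := by
  have hfa := hD.mem_adm_of_bounded hf hM
  have hga := hD.mem_adm_of_bounded hg hM'
  rw [hD.chainSum_eq hf hM hga, hD.chainSum_eq hg hM' hfa]
  congr 1
  ext n
  have key : ∀ (n : ℕ) (f g : adm ε), ∫ x : ℝ, weight ε x * (f.1 x * ((hD.op ^ n) g).1 x) =
      ∫ x : ℝ, weight ε x * (g.1 x * ((hD.op ^ n) f).1 x) := by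
    intro n
    induction n with
    | zero => intro f g; congr 1; ext x; simp only [pow_zero, Module.End.one_apply]; ring
    | succ n ih =>
      intro f g
      have := ih (hD.op f) g
      rw [← Module.End.mul_apply, ← pow_succ, pow_succ'] at this
      rw [pow_succ', Module.End.mul_apply, hD.pairing_op]
      refine Eq.trans ?_ this
      congr 1; ext x; ring
  exact key n ⟨_, hfa⟩ ⟨_, hga⟩

end IsDressing

/-! ### The derivative of the pseudoenergy -/

section Derivative

variable {B b κ m L : ℝ} {k : ℕ} {θb : Fin k → ℝ} {ε : ℂ → ℂ}

/-- The convolution term of the TBA equation. -/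
def convTerm (B : ℝ) (ε : ℂ → ℂ) (z : ℂ) : ℂ :=
  ∫ y : ℝ, phi B (z - y) * ((lg ε y : ℂ) / (2 * π))

/-- The derivative of the pseudoenergy at a point of the strips. -/
def epsDeriv (B m L : ℝ) (θb : Fin k → ℝ) (ε : ℂ → ℂ) (z : ℂ) : ℂ :=
  m * L * sinh z + ∑ i, I * phi B (z - shifted (θb i)) - deriv (convTerm B ε) z

/-- The analytic form of `e^ε` in the strips, in which the logarithms of `S` have disappeared. -/
def expEps (B m L : ℝ) (θb : Fin k → ℝ) (ε : ℂ → ℂ) (z : ℂ) : ℂ :=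
  exp (m * L * cosh z - convTerm B ε z) * ∏ i, S B (z - shifted (θb i))

lemma continuous_rootKernel (h : IsNarrow B b κ) (y : ℝ) :
    Continuous fun x : ℝ => rootKernel B y x := by
  rw [continuous_iff_continuousAt]
  intro x
  exact ContinuousAt.comp (g := phi B) (f := fun x : ℝ => (x : ℂ) - shifted y)
    (analyticAt_phi (reg_of_diffIm h (diffIm_sub (ofReal_mem_strip h.pos x)
      (shifted_mem_strip h.pos y)))).continuousAt (by fun_prop)

lemma norm_rootKernel_le (h : IsNarrow B b κ) (y x : ℝ) : ‖rootKernel B y x‖ ≤ 2 / κ ^ 2 :=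
  norm_phi_sub_le h (ofReal_mem_strip h.pos x) (shifted_mem_strip h.pos y)

lemma phi_sub_comm (h : IsNarrow B b κ) {z w : ℂ} (hz : z ∈ strip b) (hw : w ∈ strip b) :
    phi B (z - w) = phi B (w - z) := by
  rw [← phi_neg _ (reg_of_diffIm h (diffIm_sub hz hw)), neg_sub]

lemma sinh_shifted (y : ℝ) : sinh (shifted y) = I * cosh y := by
  rw [shifted, Complex.sinh_add, mul_comm I, Complex.cosh_mul_I, Complex.sinh_mul_I,
    ← Complex.ofReal_cos, ← Complex.ofReal_sin, Real.cos_pi_div_two, Real.sin_pi_div_two]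
  push_cast; ring

/-- The two forms of the root kernel differ by a shift of `iπ`, under which `phi B` is odd. -/
lemma rootKernel'_eq (h : IsNarrow B b κ) (y x : ℝ) :
    rootKernel' B y x = -I * rootKernel B y x := by
  have hreg := reg_of_diffIm h (diffIm_sub (ofReal_mem_strip h.pos x) (shifted_mem_strip h.pos y))
  rw [rootKernel', rootKernel, neg_mul, ← mul_neg, ← phi_add_I_pi _ hreg, shifted]
  congr 2
  push_cast; ring

lemma chainSum_rootKernel' (h : IsNarrow B b κ) (y : ℝ) (g : ℂ → ℂ) :
    chainSum B ε (rootKernel' B y) g = -I * chainSum B ε (rootKernel B y) g := by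
  rw [chainSum, chainSum, ← tsum_mul_left]
  congr 1
  ext n
  rw [← integral_const_mul]
  congr 1
  ext x
  rw [chainIntegrand, chainIntegrand, rootKernel'_eq h]
  ring

lemma IsDressing.chainSum_sum_rootKernel (hD : IsDressing B b κ ε) (y : ℝ) (θb : Fin k → ℝ)
    (c : Vec k) : (fun x : ℝ => ∑ i, c i * rootKernel B (θb i) x) ∈ adm ε ∧
      chainSum B ε (rootKernel B y) (fun z => ∑ i, c i * rootKernel B (θb i) z) =
        ∑ i, c i * chainSum B ε (rootKernel B y) (rootKernel B (θb i)) := by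
  have h := hD.narrow
  have hr := fun y => hD.mem_adm_of_bounded (continuous_rootKernel h y) (norm_rootKernel_le h y)
  induction (Finset.univ : Finset (Fin k)) using Finset.induction_on with
  | empty =>
    have h0 : (fun x : ℝ => (0 : ℂ)) ∈ adm ε := (adm ε).zero_mem
    have := hD.chainSum_const_mul (g := fun _ => 0) (continuous_rootKernel h y)
      (norm_rootKernel_le h y) h0 0
    exact ⟨by simpa using h0, by simpa using this⟩
  | insert i s hi ih =>
    simp only [Finset.sum_insert hi]
    have hc := (adm ε).smul_mem (c i) (hr (θb i))
    refine ⟨(adm ε).add_mem hc ih.1, ?_⟩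
    rw [hD.chainSum_add (continuous_rootKernel h y) (norm_rootKernel_le h y) hc ih.1, ih.2,
      hD.chainSum_const_mul (continuous_rootKernel h y) (norm_rootKernel_le h y) (hr (θb i))]

namespace IsPseudoenergy

variable (hε : IsPseudoenergy B m L θb ε)
include hε

lemma integrable_lg_div : Integrable fun y : ℝ => (lg ε y : ℂ) / (2 * π) :=
  hε.integrable_lg.ofReal.div_const _

lemma hasDerivAt_convTerm (h : IsNarrow B b κ) {z : ℂ} (hz : z ∈ strip b) :
    HasDerivAt (convTerm B ε) (deriv (convTerm B ε) z) z :=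
  (hasDerivAt_conv h hε.integrable_lg_div hz).2.differentiableAt.hasDerivAt

lemma eq_of_mem_strip (h : IsNarrow B b κ) {z : ℂ} (hz : z.im = 0 ∨ |z.im - π / 2| < b) :
    ε z = m * L * cosh z + ∑ i, Complex.log (S B (z - shifted (θb i))) -
      convTerm B ε z :=
  hε.eq_sub_integral (hz.imp_right fun h1 => h1.trans h.lt_width)

lemma hasDerivAt_ofReal (h : IsNarrow B b κ) (hB0 : 0 < B) (hB1 : B < 1) (hB : B ≠ 1 / 2) (x : ℝ) :
    HasDerivAt (fun x : ℝ => ε x) (epsDeriv B m L θb ε x) x := by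
  have hx := ofReal_mem_strip h.pos x
  have h1 : HasDerivAt (fun z : ℂ => m * L * cosh z +
      ∑ i, Complex.log (S B (z - shifted (θb i))) - convTerm B ε z)
      (epsDeriv B m L θb ε x) x := by
    refine (((Complex.hasDerivAt_cosh _).const_mul _).add
      (HasDerivAt.fun_sum fun i _ => ?_)).sub (hε.hasDerivAt_convTerm h hx)
    obtain ⟨v, hv, e⟩ := S_sub_shifted hB0 hB1 hB x (θb i)
    have hr := reg_of_diffIm h (diffIm_sub hx (shifted_mem_strip h.pos (θb i)))
    have h2 := ((hasDerivAt_S hr).comp (x : ℂ) ((hasDerivAt_id (x : ℂ)).sub_const _)).clog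
      (by
        change S B (x - shifted (θb i)) ∈ _
        rw [e]; exact Complex.ofReal_mem_slitPlane.2 (by linarith))
    refine h2.congr_deriv ?_
    simp only [Function.comp_def, id]
    rw [mul_one, mul_div_cancel_right₀ _ (S_ne_zero hr)]
  refine h1.comp_ofReal.congr_of_eventuallyEq (Eventually.of_forall fun y => ?_)
  exact hε.eq_of_mem_strip h (Or.inl (Complex.ofReal_im y))

lemma continuous_weight (h : IsNarrow B b κ) (hB0 : 0 < B) (hB1 : B < 1) (hB : B ≠ 1 / 2) :
    Continuous fun x : ℝ => weight ε x := by
  have h1 : Continuous fun x : ℝ => ε x := continuous_iff_continuousAt.2 fun x =>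
    (hε.hasDerivAt_ofReal h hB0 hB1 hB x).continuousAt
  refine continuous_const.mul (continuous_const.div (continuous_const.add h1.cexp) fun x => ?_)
  rw [← hε.ofReal_re x, ← Complex.ofReal_exp]
  exact_mod_cast (by positivity : 1 + Real.exp (ε x).re ≠ 0)

lemma integrable_weight_mul (h : IsNarrow B b κ) (hB0 : 0 < B) (hB1 : B < 1) (hB : B ≠ 1 / 2)
    (hmL : 0 < m * L) (hE : Real.exp (-(m * L)) ≤ 1 / 2) {g : ℝ → ℂ} (hg : Continuous g)
    (hb : ∀ x, ‖g x‖ ≤ 1 + m * L * Real.cosh x) : Integrable (fun x : ℝ => weight ε x * g x) ∧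
      ∫ x : ℝ, ‖weight ε x * g x‖ ≤ 2 * π / (m * L) := by
  have hle : ∀ x : ℝ, ‖weight ε x * g x‖ ≤ 2 / (m * L) * (1 + x ^ 2)⁻¹ := fun x => by
    rw [norm_mul]
    exact (mul_le_mul_of_nonneg_left (hb x) (norm_nonneg _)).trans
      (hε.norm_weight_mul_le h hB0 hB1 hB hmL hE x)
  have hi := integrable_inv_one_add_sq.const_mul (2 / (m * L))
  have hint := hi.mono' ((hε.continuous_weight h hB0 hB1 hB).mul hg).aestronglyMeasurable
    (Eventually.of_forall hle)
  refine ⟨hint, (integral_mono hint.norm hi hle).trans_eq ?_⟩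
  rw [integral_const_mul, integral_univ_inv_one_add_sq]
  ring

lemma integrable_weight (h : IsNarrow B b κ) (hB0 : 0 < B) (hB1 : B < 1) (hB : B ≠ 1 / 2)
    (hmL : 0 < m * L) (hE : Real.exp (-(m * L)) ≤ 1 / 2) : Integrable (fun x : ℝ => weight ε x) ∧
      ∫ x : ℝ, ‖weight ε x‖ ≤ 2 * π / (m * L) := by
  simpa only [mul_one] using hε.integrable_weight_mul h hB0 hB1 hB hmL hE (g := fun _ => 1)
    continuous_const fun x => by
      rw [norm_one]; exact le_add_of_nonneg_right (mul_pos hmL (Real.cosh_pos x)).le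

lemma integrable_weight_mul_source (h : IsNarrow B b κ) (hB0 : 0 < B) (hB1 : B < 1)
    (hB : B ≠ 1 / 2) (hmL : 0 < m * L) (hE : Real.exp (-(m * L)) ≤ 1 / 2) :
    Integrable (fun x : ℝ => weight ε x * source m L x) ∧
      ∫ x : ℝ, ‖weight ε x * source m L x‖ ≤ 2 * π / (m * L) := by
  refine hε.integrable_weight_mul h hB0 hB1 hB hmL hE (by unfold source; fun_prop) fun x => ?_
  rw [source, norm_mul, ← Complex.ofReal_sinh, ← Complex.ofReal_mul, Complex.norm_real,
    Complex.norm_real, Real.norm_of_nonneg hmL.le, Real.norm_eq_abs, Real.abs_sinh]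
  have h1 := Real.cosh_abs x ▸ (Real.sinh_lt_cosh |x|).le
  linarith [mul_le_mul_of_nonneg_left h1 hmL.le]

lemma isDressing (h : IsNarrow B b κ) (hB0 : 0 < B) (hB1 : B < 1) (hB : B ≠ 1 / 2)
    (hmL : 0 < m * L) (hE : Real.exp (-(m * L)) ≤ 1 / 2)
    (hL : 2 / κ ^ 2 * (2 * π / (m * L)) ≤ 1 / 2) : IsDressing B b κ ε := by
  have hi := hε.integrable_weight h hB0 hB1 hB hmL hE
  exact ⟨h, hε.continuous_weight h hB0 hB1 hB, hi.1,
    (mul_le_mul_of_nonneg_left hi.2 (by positivity)).trans hL⟩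

/-- The derivative of `log (1 + e^{-ε})` is `-2π w ε'`. -/
lemma hasDerivAt_lg (h : IsNarrow B b κ) (hB0 : 0 < B) (hB1 : B < 1) (hB : B ≠ 1 / 2) (x : ℝ) :
    HasDerivAt (fun x : ℝ => (lg ε x : ℂ) / (2 * π))
      (-(weight ε x * epsDeriv B m L θb ε x)) x := by
  have h1 := hε.hasDerivAt_ofReal h hB0 hB1 hB x
  have e : 1 + exp (-ε x) = ((1 + Real.exp (-(ε x).re) : ℝ) : ℂ) := by
    push_cast; rw [hε.ofReal_re x]
  have h2 := ((h1.fun_neg.cexp.const_add 1).clog_real (by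
    rw [e]; exact Complex.ofReal_mem_slitPlane.2 (by positivity))).div_const (2 * π : ℂ)
  simp only [hε.log_eq] at h2
  refine h2.congr_deriv ?_
  have hpi : (π : ℂ) ≠ 0 := by exact_mod_cast Real.pi_ne_zero
  have hne : 1 + exp (-ε x) ≠ 0 := by
    rw [e]; exact_mod_cast (by positivity : 1 + Real.exp (-(ε x).re) ≠ 0)
  have hne2 : 1 + exp (ε x) = exp (ε x) * (1 + exp (-ε x)) := by
    rw [mul_add, ← Complex.exp_add, add_neg_cancel, Complex.exp_zero]; ring
  rw [weight, hne2]
  have h3 := Complex.exp_ne_zero (ε x)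
  have h4 : exp (-ε x) = (exp (ε x))⁻¹ := Complex.exp_neg _
  field_simp
  rw [h4]
  field_simp

/-- The driving term `mL sinh` grows, but less than the weight decays. -/
lemma epsDeriv_mem_adm (h : IsNarrow B b κ) (hB0 : 0 < B) (hB1 : B < 1) (hB : B ≠ 1 / 2)
    (hmL : 0 < m * L) (hE : Real.exp (-(m * L)) ≤ 1 / 2) :
    (fun x : ℝ => source m L x) ∈ adm ε ∧ (fun x : ℝ => epsDeriv B m L θb ε x) ∈ adm ε := by
  have hwi := (hε.integrable_weight h hB0 hB1 hB hmL hE).1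
  have hs : (fun x : ℝ => source m L x) ∈ adm ε :=
    ⟨by unfold source; fun_prop, (hε.integrable_weight_mul_source h hB0 hB1 hB hmL hE).1⟩
  have hbd : ∀ {g : ℝ → ℂ} {M : ℝ}, Continuous g → (∀ x, ‖g x‖ ≤ M) → g ∈ adm ε := fun hg hM =>
    ⟨hg, hwi.mul_bdd hg.aestronglyMeasurable (Eventually.of_forall hM)⟩
  have hconv : (fun x : ℝ => deriv (convTerm B ε) x) ∈ adm ε := by
    have hd : DifferentiableOn ℂ (convTerm B ε) (strip b) := fun z hz =>
      (hε.hasDerivAt_convTerm h hz).differentiableAt.differentiableWithinAt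
    refine hbd (M := (∫ y : ℝ, 2 / κ ^ 2 * ‖(lg ε y : ℂ) / (2 * π)‖) / (b / 2)) ?_ fun x => ?_
    · rw [continuous_iff_continuousAt]
      intro x
      exact ContinuousAt.comp (g := deriv (convTerm B ε)) (f := fun x : ℝ => (x : ℂ))
        ((hd.analyticAt (isOpen_strip.mem_nhds (ofReal_mem_strip h.pos x))).deriv.continuousAt)
        Complex.continuous_ofReal.continuousAt
    · have hb := h.pos
      have hball : closedBall (x : ℂ) (b / 2) ⊆ strip b := fun z hz => by
        rw [Metric.mem_closedBall, dist_eq_norm] at hz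
        have := (Complex.abs_im_le_norm _).trans hz
        rw [Complex.sub_im, Complex.ofReal_im, sub_zero] at this
        exact Or.inl (by linarith)
      refine Complex.norm_deriv_le_of_forall_mem_sphere_norm_le (by linarith) ?_ fun z hz => ?_
      · refine DifferentiableOn.diffContOnCl (hd.mono ?_)
        rw [closure_ball _ (by linarith)]
        exact hball
      · refine norm_integral_le_of_norm_le (hε.integrable_lg_div.norm.const_mul _)
          (Eventually.of_forall fun y => ?_)
        rw [norm_mul]
        exact mul_le_mul_of_nonneg_right (norm_phi_sub_le h (hball (Metric.sphere_subset_closedBall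
          hz)) (ofReal_mem_strip h.pos y)) (norm_nonneg _)
  refine ⟨hs, (adm ε).sub_mem ((adm ε).add_mem hs ?_) hconv⟩
  have : (fun x : ℝ => ∑ i, I * phi B (x - shifted (θb i))) =
      ∑ i, fun x : ℝ => I * rootKernel B (θb i) x := by
    ext x; rw [Finset.sum_apply]; rfl
  rw [this]
  exact (adm ε).sum_mem fun i _ => (adm ε).smul_mem I
    (hbd (continuous_rootKernel h _) (norm_rootKernel_le h _))

/-- Integration by parts in the convolution term. -/
lemma deriv_convTerm (h : IsNarrow B b κ) (hB0 : 0 < B) (hB1 : B < 1) (hB : B ≠ 1 / 2)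
    (hmL : 0 < m * L) (hE : Real.exp (-(m * L)) ≤ 1 / 2) {z : ℂ} (hz : z ∈ strip b) :
    deriv (convTerm B ε) z =
      -∫ y : ℝ, phi B (z - y) * (weight ε y * epsDeriv B m L θb ε y) := by
  have h1 := hasDerivAt_conv h hε.integrable_lg_div hz
  have hadm := (hε.epsDeriv_mem_adm h hB0 hB1 hB hmL hE).2
  have hv : ∀ y : ℝ, HasDerivAt (fun y : ℝ => -phi B (z - y)) (deriv (phi B) (z - y)) y := by
    intro y
    have hr := reg_of_diffIm h (diffIm_sub hz (ofReal_mem_strip h.pos y))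
    have := ((analyticAt_phi hr).differentiableAt.hasDerivAt.comp (y : ℂ)
      ((hasDerivAt_id (y : ℂ)).const_sub z)).neg.comp_ofReal
    simpa using this
  have hphi : ∀ᵐ y : ℝ, ‖-phi B (z - y)‖ ≤ 2 / κ ^ 2 := Eventually.of_forall fun y => by
    rw [norm_neg]; exact norm_phi_sub_le h hz (ofReal_mem_strip h.pos y)
  have hphim := (continuous_phi_sub h hz).neg.aestronglyMeasurable (μ := volume)
  have h2 := integral_mul_deriv_eq_deriv_mul_of_integrable
    (u := fun y : ℝ => (lg ε y : ℂ) / (2 * π)) (v := fun y : ℝ => -phi B (z - y))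
    (fun y _ => hε.hasDerivAt_lg h hB0 hB1 hB y) (fun y _ => hv y)
    (h1.1.congr (Eventually.of_forall fun y => mul_comm _ _))
    (hadm.2.neg.mul_bdd hphim hphi) (hε.integrable_lg_div.mul_bdd hphim hphi)
  have h3 : HasDerivAt (convTerm B ε) _ z := h1.2
  rw [h3.deriv]
  simp only [neg_mul_neg] at h2
  calc _ = ∫ y : ℝ, (lg ε y : ℂ) / (2 * π) * deriv (phi B) (z - y) := by
        congr 1; ext y; ring
    _ = _ := by
        rw [h2]; congr 2; ext y; ring

/-- Pairings with `ε'` are chain sums, because `ε'` solves the dressing equation. -/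
lemma integral_phi_epsDeriv (hD : IsDressing B b κ ε) (hB0 : 0 < B) (hB1 : B < 1) (hB : B ≠ 1 / 2)
    (hmL : 0 < m * L) (hE : Real.exp (-(m * L)) ≤ 1 / 2) (y : ℝ) :
    ∫ x : ℝ, phi B (shifted y - x) * (weight ε x * epsDeriv B m L θb ε x) =
      chainSum B ε (rootKernel B y) (source m L) +
        I * ∑ i, chainSum B ε (rootKernel B y) (rootKernel B (θb i)) := by
  have h := hD.narrow
  obtain ⟨hs, hadm⟩ := hε.epsDeriv_mem_adm h hB0 hB1 hB hmL hE
  have hsum := hD.chainSum_sum_rootKernel y θb fun _ => I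
  have h1 := hD.chainSum_eq_of_eq (continuous_rootKernel h y) (norm_rootKernel_le h y)
    (g := fun z => source m L z + ∑ i, I * rootKernel B (θb i) z)
    ((adm ε).add_mem hs hsum.1) hadm fun x => by
      rw [epsDeriv,
        hε.deriv_convTerm h hB0 hB1 hB hmL hE (ofReal_mem_strip h.pos x), sub_neg_eq_add]
      rfl
  rw [hD.chainSum_add (continuous_rootKernel h y) (norm_rootKernel_le h y) hs hsum.1,
    hsum.2, ← Finset.mul_sum] at h1
  rw [h1]
  congr 1
  ext x
  rw [rootKernel, phi_sub_comm h (ofReal_mem_strip h.pos x) (shifted_mem_strip h.pos y)]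
  ring

lemma exp_eq (h : IsNarrow B b κ) {z : ℂ} (hz : |z.im - π / 2| < b) :
    exp (ε z) = expEps B m L θb ε z := by
  rw [hε.eq_of_mem_strip h (Or.inr hz), expEps, add_sub_right_comm, Complex.exp_add,
    Complex.exp_sum]
  congr 1
  refine Finset.prod_congr rfl fun i _ => Complex.exp_log (S_ne_zero ?_)
  exact reg_of_diffIm h (diffIm_sub (Or.inr hz) (shifted_mem_strip h.pos _))

lemma hasDerivAt_expEps (h : IsNarrow B b κ) {z : ℂ} (hz : z ∈ strip b) :
    HasDerivAt (expEps B m L θb ε) (expEps B m L θb ε z * epsDeriv B m L θb ε z) z := by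
  have hr : ∀ i, Reg B (z - shifted (θb i)) := fun i =>
    reg_of_diffIm h (diffIm_sub hz (shifted_mem_strip h.pos _))
  have h1 : HasDerivAt (fun z => exp (m * L * cosh z - convTerm B ε z)) _ z :=
    ((((Complex.hasDerivAt_cosh z).const_mul (m * L : ℂ)).sub (hε.hasDerivAt_convTerm h hz))).cexp
  have h2 : HasDerivAt (fun z => ∏ i, S B (z - shifted (θb i))) _ z :=
    HasDerivAt.fun_finsetProd (f := fun i z => S B (z - shifted (θb i)))
      (f' := fun i => I * phi B (z - shifted (θb i)) * S B (z - shifted (θb i)) * 1)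
      fun i _ => HasDerivAt.comp (h₂ := S B) (h := fun z => z - shifted (θb i)) z
        (hasDerivAt_S (hr i)) ((hasDerivAt_id z).sub_const (shifted (θb i)))
  refine (h1.mul h2).congr_deriv ?_
  have h3 : ∀ i, (∏ j ∈ Finset.univ.erase i, S B (z - shifted (θb j))) *
      S B (z - shifted (θb i)) = ∏ j, S B (z - shifted (θb j)) := fun i =>
    Finset.prod_erase_mul _ _ (Finset.mem_univ i)
  have h4 : ∑ i, (∏ j ∈ Finset.univ.erase i, S B (z - shifted (θb j))) •
      (I * phi B (z - shifted (θb i)) * S B (z - shifted (θb i)) * 1) =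
      (∏ j, S B (z - shifted (θb j))) * ∑ i, I * phi B (z - shifted (θb i)) := by
    rw [Finset.mul_sum]
    refine Finset.sum_congr rfl fun i _ => ?_
    rw [← h3 i, smul_eq_mul]; ring
  simp only [Pi.sub_apply]
  rw [h4, expEps, epsDeriv]
  ring

/-- The residue factors: the derivative of `e^ε` at a quantized root. -/
lemma hasDerivAt_exp_shifted (hD : IsDressing B b κ ε) (hB0 : 0 < B) (hB1 : B < 1) (hB : B ≠ 1 / 2)
    (hmL : 0 < m * L) (hE : Real.exp (-(m * L)) ≤ 1 / 2) {y : ℝ}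
    (hy : exp (ε (shifted y)) = -1) :
    HasDerivAt (fun z => exp (ε z))
      (-(I * (dressedN B m L ε y + ∑ i, dressedPhi B ε y (θb i)))) (shifted y) := by
  have h := hD.narrow
  have hmem : |(shifted y).im - π / 2| < b := by simpa [shifted_im] using h.pos
  have h1 := hε.hasDerivAt_expEps h (Or.inr hmem : shifted y ∈ strip b)
  rw [← hε.exp_eq h hmem, hy] at h1
  have hev : (fun z => exp (ε z)) =ᶠ[𝓝 (shifted y)] expEps B m L θb ε := by
    have hop : IsOpen {z : ℂ | |z.im - π / 2| < b} :=
      isOpen_lt ((Complex.continuous_im.sub continuous_const).abs) continuous_const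
    filter_upwards [hop.mem_nhds hmem] with z hz using hε.exp_eq h hz
  refine (h1.congr_of_eventuallyEq hev).congr_deriv ?_
  have hr := fun y => hD.mem_adm_of_bounded (continuous_rootKernel h y) (norm_rootKernel_le h y)
  have hs := (hε.epsDeriv_mem_adm h hB0 hB1 hB hmL hE).1
  have e2 : ∀ i, phi B (shifted y - shifted (θb i)) = phi B ((y : ℂ) - θb i) := fun i => by
    rw [shifted, shifted]; congr 1; ring
  rw [epsDeriv, hε.deriv_convTerm h hB0 hB1 hB hmL hE (shifted_mem_strip h.pos y),
    hε.integral_phi_epsDeriv hD hB0 hB1 hB hmL hE, sinh_shifted, dressedN,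
    chainSum_rootKernel' h]
  simp only [dressedPhi, e2, Finset.sum_add_distrib, Finset.mul_sum, mul_add]
  rw [← Finset.mul_sum]
  linear_combination (-chainSum B ε (rootKernel B y) (source m L)) * Complex.I_sq

end IsPseudoenergy

end Derivative

/-! ### Dependence of the pseudoenergy on the roots -/

section Jacobian

lemma norm_sub_le_of_hasDerivAt {E : Type*} [NormedAddCommGroup E] [NormedSpace ℝ E] {f f' : ℝ → E}
    {C u v : ℝ} (hd : ∀ t ∈ Set.uIcc v u, HasDerivAt f (f' t) t)
    (hC : ∀ t ∈ Set.uIcc v u, ‖f' t‖ ≤ C) : ‖f u - f v‖ ≤ C * |u - v| :=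
  (convex_uIcc v u).norm_image_sub_le_of_norm_hasDerivWithin_le
    (fun t ht => (hd t ht).hasDerivWithinAt) hC Set.left_mem_uIcc Set.right_mem_uIcc

lemma norm_sub_sub_le_of_hasDerivAt {E : Type*} [NormedAddCommGroup E] [NormedSpace ℝ E]
    {f f' : ℝ → E} {C u v : ℝ} (hC0 : 0 ≤ C) (hd : ∀ t ∈ Set.uIcc v u, HasDerivAt f (f' t) t)
    (hC : ∀ t ∈ Set.uIcc v u, ‖f' t - f' v‖ ≤ C * |t - v|) :
    ‖f u - f v - (u - v) • f' v‖ ≤ C * (u - v) ^ 2 := by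
  have h := norm_sub_le_of_hasDerivAt (f := fun t => f t - t • f' v) (f' := fun t => f' t - f' v)
    (C := C * |u - v|) (u := u) (v := v)
    (fun t ht => ((hd t ht).sub ((hasDerivAt_id t).smul_const (f' v))).congr_deriv (by simp))
    fun t ht => (hC t ht).trans (mul_le_mul_of_nonneg_left (Set.abs_sub_left_of_mem_uIcc ht) hC0)
  rw [mul_assoc, ← abs_mul, ← sq, abs_of_nonneg (sq_nonneg (u - v))] at h
  convert h using 2
  rw [sub_smul]; abel

/-- The first and second order Taylor estimates of `log (1 + e^{-u})`. -/
lemma log_one_add_exp_neg_sub {u v c : ℝ} (hu : Real.exp (-u) ≤ c) (hv : Real.exp (-v) ≤ c) :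
    |Real.log (1 + Real.exp (-u)) - Real.log (1 + Real.exp (-v))| ≤ c * |u - v| ∧
    |Real.log (1 + Real.exp (-u)) - Real.log (1 + Real.exp (-v)) +
      (u - v) * (1 / (1 + Real.exp v))| ≤ c * (u - v) ^ 2 := by
  have hc : ∀ t ∈ Set.uIcc v u, Real.exp (-t) ≤ c := fun t ht => by
    rcases le_total v u with h | h
    · rw [Set.uIcc_of_le h] at ht
      exact (Real.exp_le_exp.2 (neg_le_neg ht.1)).trans hv
    · rw [Set.uIcc_of_ge h] at ht
      exact (Real.exp_le_exp.2 (neg_le_neg ht.1)).trans hu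
  have hd : ∀ t : ℝ, HasDerivAt (fun t => Real.log (1 + Real.exp (-t)))
      (-(1 / (1 + Real.exp t))) t := fun t => by
    refine (((hasDerivAt_neg t).exp.const_add 1).log (by positivity)).congr_deriv ?_
    rw [Real.exp_neg]
    have := Real.exp_pos t
    field_simp
    ring
  have hd2 : ∀ t : ℝ, HasDerivAt (fun t => -(1 / (1 + Real.exp t)))
      (Real.exp t / (1 + Real.exp t) ^ 2) t := fun t => by
    have h1 : HasDerivAt (fun t => 1 + Real.exp t) (Real.exp t) t :=
      (Real.hasDerivAt_exp t).const_add 1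
    have := (h1.fun_inv (by positivity)).fun_neg
    simp only [neg_div, neg_neg] at this
    simpa only [one_div] using this
  have hb : ∀ t : ℝ, 1 / (1 + Real.exp t) ≤ Real.exp (-t) := fun t => by
    rw [Real.exp_neg, ← one_div]
    exact one_div_le_one_div_of_le (Real.exp_pos t) (by linarith)
  constructor
  · refine norm_sub_le_of_hasDerivAt (fun t _ => hd t) fun t ht => ?_
    rw [norm_neg, Real.norm_of_nonneg (by positivity)]
    exact (hb t).trans (hc t ht)
  · have := norm_sub_sub_le_of_hasDerivAt (u := u) (v := v) ((Real.exp_pos _).le.trans hu)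
      (fun t _ => hd t) fun t ht => norm_sub_le_of_hasDerivAt (C := c) (fun t _ => hd2 t)
        fun s hs => by
          have hs' : s ∈ Set.uIcc v u := Set.uIcc_subset_uIcc_left ht hs
          rw [Real.norm_of_nonneg (by positivity)]
          refine le_trans ?_ ((hb s).trans (hc s hs'))
          rw [div_le_div_iff₀ (by positivity) (by positivity)]
          nlinarith [Real.exp_pos s]
    rw [smul_eq_mul, mul_neg, sub_neg_eq_add] at this
    exact this

variable {B b κ m L : ℝ} {k : ℕ}

lemma hasDerivAt_sub_shifted (z : ℂ) (t : ℝ) : HasDerivAt (fun t : ℝ => z - shifted t) (-1) t :=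
  (((hasDerivAt_id t).ofReal_comp).add_const _).const_sub _

/-- The root kernel is Lipschitz in the root, uniformly on the real line. -/
lemma norm_rootKernel_sub_le (h : IsNarrow B b κ) (x y y' : ℝ) :
    ‖rootKernel B y x - rootKernel B y' x‖ ≤ 2 / κ ^ 2 / (b / 2) * |y - y'| := by
  have hb := h.pos
  have him : ∀ t : ℝ, ((x : ℂ) - shifted t).im = -(π / 2) := fun t => by
    simp [shifted_im]
  have hd : ∀ t : ℝ, HasDerivAt (fun t : ℝ => rootKernel B t x)
      (-deriv (phi B) (x - shifted t)) t := fun t => by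
    have hr := reg_of_diffIm h (diffIm_sub (ofReal_mem_strip hb x) (shifted_mem_strip hb t))
    have := HasDerivAt.comp (h₂ := phi B) t (analyticAt_phi hr).differentiableAt.hasDerivAt
      (hasDerivAt_sub_shifted x t)
    rwa [mul_neg_one] at this
  refine norm_sub_le_of_hasDerivAt (fun t _ => hd t) fun t _ => ?_
  have hmem : ∀ z ∈ closedBall ((x : ℂ) - shifted t) (b / 2), diffIm b z.im := fun z hz => by
    rw [Metric.mem_closedBall, dist_eq_norm] at hz
    have := (Complex.abs_im_le_norm _).trans hz
    rw [Complex.sub_im, him, sub_neg_eq_add] at this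
    exact Or.inr (Or.inr (by linarith))
  rw [norm_neg]
  refine Complex.norm_deriv_le_of_forall_mem_sphere_norm_le (by linarith) ?_ fun z hz => ?_
  · refine DifferentiableOn.diffContOnCl fun z hz => ?_
    rw [closure_ball _ (by linarith)] at hz
    exact (analyticAt_phi (reg_of_diffIm h (hmem z hz))).differentiableAt.differentiableWithinAt
  · refine (norm_phi_le h (hmem z (Metric.sphere_subset_closedBall hz))).trans ?_
    have := h.kpos
    exact div_le_div_of_nonneg_left zero_le_two (by positivity)
      (le_mul_of_one_le_right (by positivity) (Real.one_le_cosh _))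

/-- The source terms of the TBA equation on the real line. -/
def rootLog (B : ℝ) (y : ℝ) (x : ℝ) : ℂ := Complex.log (S B (x - shifted y))

/-- The first and second order Taylor estimates of the source terms in the root. -/
lemma rootLog_sub (h : IsNarrow B b κ) (hB0 : 0 < B) (hB1 : B < 1) (hB : B ≠ 1 / 2) (x y y' : ℝ) :
    ‖rootLog B y x - rootLog B y' x‖ ≤ 2 / κ ^ 2 * |y - y'| ∧
    ‖rootLog B y x - rootLog B y' x - (y - y') • (-I * rootKernel B y' x)‖ ≤
      2 / κ ^ 2 / (b / 2) * (y - y') ^ 2 := by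
  have hb := h.pos
  have hk := h.kpos
  have hd : ∀ t : ℝ, HasDerivAt (fun t : ℝ => rootLog B t x)
      (-I * rootKernel B t x) t := fun t => by
    have hr := reg_of_diffIm h (diffIm_sub (ofReal_mem_strip hb x) (shifted_mem_strip hb t))
    obtain ⟨v, hv, e⟩ := S_sub_shifted hB0 hB1 hB x t
    have h2 : HasDerivAt (fun t : ℝ => S B (x - shifted t))
        (I * phi B (x - shifted t) * S B (x - shifted t) * -1) t :=
      HasDerivAt.comp (h₂ := S B) t (hasDerivAt_S hr) (hasDerivAt_sub_shifted x t)
    have h3 := h2.clog_real (by rw [e]; exact Complex.ofReal_mem_slitPlane.2 (by linarith))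
    refine h3.congr_deriv ?_
    rw [mul_right_comm, mul_div_cancel_right₀ _ (S_ne_zero hr), rootKernel]
    ring
  have hI : ∀ z : ℂ, ‖-I * z‖ = ‖z‖ := fun z => by simp
  refine ⟨norm_sub_le_of_hasDerivAt (f := fun t => rootLog B t x) (fun t _ => hd t) fun t _ => ?_,
    norm_sub_sub_le_of_hasDerivAt (f := fun t => rootLog B t x)
      (f' := fun t : ℝ => -I * rootKernel B t x) (by positivity) (fun t _ => hd t)
      fun t _ => ?_⟩
  · rw [hI]; exact norm_rootKernel_le h t x
  · rw [← mul_sub, hI]; exact norm_rootKernel_sub_le h x t y'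

/-- The difference of the integrands of the convolution terms. -/
def lgDiff (ε ε' : ℂ → ℂ) (y : ℝ) : ℂ := ((lg ε y - lg ε' y : ℝ) : ℂ) / (2 * π)

lemma convTerm_sub (h : IsNarrow B b κ) {p q : Fin k → ℝ} {ε ε' : ℂ → ℂ}
    (hε : IsPseudoenergy B m L p ε) (hε' : IsPseudoenergy B m L q ε') {z : ℂ} (hz : z ∈ strip b) :
    Integrable (lgDiff ε ε') ∧
    convTerm B ε z - convTerm B ε' z = ∫ y : ℝ, phi B (z - y) * lgDiff ε ε' y := by
  have hi : ∀ {p : Fin k → ℝ} {ε}, IsPseudoenergy B m L p ε →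
      Integrable fun y : ℝ => phi B (z - y) * ((lg ε y : ℂ) / (2 * π)) := fun hε =>
    hε.integrable_lg_div.bdd_mul (continuous_phi_sub h hz).aestronglyMeasurable
      (Eventually.of_forall fun y => norm_phi_sub_le h hz (ofReal_mem_strip h.pos y))
  refine ⟨(hε.integrable_lg_div.sub hε'.integrable_lg_div).congr (Eventually.of_forall fun y => ?_),
    ?_⟩
  · simp only [lgDiff, Pi.sub_apply]; push_cast; ring
  · rw [convTerm, convTerm, ← integral_sub (hi hε) (hi hε')]
    congr 1; ext y
    simp only [lgDiff]; push_cast; ring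

/-- The response of the convolution term at a root to a displacement of the roots, to first order.
The difference `Δ` of the pseudoenergies is of first order by contraction, and solves the dressing
equation for the displaced source up to an error of second order. -/
theorem norm_response_sub_le (h : IsNarrow B b κ) (hB0 : 0 < B) (hB1 : B < 1) (hB : B ≠ 1 / 2)
    (hmL : 0 < m * L) (hE : Real.exp (-(m * L)) ≤ 1 / 2)
    (hL : 2 / κ ^ 2 * (2 * π / (m * L)) ≤ 1 / 2) {q : Fin k → ℝ} {ε' : ℂ → ℂ}
    (hε' : IsPseudoenergy B m L q ε') (j : Fin k) : ∃ C, ∀ (p : Fin k → ℝ) (ε : ℂ → ℂ),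
    IsPseudoenergy B m L p ε →
      ‖convTerm B ε (shifted (p j)) - convTerm B ε' (shifted (p j)) - ∑ i, ((p i - q i : ℝ) : ℂ) *
        (I * chainSum B ε' (rootKernel B (q j)) (rootKernel B (q i)))‖ ≤
      C * ‖p - q‖ ^ 2 := by
  have hk := h.kpos
  have hb := h.pos
  have hpi := Real.pi_pos
  have hD := hε'.isDressing h hB0 hB1 hB hmL hE hL
  set M := 2 / κ ^ 2 with hM
  set M₁ := M / (b / 2) with hM1
  have hM0 : 0 < M := by positivity
  have hM10 : 0 < M₁ := by positivity
  set A := 2 * (k * M) with hA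
  have hA0 : 0 ≤ A := by positivity
  refine ⟨M₁ * k + A ^ 2 / 2 + (k * M₁ + A ^ 2 / 2), fun p ε hε => ?_⟩
  set δ := ‖p - q‖
  have hδ : ∀ i, |p i - q i| ≤ δ := fun i => by simpa using norm_le_pi_norm (p - q) i
  have hδ0 : 0 ≤ δ := norm_nonneg _
  set d := lgDiff ε ε'
  have hreal := fun x : ℝ => ofReal_mem_strip hb x
  have hdi : Integrable d := (convTerm_sub h hε hε' (hreal 0)).1
  set Δ : ℝ → ℂ := fun x => ε x - ε' x with hΔ
  -- an integrable majorant of the weights, whose product with the kernel bound is a contraction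
  set N : ℝ → ℝ := fun x => 2 / (m * L) * (1 + x ^ 2)⁻¹ with hN
  have hN0 : ∀ x, 0 ≤ N x := fun x => by positivity
  have hNi : Integrable N := integrable_inv_one_add_sq.const_mul _
  have hNM : M * ∫ x, N x ≤ 1 / 2 := by
    rw [hN, integral_const_mul, integral_univ_inv_one_add_sq]
    refine le_trans (le_of_eq ?_) hL
    ring
  have hΔeq : ∀ x, Δ x = ∑ i, (rootLog B (p i) x - rootLog B (q i) x) -
      ∫ y : ℝ, phi B (x - y) * d y := fun x => by
    rw [← (convTerm_sub h hε hε' (hreal x)).2]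
    simp only [hΔ]
    rw [hε.eq_of_mem_strip h (Or.inl (Complex.ofReal_im x)),
      hε'.eq_of_mem_strip h (Or.inl (Complex.ofReal_im x)), Finset.sum_sub_distrib]
    simp only [rootLog]
    ring
  have hphi : ∀ {z : ℂ}, z ∈ strip b → ∀ {g : ℝ → ℂ}, Integrable g →
      Integrable (fun y : ℝ => phi B (z - y) * g y) ∧
      ‖∫ y : ℝ, phi B (z - y) * g y‖ ≤ M * ∫ y, ‖g y‖ := fun hz g hg => by
    refine ⟨hg.bdd_mul (continuous_phi_sub h hz).aestronglyMeasurable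
      (Eventually.of_forall fun y => norm_phi_sub_le h hz (hreal y)), ?_⟩
    rw [← integral_const_mul]
    refine norm_integral_le_of_norm_le (hg.norm.const_mul _) (Eventually.of_forall fun y => ?_)
    rw [norm_mul]
    exact mul_le_mul_of_nonneg_right (norm_phi_sub_le h hz (hreal y)) (norm_nonneg _)
  -- pointwise bounds for the difference of the integrands, to first and second order
  have hpt : ∀ x, ‖d x‖ ≤ N x * ‖Δ x‖ ∧ ‖d x + weight ε' x * Δ x‖ ≤ N x * ‖Δ x‖ ^ 2 := fun x => by
    have hΔx : Δ x = (((ε x).re - (ε' x).re : ℝ) : ℂ) := by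
      rw [Complex.ofReal_sub, hε.ofReal_re, hε'.ofReal_re]
    have h1 := log_one_add_exp_neg_sub (hε.exp_neg_le h hB0 hB1 hB hmL hE x)
      (hε'.exp_neg_le h hB0 hB1 hB hmL hE x)
    have hw : weight ε' x = ((1 / (2 * π) * (1 / (1 + Real.exp (ε' x).re)) : ℝ) : ℂ) := by
      rw [weight]; push_cast; rw [hε'.ofReal_re x]
    have hd : d x = ((1 / (2 * π) * (lg ε x - lg ε' x) : ℝ) : ℂ) := by
      simp only [d, lgDiff]; push_cast; ring
    have hNx : 1 / (2 * π) * (2 * Real.exp (-(m * L * Real.cosh x))) ≤ N x := by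
      have h0 : 0 < m * L * Real.cosh x := mul_pos hmL (Real.cosh_pos x)
      calc _ = 1 / π * (Real.exp (-(m * L * Real.cosh x)) * 1) := by field_simp
        _ ≤ 1 / π * (Real.exp (-(m * L * Real.cosh x)) * (1 + m * L * Real.cosh x)) := by
          gcongr; linarith
        _ ≤ _ := IsPseudoenergy.exp_neg_cosh_le hmL x
    rw [hΔx, hw, hd, ← Complex.ofReal_mul, ← Complex.ofReal_add, Complex.norm_real,
      Complex.norm_real, Complex.norm_real, Real.norm_eq_abs, Real.norm_eq_abs, Real.norm_eq_abs,
      sq_abs, abs_mul, abs_of_pos (by positivity : 0 < 1 / (2 * π))]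
    refine ⟨(mul_le_mul_of_nonneg_left h1.1 (by positivity)).trans ?_, ?_⟩
    · rw [← mul_assoc]; gcongr
    · rw [show ∀ a b c : ℝ, 1 / (2 * π) * a + 1 / (2 * π) * b * c =
        1 / (2 * π) * (a + c * b) from fun a b c => by ring, abs_mul,
        abs_of_pos (by positivity : 0 < 1 / (2 * π))]
      refine (mul_le_mul_of_nonneg_left h1.2 (by positivity)).trans ?_
      rw [← mul_assoc]; gcongr
  -- the contraction estimate
  have hs0 : ∀ x, ‖Δ x‖ ≤ k * M * δ + M * ∫ y, ‖d y‖ := fun x => by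
    rw [hΔeq]
    refine (norm_sub_le _ _).trans (add_le_add ?_ (hphi (hreal x) hdi).2)
    refine (norm_sum_le_of_le (n := fun _ => M * δ) _ fun i _ =>
      (rootLog_sub h hB0 hB1 hB x (p i) (q i)).1.trans
        (mul_le_mul_of_nonneg_left (hδ i) hM0.le)).trans_eq ?_
    simp [mul_assoc]
  have hs1 : M * ∫ y, ‖d y‖ ≤ k * M * δ := by
    have h1 : ∫ y, ‖d y‖ ≤ ∫ y, N y * (k * M * δ + M * ∫ y, ‖d y‖) :=
      integral_mono hdi.norm (hNi.mul_const _) fun y =>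
        (hpt y).1.trans (mul_le_mul_of_nonneg_left (hs0 y) (hN0 y))
    rw [integral_mul_const] at h1
    have h2 := mul_le_mul_of_nonneg_left h1 hM0.le
    have h3 : 0 ≤ k * M * δ + M * ∫ y, ‖d y‖ := (norm_nonneg _).trans (hs0 0)
    have h4 := mul_le_mul_of_nonneg_right hNM h3
    linarith
  have hΔb : ∀ x, ‖Δ x‖ ≤ A * δ := fun x => (hs0 x).trans (by rw [hA]; linarith)
  have hΔc : Continuous Δ := continuous_iff_continuousAt.2 fun x =>
    (hε.hasDerivAt_ofReal h hB0 hB1 hB x).continuousAt.sub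
      (hε'.hasDerivAt_ofReal h hB0 hB1 hB x).continuousAt
  have hΔa : Δ ∈ adm ε' := hD.mem_adm_of_bounded hΔc hΔb
  -- the error of the linearisation `d ≈ -w Δ`
  set r : ℝ → ℂ := fun x => d x + weight ε' x * Δ x
  have hri : Integrable r := hdi.add hΔa.2
  have hr : M * ∫ y, ‖r y‖ ≤ A ^ 2 / 2 * δ ^ 2 := by
    have h1 : ∫ y, ‖r y‖ ≤ ∫ y, N y * (A * δ) ^ 2 :=
      integral_mono hri.norm (hNi.mul_const _) fun y => (hpt y).2.trans
        (mul_le_mul_of_nonneg_left (pow_le_pow_left₀ (norm_nonneg _) (hΔb y) 2) (hN0 y))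
    rw [integral_mul_const] at h1
    nlinarith [mul_le_mul_of_nonneg_left h1 hM0.le,
      mul_le_mul_of_nonneg_right hNM (sq_nonneg (A * δ))]
  have hsplit : ∀ {z : ℂ}, z ∈ strip b → ∫ y : ℝ, phi B (z - y) * d y =
      (∫ y : ℝ, phi B (z - y) * r y) - ∫ y : ℝ, phi B (z - y) * (weight ε' y * Δ y) := fun hz => by
    rw [← integral_sub (hphi hz hri).1 (hphi hz hΔa.2).1]
    congr 1; ext y
    simp only [r]; ring
  -- the dressing equation for the difference of the pseudoenergies
  set c : Vec k := fun i => (p i - q i) • -I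
  obtain ⟨hca, hcs⟩ := hD.chainSum_sum_rootKernel (q j) q c
  set R : ℝ → ℂ := fun x => Δ x - (∫ y : ℝ, phi B (x - y) * (weight ε' y * Δ y)) -
    ∑ i, c i * rootKernel B (q i) x with hR
  have hRa : R ∈ adm ε' :=
    (adm ε').sub_mem ((adm ε').sub_mem hΔa (hD.op ⟨Δ, hΔa⟩).2) hca
  have hRb : ∀ x, ‖R x‖ ≤ (k * M₁ + A ^ 2 / 2) * δ ^ 2 := fun x => by
    have e : R x = ∑ i, (rootLog B (p i) x - rootLog B (q i) x -
        (p i - q i) • (-I * rootKernel B (q i) x)) - ∫ y : ℝ, phi B (x - y) * r y := by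
      simp only [hR]
      rw [hΔeq, hsplit (hreal x)]
      simp only [Finset.sum_sub_distrib, c, smul_mul_assoc]
      ring
    rw [e, add_mul]
    refine (norm_sub_le _ _).trans (add_le_add ?_ ((hphi (hreal x) hri).2.trans hr))
    refine (norm_sum_le_of_le (n := fun _ => M₁ * δ ^ 2) _ fun i _ =>
      (rootLog_sub h hB0 hB1 hB x (p i) (q i)).2.trans ?_).trans_eq (by simp [mul_assoc])
    rw [← sq_abs (p i - q i)]
    exact mul_le_mul_of_nonneg_left (pow_le_pow_left₀ (abs_nonneg _) (hδ i) 2) hM10.le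
  have hRa' : (fun x : ℝ => (fun z : ℂ => R z.re) x) ∈ adm ε' := by simpa using hRa
  have hrk := continuous_rootKernel h (q j)
  have hrkb := norm_rootKernel_le h (q j)
  have hchain := hD.chainSum_eq_of_eq hrk hrkb
    (g := fun z => ∑ i, c i * rootKernel B (q i) z + R z.re) ((adm ε').add_mem hca hRa') hΔa
    fun x => by simp only [hR, Complex.ofReal_re]; ring
  rw [hD.chainSum_add hrk hrkb hca hRa', hcs] at hchain
  have hCR : ‖chainSum B ε' (rootKernel B (q j)) fun z => R z.re‖ ≤
      (k * M₁ + A ^ 2 / 2) * δ ^ 2 := by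
    refine (hD.norm_chainSum_le hrk hrkb hRa').trans ?_
    have h1 : ∫ x : ℝ, ‖weight ε' x * R (x : ℂ).re‖ ≤
        ∫ x : ℝ, ‖weight ε' x‖ * ((k * M₁ + A ^ 2 / 2) * δ ^ 2) :=
      integral_mono hRa'.2.norm (hD.int.norm.mul_const _) fun x => by
        simp only [norm_mul, Complex.ofReal_re]
        exact mul_le_mul_of_nonneg_left (hRb x) (norm_nonneg _)
    rw [integral_mul_const] at h1
    have h2 : 0 ≤ (k * M₁ + A ^ 2 / 2) * δ ^ 2 := by positivity
    nlinarith [mul_le_mul_of_nonneg_left h1 hM0.le, mul_le_mul_of_nonneg_right hD.small h2]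
  have hpj := shifted_mem_strip hb (p j)
  have hqj := shifted_mem_strip hb (q j)
  have hpair : ∫ x : ℝ, weight ε' x * (rootKernel B (q j) x * Δ x) =
      ∫ y : ℝ, phi B (shifted (q j) - y) * (weight ε' y * Δ y) := by
    congr 1; ext y
    rw [rootKernel, phi_sub_comm h (hreal y) hqj]
    ring
  -- what remains is of second order: the displacement of the root times `d`, the error of the
  -- linearisation, and the dressed error of the dressing equation
  have hfinal : convTerm B ε (shifted (p j)) - convTerm B ε' (shifted (p j)) -
      ∑ i, ((p i - q i : ℝ) : ℂ) *
        (I * chainSum B ε' (rootKernel B (q j)) (rootKernel B (q i))) =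
      (∫ y : ℝ, (rootKernel B (p j) y - rootKernel B (q j) y) * d y) +
        (∫ y : ℝ, phi B (shifted (q j) - y) * r y) -
          chainSum B ε' (rootKernel B (q j)) fun z => R z.re := by
    have h1 : ∫ y : ℝ, (rootKernel B (p j) y - rootKernel B (q j) y) * d y =
        (∫ y : ℝ, phi B (shifted (p j) - y) * d y) - ∫ y : ℝ, phi B (shifted (q j) - y) * d y := by
      rw [← integral_sub (hphi hpj hdi).1 (hphi hqj hdi).1]
      congr 1; ext y
      rw [rootKernel, rootKernel, phi_sub_comm h (hreal y) hpj, phi_sub_comm h (hreal y) hqj,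
        sub_mul]
    rw [h1, hsplit hqj, ← hpair, ← hchain, (convTerm_sub h hε hε' hpj).2]
    have h2 : ∀ i, ((p i - q i : ℝ) : ℂ) *
        (I * chainSum B ε' (rootKernel B (q j)) (rootKernel B (q i))) =
        -(c i * chainSum B ε' (rootKernel B (q j)) (rootKernel B (q i))) := fun i => by
      simp only [c, Complex.real_smul]; ring
    simp only [h2, Finset.sum_neg_distrib]
    ring
  rw [hfinal]
  refine (norm_sub_le _ _).trans ((add_le_add ((norm_add_le _ _).trans (add_le_add ?_
    ((hphi hqj hri).2.trans hr))) hCR).trans_eq (b := M₁ * k * δ ^ 2 + _ + _) (by ring))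
  have h1 : ‖∫ y : ℝ, (rootKernel B (p j) y - rootKernel B (q j) y) * d y‖ ≤
      M₁ * δ * ∫ y, ‖d y‖ := by
    rw [← integral_const_mul]
    refine norm_integral_le_of_norm_le (hdi.norm.const_mul _) (Eventually.of_forall fun y => ?_)
    rw [norm_mul]
    exact mul_le_mul_of_nonneg_right ((norm_rootKernel_sub_le h y (p j) (q j)).trans
      (mul_le_mul_of_nonneg_left (hδ j) hM10.le)) (norm_nonneg _)
  have h2 : ∫ y, ‖d y‖ ≤ k * δ := by
    have : M * ∫ y, ‖d y‖ ≤ M * (k * δ) := by linarith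
    exact le_of_mul_le_mul_left this hM0
  calc _ ≤ M₁ * δ * (k * δ) := h1.trans (mul_le_mul_of_nonneg_left h2 (by positivity))
    _ = _ := by ring

end Jacobian

section Quantization

variable {B b κ m L : ℝ} {k : ℕ}

/-- The principal logarithm of `S` is smooth on the real line away from the origin. -/
lemma S_ofReal_mem_slitPlane (hB0 : 0 < B) (hB1 : B < 1) {t : ℝ} (ht : t ≠ 0) :
    S B t ∈ Complex.slitPlane := by
  have hs := sin_pi_mul_pos hB0 hB1
  set s := Real.sin (π * B)
  have hsh : Real.sinh t ≠ 0 := fun h0 => ht (Real.sinh_eq_zero.1 h0)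
  have e : S B t = (((Real.sinh t ^ 2 - s ^ 2) / (Real.sinh t ^ 2 + s ^ 2) : ℝ) : ℂ) +
      ((-(2 * Real.sinh t * s) / (Real.sinh t ^ 2 + s ^ 2) : ℝ) : ℂ) * I := by
    have h1 : ((Real.sinh t : ℝ) : ℂ) + I * s ≠ 0 := fun h0 => hsh (by
      simpa [← Complex.ofReal_sinh] using congr_arg Complex.re h0)
    have h2 : ((Real.sinh t : ℝ) : ℂ) ^ 2 + (s : ℂ) ^ 2 ≠ 0 := by
      exact_mod_cast (by positivity : Real.sinh t ^ 2 + s ^ 2 ≠ 0)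
    rw [S, ← Complex.ofReal_sinh]
    change (((Real.sinh t : ℝ) : ℂ) - I * s) / ((Real.sinh t : ℝ) + I * s) = _
    rw [div_eq_iff h1]
    simp only [Complex.ofReal_div, Complex.ofReal_sub, Complex.ofReal_add, Complex.ofReal_neg,
      Complex.ofReal_mul, Complex.ofReal_pow, Complex.ofReal_ofNat]
    field_simp
    linear_combination (2 * s ^ 2 * (Real.sinh t : ℂ)) * Complex.I_sq
  refine Complex.mem_slitPlane_iff.2 (Or.inr ?_)
  rw [e, Complex.add_im, Complex.ofReal_im, zero_add, Complex.im_ofReal_mul, Complex.I_im, mul_one]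
  exact div_ne_zero (neg_ne_zero.2 (by positivity)) (by positivity)

lemma shifted_sub_shifted (x y : ℝ) : shifted x - shifted y = ((x - y : ℝ) : ℂ) := by
  rw [shifted, shifted]; push_cast; ring

lemma hasDerivAt_shifted (t : ℝ) : HasDerivAt shifted 1 t :=
  ((hasDerivAt_id t).ofReal_comp).add_const _

/-- The Jacobian of the exact quantization functions. -/
theorem hasFDerivAt_quantization (h : IsNarrow B b κ) (hB0 : 0 < B) (hB1 : B < 1) (hB : B ≠ 1 / 2)
    (hmL : 0 < m * L) (hE : Real.exp (-(m * L)) ≤ 1 / 2)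
    (hL : 2 / κ ^ 2 * (2 * π / (m * L)) ≤ 1 / 2) {q : Fin k → ℝ} (hq : Function.Injective q)
    {ε : (Fin k → ℝ) → ℂ → ℂ} (hε : ∀ᶠ p in 𝓝 q, IsPseudoenergy B m L p (ε p)) :
    ∃ J : (Fin k → ℝ) →L[ℝ] (Vec k), HasFDerivAt (quantization ε) J q ∧
      ∀ j l, J (Pi.single l 1) j =
        (if l = j then dressedN B m L (ε q) (q j) + ∑ i, dressedPhi B (ε q) (q j) (q i) else 0) -
          dressedPhi B (ε q) (q j) (q l) := by
  have hε' := hε.self_of_nhds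
  have hD := hε'.isDressing h hB0 hB1 hB hmL hE hL
  set ℓ : Fin k → (Fin k → ℝ) →L[ℝ] ℝ := fun i => ContinuousLinearMap.proj i with hℓ
  set c : Fin k → Fin k → ℂ := fun j i =>
    chainSum B (ε q) (rootKernel B (q j)) (rootKernel B (q i))
  set J : Fin k → (Fin k → ℝ) →L[ℝ] ℂ := fun j =>
    (ℓ j).smulRight (dressedN B m L (ε q) (q j) + ∑ i, c j i) +
      ∑ i, (ℓ j - ℓ i).smulRight (phi B ((q j : ℂ) - q i)) + ∑ i, (ℓ i).smulRight (-c j i)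
  refine ⟨ContinuousLinearMap.pi J, hasFDerivAt_pi.2 fun j => ?_, fun j l => ?_⟩
  · have hz := shifted_mem_strip h.pos (q j)
    have hcomp : ∀ {A : ℝ → ℂ} {a : ℂ} {f : (Fin k → ℝ) →L[ℝ] ℝ}, HasDerivAt A a (f q) →
        HasFDerivAt (fun p => A (f p)) (f.smulRight a) q := fun {A a f} hA => by
      refine (hA.hasFDerivAt.comp q f.hasFDerivAt).congr_fderiv ?_
      ext p; simp
    -- the dependence through the argument of the pseudoenergy
    have h1 : HasFDerivAt (fun p : Fin k → ℝ => -I * (m * L * cosh (shifted (p j))) +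
        I * convTerm B (ε q) (shifted (p j)))
        ((ℓ j).smulRight (dressedN B m L (ε q) (q j) + ∑ i, c j i)) q := by
      refine hcomp (A := fun t => -I * (m * L * cosh (shifted t)) +
        I * convTerm B (ε q) (shifted t)) (f := ℓ j) ?_
      have hA : HasDerivAt (fun z => -I * (m * L * cosh z) +
          I * convTerm B (ε q) z) _ (shifted (q j)) :=
        (((Complex.hasDerivAt_cosh _).const_mul (m * L : ℂ)).const_mul (-I)).add
          ((hε'.hasDerivAt_convTerm h hz).const_mul I)
      refine (hA.comp (h := shifted) (q j) (hasDerivAt_shifted _)).congr_deriv ?_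
      rw [hε'.deriv_convTerm h hB0 hB1 hB hmL hE hz, hε'.integral_phi_epsDeriv hD hB0 hB1 hB hmL hE,
        sinh_shifted, dressedN, chainSum_rootKernel' h]
      linear_combination (-(m * L * cosh (q j)) - ∑ i, c j i) * Complex.I_sq
    -- the two-particle phases; the diagonal term is constant, with its logarithm on the branch cut
    have h2 : HasFDerivAt (fun p : Fin k → ℝ => ∑ i, -I * Complex.log (S B (p j - p i : ℝ)))
        (∑ i, (ℓ j - ℓ i).smulRight (phi B ((q j : ℂ) - q i))) q := by
      refine HasFDerivAt.fun_sum fun i _ => ?_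
      rcases eq_or_ne i j with rfl | hij
      · simp only [sub_self]
        refine (hasFDerivAt_const _ q).congr_fderiv ?_
        ext p; simp
      · refine hcomp (A := fun t : ℝ => -I * Complex.log (S B t)) (f := ℓ j - ℓ i) ?_
        have hne : q j - q i ≠ 0 := sub_ne_zero.2 fun h0 => hij (hq h0).symm
        have hr : Reg B ((q j - q i : ℝ) : ℂ) := by
          rw [← shifted_sub_shifted]
          exact reg_of_diffIm h (diffIm_sub hz (shifted_mem_strip h.pos _))
        have := (((hasDerivAt_S hr).comp_ofReal).clog_real
          (S_ofReal_mem_slitPlane hB0 hB1 hne)).const_mul (-I)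
        refine this.congr_deriv ?_
        rw [mul_div_cancel_right₀ _ (S_ne_zero hr), ← mul_assoc, neg_mul, Complex.I_mul_I, neg_neg,
          one_mul, Complex.ofReal_sub]
    -- the dependence through the pseudoenergy on the real line
    have h3 : HasFDerivAt (fun p : Fin k → ℝ => I *
        (convTerm B (ε p) (shifted (p j)) - convTerm B (ε q) (shifted (p j))))
        (∑ i, (ℓ i).smulRight (-c j i)) q := by
      obtain ⟨C, hC⟩ := norm_response_sub_le h hB0 hB1 hB hmL hE hL hε' j
      refine HasFDerivAt.of_isLittleO ((Asymptotics.IsBigO.of_bound C ?_).trans_isLittleO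
        (Asymptotics.isLittleO_pow_sub_sub q one_lt_two))
      filter_upwards [hε] with p hp
      rw [norm_pow, norm_norm]
      refine le_trans (le_of_eq ?_) (hC p (ε p) hp)
      have e : (∑ i, (ℓ i).smulRight (-c j i)) (p - q) =
          I * ∑ i, ((p i - q i : ℝ) : ℂ) * (I * c j i) := by
        rw [_root_.sum_apply, Finset.mul_sum]
        refine Finset.sum_congr rfl fun i _ => ?_
        change ((p i - q i : ℝ) • -c j i : ℂ) = _
        rw [Complex.real_smul]
        linear_combination (-((p i - q i : ℝ) : ℂ) * c j i) * Complex.I_sq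
      rw [sub_self, mul_zero, sub_zero, e, ← mul_sub, norm_mul, Complex.norm_I, one_mul]
    refine ((h1.add h2).add h3).congr_of_eventuallyEq ?_
    filter_upwards [hε] with p hp
    simp only [quantization, Pi.add_apply, ← shifted_sub_shifted]
    rw [hp.eq_of_mem_strip h (Or.inr (by simpa [shifted_im] using h.pos)), ← Finset.mul_sum]
    ring
  · have hs : ∀ i, (Pi.single l 1 : Fin k → ℝ) i = if i = l then 1 else 0 := fun i =>
      Pi.single_apply _ _ _
    simp only [J, hℓ, ContinuousLinearMap.pi_apply, _root_.add_apply,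
      _root_.sum_apply, ContinuousLinearMap.smulRight_apply,
      _root_.sub_apply, ContinuousLinearMap.proj_apply, hs, ite_smul, one_smul,
      zero_smul, sub_smul, Finset.sum_sub_distrib, Finset.sum_ite_eq', Finset.mem_univ, if_true]
    simp only [dressedPhi, Finset.sum_add_distrib, eq_comm (a := j)]
    split_ifs <;> simp only [c, Finset.sum_const_zero] <;> ring

end Quantization

/-! ### Symmetric functions of rapidities -/

section Multisets

variable {B b κ : ℝ} {ε : ℂ → ℂ}

/-- The multiset of the entries of a tuple. -/
def ms {α : Type*} {n : ℕ} (θ : Fin n → α) : Multiset α := Finset.univ.val.map θ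

lemma ms_succAbove {α : Type*} {n : ℕ} (θ : Fin (n + 1) → α) (i : Fin (n + 1)) :
    ms θ = θ i ::ₘ ms fun j => θ (i.succAbove j) := by
  simp [ms, Fin.univ_succAbove n i, Function.comp_def]

@[simp] lemma ms_zero {α : Type*} (θ : Fin 0 → α) : ms θ = 0 := rfl

@[simp] lemma card_ms {α : Type*} {n : ℕ} (θ : Fin n → α) : (ms θ).card = n := by simp [ms]

lemma ms_cons {α : Type*} {n : ℕ} (a : α) (θ : Fin n → α) :
    ms (Fin.cons a θ : Fin (n + 1) → α) = a ::ₘ ms θ := by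
  rw [ms_succAbove _ 0]; simp

lemma exists_ms {α : Type*} (s : Multiset α) : ∃ θ : Fin s.card → α, ms θ = s := by
  refine ⟨fun i => s.toList.get (i.cast (by simp)), ?_⟩
  rw [ms, Fin.univ_val_map]
  conv_rhs => rw [← s.coe_toList, ← List.ofFn_get s.toList]
  congr 1
  apply List.ext_getElem <;> simp

/-- A family of symmetric functions of rapidities in the strips that is jointly continuous and
bounded on multisets of cardinality `n`. -/
def NiceAt {T : Type*} [TopologicalSpace T] (n : ℕ) (h : T → Multiset (strip b) → ℂ) : Prop :=
  (∀ (m : ℕ) (s : Multiset (strip b)), m + s.card = n →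
    Continuous fun p : T × (Fin m → strip b) => h p.1 (ms p.2 + s)) ∧
  ∃ M, ∀ τ s, s.card = n → ‖h τ s‖ ≤ M

variable {T T' : Type*} [TopologicalSpace T] [TopologicalSpace T'] {n : ℕ}
  {h : T → Multiset (strip b) → ℂ}

namespace NiceAt

lemma continuous (hh : NiceAt n h) {s : Multiset (strip b)} (hs : s.card = n) :
    Continuous fun τ => h τ s := by
  have := (hh.1 0 s (by omega)).comp (f := fun τ : T => (τ, Fin.elim0)) (by fun_prop)
  simpa [Function.comp_def] using this

lemma continuous_cons (hh : NiceAt n h) {s : Multiset (strip b)} (hs : s.card + 1 = n) :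
    Continuous fun p : T × strip b => h p.1 (p.2 ::ₘ s) := by
  have := (hh.1 1 s (by omega)).comp (f := fun p : T × strip b => (p.1, fun _ => p.2))
    (by fun_prop)
  simpa [Function.comp_def, ms] using this

lemma comp (hh : NiceAt n h) {g : T' → T} (hg : Continuous g) : NiceAt n fun τ => h (g τ) := by
  refine ⟨fun m s hs => ?_, hh.2.imp fun M hM τ s hs => hM _ _ hs⟩
  exact (hh.1 m s hs).comp (f := fun p : T' × (Fin m → strip b) => (g p.1, p.2)) (by fun_prop)

/-- Inserting a rapidity that depends continuously on the parameter. -/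
lemma cons (hh : NiceAt (n + 1) h) {g : T → strip b} (hg : Continuous g) :
    NiceAt n fun τ s => h τ (g τ ::ₘ s) := by
  refine ⟨fun m s hs => ?_, hh.2.imp fun M hM τ s hs => hM _ _ (by simp [hs])⟩
  have := (hh.1 (m + 1) s (by omega)).comp (f := fun p : T × (Fin m → strip b) =>
    (p.1, (Fin.cons (g p.1) p.2 : Fin (m + 1) → strip b)))
    (continuous_fst.prodMk ((hg.comp continuous_fst).finCons continuous_snd))
  simpa [Function.comp_def, ms_cons] using this

lemma add {h' : T → Multiset (strip b) → ℂ} (hh : NiceAt n h) (hh' : NiceAt n h') :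
    NiceAt n fun τ s => h τ s + h' τ s := by
  obtain ⟨M, hM⟩ := hh.2
  obtain ⟨M', hM'⟩ := hh'.2
  exact ⟨fun m s hs => (hh.1 m s hs).add (hh'.1 m s hs), M + M', fun τ s hs =>
    (norm_add_le _ _).trans (add_le_add (hM τ s hs) (hM' τ s hs))⟩

lemma mul {g : T → ℂ} (hg : Continuous g) {M' : ℝ} (hM' : ∀ τ, ‖g τ‖ ≤ M') (hh : NiceAt n h) :
    NiceAt n fun τ s => g τ * h τ s := by
  obtain ⟨M, hM⟩ := hh.2
  refine ⟨fun m s hs => (hg.comp continuous_fst).mul (hh.1 m s hs), M' * M, fun τ s hs => ?_⟩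
  rw [norm_mul]
  exact mul_le_mul (hM' τ) (hM τ s hs) (norm_nonneg _) ((norm_nonneg _).trans (hM' τ))

end NiceAt

/-- The kernel `φ(τ - y)` for points of the strips. -/
def ker (B : ℝ) (τ y : strip b) : ℂ := phi B ((τ : ℂ) - y)

lemma continuous_ker (H : IsNarrow B b κ) : Continuous fun p : strip b × strip b =>
    ker B p.1 p.2 := by
  rw [continuous_iff_continuousAt]
  intro p
  exact ContinuousAt.comp (g := phi B) (f := fun p : strip b × strip b => (p.1 : ℂ) - p.2)
    (analyticAt_phi (reg_of_diffIm H (diffIm_sub p.1.2 p.2.2))).continuousAt (by fun_prop)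

lemma norm_ker_le (H : IsNarrow B b κ) (τ y : strip b) : ‖ker B τ y‖ ≤ 2 / κ ^ 2 :=
  norm_phi_sub_le H τ.2 y.2

open Classical in
/-- Prolonging a chain at its beginning: `K h(τ, s) = ∑_{y ∈ s} φ(τ - y) h(y, s - y)`. -/
def prolong (B : ℝ) (h : strip b → Multiset (strip b) → ℂ) (τ : strip b)
    (s : Multiset (strip b)) : ℂ :=
  (s.map fun y => ker B τ y * h y (s.erase y)).sum

open Classical in
lemma prolong_cons (h : strip b → Multiset (strip b) → ℂ) (τ x : strip b)
    (s : Multiset (strip b)) : prolong B h τ (x ::ₘ s) =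
    ker B τ x * h x s + prolong B (fun y s => h y (x ::ₘ s)) τ s := by
  rw [prolong, Multiset.map_cons, Multiset.sum_cons, Multiset.erase_cons_head, prolong]
  congr 2
  exact Multiset.map_congr rfl fun y hy => by rw [Multiset.erase_cons_tail_of_mem hy]

lemma norm_prolong_le (H : IsNarrow B b κ) {h : strip b → Multiset (strip b) → ℂ} {M : ℝ}
    (hM : ∀ τ s, s.card = n → ‖h τ s‖ ≤ M) (τ : strip b) {s : Multiset (strip b)}
    (hs : s.card = n + 1) : ‖prolong B h τ s‖ ≤ (n + 1) * (2 / κ ^ 2 * M) := by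
  classical
  refine (norm_multiset_sum_le _).trans ?_
  rw [Multiset.map_map]
  refine (Multiset.sum_le_card_nsmul _ (2 / κ ^ 2 * M) fun x hx => ?_).trans_eq ?_
  · obtain ⟨y, hy, rfl⟩ := Multiset.mem_map.1 hx
    rw [Function.comp, norm_mul]
    have : (s.erase y).card = n := by rw [Multiset.card_erase_of_mem hy, hs]; rfl
    exact mul_le_mul (norm_ker_le H τ y) (hM y _ this) (norm_nonneg _)
      ((norm_nonneg _).trans (norm_ker_le H τ y))
  · simp [hs]

lemma NiceAt.prolong (H : IsNarrow B b κ) {h : strip b → Multiset (strip b) → ℂ}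
    (hh : NiceAt n h) : NiceAt (n + 1) (prolong B h) := by
  classical
  refine ⟨fun m s hs => ?_, hh.2.imp' _ fun M hM τ s => norm_prolong_le H hM τ⟩
  have e : ∀ p : strip b × (Fin m → strip b), SinhGordon.prolong B h p.1 (ms p.2 + s) =
      (∑ i, ker B p.1 (p.2 i) * h (p.2 i) ((ms p.2 + s).erase (p.2 i))) +
      (s.map fun y => ker B p.1 y * h y (ms p.2 + s.erase y)).sum := fun p => by
    rw [SinhGordon.prolong, Multiset.map_add, Multiset.sum_add]
    congr 1
    · rw [ms, Multiset.map_map]; rfl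
    · congr 1
      exact Multiset.map_congr rfl fun y hy => by rw [Multiset.erase_add_right_pos _ hy]
  simp only [e]
  have hk := continuous_ker (b := b) H
  refine (continuous_finsetSum _ fun i _ => ?_).add (continuous_multiset_sum _ fun y hy => ?_)
  · obtain ⟨m, rfl⟩ : ∃ k, m = k + 1 := ⟨m - 1, by have := i.2; omega⟩
    have e2 : ∀ θ : Fin (m + 1) → strip b, (ms θ + s).erase (θ i) =
        (ms fun j => θ (i.succAbove j)) + s := fun θ => by
      rw [ms_succAbove θ i, Multiset.cons_add, Multiset.erase_cons_head]
    simp only [e2]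
    exact (hk.comp (f := fun p : strip b × (Fin (m + 1) → strip b) => (p.1, p.2 i))
      (by fun_prop)).mul ((hh.1 m s (by omega)).comp
      (f := fun p : strip b × (Fin (m + 1) → strip b) => (p.2 i, fun j => p.2 (i.succAbove j)))
      (by fun_prop))
  · have hc : m + (s.erase y).card = n := by
      have := Multiset.card_pos_iff_exists_mem.2 ⟨y, hy⟩
      rw [Multiset.card_erase_of_mem hy, Nat.pred_eq_sub_one]; omega
    exact (hk.comp (f := fun p : strip b × (Fin m → strip b) => (p.1, y)) (by fun_prop)).mul
      ((hh.1 m _ hc).comp (f := fun p : strip b × (Fin m → strip b) => (y, p.2)) (by fun_prop))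

end Multisets

/-! ### Integration of symmetric functions against the weight -/

namespace IsDressing

variable {B b κ : ℝ} {ε : ℂ → ℂ} (D : IsDressing B b κ ε) {T : Type*} [TopologicalSpace T] {n : ℕ}

/-- A real rapidity as a point of the strips. -/
def pt (x : ℝ) : strip b := ⟨x, ofReal_mem_strip D.narrow.pos x⟩

lemma continuous_pt : Continuous D.pt := by
  unfold pt; exact Complex.continuous_ofReal.subtype_mk _

/-- Integration of one rapidity over the real line. -/
def integ (f : Multiset (strip b) → ℂ) (s : Multiset (strip b)) : ℂ :=
  ∫ x : ℝ, weight ε x * f (D.pt x ::ₘ s)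

/-- Prolonging a chain at its beginning by an integrated rapidity. -/
def conv (h : strip b → Multiset (strip b) → ℂ) (τ : strip b) (s : Multiset (strip b)) : ℂ :=
  ∫ x : ℝ, weight ε x * (ker B τ (D.pt x) * h (D.pt x) s)

include D in
lemma integrable_bdd {f : ℝ → ℂ} {M : ℝ} (hf : Continuous f) (hM : ∀ x, ‖f x‖ ≤ M) :
    Integrable fun x : ℝ => weight ε x * f x := (D.mem_adm_of_bounded hf hM).2

include D in
lemma norm_integral_le {f : ℝ → ℂ} {M : ℝ} (hM : ∀ x, ‖f x‖ ≤ M) :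
    ‖∫ x : ℝ, weight ε x * f x‖ ≤ (∫ x : ℝ, ‖weight ε x‖) * M := by
  rw [← integral_mul_const]
  refine norm_integral_le_of_norm_le (D.int.norm.mul_const _) (Eventually.of_forall fun x => ?_)
  rw [norm_mul]
  exact mul_le_mul_of_nonneg_left (hM x) (norm_nonneg _)

include D in
lemma niceAt_integral [FirstCountableTopology T] {h : T × ℝ → Multiset (strip b) → ℂ}
    (hh : NiceAt n h) :
    NiceAt n fun τ s => ∫ x : ℝ, weight ε x * h (τ, x) s := by
  obtain ⟨M, hM⟩ := hh.2
  refine ⟨fun m s hs => ?_, _, fun τ s hs => D.norm_integral_le fun x => hM (τ, x) s hs⟩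
  have hc := hh.1 m s hs
  refine continuous_of_dominated (bound := fun x => ‖weight ε x‖ * M) (fun p => ?_) (fun p => ?_)
    (D.int.norm.mul_const _) (Eventually.of_forall fun x => ?_)
  · exact (D.cont.mul (hc.comp (f := fun x : ℝ => ((p.1, x), p.2))
      (by fun_prop))).aestronglyMeasurable
  · refine Eventually.of_forall fun x => ?_
    rw [norm_mul]
    exact mul_le_mul_of_nonneg_left (hM _ _ (by simp [hs])) (norm_nonneg _)
  · exact continuous_const.mul (hc.comp (f := fun p : T × (Fin m → strip b) => ((p.1, x), p.2))
      (by fun_prop))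

lemma niceAt_integ [FirstCountableTopology T] {h : T → Multiset (strip b) → ℂ}
    (hh : NiceAt (n + 1) h) :
    NiceAt n fun τ => D.integ (h τ) :=
  D.niceAt_integral (h := fun p s => h p.1 (D.pt p.2 ::ₘ s))
    ((hh.comp continuous_fst).cons (D.continuous_pt.comp continuous_snd))

lemma niceAt_conv {h : strip b → Multiset (strip b) → ℂ} (hh : NiceAt n h) :
    NiceAt n (D.conv h) := by
  have hk : Continuous fun p : strip b × ℝ => ker B p.1 (D.pt p.2) :=
    (continuous_ker D.narrow).comp (f := fun p : strip b × ℝ => (p.1, D.pt p.2))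
      (continuous_fst.prodMk (D.continuous_pt.comp continuous_snd))
  have hp : Continuous fun p : strip b × ℝ => D.pt p.2 := D.continuous_pt.comp continuous_snd
  have h1 := (hh.comp hp).mul hk fun p => norm_ker_le D.narrow _ _
  exact D.niceAt_integral h1

lemma integrable_integ {h : T → Multiset (strip b) → ℂ} (hh : NiceAt (n + 1) h) (τ : T)
    {s : Multiset (strip b)} (hs : s.card = n) :
    Integrable fun x : ℝ => weight ε x * h τ (D.pt x ::ₘ s) := by
  obtain ⟨M, hM⟩ := hh.2
  exact D.integrable_bdd ((hh.continuous_cons (by omega)).comp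
    (f := fun x : ℝ => (τ, D.pt x)) (continuous_const.prodMk D.continuous_pt))
    fun x => hM _ _ (by simp [hs])

lemma integ_add {h h' : T → Multiset (strip b) → ℂ} (hh : NiceAt (n + 1) h)
    (hh' : NiceAt (n + 1) h') (τ : T) {s : Multiset (strip b)} (hs : s.card = n) :
    D.integ (fun s => h τ s + h' τ s) s = D.integ (h τ) s + D.integ (h' τ) s := by
  simp only [integ, mul_add]
  exact integral_add (D.integrable_integ hh τ hs) (D.integrable_integ hh' τ hs)

lemma integ_const_mul (c : ℂ) (f : Multiset (strip b) → ℂ) (s : Multiset (strip b)) :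
    D.integ (fun s => c * f s) s = c * D.integ f s := by
  simp only [integ]
  rw [← integral_const_mul]
  congr 1; ext x; ring

lemma integrable_conv {h : strip b → Multiset (strip b) → ℂ} (hh : NiceAt n h) (τ : strip b)
    {s : Multiset (strip b)} (hs : s.card = n) :
    Integrable fun x : ℝ => weight ε x * (ker B τ (D.pt x) * h (D.pt x) s) := by
  obtain ⟨M, hM⟩ := hh.2
  have hk := (continuous_ker D.narrow).comp (f := fun x : ℝ => (τ, D.pt x))
    (continuous_const.prodMk D.continuous_pt)
  refine D.integrable_bdd (hk.mul ((hh.continuous hs).comp D.continuous_pt))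
    (M := 2 / κ ^ 2 * M) fun x => ?_
  rw [norm_mul]
  exact mul_le_mul (norm_ker_le D.narrow _ _) (hM _ _ hs) (norm_nonneg _)
    ((norm_nonneg _).trans (norm_ker_le D.narrow τ τ))

lemma integral_multiset_sum {α : Type*} (s : Multiset α) {f : α → ℝ → ℂ}
    (hf : ∀ y ∈ s, Integrable (f y)) : Integrable (fun x => (s.map fun y => f y x).sum) ∧
    ∫ x, (s.map fun y => f y x).sum = (s.map fun y => ∫ x, f y x).sum := by
  induction s using Multiset.induction_on with
  | empty => simp
  | cons a s ih =>
    have ih := ih fun y hy => hf y (Multiset.mem_cons_of_mem hy)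
    have ha := hf a (Multiset.mem_cons_self a s)
    simp only [Multiset.map_cons, Multiset.sum_cons]
    exact ⟨ha.add ih.1, by rw [integral_add ha ih.1, ih.2]⟩

/-- Integrating a prolonged chain either prolongs the integrated chain or integrates the rapidity
by which the chain was prolonged. -/
lemma integ_prolong {h : strip b → Multiset (strip b) → ℂ} (hh : NiceAt n h) (τ : strip b)
    {s : Multiset (strip b)} (hs : s.card = n) :
    D.integ (prolong B h τ) s = prolong B (fun y => D.integ (h y)) τ s + D.conv h τ s := by
  classical
  have hi : ∀ y ∈ s, Integrable fun x : ℝ =>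
      weight ε x * (ker B τ y * h y (D.pt x ::ₘ s.erase y)) := fun y hy => by
    obtain ⟨k, rfl⟩ : ∃ k, n = k + 1 :=
      ⟨n - 1, by have := Multiset.card_pos_iff_exists_mem.2 ⟨y, hy⟩; omega⟩
    have hc : (s.erase y).card = k := by rw [Multiset.card_erase_of_mem hy, hs]; rfl
    refine ((D.integrable_integ hh y hc).const_mul (ker B τ y)).congr
      (Eventually.of_forall fun x => ?_)
    simp only; ring
  have h1 := integral_multiset_sum s hi
  simp only [integ, prolong_cons, mul_add, conv]
  have e : ∀ x : ℝ, weight ε x * prolong B (fun y s => h y (D.pt x ::ₘ s)) τ s =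
      (s.map fun y => weight ε x * (ker B τ y * h y (D.pt x ::ₘ s.erase y))).sum := fun x => by
    rw [prolong, ← Multiset.sum_map_mul_left]
  simp only [e]
  rw [integral_add (D.integrable_conv hh τ hs) h1.1, h1.2, add_comm, prolong]
  congr 2
  refine Multiset.map_congr rfl fun y _ => ?_
  simp only [integ]
  rw [← integral_const_mul]
  congr 1; ext x; ring

lemma integ_conv {h : strip b → Multiset (strip b) → ℂ} (hh : NiceAt (n + 1) h) (τ : strip b)
    {s : Multiset (strip b)} (hs : s.card = n) :
    D.integ (D.conv h τ) s = D.conv (fun y => D.integ (h y)) τ s := by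
  obtain ⟨M, hM⟩ := hh.2
  have hk := (continuous_ker D.narrow).comp (f := fun p : ℝ × ℝ => (τ, D.pt p.2))
    (continuous_const.prodMk (D.continuous_pt.comp continuous_snd))
  have hc := (hh.continuous_cons (by omega : s.card + 1 = n + 1)).comp
    (f := fun p : ℝ × ℝ => (D.pt p.2, D.pt p.1))
    ((D.continuous_pt.comp continuous_snd).prodMk (D.continuous_pt.comp continuous_fst))
  have hi : Integrable (fun p : ℝ × ℝ => (weight ε p.1 * weight ε p.2) *
      (ker B τ (D.pt p.2) * h (D.pt p.2) (D.pt p.1 ::ₘ s))) (volume.prod volume) := by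
    refine (D.int.mul_prod D.int).mul_bdd (c := 2 / κ ^ 2 * M) (hk.mul hc).aestronglyMeasurable
      (Eventually.of_forall fun p => ?_)
    rw [norm_mul]
    exact mul_le_mul (norm_ker_le D.narrow _ _) (hM _ _ (by simp [hs])) (norm_nonneg _)
      ((norm_nonneg _).trans (norm_ker_le D.narrow τ τ))
  have h1 := integral_integral_swap (f := fun x y : ℝ => (weight ε x * weight ε y) *
      (ker B τ (D.pt y) * h (D.pt y) (D.pt x ::ₘ s))) hi
  simp only [integ, conv]
  refine Eq.trans ?_ (h1.trans ?_)
  · congr 1; ext x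
    rw [← integral_const_mul]
    congr 1; ext y; ring
  · congr 1; ext y
    rw [← integral_const_mul, ← integral_const_mul]
    congr 1; ext x; ring

end IsDressing

section

variable {B b κ : ℝ}

lemma niceAt_prolong_zero (h : strip b → Multiset (strip b) → ℂ) : NiceAt 0 (prolong B h) := by
  have h0 : ∀ τ : strip b, ∀ s : Multiset (strip b), s.card = 0 → prolong B h τ s = 0 :=
    fun τ s hs => by rw [Multiset.card_eq_zero.1 hs]; simp [prolong]
  refine ⟨fun m s hs => ?_, 0, fun τ s hs => by rw [h0 τ s hs, norm_zero]⟩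
  rw [show (fun p : strip b × (Fin m → strip b) => prolong B h p.1 (ms p.2 + s)) =
    fun _ => 0 from funext fun p => h0 _ _ (by simpa using hs)]
  exact continuous_const

lemma NiceAt.prolong' (H : IsNarrow B b κ) {h : strip b → Multiset (strip b) → ℂ}
    (hh : ∀ n, NiceAt n h) : ∀ n, NiceAt n (SinhGordon.prolong B h)
  | 0 => niceAt_prolong_zero h
  | n + 1 => (hh n).prolong H

lemma niceAt_ker_mul (H : IsNarrow B b κ) {C : Multiset (strip b) → ℂ}
    (hC : ∀ n, NiceAt n fun _ : Unit => C) (β : strip b) (n : ℕ) :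
    NiceAt n fun τ s => ker B τ β * C (β ::ₘ s) :=
  (((hC (n + 1)).cons (g := fun _ => β) continuous_const).comp
    (g := fun _ : strip b => ()) continuous_const).mul
    ((continuous_ker H).comp (f := fun τ : strip b => (τ, β)) (by fun_prop))
    fun τ => norm_ker_le H τ β

end

namespace IsDressing

variable {B b κ : ℝ} {ε : ℂ → ℂ} (D : IsDressing B b κ ε) {T : Type*} [TopologicalSpace T]

section Iterates

variable [FirstCountableTopology T] {h h' : T → Multiset (strip b) → ℂ}

lemma niceAt_iterate (hh : ∀ n, NiceAt n h) (r n : ℕ) : NiceAt n fun τ => D.integ^[r] (h τ) := by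
  induction r generalizing n with
  | zero => exact hh n
  | succ r ih =>
    simpa only [Function.iterate_succ', Function.comp] using D.niceAt_integ (ih (n + 1))

lemma iterate_add (hh : ∀ n, NiceAt n h) (hh' : ∀ n, NiceAt n h') (r : ℕ) (τ : T) :
    D.integ^[r] (fun s => h τ s + h' τ s) =
      fun s => D.integ^[r] (h τ) s + D.integ^[r] (h' τ) s := by
  induction r with
  | zero => rfl
  | succ r ih =>
    simp only [Function.iterate_succ', Function.comp, ih]
    ext s
    exact D.integ_add (D.niceAt_iterate hh r _) (D.niceAt_iterate hh' r _) τ rfl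

omit [FirstCountableTopology T] [TopologicalSpace T] in
lemma iterate_const_mul (c : ℂ) (f : Multiset (strip b) → ℂ) (r : ℕ) :
    D.integ^[r] (fun s => c * f s) = fun s => c * D.integ^[r] f s := by
  induction r with
  | zero => rfl
  | succ r ih =>
    simp only [Function.iterate_succ', Function.comp, ih]
    ext s
    exact D.integ_const_mul c _ s

lemma iterate_cons (f : Multiset (strip b) → ℂ) (β : strip b) (r : ℕ) (s : Multiset (strip b)) :
    D.integ^[r] (fun s => f (β ::ₘ s)) s = D.integ^[r] f (β ::ₘ s) := by
  induction r generalizing s with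
  | zero => rfl
  | succ r ih =>
    simp only [Function.iterate_succ', Function.comp, integ, ih]
    congr 1; ext x
    rw [Multiset.cons_swap]

lemma norm_iterate_le {f : Multiset (strip b) → ℂ} {M : ℕ → ℝ} (hM : ∀ s, ‖f s‖ ≤ M s.card)
    (r : ℕ) (s : Multiset (strip b)) :
    ‖D.integ^[r] f s‖ ≤ (∫ x : ℝ, ‖weight ε x‖) ^ r * M (s.card + r) := by
  induction r generalizing s with
  | zero => simpa using hM s
  | succ r ih =>
    rw [Function.iterate_succ', Function.comp, pow_succ', mul_assoc]
    refine D.norm_integral_le fun x => (ih _).trans_eq ?_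
    rw [Multiset.card_cons, add_assoc, add_comm 1]

/-- Integration either keeps the prolonged chain or absorbs its new link into a convolution. -/
lemma iterate_prolong {h : strip b → Multiset (strip b) → ℂ} (hh : ∀ n, NiceAt n h) (r : ℕ)
    (τ : strip b) : D.integ^[r + 1] (prolong B h τ) = fun s =>
      prolong B (fun y => D.integ^[r + 1] (h y)) τ s +
        (r + 1 : ℂ) * D.conv (fun y => D.integ^[r] (h y)) τ s := by
  induction r with
  | zero =>
    ext s
    simpa using D.integ_prolong (hh _) τ rfl
  | succ r ih =>
    rw [Function.iterate_succ', Function.comp, ih]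
    ext s
    have h1 := D.niceAt_iterate hh r
    have h2 := D.niceAt_iterate hh (r + 1)
    have hc : NiceAt (s.card + 1) fun τ s =>
        (r + 1 : ℂ) * D.conv (fun y => D.integ^[r] (h y)) τ s :=
      (D.niceAt_conv (h1 _)).mul (g := fun _ => (r + 1 : ℂ)) continuous_const fun _ => le_rfl
    rw [D.integ_add ((h2 _).prolong D.narrow) hc τ rfl, D.integ_const_mul,
      D.integ_prolong (h2 _) τ rfl, D.integ_conv (h1 _) τ rfl]
    simp only [Function.iterate_succ' D.integ, Function.comp]
    push_cast
    ring

end Iterates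

/-- The series `∑_r 1/r! ∫ w(x₁) ⋯ w(x_r) f(x₁, …, x_r, s)`. -/
def series (f : Multiset (strip b) → ℂ) (s : Multiset (strip b)) : ℂ :=
  ∑' r : ℕ, D.integ^[r] f s / r.factorial

/-- A factorial bound, with a shift `c` of the number of rapidities. -/
def FactBound (A Q : ℝ) (c : ℕ) (f : Multiset (strip b) → ℂ) : Prop :=
  ∀ s, ‖f s‖ ≤ A * (s.card + c).factorial * Q ^ s.card

omit D in
lemma factorial_add_le (i j : ℕ) :
    ((i + j).factorial : ℝ) ≤ 2 ^ (i + j) * (i.factorial * j.factorial) := by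
  have h1 := Nat.add_choose_mul_factorial_mul_factorial i j
  have h2 := Nat.choose_le_two_pow (i + j) j
  have h3 : (i + j).factorial ≤ 2 ^ (i + j) * (i.factorial * j.factorial) := by
    rw [← h1, mul_assoc]
    exact Nat.mul_le_mul_right _ h2
  exact_mod_cast h3

variable {A Q : ℝ} {c : ℕ} {f : Multiset (strip b) → ℂ}

lemma norm_term_le (hA : 0 ≤ A) (hQ : 0 ≤ Q) (hW : 2 * Q * ∫ x : ℝ, ‖weight ε x‖ ≤ 1 / 2)
    (hf : FactBound A Q c f) (s : Multiset (strip b)) (r : ℕ) :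
    ‖D.integ^[r] f s / r.factorial‖ ≤
      A * (s.card + c).factorial * 2 ^ (s.card + c) * Q ^ s.card * (1 / 2) ^ r := by
  set W := ∫ x : ℝ, ‖weight ε x‖
  have hW0 : 0 ≤ W := integral_nonneg fun x => norm_nonneg _
  have h1 := D.norm_iterate_le (M := fun n => A * (n + c).factorial * Q ^ n) hf r s
  have hr : (0 : ℝ) < r.factorial := by exact_mod_cast r.factorial_pos
  rw [norm_div, Complex.norm_natCast, div_le_iff₀ hr]
  refine h1.trans ?_
  have h2 := factorial_add_le (s.card + c) r
  rw [show s.card + r + c = s.card + c + r by ring]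
  calc W ^ r * (A * (s.card + c + r).factorial * Q ^ (s.card + r))
      ≤ W ^ r * (A * (2 ^ (s.card + c + r) * ((s.card + c).factorial * r.factorial)) *
        Q ^ (s.card + r)) := by gcongr
    _ = A * (s.card + c).factorial * 2 ^ (s.card + c) * Q ^ s.card * (2 * Q * W) ^ r *
        r.factorial := by rw [mul_pow, mul_pow]; ring
    _ ≤ _ := by gcongr

lemma summable_series (hA : 0 ≤ A) (hQ : 0 ≤ Q) (hW : 2 * Q * ∫ x : ℝ, ‖weight ε x‖ ≤ 1 / 2)
    (hf : FactBound A Q c f) (s : Multiset (strip b)) :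
    Summable fun r : ℕ => D.integ^[r] f s / r.factorial :=
  Summable.of_norm_bounded (hasSum_geometric_two.summable.mul_left _)
    (D.norm_term_le hA hQ hW hf s)

lemma norm_series_le (hA : 0 ≤ A) (hQ : 0 ≤ Q) (hW : 2 * Q * ∫ x : ℝ, ‖weight ε x‖ ≤ 1 / 2)
    (hf : FactBound A Q c f) (s : Multiset (strip b)) : ‖D.series f s‖ ≤
      A * (s.card + c).factorial * 2 ^ (s.card + c) * Q ^ s.card * 2 :=
  tsum_of_norm_bounded (hasSum_geometric_two.mul_left _) (D.norm_term_le hA hQ hW hf s)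

lemma continuous_series [FirstCountableTopology T] {h : T → Multiset (strip b) → ℂ}
    (hh : ∀ n, NiceAt n h) (hA : 0 ≤ A) (hQ : 0 ≤ Q)
    (hW : 2 * Q * ∫ x : ℝ, ‖weight ε x‖ ≤ 1 / 2) (hf : ∀ τ, FactBound A Q c (h τ))
    (s : Multiset (strip b)) : Continuous fun τ => D.series (h τ) s :=
  continuous_tsum (fun r => ((D.niceAt_iterate hh r _).continuous rfl).div_const _)
    (hasSum_geometric_two.summable.mul_left _) fun r τ => D.norm_term_le hA hQ hW (hf τ) s r

omit D in
lemma hasSum_multiset_sum {α : Type*} (s : Multiset α) {f : α → ℕ → ℂ} {g : α → ℂ}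
    (hf : ∀ y ∈ s, HasSum (f y) (g y)) :
    HasSum (fun r => (s.map fun y => f y r).sum) (s.map g).sum := by
  induction s using Multiset.induction_on with
  | empty => simp
  | cons a s ih =>
    simp only [Multiset.map_cons, Multiset.sum_cons]
    exact (hf a (Multiset.mem_cons_self a s)).add
      (ih fun y hy => hf y (Multiset.mem_cons_of_mem hy))

/-- The integrated form of the recursion `h(τ, s) = φ(τ - β) C(β, s) + K h(τ, s)` for chains: the
rapidity next to the beginning of the chain is now also integrated over. -/
theorem series_chain {C : Multiset (strip b) → ℂ} (hC : ∀ n, NiceAt n fun _ : Unit => C)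
    {h : strip b → Multiset (strip b) → ℂ} (hh : ∀ n, NiceAt n h) {β : strip b}
    (heq : ∀ τ s, h τ s = ker B τ β * C (β ::ₘ s) + prolong B h τ s) (hA : 0 ≤ A) (hQ : 0 ≤ Q)
    (hW : 2 * Q * ∫ x : ℝ, ‖weight ε x‖ ≤ 1 / 2) {c' : ℕ} (hCb : FactBound A Q c' C)
    (hhb : ∀ τ, FactBound A Q c (h τ)) (τ : strip b) (s : Multiset (strip b)) :
    D.series (h τ) s = ker B τ β * D.series C (β ::ₘ s) +
      prolong B (fun y => D.series (h y)) τ s + D.conv (fun y => D.series (h y)) τ s := by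
  classical
  set a : ℕ → ℂ := fun r => ker B τ β * (D.integ^[r] C (β ::ₘ s) / r.factorial)
  set p : ℕ → ℂ := fun r => prolong B (fun y s => D.integ^[r] (h y) s / r.factorial) τ s
  set v : ℕ → ℂ := fun r => D.conv (fun y s => D.integ^[r] (h y) s / r.factorial) τ s
  set t : ℕ → ℂ := fun r => D.integ^[r] (h τ) s / r.factorial
  have ha : HasSum a (ker B τ β * D.series C (β ::ₘ s)) :=
    (D.summable_series hA hQ hW hCb _).hasSum.mul_left _
  have hp : HasSum p (prolong B (fun y => D.series (h y)) τ s) :=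
    hasSum_multiset_sum s fun y _ => (D.summable_series hA hQ hW (hhb y) _).hasSum.mul_left _
  have hdiv : ∀ (r n : ℕ), NiceAt n fun y s => D.integ^[r] (h y) s / (r.factorial : ℂ) :=
    fun r n => by
      simpa only [div_eq_inv_mul] using (D.niceAt_iterate hh r n).mul
        (g := fun _ => ((r.factorial : ℂ))⁻¹) continuous_const fun _ => le_rfl
  have hv : HasSum v (D.conv (fun y => D.series (h y)) τ s) := by
    have hb : ∀ (r : ℕ) (x : ℝ), ‖weight ε x * (ker B τ (D.pt x) *
        (D.integ^[r] (h (D.pt x)) s / r.factorial))‖ ≤ ‖weight ε x‖ * (2 / κ ^ 2 *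
        (A * (s.card + c).factorial * 2 ^ (s.card + c) * Q ^ s.card * (1 / 2) ^ r)) :=
      fun r x => by
        rw [norm_mul, norm_mul]
        exact mul_le_mul_of_nonneg_left (mul_le_mul (norm_ker_le D.narrow _ _)
          (D.norm_term_le hA hQ hW (hhb _) s r) (norm_nonneg _)
          ((norm_nonneg _).trans (norm_ker_le D.narrow τ τ))) (norm_nonneg _)
    have hi := fun r => D.integrable_conv (hdiv r _) τ (s := s) rfl
    have hs : Summable fun r => ∫ x : ℝ, ‖weight ε x * (ker B τ (D.pt x) *
        (D.integ^[r] (h (D.pt x)) s / r.factorial))‖ := by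
      refine Summable.of_nonneg_of_le (fun r => integral_nonneg fun x => norm_nonneg _) (fun r =>
        (integral_mono (hi r).norm (D.int.norm.mul_const _) (hb r)).trans_eq
          (integral_mul_const _ _)) ?_
      exact ((hasSum_geometric_two.summable.mul_left _).mul_left _).mul_left _
    have h1 := hasSum_integral_of_summable_integral_norm hi hs
    simp only [tsum_mul_left] at h1
    exact h1
  have e0 : t 0 = a 0 + p 0 := by simpa [t, a, p] using heq τ s
  -- the term `(r + 1) conv` from `iterate_prolong` cancels one factor of `(r + 1)!`
  have hstep : ∀ r, t (r + 1) = a (r + 1) + p (r + 1) + v r := fun r => by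
    have e1 : h τ = fun s => ker B τ β * C (β ::ₘ s) + prolong B h τ s := funext (heq τ)
    have hf : ((r + 1).factorial : ℂ) = (r + 1) * r.factorial := by
      rw [Nat.factorial_succ]; push_cast; ring
    have hr0 : (r.factorial : ℂ) ≠ 0 := by exact_mod_cast r.factorial_ne_zero
    have hr1 : (r + 1 : ℂ) ≠ 0 := by exact_mod_cast r.succ_ne_zero
    simp only [t, a, p, v]
    conv_lhs => rw [e1]
    rw [D.iterate_add (niceAt_ker_mul D.narrow hC β) (NiceAt.prolong' D.narrow hh),
      D.iterate_const_mul, D.iterate_prolong hh]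
    simp only [D.iterate_cons]
    have e2 : prolong B (fun y s => D.integ^[r + 1] (h y) s / ((r + 1).factorial : ℂ)) τ s =
        prolong B (fun y => D.integ^[r + 1] (h y)) τ s / ((r + 1).factorial : ℂ) := by
      simp only [prolong, div_eq_mul_inv, ← mul_assoc, Multiset.sum_map_mul_right]
    have e3 : D.conv (fun y s => D.integ^[r] (h y) s / (r.factorial : ℂ)) τ s =
        D.conv (fun y => D.integ^[r] (h y)) τ s / (r.factorial : ℂ) := by
      simp only [conv, div_eq_mul_inv, ← mul_assoc, integral_mul_const]
    rw [e2, e3, hf]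
    field_simp
    ring
  have ht : Summable t := D.summable_series hA hQ hW (hhb τ) s
  change ∑' r, t r = _
  rw [ht.tsum_eq_zero_add, e0]
  simp only [hstep]
  have ha' := (summable_nat_add_iff 1).2 ha.summable
  have hp' := (summable_nat_add_iff 1).2 hp.summable
  rw [(ha'.add hp').tsum_add hv.summable, ha'.tsum_add hp', hv.tsum_eq, ← ha.tsum_eq,
    ← hp.tsum_eq, ha.summable.tsum_eq_zero_add, hp.summable.tsum_eq_zero_add]
  ring

end IsDressing

/-! ### Relations between dressed form factors -/

section Chains

variable {B b κ : ℝ} {C : Multiset (strip b) → ℂ}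

/-- Chains `φ(τ - y₁) φ(y₁ - y₂) ⋯ φ(y_p - β) C(β, s - {y₁, …, y_p})` with fewer than `n` links,
summed over all `y₁, …, y_p ∈ s`. -/
def chainMSAux (B : ℝ) (C : Multiset (strip b) → ℂ) (β : strip b) :
    ℕ → strip b → Multiset (strip b) → ℂ
  | 0 => fun _ _ => 0
  | n + 1 => fun τ s => ker B τ β * C (β ::ₘ s) + prolong B (chainMSAux B C β n) τ s

/-- The sum over all chains from `τ` to `β`; the version of `chainFF` for multisets. -/
def chainMS (B : ℝ) (C : Multiset (strip b) → ℂ) (β τ : strip b) (s : Multiset (strip b)) : ℂ :=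
  chainMSAux B C β (s.card + 1) τ s

lemma chainMS_eq (β τ : strip b) (s : Multiset (strip b)) : chainMS B C β τ s =
    ker B τ β * C (β ::ₘ s) + prolong B (chainMS B C β) τ s := by
  classical
  rw [chainMS, chainMSAux]
  simp only [prolong]
  congr 2
  refine Multiset.map_congr rfl fun y hy => ?_
  rw [chainMS, Multiset.card_erase_of_mem hy, Nat.pred_eq_sub_one,
    Nat.sub_add_cancel (Multiset.card_pos_iff_exists_mem.2 ⟨y, hy⟩)]

lemma niceAt_chainMS (H : IsNarrow B b κ) (hC : ∀ n, NiceAt n fun _ : Unit => C) (β : strip b)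
    (n : ℕ) : NiceAt n (chainMS B C β) := by
  rw [show chainMS B C β = fun τ s => _ from funext fun τ => funext fun s => chainMS_eq β τ s]
  induction n with
  | zero => exact (niceAt_ker_mul H hC β 0).add (niceAt_prolong_zero _)
  | succ n ih =>
    refine (niceAt_ker_mul H hC β (n + 1)).add (NiceAt.prolong H ?_)
    rwa [show chainMS B C β = fun τ s => _ from funext fun τ => funext fun s => chainMS_eq β τ s]

/-- `n` rapidities have at most `n! / (n - p)!` chains with `p` links, which is compensated by the
smaller factorial in the bound for the remaining ones. -/
lemma factBound_chainMS (H : IsNarrow B b κ) {A Q : ℝ} (hA : 0 ≤ A) (hQ : 1 ≤ Q)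
    (hκ : 2 / κ ^ 2 ≤ Q) (hC : IsDressing.FactBound A Q 0 C) (β τ : strip b) :
    IsDressing.FactBound (A * Q ^ 2) (2 * Q) 1 (chainMS B C β τ) := by
  have hQ0 : 0 ≤ Q := by linarith
  suffices ∀ n τ s, s.card = n → ‖chainMS B C β τ s‖ ≤
      A * Q ^ 2 * (n + 1).factorial * (2 * Q) ^ n from fun s => this _ τ s rfl
  intro n
  induction n with
  | zero =>
    intro τ s hs
    rw [chainMS_eq, Multiset.card_eq_zero.1 hs]
    have h1 := hC (β ::ₘ 0)
    simp only [prolong, Multiset.map_zero, Multiset.sum_zero, add_zero, norm_mul]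
    refine (mul_le_mul ((norm_ker_le H τ β).trans hκ) h1 (norm_nonneg _) hQ0).trans_eq ?_
    simp; ring
  | succ n ih =>
    intro τ s hs
    rw [chainMS_eq]
    refine (norm_add_le _ _).trans ((add_le_add ((norm_mul_le _ _).trans (mul_le_mul
      ((norm_ker_le H τ β).trans hκ) (hC _) (norm_nonneg _) hQ0))
      (norm_prolong_le H ih τ hs)).trans ?_)
    have hf : ((n + 1 + 1).factorial : ℝ) = (n + 2) * (n + 1).factorial := by
      rw [Nat.factorial_succ]; push_cast; ring
    have h2 : (2 : ℝ) * Q ^ (n + 1) ≤ (2 * Q) ^ (n + 1) := by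
      rw [mul_pow]
      exact mul_le_mul_of_nonneg_right (le_self_pow₀ one_le_two n.succ_ne_zero) (by positivity)
    simp only [Multiset.card_cons, hs, add_zero]
    calc _ ≤ Q * (A * (n + 1 + 1).factorial * Q ^ (n + 1 + 1)) +
          (n + 1) * (Q * (A * Q ^ 2 * (n + 1).factorial * (2 * Q) ^ n)) := by gcongr
      _ = A * Q ^ 2 * (n + 1).factorial * ((n + 2) * (2 * Q ^ (n + 1)) +
          (n + 1) * (2 * Q) ^ (n + 1)) / 2 := by rw [hf]; ring
      _ ≤ A * Q ^ 2 * (n + 1).factorial * ((n + 2) * (2 * Q) ^ (n + 1) +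
          (n + 2) * (2 * Q) ^ (n + 1)) / 2 := by gcongr; linarith
      _ = _ := by rw [hf]; ring

/-- The position `y + iπ/2` as a point of the strips. -/
def IsNarrow.root (H : IsNarrow B b κ) (y : ℝ) : strip b := ⟨shifted y, shifted_mem_strip H.pos y⟩

end Chains

namespace IsDressing

variable {B b κ : ℝ} {ε : ℂ → ℂ}

/-- A solution of the dressing equation takes the values of the dressed kernel at the roots. -/
lemma eq_dressedPhi (D : IsDressing B b κ ε) {k : ℕ} {y : Fin k → ℝ} {c : Vec k}
    {u : strip b → ℂ} (hu : Continuous u) {M : ℝ} (hM : ∀ τ, ‖u τ‖ ≤ M)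
    (h : ∀ τ, u τ = (∑ i, c i * ker B τ (D.narrow.root (y i))) +
      ∫ x : ℝ, weight ε x * (ker B τ (D.pt x) * u (D.pt x))) (x : ℝ) :
    u (D.narrow.root x) = ∑ i, c i * dressedPhi B ε x (y i) := by
  have hn := D.narrow
  have hs := D.chainSum_sum_rootKernel x y c
  have h1 := D.chainSum_eq_of_eq (continuous_rootKernel hn x) (norm_rootKernel_le hn x)
    (g := fun z => ∑ i, c i * rootKernel B (y i) z) hs.1
    (u := fun t => u (D.pt t)) (D.mem_adm_of_bounded (hu.comp D.continuous_pt) fun _ => hM _)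
    fun t => by
      rw [h]
      congr 2; ext v
      change _ * (phi B ((t : ℂ) - v) * _) = _
      ring
  simp only [dressedPhi, mul_add, Finset.sum_add_distrib]
  rw [← hs.2, h1, h]
  congr 1
  · refine Finset.sum_congr rfl fun i _ => ?_
    change c i * phi B (shifted x - shifted (y i)) = _
    rw [shifted_sub_shifted, Complex.ofReal_sub]
  · congr 1; ext t
    rw [rootKernel, phi_sub_comm hn (ofReal_mem_strip hn.pos t) (shifted_mem_strip hn.pos x)]
    rfl

/-- The dressed kernel is symmetric because the dressing operator is. -/
lemma dressedPhi_comm (D : IsDressing B b κ ε) (x y : ℝ) :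
    dressedPhi B ε x y = dressedPhi B ε y x := by
  have hn := D.narrow
  rw [dressedPhi, dressedPhi, D.chainSum_comm (continuous_rootKernel hn x)
    (norm_rootKernel_le hn x) (continuous_rootKernel hn y) (norm_rootKernel_le hn y),
    phi_sub_comm hn (ofReal_mem_strip hn.pos x) (ofReal_mem_strip hn.pos y)]

/-- A symmetric function of the rapidities with factorial bounds, whose values at coinciding
rapidities are given by chains; the connected form factors are of this kind. -/
structure IsChained (D : IsDressing B b κ ε) (A Q : ℝ) (C : Multiset (strip b) → ℂ) : Prop where
  nice : ∀ n, NiceAt n fun _ : Unit => C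
  bound : FactBound A Q 0 C
  nonneg : 0 ≤ A
  one_le : 1 ≤ Q
  ker_le : 2 / κ ^ 2 ≤ Q
  small : 2 * (2 * Q) * ∫ x : ℝ, ‖weight ε x‖ ≤ 1 / 2
  coincide : ∀ β s, C (β ::ₘ β ::ₘ s) = 2 * chainMS B C β β s

namespace IsChained

variable {D : IsDressing B b κ ε} {A Q : ℝ} {C : Multiset (strip b) → ℂ} (hC : D.IsChained A Q C)

/-- `k` rapidities at `y + iπ/2` and `l` rapidities at `y' + iπ/2`. -/
def _root_.SinhGordon.IsNarrow.roots (H : IsNarrow B b κ) (y y' : ℝ) (k l : ℕ) :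
    Multiset (strip b) :=
  Multiset.replicate k (H.root y) + Multiset.replicate l (H.root y')

/-- The dressed form factor with `k` rapidities at `y + iπ/2` and `l` at `y' + iπ/2`. -/
def _root_.SinhGordon.IsDressing.dress (D : IsDressing B b κ ε) (C : Multiset (strip b) → ℂ)
    (y y' : ℝ) (k l : ℕ) : ℂ := D.series C (D.narrow.roots y y' k l)

include hC

lemma nonneg_Q : 0 ≤ Q := zero_le_one.trans hC.one_le

lemma small' : 2 * Q * ∫ x : ℝ, ‖weight ε x‖ ≤ 1 / 2 := by
  have h0 : 0 ≤ ∫ x : ℝ, ‖weight ε x‖ := integral_nonneg fun x => norm_nonneg _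
  nlinarith [hC.small, hC.nonneg_Q]

lemma factBound : FactBound (A * Q ^ 2) (2 * Q) 0 C := fun s => (hC.bound s).trans <| by
  have := hC.nonneg_Q
  have := hC.nonneg
  have h1 : A ≤ A * Q ^ 2 := le_mul_of_one_le_right hC.nonneg (one_le_pow₀ hC.one_le)
  gcongr
  linarith

lemma dress_add_two (y y' : ℝ) (k l : ℕ) : D.dress C y y' (k + 2) l =
    2 * D.series (chainMS B C (D.narrow.root y) (D.narrow.root y)) (D.narrow.roots y y' k l) := by
  have e : D.narrow.roots y y' (k + 2) l =
      D.narrow.root y ::ₘ D.narrow.root y ::ₘ D.narrow.roots y y' k l := by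
    simp only [IsNarrow.roots, Multiset.replicate_succ, Multiset.cons_add]
  rw [dress, e]
  simp only [series, ← D.iterate_cons C, ← D.iterate_cons (fun s => C (_ ::ₘ s)), hC.coincide]
  rw [← tsum_mul_left]
  congr 1; ext r
  rw [D.iterate_const_mul, mul_div_assoc]

/-- The integrated chains are dressed by `dressedPhi`. -/
lemma series_chainMS (y y' x : ℝ) (k l : ℕ) :
    D.series (chainMS B C (D.narrow.root y) (D.narrow.root x)) (D.narrow.roots y y' k l) =
    dressedPhi B ε x y * ((1 + k / 2) * D.dress C y y' (k + 1) l) +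
      l * (dressedPhi B ε x y' * D.series (chainMS B C (D.narrow.root y) (D.narrow.root y'))
        (D.narrow.roots y y' k (l - 1))) := by
  classical
  set β := D.narrow.root y
  set β' := D.narrow.root y'
  set h := chainMS B C β
  have hA : 0 ≤ A * Q ^ 2 := mul_nonneg hC.nonneg (sq_nonneg _)
  have hQ : 0 ≤ 2 * Q := by linarith [hC.one_le]
  have hh := niceAt_chainMS D.narrow hC.nice β
  have hb := factBound_chainMS D.narrow hC.nonneg hC.one_le hC.ker_le hC.bound β
  set s := D.narrow.roots y y' k l with hs
  have hkey := fun τ => D.series_chain hC.nice hh (chainMS_eq β) hA hQ hC.small hC.factBound hb τ s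
  -- a chain that next visits one of the `k` rapidities at `y` is half a value of the form factor at
  -- coinciding rapidities; the `l` rapidities at `y'` give an unknown constant
  have hsum : ∀ τ, prolong B (fun y => D.series (h y)) τ s =
      k / 2 * D.dress C y y' (k + 1) l * ker B τ β +
      l * D.series (h β') (D.narrow.roots y y' k (l - 1)) * ker B τ β' := fun τ => by
    rw [prolong, hs, IsNarrow.roots, Multiset.map_add, Multiset.sum_add, Multiset.map_replicate,
      Multiset.map_replicate, Multiset.sum_replicate, Multiset.sum_replicate, nsmul_eq_mul,
      nsmul_eq_mul]
    congr 1
    · rcases k with _ | k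
      · simp
      have e1 : (Multiset.replicate (k + 1) β + Multiset.replicate l β').erase β =
          D.narrow.roots y y' k l := by
        rw [Multiset.replicate_succ, Multiset.cons_add, Multiset.erase_cons_head]; rfl
      rw [e1, hC.dress_add_two]; ring
    · rcases l with _ | l
      · simp
      have e1 : (Multiset.replicate k β + Multiset.replicate (l + 1) β').erase β' =
          D.narrow.roots y y' k l := by
        rw [Multiset.replicate_succ, Multiset.add_cons, Multiset.erase_cons_head]; rfl
      rw [e1, Nat.add_sub_cancel]; ring
  have e0 : D.series C (β ::ₘ s) = D.dress C y y' (k + 1) l := by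
    rw [dress, IsNarrow.roots, Multiset.replicate_succ, Multiset.cons_add]; rfl
  have := D.eq_dressedPhi (y := ![y, y']) (c := ![(1 + k / 2) * D.dress C y y' (k + 1) l,
    l * D.series (h β') (D.narrow.roots y y' k (l - 1))]) (u := fun τ => D.series (h τ) s)
    (D.continuous_series hh hA hQ hC.small hb s) (fun τ => D.norm_series_le hA hQ hC.small (hb τ) s)
    (fun τ => by
      rw [hkey, hsum, e0, Fin.sum_univ_two]
      simp only [Matrix.cons_val_zero, Matrix.cons_val_one, conv]
      ring) x
  rw [this, Fin.sum_univ_two]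
  simp only [Matrix.cons_val_zero, Matrix.cons_val_one]
  ring

/-- The relation that determines a dressed form factor with two or more rapidities at the same
root from those with fewer rapidities. -/
theorem dress_relation (y y' : ℝ) (k l : ℕ) : D.dress C y y' (k + 2) l =
    (k + 2) * dressedPhi B ε y y * D.dress C y y' (k + 1) l +
    l * dressedPhi B ε y' y' * D.dress C y y' (k + 2) (l - 1) - (k + 2) * l *
      (dressedPhi B ε y y * dressedPhi B ε y' y' - dressedPhi B ε y y' ^ 2) *
        D.dress C y y' (k + 1) (l - 1) := by
  have h1 := hC.series_chainMS y y' y k l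
  have h2 := hC.series_chainMS y y' y k (l - 1)
  have h3 := hC.series_chainMS y y' y' k (l - 1)
  rw [D.dressedPhi_comm y' y] at h3
  rw [hC.dress_add_two, h1, hC.dress_add_two, h3]
  linear_combination (-l * dressedPhi B ε y' y' * 2) * h2

end IsChained

end IsDressing

/-! ### The connected form factors as symmetric functions -/

lemma exists_perm_of_ms_eq {α : Type*} {n : ℕ} {θ θ' : Fin n → α} (h : ms θ = ms θ') :
    ∃ σ : Equiv.Perm (Fin n), θ' ∘ σ = θ := by
  classical
  have e : ∀ c, Nonempty ({a // θ a = c} ≃ {a // θ' a = c}) := fun c => by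
    rw [← Fintype.card_eq, Fintype.card_subtype, Fintype.card_subtype]
    have := congrArg (Multiset.count c) h
    rw [ms, ms, Multiset.count_map, Multiset.count_map] at this
    simpa only [Finset.card, Finset.filter_val, eq_comm] using this
  have e := fun c => (e c).some
  exact ⟨Equiv.ofFiberEquiv e, funext fun a => Equiv.ofFiberEquiv_map e a⟩

lemma ms_append {α : Type*} {m n : ℕ} (θ : Fin m → α) (ξ : Fin n → α) :
    ms (Fin.append θ ξ) = ms θ + ms ξ := by
  simp only [ms, Fin.univ_val_map, List.ofFn_fin_append, Multiset.coe_add]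

/-- The connected form factor as a function of multisets. -/
def symFF (b : ℝ) (F : (n : ℕ) → Vec n → ℂ) (s : Multiset (strip b)) : ℂ :=
  connectedFF F s.card fun i => (exists_ms s).choose i

namespace IsBoundedFF

variable {B b κ : ℝ} {F G : (n : ℕ) → Vec n → ℂ} (H : IsBoundedFF B b κ F G) {n : ℕ}

include H

lemma symFF_ms (θ : Fin n → strip b) : symFF b F (ms θ) = connectedFF F n fun i => θ i := by
  have key : ∀ (m : ℕ) (ξ : Fin m → strip b), m = n → ms ξ = ms θ →
      (connectedFF F m fun i => ξ i) = connectedFF F n fun i => θ i := by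
    rintro _ ξ rfl h
    obtain ⟨σ, rfl⟩ := exists_perm_of_ms_eq h
    exact H.comp_perm σ (θ := fun i => (θ i : ℂ)) fun j => (θ j).2
  exact key _ _ (card_ms θ) (exists_ms (ms θ)).choose_spec

lemma symFF_cons (s : Multiset (strip b)) : ∃ g : ℂ → ℂ, DifferentiableOn ℂ g (strip b) ∧
    ∀ z : strip b, symFF b F (z ::ₘ s) = g z := by
  obtain ⟨n, Y, rfl⟩ : ∃ (n : ℕ) (Y : Fin n → strip b), ms Y = s := ⟨_, exists_ms s⟩
  refine ⟨_, H.differentiableOn (θ := vcons (0 : ℝ) fun i => Y i)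
    (vcons_mem_stripPi (ofReal_mem_strip H.narrow.pos 0) fun i => (Y i).2) 0, fun z => ?_⟩
  rw [← ms_cons, H.symFF_ms, Fin.update_cons_zero]
  congr 1; ext i
  refine Fin.cases rfl (fun j => rfl) i

lemma chainFF_eq_chainMS (τ β : strip b) (Y : Fin n → strip b) :
    chainFF B (connectedFF F) n τ β (fun i => Y i) = chainMS B (symFF b F) β τ (ms Y) := by
  classical
  have e : ∀ n (Y : Fin n → strip b), connectedFF F (n + 1) (vcons β fun i => Y i) =
      symFF b F (β ::ₘ ms Y) := fun n Y => by
    rw [← ms_cons, H.symFF_ms]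
    congr 1; ext i
    refine Fin.cases rfl (fun j => rfl) i
  induction n generalizing τ with
  | zero =>
    rw [chainFF, chainMS_eq, e, prolong, ms_zero, Multiset.map_zero, Multiset.sum_zero, add_zero]
    rfl
  | succ n ih =>
    rw [chainFF, chainMS_eq, e, prolong]
    congr 1
    conv_rhs => rw [ms, Multiset.map_map]
    refine Finset.sum_congr rfl fun k _ => ?_
    refine congrArg _ ((ih (Y k) fun j => Y (k.succAbove j)).trans ?_)
    change _ = chainMS B (symFF b F) β (Y k) ((ms Y).erase (Y k))
    rw [ms_succAbove Y k, Multiset.erase_cons_head]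

/-- The connected form factors satisfy the hypotheses of the dressing relations. -/
lemma isChained {ε : ℂ → ℂ} (D : IsDressing B b κ ε) {A K Q : ℝ} (hK : FactorialBound F b K)
    (hA : 1 ≤ A) (hA' : ‖connectedFF F 0 ![]‖ ≤ A) (hQ : 1 ≤ Q) (hKQ : |K| ≤ Q)
    (hκ : 2 / κ ^ 2 ≤ Q) (hW : 2 * (2 * Q) * ∫ x : ℝ, ‖weight ε x‖ ≤ 1 / 2) :
    D.IsChained A Q (symFF b F) := by
  have hb : IsDressing.FactBound A Q 0 (symFF b F) := fun s => by
    obtain ⟨n, Y, rfl⟩ : ∃ (n : ℕ) (Y : Fin n → strip b), ms Y = s := ⟨_, exists_ms s⟩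
    rw [H.symFF_ms, card_ms, add_zero]
    rcases n with _ | n
    · simpa [Subsingleton.elim (fun i => (Y i : ℂ)) ![]] using hA'
    · refine (hK (n + 1) (by omega) _ fun j => (Y j).2).trans ?_
      have h1 : K ^ (n + 1) ≤ Q ^ (n + 1) := (le_abs_self _).trans <| by
        rw [abs_pow]; exact pow_le_pow_left₀ (abs_nonneg K) hKQ _
      have h2 : (1 : ℝ) * ((n + 1).factorial * K ^ (n + 1)) ≤
          A * ((n + 1).factorial * Q ^ (n + 1)) :=
        (one_mul _).trans_le ((mul_le_mul_of_nonneg_left h1 (by positivity)).trans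
          (le_mul_of_one_le_left (by positivity) hA))
      linarith
  refine ⟨fun n => ⟨fun m s hs => ?_, A * n.factorial * Q ^ n, fun _ s hs => ?_⟩, hb, by linarith,
    hQ, hκ, hW, fun β s => ?_⟩
  · obtain ⟨k, ξ, rfl⟩ : ∃ (k : ℕ) (ξ : Fin k → strip b), ms ξ = s := ⟨_, exists_ms s⟩
    have e : (fun p : Unit × (Fin m → strip b) => symFF b F (ms p.2 + ms ξ)) = fun p =>
        connectedFF F (m + k) fun i => ((Fin.append p.2 ξ i : strip b) : ℂ) := funext fun p => by
      rw [← ms_append, H.symFF_ms]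
    rw [e]
    refine (H.continuousOn _).comp_continuous (f := fun (p : Unit × (Fin m → strip b)) i =>
      ((Fin.append p.2 ξ i : strip b) : ℂ)) (continuous_pi fun i => ?_)
        fun p i => (Fin.append p.2 ξ i).2
    refine Fin.addCases (fun j => ?_) (fun j => ?_) i
    · simp only [Fin.append_left]; fun_prop
    · simp only [Fin.append_right]; fun_prop
  · simpa [hs] using hb s
  · obtain ⟨n, Y, rfl⟩ : ∃ (n : ℕ) (Y : Fin n → strip b), ms Y = s := ⟨_, exists_ms s⟩
    rw [← H.chainFF_eq_chainMS, ← H.coincidence β.2 fun i => (Y i).2, ← ms_cons, ← ms_cons,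
      H.symFF_ms]
    congr 1; ext i
    refine Fin.cases rfl (fun j => Fin.cases rfl (fun j => rfl) j) i

end IsBoundedFF

/-! ### Contour integrals as commuting operators -/

section Operators

variable {B b κ : ℝ} {ε : ℂ → ℂ}

/-- The symmetric functions that are continuous and bounded for each number of rapidities and
holomorphic in each rapidity. -/
def holSym (b : ℝ) : Submodule ℂ (Multiset (strip b) → ℂ) where
  carrier := {f | (∀ n, NiceAt n fun _ : Unit => f) ∧ ∀ s, ∃ g : ℂ → ℂ,
    DifferentiableOn ℂ g (strip b) ∧ ∀ z : strip b, f (z ::ₘ s) = g z}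
  add_mem' {f f'} hf hf' := ⟨fun n => (hf.1 n).add (hf'.1 n), fun s => by
    obtain ⟨g, hg, e⟩ := hf.2 s
    obtain ⟨g', hg', e'⟩ := hf'.2 s
    exact ⟨_, hg.add hg', fun z => congrArg₂ (· + ·) (e z) (e' z)⟩⟩
  zero_mem' := ⟨fun _ => ⟨fun _ _ _ => continuous_const, 0, fun _ _ _ => norm_zero.le⟩,
    fun s => ⟨0, differentiableOn_const 0, fun _ => rfl⟩⟩
  smul_mem' c f hf := ⟨fun n => (hf.1 n).mul (g := fun _ => c) continuous_const fun _ => le_rfl,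
    fun s => by
      obtain ⟨g, hg, e⟩ := hf.2 s
      exact ⟨_, hg.const_mul c, fun z => congrArg (c * ·) (e z)⟩⟩

/-- Inserting a rapidity. -/
def insertOp (β : strip b) : holSym b →ₗ[ℂ] holSym b where
  toFun f := ⟨fun s => f.1 (β ::ₘ s), fun n => (f.2.1 (n + 1)).cons (g := fun _ => β)
    continuous_const, fun s => by
      obtain ⟨g, hg, e⟩ := f.2.2 (β ::ₘ s)
      exact ⟨g, hg, fun z => (congrArg f.1 (Multiset.cons_swap _ _ _)).trans (e z)⟩⟩
  map_add' _ _ := rfl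
  map_smul' _ _ := rfl

/-- Integrating a rapidity over the real line against the weight. -/
def IsDressing.integOp (D : IsDressing B b κ ε) : holSym b →ₗ[ℂ] holSym b where
  toFun f := ⟨D.integ f.1, fun n => D.niceAt_integ (f.2.1 (n + 1)), fun s => by
    choose g hg e using fun x : ℝ => f.2.2 (D.pt x ::ₘ s)
    obtain ⟨M, hM⟩ := (f.2.1 (s.card + 2)).2
    have e' : ∀ (z : strip b) x, f.1 (D.pt x ::ₘ z ::ₘ s) = g x z := fun z x => by
      rw [Multiset.cons_swap, e]
    have hint : ∀ z : strip b, Integrable fun x : ℝ => weight ε x * g x z := fun z => by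
      simp only [← e']
      exact D.integrable_integ (f.2.1 (s.card + 2)) () (by simp)
    refine ⟨fun z => ∫ x : ℝ, weight ε x * g x z, fun z hz => ?_, fun z => ?_⟩
    · exact (hasDerivAt_integral_of_holomorphic isOpen_strip
        (bound := fun x : ℝ => ‖weight ε x‖ * M)
        (fun z hz => (hint ⟨z, hz⟩).aestronglyMeasurable) (fun x => (hg x).const_mul _)
        (fun z hz x => by
          rw [norm_mul, ← e' ⟨z, hz⟩]
          exact mul_le_mul_of_nonneg_left (hM () _ (by simp)) (norm_nonneg _))
        (D.int.norm.mul_const M) hz).2.differentiableAt.differentiableWithinAt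
    · simp only [IsDressing.integ, e']⟩
  map_add' f f' := Subtype.ext <| funext fun s =>
    D.integ_add (f.2.1 (s.card + 1)) (f'.2.1 (s.card + 1)) () rfl
  map_smul' c f := Subtype.ext <| funext <| D.integ_const_mul c f.1

lemma commute_insertOp (β β' : strip b) : Commute (insertOp β) (insertOp β') :=
  LinearMap.ext fun f => Subtype.ext <| funext fun _ => congrArg f.1 (Multiset.cons_swap _ _ _)

lemma IsDressing.commute_integOp (D : IsDressing B b κ ε) (β : strip b) :
    Commute D.integOp (insertOp β) :=
  LinearMap.ext fun f => Subtype.ext <| funext fun s => D.iterate_cons f.1 β 1 s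

lemma IsDressing.integOp_pow (D : IsDressing B b κ ε) (n : ℕ) (f : holSym b) :
    ((D.integOp ^ n) f).1 = D.integ^[n] f.1 := by
  induction n with
  | zero => rfl
  | succ n ih => rw [pow_succ', Function.iterate_succ', Function.comp, ← ih]; rfl

/-- A sum of integrals of a symmetric function over all ways to distribute the rapidities over
the pieces of a contour is a power of the sum of the operators for the pieces. -/
theorem sum_integral_pieces {ι : Type*} [Fintype ι] {μ : ι → Measure ℝ} [∀ p, SigmaFinite (μ p)]
    {P : ι → ℝ → strip b} (hP : ∀ p, Continuous (P p)) {ω : ι → ℝ → ℂ}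
    (hω : ∀ p, Integrable (ω p) (μ p)) {X : ι → holSym b →ₗ[ℂ] holSym b}
    (hX : ∀ p f s, (X p f).1 s = ∫ t, ω p t * f.1 (P p t ::ₘ s) ∂μ p) (n : ℕ) (f : holSym b)
    (s : Multiset (strip b)) :
    (∀ c : Fin n → ι, Integrable (fun t => (∏ i, ω (c i) (t i)) *
      f.1 (ms (fun i => P (c i) (t i)) + s)) (Measure.pi fun i => μ (c i))) ∧
    ∑ c : Fin n → ι, ∫ t, (∏ i, ω (c i) (t i)) * f.1 (ms (fun i => P (c i) (t i)) + s)
      ∂(Measure.pi fun i => μ (c i)) = (((∑ p, X p) ^ n) f).1 s := by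
  have hint : ∀ n (f : holSym b) (c : Fin n → ι), Integrable (fun t => (∏ i, ω (c i) (t i)) *
      f.1 (ms (fun i => P (c i) (t i)) + s)) (Measure.pi fun i => μ (c i)) := fun n f c => by
    obtain ⟨M, hM⟩ := (f.2.1 (n + s.card)).2
    refine (Integrable.fintype_prod_dep fun i => hω (c i)).mul_bdd (c := M)
      (Continuous.aestronglyMeasurable ?_) (Eventually.of_forall fun t => hM () _ (by simp))
    exact ((f.2.1 (n + s.card)).1 n s rfl).comp (f := fun t : Fin n → ℝ =>
      ((), fun i => P (c i) (t i))) (by fun_prop)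
  refine ⟨hint n f, ?_⟩
  induction n generalizing f with
  | zero => simp [Measure.real]
  | succ n ih =>
    have key : ∀ p (c : Fin n → ι), ∫ t, (∏ i, ω ((Fin.cons p c : Fin (n + 1) → ι) i) (t i)) *
        f.1 (ms (fun i => P ((Fin.cons p c : Fin (n + 1) → ι) i) (t i)) + s)
          ∂(Measure.pi fun i => μ ((Fin.cons p c : Fin (n + 1) → ι) i)) =
        ∫ t, (∏ i, ω (c i) (t i)) * (X p f).1 (ms (fun i => P (c i) (t i)) + s)
          ∂(Measure.pi fun i => μ (c i)) := fun p c => by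
      have h1 := integral_pi_succ (hint (n + 1) f (Fin.cons p c))
      have h2 := h1.2.trans (integral_prod_symm _ h1.1)
      refine h2.trans (integral_congr_ae (Eventually.of_forall fun t => ?_))
      simp only [hX, ← integral_const_mul]
      refine integral_congr_ae (Eventually.of_forall fun x => ?_)
      simp only [Fin.prod_univ_succ, Fin.cons_zero, Fin.cons_succ]
      rw [ms_succAbove _ 0]
      simp only [Fin.cons_zero, Fin.zero_succAbove, Fin.cons_succ, Multiset.cons_add]
      ring
    rw [← (Fin.consEquiv fun _ => ι).sum_comp, Fintype.sum_prod_type]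
    simp only [Fin.consEquiv, Equiv.coe_fn_mk, key, ih]
    rw [pow_succ, Module.End.mul_apply, LinearMap.sum_apply, map_sum]
    simp only [Submodule.coe_sum, Finset.sum_apply]

end Operators

/-! ### The pieces of the contour -/

/-- Clockwise integration along a small circle around a simple zero of `A` of a function with
denominator `A`. -/
lemma eventually_clockwise {U : Set ℂ} (hU : IsOpen U) {A : ℂ → ℂ} (hA : DifferentiableOn ℂ A U)
    {ρ : ℂ} (hρ : ρ ∈ U) (h0 : A ρ = 0) {n : ℂ} (hn : n ≠ 0)
    (hd : HasDerivAt A (-(I * n)) ρ) : ∀ᶠ r : ℝ in 𝓝[>] 0,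
    (∀ t : ℝ, ρ + r * exp (-(I * t)) ∈ U) ∧
    IntegrableOn (fun t : ℝ => -(I * r * exp (-(I * t))) *
      (1 / (2 * π) * (1 / A (ρ + r * exp (-(I * t))))))
      (Set.Ioc 0 (2 * π)) ∧
    ∀ g : ℂ → ℂ, DifferentiableOn ℂ g U → ∫ t : ℝ in Set.Ioc 0 (2 * π),
      -(I * r * exp (-(I * t))) *
      (1 / (2 * π) * (1 / A (ρ + r * exp (-(I * t))))) *
      g (ρ + r * exp (-(I * t))) = n⁻¹ * g ρ := by
  have hq := (Complex.differentiableOn_dslope (hU.mem_nhds hρ)).2 hA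
  have hqρ : dslope A ρ ρ = -(I * n) := by rw [dslope_same, hd.deriv]
  have hA' : ∀ z, A z = (z - ρ) * dslope A ρ z := fun z => by
    rw [← smul_eq_mul, sub_smul_dslope, h0, sub_zero]
  obtain ⟨R, hR, hRU⟩ := Metric.mem_nhds_iff.1 (Filter.inter_mem (hU.mem_nhds hρ)
    ((hq.continuousOn.continuousAt (hU.mem_nhds hρ)).eventually_ne
      (y := 0) (by rw [hqρ]; simpa using hn)))
  filter_upwards [Ioo_mem_nhdsGT hR] with r hr
  have hsub : closedBall ρ r ⊆ U ∩ {z | dslope A ρ z ≠ 0} :=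
    (Metric.closedBall_subset_ball hr.2).trans hRU
  have hcirc : ∀ t : ℝ, ρ + r * exp (-(I * t)) = circleMap ρ r (2 * π - t) :=
    fun t => by
      rw [circleMap, show ((2 * π - t : ℝ) : ℂ) * I =
        2 * π * I - I * t by push_cast; ring, sub_eq_add_neg,
        Complex.exp_add, Complex.exp_two_pi_mul_I, one_mul]
  have hmem : ∀ t, circleMap ρ r t ∈ U ∩ {z | dslope A ρ z ≠ 0} := fun t =>
    hsub (circleMap_mem_closedBall ρ hr.1.le t)
  have hne : ∀ t, A (circleMap ρ r t) ≠ 0 := fun t => by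
    rw [hA']
    exact mul_ne_zero (sub_ne_zero.2 (circleMap_ne_center hr.1.ne')) (hmem t).2
  simp only [hcirc]
  refine ⟨fun t => (hmem _).1, ?_, fun g hg => ?_⟩
  · refine (Continuous.integrableOn_Icc ?_).mono_set Set.Ioc_subset_Icc_self
    have hc : Continuous fun t : ℝ => A (circleMap ρ r (2 * π - t)) :=
      hA.continuousOn.comp_continuous (by fun_prop) fun t => (hmem _).1
    exact Continuous.mul (by fun_prop) (continuous_const.mul (continuous_const.div hc
      fun t => hne _))
  · have h1 := DifferentiableOn.circleIntegral_sub_inv_smul (f := fun z => g z / dslope A ρ z)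
      (c := ρ) (w := ρ) (R := r) (((hg.mono fun z hz => (hsub hz).1).div
        (hq.mono fun z hz => (hsub hz).1)) fun z hz => (hsub hz).2) (Metric.mem_ball_self hr.1)
    have h2 : ∀ t : ℝ, -(I * r * exp (-(I * t))) *
        (1 / (2 * π) * (1 / A (circleMap ρ r (2 * π - t)))) *
        g (circleMap ρ r (2 * π - t)) = -(1 / (2 * π)) *
        (fun u => deriv (circleMap ρ r) u • ((circleMap ρ r u - ρ)⁻¹ •
          (g (circleMap ρ r u) / dslope A ρ (circleMap ρ r u)))) (2 * π - t) := fun t => by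
      have e := hcirc t
      rw [circleMap] at e
      have e' : circleMap 0 r (2 * π - t) = r * exp (-(I * t)) := by
        rw [circleMap, zero_add]; exact (add_left_cancel e).symm
      simp only [deriv_circleMap, smul_eq_mul, e']
      simp only [hA', one_div, mul_inv]
      ring
    rw [← intervalIntegral.integral_of_le Real.two_pi_pos.le]
    simp only [h2]
    rw [intervalIntegral.integral_const_mul, intervalIntegral.integral_comp_sub_left
      (fun u => deriv (circleMap ρ r) u • ((circleMap ρ r u - ρ)⁻¹ •
          (g (circleMap ρ r u) / dslope A ρ (circleMap ρ r u)))), sub_self, sub_zero]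
    rw [circleIntegral] at h1
    rw [h1, hqρ, smul_eq_mul]
    have := Real.pi_ne_zero
    have := Complex.I_ne_zero
    field_simp

namespace IsBoundedFF

variable {B b κ m L : ℝ} {F G : (n : ℕ) → Vec n → ℂ} {ε : ℂ → ℂ} {k : ℕ}

/-- The connected form factors as a symmetric function with the regularity of `holSym`. -/
def hol (H : IsBoundedFF B b κ F G) {D : IsDressing B b κ ε} {A Q : ℝ}
    (hC : D.IsChained A Q (symFF b F)) : holSym b := ⟨symFF b F, hC.nice, H.symFF_cons⟩

variable (H : IsBoundedFF B b κ F G) {D : IsDressing B b κ ε} {A Q : ℝ}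
  (hC : D.IsChained A Q (symFF b F))

include H hC

/-- The series of integrals over `ℝⁿ` is the exponential series of the integration operator. -/
lemma dressed_eq (y : Fin k → ℝ) : DressedConverges F ε y ∧
    dressed F ε y = D.series (symFF b F) (ms fun i => D.narrow.root (y i)) := by
  have h := fun n => sum_integral_pieces (ι := Unit) (μ := fun _ => volume)
    (P := fun _ => D.pt) (fun _ => D.continuous_pt) (ω := fun _ (x : ℝ) => weight ε x)
    (fun _ => D.int) (X := fun _ => D.integOp) (fun _ _ _ => rfl) n (H.hol hC)
    (ms fun i => D.narrow.root (y i))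
  have e : ∀ n (x : Fin n → ℝ), dressedIntegrand F ε y n x = (∏ i, weight ε (x i)) *
      (H.hol hC).1 (ms (fun i => D.pt (x i)) + ms fun i => D.narrow.root (y i)) := fun n x => by
    rw [dressedIntegrand, add_comm (ms _), ← ms_append]
    refine congrArg _ (Eq.trans ?_ (H.symFF_ms _).symm)
    congr 1; ext i
    refine Fin.addCases (fun j => ?_) (fun j => ?_) i
    · simp only [Fin.append_left]; rfl
    · simp only [Fin.append_right]; rfl
  have ht : ∀ n, dressedTerm F ε y n =
      D.integ^[n] (symFF b F) (ms fun i => D.narrow.root (y i)) / n.factorial := fun n => by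
    have h2 := (h n).2
    rw [Fintype.sum_unique, Fintype.sum_unique, D.integOp_pow] at h2
    rw [dressedTerm, one_div_mul_eq_div]
    refine congrArg (· / _) (Eq.trans ?_ h2)
    simp only [e]
    rfl
  refine ⟨⟨fun n => ((h n).1 fun _ => ()).congr (Eventually.of_forall fun x => (e n x).symm), ?_⟩,
    tsum_congr ht⟩
  rw [show dressedTerm F ε y = _ from funext ht]
  exact D.summable_series hC.nonneg hC.nonneg_Q hC.small' hC.bound _

/-- The terms of the series over the contour: integrals over the circles are evaluations at the
roots. -/
lemma eventually_contour {θb : Fin k → ℝ} (hp : IsPseudoenergy B m L θb ε) (hB0 : 0 < B)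
    (hB1 : B < 1) (hB : B ≠ 1 / 2) (hmL : 0 < m * L) (hE : Real.exp (-(m * L)) ≤ 1 / 2)
    (hy : ∀ j, exp (ε (shifted (θb j))) = -1) {n : Vec k} (hn : ∀ j, n j ≠ 0)
    (hn' : ∀ j, n j = dressedN B m L ε (θb j) + ∑ i, dressedPhi B ε (θb j) (θb i)) :
    ∀ᶠ r : ℝ in 𝓝[>] 0, ∀ N, ContourIntegrable θb r (meanValueIntegrand F ε N) ∧
      contourIntegral θb r (meanValueIntegrand F ε N) =
        (((D.integOp + ∑ j, (n j)⁻¹ • insertOp (D.narrow.root (θb j))) ^ N) (H.hol hC)).1 0 := by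
  have hnar := D.narrow
  set U : Set ℂ := {z | |z.im - π / 2| < b}
  have hU : IsOpen U :=
    isOpen_lt ((Complex.continuous_im.sub continuous_const).abs) continuous_const
  have hUs : U ⊆ strip b := fun z hz => Or.inr hz
  have hA : DifferentiableOn ℂ (fun z => 1 + exp (ε z)) U := fun z hz =>
    (((hp.hasDerivAt_expEps hnar (hUs hz)).differentiableAt.differentiableWithinAt.const_add
      1)).congr (fun z hz => by rw [hp.exp_eq hnar hz]) (by rw [hp.exp_eq hnar hz])
  have hroot : ∀ y, shifted y ∈ U := fun y => by
    simpa only [U, Set.mem_ofPred_eq, shifted_im, sub_self, abs_zero] using hnar.pos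
  have hev := fun j => eventually_clockwise hU hA (hroot (θb j)) (by rw [hy, add_neg_cancel])
    (hn j) (by
      rw [hn']
      exact (hp.hasDerivAt_exp_shifted D hB0 hB1 hB hmL hE (hy j)).const_add 1)
  filter_upwards [eventually_all.2 hev] with r hr N
  have hmem : ∀ p t, contourPoint θb r p t ∈ strip b := fun p t => by
    cases p with
    | none => exact ofReal_mem_strip hnar.pos t
    | some j => exact hUs ((hr j).1 t)
  have hsf : ∀ p : Option (Fin k), SigmaFinite (contourMeasure p) := fun p => by
    cases p <;> rw [contourMeasure] <;> infer_instance
  have h := sum_integral_pieces (μ := contourMeasure) (P := fun p t => ⟨_, hmem p t⟩) (fun p => by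
      refine Continuous.subtype_mk ?_ _
      cases p with
      | none => exact Complex.continuous_ofReal
      | some j =>
        change Continuous fun t : ℝ => shifted (θb j) + r * exp (-(I * t))
        fun_prop)
    (ω := fun p t => contourVelocity r p t * weight ε (contourPoint θb r p t)) (fun p => by
      cases p with
      | none =>
        change Integrable (fun t : ℝ => 1 * weight ε t) volume
        simpa only [one_mul] using D.int
      | some j => exact (hr j).2.1)
    (X := fun p => p.elim D.integOp fun j => (n j)⁻¹ • insertOp (D.narrow.root (θb j)))
    (fun p f s => by
      cases p with
      | none => simp only [contourVelocity, one_mul]; rfl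
      | some j =>
        obtain ⟨g, hg, e⟩ := f.2.2 s
        simp only [e]
        refine Eq.trans ?_ ((hr j).2.2 g (hg.mono hUs)).symm
        exact congrArg ((n j)⁻¹ * ·) (e _)) N (H.hol hC) 0
  have e : ∀ c : Fin N → Option (Fin k), contourIntegrand θb r (meanValueIntegrand F ε N) c =
      fun t => (∏ i, contourVelocity r (c i) (t i) * weight ε (contourPoint θb r (c i) (t i))) *
        (H.hol hC).1 (ms (fun i => (⟨_, hmem (c i) (t i)⟩ : strip b)) + 0) :=
    fun c => funext fun t => by
      change _ = _ * symFF b F _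
      rw [contourIntegrand, meanValueIntegrand, Finset.prod_mul_distrib, mul_assoc, add_zero,
        H.symFF_ms]
  rw [Fintype.sum_option] at h
  refine ⟨fun c => ?_, ?_⟩
  · rw [e]; exact h.1 c
  · simp only [contourIntegral, e]; exact h.2

end IsBoundedFF

/-! ### Summation of the series -/

section Sums

lemma hasSum_antidiagonal {f : ℕ × ℕ → ℂ} {S : ℂ} (h : HasSum f S) :
    HasSum (fun n => ∑ p ∈ Finset.HasAntidiagonal.antidiagonal n, f p) S := by
  refine ((Finset.HasAntidiagonal.sigmaAntidiagonalEquivProd.hasSum_iff).2 h).sigma fun n => ?_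
  rw [← Finset.sum_finset_coe]
  exact hasSum_fintype _

lemma add_pow_div_factorial {V : Type*} [AddCommGroup V] [Module ℂ V] {X Y : Module.End ℂ V}
    (hc : Commute X Y) (ev : V →ₗ[ℂ] ℂ) (v : V) (n : ℕ) : ev (((X + Y) ^ n) v) / n.factorial =
      ∑ p ∈ Finset.HasAntidiagonal.antidiagonal n,
        ev ((X ^ p.1) ((Y ^ p.2) v)) / (p.1.factorial * p.2.factorial) := by
  rw [hc.add_pow', LinearMap.sum_apply, map_sum, Finset.sum_div]
  refine Finset.sum_congr rfl fun p hp => ?_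
  rw [LinearMap.smul_apply, map_nsmul, nsmul_eq_mul, Module.End.mul_apply,
    ← Finset.HasAntidiagonal.mem_antidiagonal.1 hp, Nat.cast_add_choose ℂ]
  have h0 : ∀ k : ℕ, (k.factorial : ℂ) ≠ 0 := fun k => by exact_mod_cast k.factorial_ne_zero
  have := h0 (p.1 + p.2)
  field_simp

/-- The terms of a double exponential generating series. -/
def egf (x y : ℂ) (d : ℕ → ℕ → ℂ) (p : ℕ × ℕ) : ℂ :=
  x ^ p.1 * y ^ p.2 * d p.1 p.2 / (p.1.factorial * p.2.factorial)

/-- Multiplication of a generating series by one of its variables. -/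
lemma hasSum_egf_shift {x y S : ℂ} {d : ℕ → ℕ → ℂ} (h : HasSum (egf x y d) S) :
    HasSum (egf x y fun k l => k * d (k - 1) l) (x * S) ∧
      HasSum (egf x y fun k l => l * d k (l - 1)) (y * S) := by
  have hf : ∀ k : ℕ, ((k + 1).factorial : ℂ) = (k + 1) * k.factorial := fun k => by
    rw [Nat.factorial_succ]; push_cast; ring
  have hf0 : ∀ k : ℕ, (k.factorial : ℂ) ≠ 0 := fun k => by exact_mod_cast k.factorial_ne_zero
  have hk0 : ∀ k : ℕ, (k + 1 : ℂ) ≠ 0 := fun k => by exact_mod_cast k.succ_ne_zero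
  constructor
  · have i1 : Function.Injective fun p : ℕ × ℕ => (p.1 + 1, p.2) := fun p q h => by
      simpa [Prod.ext_iff] using h
    rw [← i1.hasSum_iff fun p hp => ?_]
    · refine Eq.subst (motive := fun f => HasSum f (x * S)) (funext fun p => ?_) (h.mul_left x)
      simp only [egf, Function.comp, hf, Nat.add_sub_cancel]
      have := hf0 p.1
      have := hf0 p.2
      have := hk0 p.1
      push_cast
      field_simp
      ring
    · rcases p with ⟨_ | k, l⟩
      · simp [egf]
      · exact absurd ⟨(k, l), rfl⟩ hp
  · have i2 : Function.Injective fun p : ℕ × ℕ => (p.1, p.2 + 1) := fun p q h => by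
      simpa [Prod.ext_iff] using h
    rw [← i2.hasSum_iff fun p hp => ?_]
    · refine Eq.subst (motive := fun f => HasSum f (y * S)) (funext fun p => ?_) (h.mul_left y)
      simp only [egf, Function.comp, hf, Nat.add_sub_cancel]
      have := hf0 p.1
      have := hf0 p.2
      have := hk0 p.2
      push_cast
      field_simp
      ring
    · rcases p with ⟨k, _ | l⟩
      · simp [egf]
      · exact absurd ⟨(k, l), rfl⟩ hp

/-- A double exponential generating series whose coefficients obey relations of the type of
`dress_relation`. -/
theorem hasSum_of_relation {d : ℕ → ℕ → ℂ} {x y P Q Δ S : ℂ} (hs : HasSum (egf x y d) S)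
    (h1 : ∀ k l, d (k + 2) l = (k + 2) * P * d (k + 1) l + l * Q * d (k + 2) (l - 1) -
      (k + 2) * l * Δ * d (k + 1) (l - 1))
    (h2 : ∀ k l, d k (l + 2) = (l + 2) * Q * d k (l + 1) + k * P * d (k - 1) (l + 2) -
      (l + 2) * k * Δ * d (k - 1) (l + 1)) :
    (1 - x * P - y * Q + x * y * Δ) * S = d 0 0 + x * (d 1 0 - P * d 0 0) +
      y * (d 0 1 - Q * d 0 0) +
      x * y * (d 1 1 - P * d 0 1 - Q * d 1 0 + Δ * d 0 0) := by
  have hsum := ((hs.sub ((hasSum_egf_shift hs).1.mul_left P)).sub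
    ((hasSum_egf_shift hs).2.mul_left Q)).add
    ((hasSum_egf_shift (hasSum_egf_shift hs).2).1.mul_left Δ)
  -- the relations cancel all terms of the combination except four
  have hfin := hasSum_sum_of_ne_finset_zero (L := .unconditional _) (f := fun p =>
    egf x y d p - P * egf x y (fun k l => k * d (k - 1) l) p -
    Q * egf x y (fun k l => l * d k (l - 1)) p +
    Δ * egf x y (fun k l => k * (l * d (k - 1) (l - 1))) p)
    (s := ({(0, 0), (1, 0), (0, 1), (1, 1)} : Finset (ℕ × ℕ))) (fun p hp => ?_)
  · have := hsum.unique hfin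
    rw [Finset.sum_insert (by simp), Finset.sum_insert (by simp), Finset.sum_insert (by simp),
      Finset.sum_singleton] at this
    simp [egf] at this
    linear_combination this
  · rcases p with ⟨_ | _ | k, _ | _ | l⟩
    · simp at hp
    · simp at hp
    · simp only [egf]; rw [h2]; push_cast; ring_nf
    · simp at hp
    · simp at hp
    · simp only [egf]; rw [h2]; push_cast; ring_nf
    all_goals simp only [egf]; rw [h1]; push_cast; ring_nf

end Sums

namespace IsDressing

variable {B b κ : ℝ} {ε : ℂ → ℂ} {D : IsDressing B b κ ε} {A Q : ℝ}

lemma insertOp_pow (x : ℂ) (β : strip b) (n : ℕ) (f : holSym b) (s : Multiset (strip b)) :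
    (((x • insertOp β) ^ n) f).1 s = x ^ n * f.1 (Multiset.replicate n β + s) := by
  induction n generalizing s with
  | zero => simp
  | succ n ih =>
    rw [pow_succ']
    change x * (((x • insertOp β) ^ n) f).1 (β ::ₘ s) = _
    rw [ih, Multiset.add_cons, ← Multiset.cons_add, ← Multiset.replicate_succ, pow_succ', mul_assoc]

lemma norm_insertOps_pow_le (x x' : ℂ) (β β' : strip b) (i : ℕ) (f : holSym b) {M : ℕ → ℝ}
    (hM : ∀ s, ‖f.1 s‖ ≤ M s.card) (s : Multiset (strip b)) :
    ‖(((x • insertOp β + x' • insertOp β') ^ i) f).1 s‖ ≤ (‖x‖ + ‖x'‖) ^ i * M (s.card + i) := by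
  induction i generalizing s with
  | zero => simpa using hM s
  | succ i ih =>
    rw [pow_succ']
    set g := ((x • insertOp β + x' • insertOp β') ^ i) f
    have h : ∀ β : strip b, ‖g.1 (β ::ₘ s)‖ ≤ (‖x‖ + ‖x'‖) ^ i * M (s.card + (i + 1)) := fun β =>
      (ih _).trans_eq (by rw [Multiset.card_cons, add_assoc, add_comm 1])
    change ‖x * g.1 (β ::ₘ s) + x' * g.1 (β' ::ₘ s)‖ ≤ _
    refine (norm_add_le _ _).trans ?_
    rw [norm_mul, norm_mul, pow_succ', mul_assoc, add_mul]
    exact add_le_add (mul_le_mul_of_nonneg_left (h β) (norm_nonneg _))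
      (mul_le_mul_of_nonneg_left (h β') (norm_nonneg _))

/-- The series over the contour is the generating function of the dressed form factors. -/
theorem hasSum_contour (f : holSym b) (hC : D.IsChained A Q f.1) (y y' : ℝ) {x x' : ℂ}
    (hx : 4 * Q * ‖x‖ ≤ 1 / 4) (hx' : 4 * Q * ‖x'‖ ≤ 1 / 4) :
    ∃ S, HasSum (egf x x' (D.dress f.1 y y')) S ∧ HasSum (fun n : ℕ =>
      (((D.integOp + (x • insertOp (D.narrow.root y) +
        x' • insertOp (D.narrow.root y'))) ^ n) f).1 0
        / n.factorial) S := by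
  set β := D.narrow.root y
  set β' := D.narrow.root y'
  set Z := x • insertOp β + x' • insertOp β' with hZ
  have hQ := hC.nonneg_Q
  have hA := hC.nonneg
  have hW : 2 * Q * ∫ x : ℝ, ‖weight ε x‖ ≤ 1 / 2 := hC.small'
  have hc : Commute Z D.integOp :=
    (((D.commute_integOp β).smul_right x).add_right ((D.commute_integOp β').smul_right x')).symm
  let ev : Multiset (strip b) → holSym b →ₗ[ℂ] ℂ := fun s =>
    (LinearMap.proj s).comp (holSym b).subtype
  have hgeom : Summable fun p : ℕ × ℕ => (1 / 4 : ℝ) ^ p.1 * (1 / 2 : ℝ) ^ p.2 :=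
    (summable_geometric_of_lt_one (by norm_num) (by norm_num)).mul_of_nonneg
      (summable_geometric_of_lt_one (by norm_num) (by norm_num))
      (fun _ => by positivity) fun _ => by positivity
  -- the binomial expansion of the exponential of commuting operators, absolutely summable
  have hT : Summable fun p : ℕ × ℕ =>
      ev 0 ((Z ^ p.1) ((D.integOp ^ p.2) f)) / (p.1.factorial * p.2.factorial) := by
    refine Summable.of_norm_bounded (hgeom.mul_left A) fun p => ?_
    have h1 := norm_insertOps_pow_le x x' β β' p.1 ((D.integOp ^ p.2) f)
      (M := fun n => A * n.factorial * 2 ^ n * Q ^ n * (1 / 2) ^ p.2 * p.2.factorial) (fun s => by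
        have := D.norm_term_le hA hQ hW hC.bound s p.2
        rw [norm_div, Complex.norm_natCast, div_le_iff₀ (by positivity)] at this
        rwa [integOp_pow]) 0
    rw [norm_div, norm_mul, Complex.norm_natCast, Complex.norm_natCast,
      div_le_iff₀ (by positivity)]
    refine h1.trans ?_
    have h2 : (2 * Q * (‖x‖ + ‖x'‖)) ^ p.1 ≤ (1 / 4) ^ p.1 :=
      pow_le_pow_left₀ (by positivity) (by linarith) _
    rw [Multiset.card_zero, zero_add]
    calc _ = A * ((2 * Q * (‖x‖ + ‖x'‖)) ^ p.1 * (1 / 2) ^ p.2) *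
          (p.1.factorial * p.2.factorial) := by rw [mul_pow, mul_pow]; ring
      _ ≤ _ := by gcongr
  have hd : Summable (egf x x' (D.dress f.1 y y')) := by
    refine Summable.of_norm_bounded (hgeom.mul_left (A * 2)) fun p => ?_
    have h1 := D.norm_series_le hA hQ hW hC.bound (D.narrow.roots y y' p.1 p.2)
    have h2 := factorial_add_le p.1 p.2
    have h3 : (4 * Q * ‖x‖) ^ p.1 ≤ (1 / 4) ^ p.1 := pow_le_pow_left₀ (by positivity) hx _
    have h4 : (4 * Q * ‖x'‖) ^ p.2 ≤ (1 / 2) ^ p.2 :=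
      pow_le_pow_left₀ (by positivity) (by linarith) _
    have hcard : (D.narrow.roots y y' p.1 p.2).card = p.1 + p.2 := by simp [IsNarrow.roots]
    rw [hcard, add_zero] at h1
    rw [egf, norm_div, norm_mul, norm_mul, norm_mul, norm_pow, norm_pow, Complex.norm_natCast,
      Complex.norm_natCast, div_le_iff₀ (by positivity)]
    calc _ ≤ ‖x‖ ^ p.1 * ‖x'‖ ^ p.2 * (A * (2 ^ (p.1 + p.2) * (p.1.factorial * p.2.factorial)) *
          2 ^ (p.1 + p.2) * Q ^ (p.1 + p.2) * 2) := by
            refine mul_le_mul_of_nonneg_left (h1.trans ?_) (by positivity)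
            gcongr
      _ = A * 2 * ((4 * Q * ‖x‖) ^ p.1 * (4 * Q * ‖x'‖) ^ p.2) *
          (p.1.factorial * p.2.factorial) := by
            rw [show (4 : ℝ) = 2 * 2 by norm_num]; simp only [mul_pow, pow_add]; ring
      _ ≤ _ := by gcongr
  have h1 := hT.hasSum.prod_fiberwise (g := fun i =>
    ∑ p ∈ Finset.HasAntidiagonal.antidiagonal i, egf x x' (D.dress f.1 y y') p) fun i => by
      have e : ∀ n : ℕ, ev 0 ((Z ^ i) ((D.integOp ^ n) f)) / (i.factorial * n.factorial) =
          ∑ p ∈ Finset.HasAntidiagonal.antidiagonal i, x ^ p.1 * x' ^ p.2 /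
            (p.1.factorial * p.2.factorial) *
            (D.integ^[n] f.1 (D.narrow.roots y y' p.1 p.2) / n.factorial) := fun n => by
        rw [← div_div, hZ, add_pow_div_factorial (((commute_insertOp β β').smul_left x).smul_right
          x'), Finset.sum_div]
        refine Finset.sum_congr rfl fun p _ => ?_
        change (((x • insertOp β) ^ p.1) _).1 0 / _ / _ = _
        rw [insertOp_pow, insertOp_pow, integOp_pow, add_zero, add_comm (Multiset.replicate p.2 _)]
        change _ * (_ * D.integ^[n] f.1 (D.narrow.roots y y' p.1 p.2)) / _ / _ = _
        ring
      simp only [e]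
      refine hasSum_sum fun p _ => ?_
      rw [egf, mul_div_right_comm (x ^ p.1 * x' ^ p.2)]
      exact (D.summable_series hA hQ hW hC.bound _).hasSum.mul_left _
  refine ⟨_, hd.hasSum, ?_⟩
  rw [← h1.unique (hasSum_antidiagonal hd.hasSum)]
  refine Eq.subst (motive := fun f => HasSum f _) (funext fun n => ?_)
    (hasSum_antidiagonal hT.hasSum)
  rw [add_comm D.integOp]
  exact (add_pow_div_factorial hc (ev 0) f n).symm

end IsDressing

/-! ### The mean value -/

section MeanValue

variable {B b κ m L : ℝ} {F G : (n : ℕ) → Vec n → ℂ} {ε : ℂ → ℂ} {A Q : ℝ}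

lemma IsDressing.norm_dressedPhi_le (D : IsDressing B b κ ε) (y y' : ℝ) :
    ‖dressedPhi B ε y y'‖ ≤ 2 * (2 / κ ^ 2) := by
  have h := D.narrow
  have h1 := D.norm_chainSum_le (continuous_rootKernel h y) (norm_rootKernel_le h y)
    (D.mem_adm_of_bounded (continuous_rootKernel h y') (norm_rootKernel_le h y'))
  have h2 : ∫ x : ℝ, ‖weight ε x * rootKernel B y' x‖ ≤
      ∫ x : ℝ, 2 / κ ^ 2 * ‖weight ε x‖ := by
    refine integral_mono_of_nonneg (Eventually.of_forall fun x => norm_nonneg _)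
      (D.int.norm.const_mul _) (Eventually.of_forall fun x => ?_)
    simp only [norm_mul, mul_comm ‖weight ε x‖]
    gcongr
    exact norm_rootKernel_le h y' x
  rw [integral_const_mul] at h2
  have h3 := norm_phi_sub_le h (ofReal_mem_strip h.pos y) (ofReal_mem_strip h.pos y')
  have h4 := mul_le_mul_of_nonneg_left (h2.trans D.small) (by positivity : 0 ≤ 2 * (2 / κ ^ 2))
  rw [dressedPhi]
  linarith [norm_add_le (phi B ((y : ℂ) - y')) (chainSum B ε (rootKernel B y) (rootKernel B y'))]

lemma IsPseudoenergy.le_norm_dressedN {k : ℕ} {θb : Fin k → ℝ} (hp : IsPseudoenergy B m L θb ε)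
    (D : IsDressing B b κ ε) (hB0 : 0 < B) (hB1 : B < 1) (hB : B ≠ 1 / 2) (hmL : 0 < m * L)
    (hE : Real.exp (-(m * L)) ≤ 1 / 2) (hL : 2 / κ ^ 2 * (2 * π / (m * L)) ≤ 1 / 2) (y : ℝ) :
    m * L - 1 ≤ ‖dressedN B m L ε y‖ := by
  have h := D.narrow
  have h1 := D.norm_chainSum_le (continuous_rootKernel h y) (norm_rootKernel_le h y)
    (hp.epsDeriv_mem_adm h hB0 hB1 hB hmL hE).1
  have h2 := mul_le_mul_of_nonneg_left (hp.integrable_weight_mul_source h hB0 hB1 hB hmL hE).2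
    (by positivity : 0 ≤ 2 * (2 / κ ^ 2))
  have h3 : ‖(m * L * cosh y : ℂ)‖ = m * L * Real.cosh y := by
    rw [← Complex.ofReal_cosh, ← Complex.ofReal_mul, ← Complex.ofReal_mul, Complex.norm_real,
      Real.norm_of_nonneg (mul_pos hmL (Real.cosh_pos y)).le]
  have h4 := norm_sub_le_norm_add (m * L * cosh y : ℂ)
    (-I * chainSum B ε (rootKernel B y) (source m L))
  rw [dressedN, chainSum_rootKernel' h]
  rw [h3, norm_mul, norm_neg, Complex.norm_I, one_mul] at h4
  linarith [le_mul_of_one_le_right hmL.le (Real.one_le_cosh y)]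

/-- The contour series in terms of the dressed form factors; the determinant
`(n₁ - Φ₁₁) (n₂ - Φ₂₂) - Φ₁₂²` comes from the relations between dressed form factors. -/
theorem IsBoundedFF.eventually_meanValue (H : IsBoundedFF B b κ F G) {D : IsDressing B b κ ε}
    (hC : D.IsChained A Q (symFF b F)) {θb : Fin 2 → ℝ} (hp : IsPseudoenergy B m L θb ε)
    (hB : B ≠ 1 / 2) (hmL : 0 < m * L) (hE : Real.exp (-(m * L)) ≤ 1 / 2)
    (hy : ∀ j, exp (ε (shifted (θb j))) = -1) {N₁ N₂ Nφ : ℂ}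
    (h1 : N₁ = dressedN B m L ε (θb 0)) (h2 : N₂ = dressedN B m L ε (θb 1))
    (hφ : Nφ = dressedPhi B ε (θb 0) (θb 1))
    (hn1 : 16 * Q ≤ ‖N₁ + Nφ + dressedPhi B ε (θb 0) (θb 0)‖)
    (hn2 : 16 * Q ≤ ‖N₂ + Nφ + dressedPhi B ε (θb 1) (θb 1)‖)
    (hN : N₁ * N₂ + (N₁ + N₂) * Nφ ≠ 0) : ∀ᶠ r : ℝ in 𝓝[>] 0,
    MeanValueConverges F ε θb r ∧ meanValue F ε θb r = dressed F ε ![] +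
      ((N₂ + Nφ) * dressed F ε ![θb 0] + (N₁ + Nφ) * dressed F ε ![θb 1] +
        dressed F ε ![θb 0, θb 1]) / (N₁ * N₂ + (N₁ + N₂) * Nφ) := by
  set Φ := fun j => dressedPhi B ε (θb j) (θb j)
  have hQ : 0 < Q := zero_lt_one.trans_le hC.one_le
  set n₁ := N₁ + Nφ + Φ 0
  set n₂ := N₂ + Nφ + Φ 1
  have hinv : ∀ {n : ℂ}, 16 * Q ≤ ‖n‖ → n ≠ 0 ∧ 4 * Q * ‖n⁻¹‖ ≤ 1 / 4 := fun hn => by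
    have h0 := (by positivity : 0 < 16 * Q).trans_le hn
    refine ⟨norm_pos_iff.1 h0, ?_⟩
    rw [norm_inv, ← div_eq_mul_inv, div_le_iff₀ h0]
    linarith
  obtain ⟨i1, i1'⟩ := hinv hn1
  obtain ⟨i2, i2'⟩ := hinv hn2
  obtain ⟨S, hS, hS'⟩ := IsDressing.hasSum_contour (H.hol hC) hC (θb 0) (θb 1) i1' i2'
  have hd : ∀ k l, D.dress (symFF b F) (θb 1) (θb 0) l k =
      D.dress (symFF b F) (θb 0) (θb 1) k l := fun k l => by
    rw [IsDressing.dress, IsDressing.dress, IsNarrow.roots, IsNarrow.roots, add_comm]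
  -- each circle contributes an insertion with weight `1 / n_j`
  have hrel := hasSum_of_relation (P := Φ 0) (Q := Φ 1) (Δ := Φ 0 * Φ 1 - Nφ ^ 2) hS
    (fun k l => by rw [hφ]; exact hC.dress_relation _ _ k l) fun k l => by
      have := hC.dress_relation (θb 1) (θb 0) l k
      rw [D.dressedPhi_comm (θb 1) (θb 0), ← hφ] at this
      simp only [hd] at this
      simp only [IsBoundedFF.hol, Φ]
      rw [this]
      ring
  have e00 : dressed F ε ![] = D.dress (symFF b F) (θb 0) (θb 1) 0 0 :=
    (H.dressed_eq hC ![]).2.trans rfl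
  have e10 : dressed F ε ![θb 0] = D.dress (symFF b F) (θb 0) (θb 1) 1 0 :=
    (H.dressed_eq hC ![θb 0]).2.trans rfl
  have e01 : dressed F ε ![θb 1] = D.dress (symFF b F) (θb 0) (θb 1) 0 1 :=
    (H.dressed_eq hC ![θb 1]).2.trans (by
      rw [IsDressing.dress, IsNarrow.roots, Multiset.replicate_zero, zero_add]; rfl)
  have e11 : dressed F ε ![θb 0, θb 1] = D.dress (symFF b F) (θb 0) (θb 1) 1 1 :=
    (H.dressed_eq hC ![θb 0, θb 1]).2.trans rfl
  have hev := H.eventually_contour hC hp H.pos H.lt_one hB hmL hE hy (n := ![n₁, n₂])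
    (by simp [Fin.forall_fin_two, i1, i2]) (by
      rw [Fin.forall_fin_two]
      simp only [Matrix.cons_val_zero, Matrix.cons_val_one, Fin.sum_univ_two, n₁, n₂, Φ, ← h1, ← h2,
        ← hφ, D.dressedPhi_comm (θb 1) (θb 0)]
      exact ⟨by ring, by ring⟩)
  filter_upwards [hev] with r hr
  rw [Fin.sum_univ_two] at hr
  have ht : HasSum (meanValueTerm F ε θb r) S := by
    refine Eq.subst (motive := fun f => HasSum f S) (funext fun n => ?_) hS'
    rw [meanValueTerm, (hr n).2, one_div_mul_eq_div]
    rfl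
  refine ⟨⟨fun n => (hr n).1, ht.summable⟩, ?_⟩
  rw [meanValue, ht.tsum_eq, e00, e10, e01, e11, ← sub_eq_iff_eq_add', eq_div_iff hN]
  have e : (1 - n₁⁻¹ * Φ 0 - n₂⁻¹ * Φ 1 + n₁⁻¹ * n₂⁻¹ * (Φ 0 * Φ 1 - Nφ ^ 2)) * (n₁ * n₂) =
      N₁ * N₂ + (N₁ + N₂) * Nφ := by
    field_simp
    simp only [n₁, n₂]
    ring
  have := congrArg (· * (n₁ * n₂)) hrel
  simp only [IsBoundedFF.hol] at this
  rw [mul_right_comm, e] at this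
  rw [sub_mul, mul_comm S, this, ← e]
  field_simp
  simp only [n₁, n₂]
  ring

end MeanValue

end SinhGordon

end

theorem mainTheorem2 (B m : ℝ) (hB0 : 0 < B) (hB1 : B < 1) (hB : B ≠ 1 / 2) (hm : 0 < m)
    (F : (n : ℕ) → (Fin n → ℂ) → ℂ) (hF : SinhGordon.IsFormFactorFamily B F)
    (a K : ℝ) (ha : 0 < a) (hK : SinhGordon.FactorialBound F a K) :
    ∃ L₀ : ℝ, 0 < L₀ ∧ ∀ L : ℝ, L₀ ≤ L →
      ∀ (θb : Fin 2 → ℝ) (ε : (Fin 2 → ℝ) → ℂ → ℂ) (q : Fin 2 → ℤ),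
        θb 0 ≠ θb 1 →
        (∀ᶠ p in 𝓝 θb, SinhGordon.IsPseudoenergy B m L p (ε p)) →
        (∀ j, ε θb (SinhGordon.shifted (θb j)) = Complex.I * ((2 * (q j : ℂ) + 1) * Real.pi)) →
        ∀ N₁ N₂ Nφ : ℂ,
          N₁ = SinhGordon.dressedN B m L (ε θb) (θb 0) →
          N₂ = SinhGordon.dressedN B m L (ε θb) (θb 1) →
          Nφ = SinhGordon.dressedPhi B (ε θb) (θb 0) (θb 1) →
          -- the series for the normalization factors and the dressed form factors converge
          (∀ j, SinhGordon.ChainConverges B (ε θb) (SinhGordon.rootKernel' B (θb j))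
            (SinhGordon.source m L)) ∧
          (∀ j l, SinhGordon.ChainConverges B (ε θb) (SinhGordon.rootKernel B (θb j))
            (SinhGordon.rootKernel B (θb l))) ∧
          SinhGordon.DressedConverges F (ε θb) ![] ∧
          (∀ j, SinhGordon.DressedConverges F (ε θb) ![θb j]) ∧
          SinhGordon.DressedConverges F (ε θb) ![θb 0, θb 1] ∧
          N₁ * N₂ + (N₁ + N₂) * Nφ ≠ 0 ∧
          -- the mean value
          (∀ᶠ r in 𝓝[>] (0 : ℝ),
            SinhGordon.MeanValueConverges F (ε θb) θb r ∧
            SinhGordon.meanValue F (ε θb) θb r =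
              SinhGordon.dressed F (ε θb) ![] +
                ((N₂ + Nφ) * SinhGordon.dressed F (ε θb) ![θb 0] +
                  (N₁ + Nφ) * SinhGordon.dressed F (ε θb) ![θb 1] +
                  SinhGordon.dressed F (ε θb) ![θb 0, θb 1]) /
                (N₁ * N₂ + (N₁ + N₂) * Nφ)) ∧
          -- the residue factors: `(e^ε)' = -i n_j` at the roots, with `N_j = n_j (1 - M_jj) - N_φ`
          (∀ j, HasDerivAt (fun θ => Complex.exp (ε θb θ))
            (-(Complex.I * (![N₁, N₂] j + Nφ + SinhGordon.dressedPhi B (ε θb) (θb j) (θb j))))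
            (SinhGordon.shifted (θb j))) ∧
          -- the Jacobian of the quantization conditions
          (∃ J : (Fin 2 → ℝ) →L[ℝ] (Fin 2 → ℂ),
            HasFDerivAt (SinhGordon.quantization ε) J θb ∧
            ∀ j l, J (Pi.single l 1) j = !![N₁ + Nφ, -Nφ; -Nφ, N₂ + Nφ] j l) := by
  obtain ⟨b, κ, hba, h⟩ := SinhGordon.exists_isNarrow hB0 hB1 hB ha
  obtain ⟨G, hG⟩ := hF.exists_regularizes
  have hKb : SinhGordon.FactorialBound F b K := fun n hn θ hθ =>
    hK n hn θ fun j => (hθ j).imp (fun h => h.trans_le hba) fun h => h.trans_le hba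
  have H : SinhGordon.IsBoundedFF B b κ F G := ⟨hB0, hB1, hF, hG, h, fun n => by
    rcases n with _ | n
    · exact ⟨‖SinhGordon.conn G ![]‖, fun θ _ _ => by rw [Subsingleton.elim θ ![]]⟩
    · refine ⟨(n + 1).factorial * K ^ (n + 1), fun θ hθ hg => ?_⟩
      rw [← SinhGordon.connectedFF_eq_conn hB0 hB1 hG hg]
      exact hKb (n + 1) n.succ_pos θ hθ⟩
  -- `Q` bounds the growth of the form factors and the kernels between points of the strips
  set Q := max 1 (max |K| (2 / κ ^ 2))
  have hQ1 : 1 ≤ Q := le_max_left _ _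
  have hQK : |K| ≤ Q := (le_max_left _ _).trans (le_max_right _ _)
  have hQκ : 2 / κ ^ 2 ≤ Q := (le_max_right _ _).trans (le_max_right _ _)
  -- for `m L ≥ 64 Q` the weights have mass at most `1 / (8 Q)`, and `|n_j| ≥ 16 Q` makes the
  -- generating series of the dressed form factors converge
  refine ⟨64 * Q / m, by positivity, fun L hL θb ε q hne hε hq N₁ N₂ Nφ h1 h2 hφ => ?_⟩
  have hX : 64 * Q ≤ m * L := by rwa [div_le_iff₀' hm] at hL
  have hmL : 0 < m * L := by linarith
  have hE : Real.exp (-(m * L)) ≤ 1 / 2 := by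
    have := Real.add_one_le_exp (m * L)
    rw [Real.exp_neg, one_div]
    exact inv_anti₀ two_pos (by linarith)
  have hWQ : Q * (2 * Real.pi / (m * L)) ≤ 1 / 8 := by
    rw [← mul_div_assoc, div_le_iff₀ hmL]
    nlinarith [Real.pi_le_four]
  have hL' : 2 / κ ^ 2 * (2 * Real.pi / (m * L)) ≤ 1 / 2 :=
    (mul_le_mul_of_nonneg_right hQκ (by positivity)).trans (by linarith)
  have hp := hε.self_of_nhds
  have D := hp.isDressing h hB0 hB1 hB hmL hE hL'
  have hC := H.isChained D hKb (le_max_left 1 ‖SinhGordon.connectedFF F 0 ![]‖) (le_max_right _ _)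
    hQ1 hQK hQκ (by
      have := mul_le_mul_of_nonneg_left (hp.integrable_weight h hB0 hB1 hB hmL hE).2
        (by linarith : 0 ≤ 2 * (2 * Q))
      linarith)
  -- the only information on the roots that enters besides the TBA equation
  have hy : ∀ j, Complex.exp (ε θb (SinhGordon.shifted (θb j))) = -1 := fun j => by
    rw [hq, show Complex.I * ((2 * (q j : ℂ) + 1) * Real.pi) =
      Real.pi * Complex.I + q j * (2 * Real.pi * Complex.I) by ring,
      Complex.exp_periodic.int_mul, Complex.exp_pi_mul_I]
  have hΦ : ∀ y y', ‖SinhGordon.dressedPhi B (ε θb) y y'‖ ≤ 2 * Q := fun y y' =>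
    (D.norm_dressedPhi_le y y').trans (by linarith)
  have hN : ∀ y, m * L - 1 ≤ ‖SinhGordon.dressedN B m L (ε θb) y‖ :=
    hp.le_norm_dressedN D hB0 hB1 hB hmL hE hL'
  have hNφ : ‖Nφ‖ ≤ 2 * Q := hφ ▸ hΦ _ _
  have hA : ∀ {N : ℂ}, m * L - 1 ≤ ‖N‖ → 18 * Q ≤ ‖N + Nφ‖ := fun hN => by
    linarith [norm_sub_le_norm_add _ Nφ |>.trans' (sub_le_sub_right hN _)]
  have hA₁ := hA (h1 ▸ hN _)
  have hA₂ := hA (h2 ▸ hN _)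
  have hn : ∀ {M : ℂ} y, 18 * Q ≤ ‖M‖ →
      16 * Q ≤ ‖M + SinhGordon.dressedPhi B (ε θb) y y‖ := fun y hM => by
    linarith [norm_sub_le_norm_add _ (SinhGordon.dressedPhi B (ε θb) y y) |>.trans'
      (sub_le_sub_right hM _), hΦ y y]
  -- `N_φ` is small compared with `N_j + N_φ`
  have hden : N₁ * N₂ + (N₁ + N₂) * Nφ ≠ 0 := fun h0 => by
    have e : (N₁ + Nφ) * (N₂ + Nφ) = Nφ * Nφ := by linear_combination h0
    have e' := congrArg norm e
    rw [norm_mul, norm_mul] at e'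
    nlinarith [mul_le_mul hA₁ hA₂ (by positivity) (norm_nonneg _), mul_le_mul hNφ hNφ
      (norm_nonneg _) (by positivity)]
  have hinj : Function.Injective θb := fun i j hij => by
    fin_cases i <;> fin_cases j <;> simp_all [eq_comm]
  have hr := fun y => SinhGordon.continuous_rootKernel h y
  have hr' := fun y => SinhGordon.norm_rootKernel_le h y
  refine ⟨fun j => ?_, fun j l => D.chainConverges (hr _) (hr' _)
    (D.mem_adm_of_bounded (hr _) (hr' _)), (H.dressed_eq hC _).1, fun j => (H.dressed_eq hC _).1,
    (H.dressed_eq hC _).1, hden, H.eventually_meanValue hC hp hB hmL hE hy h1 h2 hφ (hn _ hA₁)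
    (hn _ hA₂) hden, fun j => ?_, ?_⟩
  · refine D.chainConverges (M := 2 / κ ^ 2) ?_ (fun x => ?_)
      (hp.epsDeriv_mem_adm h hB0 hB1 hB hmL hE).1
    · simp only [SinhGordon.rootKernel'_eq h]
      exact continuous_const.mul (hr _)
    · rw [SinhGordon.rootKernel'_eq h, norm_mul, norm_neg, Complex.norm_I, one_mul]
      exact hr' _ x
  · refine (hp.hasDerivAt_exp_shifted D hB0 hB1 hB hmL hE (hy j)).congr_deriv ?_
    rw [Fin.sum_univ_two]
    fin_cases j <;> simp [h1, h2, hφ, D.dressedPhi_comm (θb 1) (θb 0)] <;> ring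
  · obtain ⟨J, hJ, hJ'⟩ := SinhGordon.hasFDerivAt_quantization h hB0 hB1 hB hmL hE hL' hinj hε
    refine ⟨J, hJ, fun j l => (hJ' j l).trans ?_⟩
    rw [Fin.sum_univ_two]
    fin_cases j <;> fin_cases l <;> simp [h1, h2, hφ, D.dressedPhi_comm (θb 1) (θb 0)] <;> ring
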